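/- Let $\mathbb F=\mathbb Z/2$ and let $m>1$, $0\le k<m$ be integers. **The pong algebra.** Let $G_m$ be the group of motions of $\mathbb Z$ generated by the reflections $x\mapsto 1-x$ and $x\mapsto 2m-1-x$; then $\mathbb Z/G_m=\{1,\dots,m-1\}$. A *lifted partial permutation on $k$ letters* is a $G_m$-equivariant map $f\colon\widetilde S\to\mathbb Z$ defined on a $G_m$-invariant set $\widetilde S\subset\mathbb Z$ with $|\widetilde S/G_m|=k$, such that the induced map $\widetilde S/G_m\to\mathbb Z/G_m$ is injective. Its weight is the vector $w(f)\in(\frac12\mathbb Z)^m$ with $w_i(f)=\frac12\#\{j\in\widetilde S : i-\tfrac12 \text{ lies strictly between } j \text{ and } f(j)\}$. A crossing of $f$ is a class $\langle i,j\rangle$ of pairs $(i,j)\in\widetilde S\times\widetilde S$ with $\operatorname{sgn}(i-j)\ne\operatorname{sgn}(f(i)-f(j))$, under the relation generated by $(i,j)\sim(j,i)$ and $(i,j)\sim(\gamma i,\gamma j)$, $\gamma\in G_m$; $\mathrm{cross}(f)$ is the number of crossings. The resolution $f_{\langle i,j\rangle}$ sends $\gamma i\mapsto\gamma f(j)$ and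 $\gamma j\mapsto\gamma f(i)$ for $\gamma\in G_m$ and agrees with $f$ elsewhere. $P(m,k)$ is the free $\mathbb F[v_1,\dots,v_m]$-module on the lifted partial permutations on $k$ letters. The $\mathbb F[v_1,\dots,v_m]$-bilinear product is $g\cdot f=v^{\,w(f)+w(g)-w(g\circ f)}\,(g\circ f)$ if the domain of $g$ is the image of $f$ and $\mathrm{cross}(g\circ f)=\mathrm{cross}(g)+\mathrm{cross}(f)$, and $g\cdot f=0$ otherwise. The $\mathbb F[v_1,\dots,v_m]$-linear differential is $\partial f=\sum_c v^{\,w(f)-w(f_c)}f_c$, summed over the crossings $c$ of $f$ with $\mathrm{cross}(f_c)=\mathrm{cross}(f)-1$. The unit is the sum of all lifted partial permutations that are the identity on their domain; for $S\subset\{1,\dots,m-1\}$ with $|S|=k$, $I_S$ denotes the one with $\widetilde S/G_m=S$. $P(m,k)$ is graded by $\mathrm{cross}$ (with $v_i$ in degree $0$) and by $w$ (with $v_i$ in degree the $i$-th basis vector $e_i$). For $0<i<m$ let $\mathcal X_{0,i}$ (resp. $\mathcal X_{i,m}$) be the sum of all lifted partial permutations $f$ with $f(i)=1-i$ (resp.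 $f(i)=2m-1-i$) and $f(\ell)=\ell$ for all other $\ell\in\{1,\dots,m-1\}$ in the domain, and put $$\Omega=\sum_{0<i<m}[\mathcal X_{0,i},\mathcal X_{i,m}].$$ **The bordered algebra.** For $0\le l\le m-1$ let $\mathcal B_0(m,l)$ be the free $\mathbb F[U_1,\dots,U_m]$-module on symbols $\gamma_{x,y}$, where $x,y$ are $l$-element subsets of $\{0,\dots,m\}$, with the product given by $\gamma_{x,y}\gamma_{y,z}=U_1^{n_1}\cdots U_m^{n_m}\gamma_{x,z}$, $n_i=\frac12(|v^x_i-v^y_i|+|v^y_i-v^z_i|-|v^x_i-v^z_i|)$, $v^x_i=\#\{a\in x: a\ge i\}$ (and $\gamma_{x,y}\gamma_{y',z}=0$ for $y\ne y'$). For $1\le i\le m$ let $L_i$ be the sum of all $\gamma_{x,y}$ such that $y$ arises from $x$ by replacing $i\in x$ by $i-1\notin x$, and $R_i$ the sum of the $\gamma_{y,x}$ over the same pairs. Let $\mathcal J$ be the two-sided ideal generated by the $L_{i+1}L_i$ and $R_iR_{i+1}$ ($1\le i<m$) and the $U_j\gamma_{x,x}$ with $1\le j\le m$ and $x\cap\{j-1,j\}=\emptyset$.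 Then $\mathcal C(m,l)=\mathbf J\cdot(\mathcal B_0(m,l)/\mathcal J)\cdot\mathbf J$ with unit $\mathbf J=\sum_{x\subset\{1,\dots,m-1\}}\gamma_{x,x}$. **Theorem.** $P(m,k)$ is a differential graded algebra. (a) If $0<k<m$, then its homology is a polynomial algebra over $\mathcal C(m,m-k-1)$ in the class of the cycle $\Omega$: there is an isomorphism of rings $$\mathcal C(m,m-k-1)[t]\;\cong\;H_*(P(m,k)),\qquad t\mapsto[\Omega],$$ under which multiplication by $U_i$ corresponds to multiplication by $v_i$, and $\gamma_{x,x}$ corresponds to $[I_{\{1,\dots,m-1\}\setminus x}]$ for every $(m-k-1)$-element set $x\subset\{1,\dots,m-1\}$. It respects the gradings: for $(m-k-1)$-element sets $x,y\subset\{1,\dots,m-1\}$, $a\in\mathbb Z_{\ge0}^m$ and $n\ge 0$, the image of $U^a\gamma_{x,y}\,t^n$ is represented by a cycle of crossing degree $2kn$ and of weight $\big(\tfrac12|v^x_i-v^y_i|+a_i+n\big)_{i=1}^m$. (b) If $k=0$, there is an isomorphism of abelian groups $\mathcal C(m,m-1)[t]\cong H_*(P(m,0))$ that respects the idempotents and the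 gradings in the same sense. -/

import Mathlib

open scoped Polynomial

noncomputable section

namespace PongAlgebra

/-- The polynomial ring `𝔽₂[v₁, …, v_m]` (also written `𝔽₂[U₁, …, U_m]`).
The variable with index `i : Fin m` is the one called `v_{i+1}` in one-based numbering. -/
abbrev Base (m : ℕ) : Type := MvPolynomial (Fin m) (ZMod 2)

/-! ### Differential graded algebras in characteristic two and their homology -/

section Homology

variable {R A : Type*} [CommRing R] [AddCommGroup A] [Module R A]

/-- The laws of a differential algebra over `R`, without signs (all algebras below have
characteristic two). -/
structure IsDGAlgebra (mul : A →ₗ[R] A →ₗ[R] A) (one : A) (d : A →ₗ[R] A) : Prop where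
  mul_assoc : ∀ a b c, mul (mul a b) c = mul a (mul b c)
  one_mul : ∀ a, mul one a = a
  mul_one : ∀ a, mul a one = a
  d_d : ∀ a, d (d a) = 0
  leibniz : ∀ a b, d (mul a b) = mul (d a) b + mul a (d b)

/-- Cycles modulo boundaries. -/
abbrev Homology (d : A →ₗ[R] A) : Type _ :=
  LinearMap.ker d ⧸ (LinearMap.range d).submoduleOf (LinearMap.ker d)

/-- The element `z` is a cycle and `h` is its homology class. -/
def IsClassOf {d : A →ₗ[R] A} (h : Homology d) (z : A) : Prop :=
  ∃ hz : z ∈ LinearMap.ker d, h = Submodule.Quotient.mk ⟨z, hz⟩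

variable {mul : A →ₗ[R] A →ₗ[R] A} {one : A} {d : A →ₗ[R] A}

theorem IsDGAlgebra.d_one (h : IsDGAlgebra mul one d) : d one = 0 := by
  have := h.leibniz one one
  rw [h.one_mul, h.one_mul, h.mul_one] at this
  simpa using this

theorem IsDGAlgebra.mul_mem_ker (h : IsDGAlgebra mul one d) {a b : A}
    (ha : a ∈ LinearMap.ker d) (hb : b ∈ LinearMap.ker d) : mul a b ∈ LinearMap.ker d := by
  rw [LinearMap.mem_ker] at *
  rw [h.leibniz, ha, hb]
  simp

/-- Multiplication of cycles. -/
def cycleMul (h : IsDGAlgebra mul one d) :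
    LinearMap.ker d →ₗ[R] LinearMap.ker d →ₗ[R] LinearMap.ker d :=
  LinearMap.mk₂ R (fun a b => ⟨mul a b, h.mul_mem_ker a.2 b.2⟩)
    (fun a b c => Subtype.ext (by simp)) (fun r a b => Subtype.ext (by simp))
    (fun a b c => Subtype.ext (by simp)) (fun r a b => Subtype.ext (by simp))

/-- The induced multiplication on homology, `[a] * [b] = [a * b]`. -/
def homologyMul (h : IsDGAlgebra mul one d) :
    Homology d →ₗ[R] Homology d →ₗ[R] Homology d :=
  Submodule.liftQ _
    { toFun := fun a => Submodule.mapQ _ _ (cycleMul h a) (by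
        rintro ⟨b, hb⟩ ⟨c, hc⟩
        refine ⟨mul a c, ?_⟩
        have ha : d a = 0 := a.2
        have hc' : d c = b := hc
        simp [h.leibniz, ha, hc', cycleMul])
      map_add' := fun a b => by ext c; simp
      map_smul' := fun r a => by ext c; simp } (by
    rintro ⟨a, ha⟩ ⟨c, hc⟩
    rw [LinearMap.mem_ker]
    ext b
    have hb : d b = 0 := b.2
    have hc' : d c = a := hc
    refine (Submodule.Quotient.mk_eq_zero _).2 ⟨mul c b, ?_⟩
    simp [h.leibniz, hb, hc', cycleMul])

theorem homologyMul_mk (h : IsDGAlgebra mul one d) (a b : LinearMap.ker d) :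
    homologyMul h (Submodule.Quotient.mk a) (Submodule.Quotient.mk b)
      = Submodule.Quotient.mk ⟨mul a b, h.mul_mem_ker a.2 b.2⟩ := rfl

/-- The homology of a differential algebra as a ring. -/
@[reducible]
def homologyRing (h : IsDGAlgebra mul one d) : Ring (Homology d) where
  __ := (inferInstance : AddCommGroup (Homology d))
  mul a b := homologyMul h a b
  one := Submodule.Quotient.mk ⟨one, h.d_one⟩
  mul_assoc a b c := by
    obtain ⟨a, rfl⟩ := Submodule.Quotient.mk_surjective _ a
    obtain ⟨b, rfl⟩ := Submodule.Quotient.mk_surjective _ b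
    obtain ⟨c, rfl⟩ := Submodule.Quotient.mk_surjective _ c
    exact congrArg Submodule.Quotient.mk (Subtype.ext (h.mul_assoc _ _ _))
  one_mul a := by
    obtain ⟨a, rfl⟩ := Submodule.Quotient.mk_surjective _ a
    exact congrArg Submodule.Quotient.mk (Subtype.ext (h.one_mul _))
  mul_one a := by
    obtain ⟨a, rfl⟩ := Submodule.Quotient.mk_surjective _ a
    exact congrArg Submodule.Quotient.mk (Subtype.ext (h.mul_one _))
  zero_mul a := by
    change homologyMul h 0 a = 0
    simp
  mul_zero a := by
    change homologyMul h a 0 = 0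
    simp
  left_distrib a b c := by
    change homologyMul h a (b + c) = homologyMul h a b + homologyMul h a c
    simp
  right_distrib a b c := by
    change homologyMul h (a + b) c = homologyMul h a c + homologyMul h b c
    simp
  zsmul := fun n a => n • a
  zsmul_zero' := fun a => zero_smul ℤ a
  zsmul_succ' := fun n a => SubNegMonoid.zsmul_succ' n a
  zsmul_neg' := fun n a => SubNegMonoid.zsmul_neg' n a
  nsmul := fun n a => n • a
  nsmul_zero := fun a => zero_smul ℕ a
  nsmul_succ := fun n a => AddMonoid.nsmul_succ n a
  neg_add_cancel := fun a => neg_add_cancel a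

end Homology

/-! ### The bordered algebras -/

/-- Idempotent states: `k`-element subsets of `{0, …, m}`. -/
abbrev IdState (m k : ℕ) : Type := {x : Finset (Fin (m + 1)) // x.card = k}

/-- The weight vector of an idempotent state; the entry with index `i : Fin m` is
`v_{i+1} = #{a ∈ x | a ≥ i + 1}`. -/
def stateWeight {m k : ℕ} (x : IdState m k) (i : Fin m) : ℤ :=
  ((x.1.filter (fun a : Fin (m + 1) => (i : ℕ) + 1 ≤ (a : ℕ))).card : ℤ)

/-- The (always integral and nonnegative) number
`(|v^x_i - v^y_i| + |v^y_i - v^z_i| - |v^x_i - v^z_i|) / 2`, as a vector of exponents. -/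
def mulExponent {m k : ℕ} (x y z : IdState m k) : Fin m →₀ ℕ :=
  Finsupp.equivFunOnFinite.symm fun i =>
    ((stateWeight x i - stateWeight y i).natAbs + (stateWeight y i - stateWeight z i).natAbs
      - (stateWeight x i - stateWeight z i).natAbs) / 2

theorem mulExponent_assoc {m k : ℕ} (x y z w : IdState m k) :
    mulExponent x y z + mulExponent x z w = mulExponent x y w + mulExponent y z w := by
  ext i
  simp only [mulExponent, Finsupp.add_apply, Finsupp.equivFunOnFinite_symm_apply_apply]
  omega

theorem mulExponent_left {m k : ℕ} (x y : IdState m k) : mulExponent x x y = 0 := by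
  ext i
  simp [mulExponent]

theorem mulExponent_right {m k : ℕ} (x y : IdState m k) : mulExponent x y y = 0 := by
  ext i
  simp [mulExponent]

/-- The algebra `B₀(m,k)`: the `(x, y)` entry is the coefficient in `𝔽₂[U₁, …, U_m]` of the
generator `γ_{x,y}`. -/
def Blg0 (m k : ℕ) : Type := IdState m k → IdState m k → Base m

namespace Blg0

variable {m k : ℕ}

instance : AddCommGroup (Blg0 m k) :=
  inferInstanceAs (AddCommGroup (IdState m k → IdState m k → Base m))

/-- `p · γ_{x,y}`. -/
def gen (x y : IdState m k) (p : Base m) : Blg0 m k := Pi.single x (Pi.single y p)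

/-- The product determined by `γ_{x,y} · γ_{y,z} = U^n · γ_{x,z}`. -/
instance : Mul (Blg0 m k) :=
  ⟨fun a b x z => ∑ y, a x y * b y z * MvPolynomial.monomial (mulExponent x y z) 1⟩

instance : One (Blg0 m k) := ⟨fun x y => if x = y then 1 else 0⟩

theorem mul_apply (a b : Blg0 m k) (x z : IdState m k) :
    (a * b) x z = ∑ y, a x y * b y z * MvPolynomial.monomial (mulExponent x y z) 1 := rfl

theorem one_apply (x y : IdState m k) : (1 : Blg0 m k) x y = if x = y then 1 else 0 := rfl

theorem add_apply (a b : Blg0 m k) (x y : IdState m k) : (a + b) x y = a x y + b x y := rfl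

theorem zero_apply (x y : IdState m k) : (0 : Blg0 m k) x y = 0 := rfl

theorem ext' {a b : Blg0 m k} (h : ∀ x y, a x y = b x y) : a = b :=
  funext fun x => funext fun y => h x y

instance : Ring (Blg0 m k) where
  __ := (inferInstance : AddCommGroup (Blg0 m k))
  mul_assoc a b c := ext' fun x w => by
    simp only [mul_apply, Finset.sum_mul]
    rw [Finset.sum_comm]
    refine Finset.sum_congr rfl fun y _ => ?_
    rw [Finset.mul_sum, Finset.sum_mul]
    refine Finset.sum_congr rfl fun z _ => ?_
    have h : (MvPolynomial.monomial (mulExponent x y z) (1 : ZMod 2))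
        * MvPolynomial.monomial (mulExponent x z w) 1
        = MvPolynomial.monomial (mulExponent x y w) 1
        * MvPolynomial.monomial (mulExponent y z w) 1 := by
      rw [MvPolynomial.monomial_mul, MvPolynomial.monomial_mul, mulExponent_assoc]
    linear_combination (a x y * b y z * c z w) * h
  one_mul a := ext' fun x y => by
    simp [mul_apply, one_apply, mulExponent_left]
  mul_one a := ext' fun x y => by
    simp [mul_apply, one_apply, mulExponent_right]
  zero_mul a := ext' fun x y => by simp [mul_apply, zero_apply]
  mul_zero a := ext' fun x y => by simp [mul_apply, zero_apply]
  left_distrib a b c := ext' fun x y => by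
    simp [mul_apply, add_apply, mul_add, add_mul, Finset.sum_add_distrib]
  right_distrib a b c := ext' fun x y => by
    simp [mul_apply, add_apply, add_mul, Finset.sum_add_distrib]
  zsmul := fun n a => n • a
  zsmul_zero' := fun a => zero_smul ℤ a
  zsmul_succ' := fun n a => SubNegMonoid.zsmul_succ' n a
  zsmul_neg' := fun n a => SubNegMonoid.zsmul_neg' n a
  nsmul := fun n a => n • a
  nsmul_zero := fun a => zero_smul ℕ a
  nsmul_succ := fun n a => AddMonoid.nsmul_succ n a
  neg_add_cancel := fun a => neg_add_cancel a

/-- `y` arises from `x` by moving one element from `i + 1` to the unoccupied position `i`. -/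
def IsLeftMove (i : Fin m) (x y : IdState m k) : Prop :=
  i.succ ∈ x.1 ∧ i.castSucc ∉ x.1 ∧ y.1 = insert i.castSucc (x.1.erase i.succ)

open Classical in
/-- The element `L_{i+1}`. -/
def L (i : Fin m) : Blg0 m k := fun x y => if IsLeftMove i x y then 1 else 0

open Classical in
/-- The element `R_{i+1}`. -/
def R (i : Fin m) : Blg0 m k := fun x y => if IsLeftMove i y x then 1 else 0

/-- The element `U_{i+1}`. -/
def U (i : Fin m) : Blg0 m k := fun x y => if x = y then MvPolynomial.X i else 0

/-- The idempotent of an idempotent state. -/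
def idem (x : IdState m k) : Blg0 m k := gen x x 1

/-- The generators of the ideal `J`: the products `L_{j+1} L_j` and `R_j R_{j+1}`, and
`I_x U_j` for `x ∩ {j - 1, j} = ∅`. -/
def relations (m k : ℕ) : Set (Blg0 m k) :=
  {b | ∃ i j : Fin m, (j : ℕ) = i + 1 ∧ b = L j * L i}
    ∪ {b | ∃ i j : Fin m, (j : ℕ) = i + 1 ∧ b = R i * R j}
    ∪ {b | ∃ (x : IdState m k) (j : Fin m),
        j.castSucc ∉ x.1 ∧ j.succ ∉ x.1 ∧ b = idem x * U j}

/-- The states `x` with `x ∩ {0, m} = ∅`. -/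
def IsInner (x : IdState m k) : Prop := 0 ∉ x.1 ∧ Fin.last m ∉ x.1

open Classical in
/-- The sum of the idempotents of all states `x` with `x ∩ {0, m} = ∅`. -/
def innerIdem (m k : ℕ) : Blg0 m k := ∑ x : IdState m k with IsInner x, idem x

theorem gen_mul_gen_same (x : IdState m k) : idem x * idem x = idem x := by
  refine ext' fun a b => ?_
  rw [mul_apply, Finset.sum_eq_single x]
  · by_cases ha : a = x
    · subst ha
      by_cases hb : b = a
      · subst hb; simp [idem, gen, mulExponent_left]
      · simp [idem, gen, Pi.single_eq_of_ne hb]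
    · simp [idem, gen, Pi.single_eq_of_ne ha]
  · intro y _ hy
    simp [idem, gen, Pi.single_eq_of_ne hy]
  · simp

theorem idem_mul_idem_ne {x y : IdState m k} (h : x ≠ y) : idem x * idem y = 0 := by
  refine ext' fun a b => ?_
  rw [mul_apply]
  refine Finset.sum_eq_zero fun z _ => ?_
  by_cases hz : z = y
  · subst hz
    by_cases ha : a = x
    · subst ha
      simp [idem, gen, Pi.single_eq_of_ne (Ne.symm h)]
    · simp [idem, gen, Pi.single_eq_of_ne ha]
  · simp [idem, gen, Pi.single_eq_of_ne hz]

theorem isIdempotentElem_innerIdem : IsIdempotentElem (innerIdem m k) := by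
  unfold IsIdempotentElem innerIdem
  rw [Finset.sum_mul_sum]
  refine Finset.sum_congr rfl fun x hx => ?_
  rw [Finset.sum_eq_single x]
  · exact gen_mul_gen_same x
  · intro y _ hy
    exact idem_mul_idem_ne (Ne.symm hy)
  · intro h; exact absurd hx h

end Blg0

/-- The algebra `B(m,k) = B₀(m,k) / J`. -/
abbrev Blg (m k : ℕ) : Type := (TwoSidedIdeal.span (Blg0.relations m k)).ringCon.Quotient

/-- The quotient map `B₀(m,k) → B(m,k)`. -/
def Blg.mk (m k : ℕ) : Blg0 m k →+* Blg m k :=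
  (TwoSidedIdeal.span (Blg0.relations m k)).ringCon.mk'

theorem Blg.isIdempotentElem_inner (m k : ℕ) :
    IsIdempotentElem (Blg.mk m k (Blg0.innerIdem m k)) :=
  Blg0.isIdempotentElem_innerIdem.map (Blg.mk m k)

/-- The bordered algebra `C(m,k)`: the corner `J · B(m,k) · J` of `B(m,k)`, where `J` is the
sum of the idempotents of the states contained in `{1, …, m - 1}`; its unit is `J`. -/
abbrev Clg (m k : ℕ) : Type := (Blg.isIdempotentElem_inner m k).Corner

/-- The element `J · b · J` of `C(m,k)` for `b ∈ B₀(m,k)`. -/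
def Clg.proj {m k : ℕ} (b : Blg0 m k) : Clg m k :=
  ⟨Blg.mk m k (Blg0.innerIdem m k) * Blg.mk m k b * Blg.mk m k (Blg0.innerIdem m k),
    Blg.mk m k b, rfl⟩

/-! ### Lifted partial permutations -/

/-- The group `G_m` of motions of `ℤ` generated by the reflections `r_{1/2} : x ↦ 1 - x` and
`r_{m-1/2} : x ↦ 2m - 1 - x`. -/
def reflGroup (m : ℕ) : Subgroup (Equiv.Perm ℤ) :=
  Subgroup.closure {Equiv.subLeft (1 : ℤ), Equiv.subLeft (2 * (m : ℤ) - 1)}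

/-- The class of an integer in `ℤ / G_m`. -/
def orb (m : ℕ) (i : ℤ) : MulAction.orbitRel.Quotient (reflGroup m) ℤ := Quotient.mk _ i

theorem orb_eq_iff {m : ℕ} {i j : ℤ} : orb m i = orb m j ↔ ∃ g ∈ reflGroup m, i = g j := by
  unfold orb
  rw [Quotient.eq, MulAction.orbitRel_apply, MulAction.mem_orbit_iff]
  constructor
  · rintro ⟨g, hg⟩
    exact ⟨g, g.2, hg.symm⟩
  · rintro ⟨g, hg, h⟩
    exact ⟨⟨g, hg⟩, h.symm⟩

theorem orb_apply {m : ℕ} {g : Equiv.Perm ℤ} (hg : g ∈ reflGroup m) (i : ℤ) :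
    orb m (g i) = orb m i :=
  orb_eq_iff.2 ⟨g, hg, rfl⟩

/-- Every element of `G_m` is a translation or a reflection about a half-integer. -/
theorem reflGroup_form {m : ℕ} {g : Equiv.Perm ℤ} (hg : g ∈ reflGroup m) :
    (∃ n : ℤ, ∀ x, g x = x + n * (2 * m - 2)) ∨ (∃ n : ℤ, ∀ x, g x = 1 - x + n * (2 * m - 2)) := by
  induction hg using Subgroup.closure_induction with
  | mem g hg =>
    rcases hg with rfl | rfl
    · exact Or.inr ⟨0, fun x => by simp⟩
    · exact Or.inr ⟨1, fun x => by simp; ring⟩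
  | one => exact Or.inl ⟨0, fun x => by simp⟩
  | mul g h _ _ hg hh =>
    rcases hg with ⟨n, hn⟩ | ⟨n, hn⟩ <;> rcases hh with ⟨l, hl⟩ | ⟨l, hl⟩
    · exact Or.inl ⟨n + l, fun x => by rw [Equiv.Perm.mul_apply, hn, hl]; ring⟩
    · exact Or.inr ⟨n + l, fun x => by rw [Equiv.Perm.mul_apply, hn, hl]; ring⟩
    · exact Or.inr ⟨n - l, fun x => by rw [Equiv.Perm.mul_apply, hn, hl]; ring⟩
    · exact Or.inl ⟨n - l, fun x => by rw [Equiv.Perm.mul_apply, hn, hl]; ring⟩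
  | inv g _ hg =>
    rcases hg with ⟨n, hn⟩ | ⟨n, hn⟩
    · exact Or.inl ⟨-n, fun x => by rw [Equiv.Perm.inv_eq_iff_eq, hn]; ring⟩
    · exact Or.inr ⟨n, fun x => by rw [Equiv.Perm.inv_eq_iff_eq, hn]; ring⟩

/-- `G_m` acts freely on `ℤ`. -/
theorem reflGroup_free {m : ℕ} {g h : Equiv.Perm ℤ} (hg : g ∈ reflGroup m)
    (hh : h ∈ reflGroup m) {i : ℤ} (e : g i = h i) : g = h := by
  ext x
  rcases reflGroup_form hg with ⟨n, hn⟩ | ⟨n, hn⟩ <;>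
    rcases reflGroup_form hh with ⟨l, hl⟩ | ⟨l, hl⟩
  · rw [hn, hl] at *; linarith
  · rw [hn, hl] at e
    have : 2 * (i + (n - l) * (m - 1)) = 1 := by linarith
    omega
  · rw [hn, hl] at e
    have : 2 * (i + (l - n) * (m - 1)) = 1 := by linarith
    omega
  · rw [hn, hl] at *; linarith

/-- A lifted partial permutation on `k` letters: a `G_m`-equivariant map to `ℤ` from a
`G_m`-invariant subset of `ℤ` with `k` orbits, injective on orbits.  It is encoded as a partial
function; the value `none` means that the integer is not in the domain. -/
@[ext]
structure LiftedPartialPerm (m k : ℕ) where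
  /-- the underlying partial function -/
  toFun : ℤ → Option ℤ
  equivariant : ∀ g ∈ reflGroup m, ∀ i, toFun (g i) = (toFun i).map g
  card_orbits : (orb m '' {i | (toFun i).isSome}).ncard = k
  injective : ∀ i j a b, toFun i = some a → toFun j = some b → orb m a = orb m b →
    orb m i = orb m j

namespace LiftedPartialPerm

variable {m k : ℕ}

/-- The component of index `j : Fin m` of the vector of local multiplicities: half the number
of lifted strands that pass the wall at horizontal position `j + 1/2`. -/
def weight (f : LiftedPartialPerm m k) (j : Fin m) : ℚ :=
  (1 / 2) * (Set.ncard {i : ℤ | ∃ b : ℤ, f.toFun i = some b ∧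
    (((i : ℚ) < (j : ℚ) + 1 / 2 ∧ (j : ℚ) + 1 / 2 < (b : ℚ)) ∨
      ((b : ℚ) < (j : ℚ) + 1 / 2 ∧ (j : ℚ) + 1 / 2 < (i : ℚ)))} : ℚ)

/-- Lifted crossings: pairs in the domain whose order is reversed. -/
abbrev LiftedCrossing (f : LiftedPartialPerm m k) : Type :=
  {p : ℤ × ℤ // ∃ a b, f.toFun p.1 = some a ∧ f.toFun p.2 = some b ∧
    Int.sign (p.1 - p.2) ≠ Int.sign (a - b)}

/-- The equivalence relation on lifted crossings generated by `(i, j) ∼ (j, i)` and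
`(i, j) ∼ (g i, g j)` for `g ∈ G_m`. -/
def crossingSetoid (f : LiftedPartialPerm m k) : Setoid (LiftedCrossing f) where
  r p q := ∃ g ∈ reflGroup m, p.1 = (g q.1.1, g q.1.2) ∨ p.1 = (g q.1.2, g q.1.1)
  iseqv :=
    { refl := fun p => ⟨1, one_mem _, Or.inl rfl⟩
      symm := by
        rintro p q ⟨g, hg, h | h⟩
        · exact ⟨g⁻¹, inv_mem hg, Or.inl (by simp [h])⟩
        · exact ⟨g⁻¹, inv_mem hg, Or.inr (by simp [h])⟩
      trans := by
        rintro p q r ⟨g, hg, h | h⟩ ⟨g', hg', h' | h'⟩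
        · exact ⟨g * g', mul_mem hg hg', Or.inl (by simp [h, h'])⟩
        · exact ⟨g * g', mul_mem hg hg', Or.inr (by simp [h, h'])⟩
        · exact ⟨g * g', mul_mem hg hg', Or.inr (by simp [h, h'])⟩
        · exact ⟨g * g', mul_mem hg hg', Or.inl (by simp [h, h'])⟩ }

/-- Crossings. -/
def Crossing (f : LiftedPartialPerm m k) : Type := Quotient (crossingSetoid f)

/-- The crossing number. -/
def cross (f : LiftedPartialPerm m k) : ℕ := Nat.card (Crossing f)

/-- The composite of `f` and `g` is defined when the domain of `g` is the range of `f`. -/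
def Composable (g f : LiftedPartialPerm m k) : Prop :=
  ∀ a, (g.toFun a).isSome ↔ ∃ i, f.toFun i = some a

/-- The composite `g ∘ f`. -/
def comp (g f : LiftedPartialPerm m k) (h : Composable g f) : LiftedPartialPerm m k where
  toFun i := (f.toFun i).bind g.toFun
  equivariant s hs i := by
    rw [f.equivariant s hs]
    cases hf : f.toFun i with
    | none => rfl
    | some a => exact g.equivariant s hs a
  card_orbits := by
    refine Eq.trans ?_ f.card_orbits
    congr 2
    ext i
    simp only [Set.mem_ofPred_eq]
    cases hf : f.toFun i with
    | none => simp
    | some a => simpa using (h a).2 ⟨i, hf⟩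
  injective i j a b hi hj hab := by
    obtain ⟨a', ha', ha⟩ := Option.bind_eq_some_iff.1 hi
    obtain ⟨b', hb', hb⟩ := Option.bind_eq_some_iff.1 hj
    exact f.injective i j a' b' ha' hb' (g.injective a' b' a b ha hb hab)

end LiftedPartialPerm

open Classical in
/-- The equivariant exchange of the orbits of `i` and `j`: it sends `g i` to `g j` and `g j` to
`g i`, and fixes all integers outside these orbits. -/
def orbitSwap (m : ℕ) (i j k : ℤ) : ℤ :=
  if h : ∃ g ∈ reflGroup m, k = g i then h.choose j
  else if h : ∃ g ∈ reflGroup m, k = g j then h.choose i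
  else k

section orbitSwap

variable {m : ℕ} {i j : ℤ}

theorem orbitSwap_left {g : Equiv.Perm ℤ} (hg : g ∈ reflGroup m) :
    orbitSwap m i j (g i) = g j := by
  have h : ∃ g' ∈ reflGroup m, g i = g' i := ⟨g, hg, rfl⟩
  rw [orbitSwap, dif_pos h]
  exact congrArg (fun s : Equiv.Perm ℤ => s j)
    (reflGroup_free hg h.choose_spec.1 h.choose_spec.2).symm

theorem orbitSwap_right {g : Equiv.Perm ℤ} (hg : g ∈ reflGroup m) (hij : orb m i ≠ orb m j) :
    orbitSwap m i j (g j) = g i := by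
  have h : ∃ g' ∈ reflGroup m, g j = g' j := ⟨g, hg, rfl⟩
  have h' : ¬ ∃ g' ∈ reflGroup m, g j = g' i := by
    intro h'
    exact hij ((orb_eq_iff.2 h').symm.trans (orb_apply hg j))
  rw [orbitSwap, dif_neg h', dif_pos h]
  exact congrArg (fun s : Equiv.Perm ℤ => s i)
    (reflGroup_free hg h.choose_spec.1 h.choose_spec.2).symm

theorem orbitSwap_of_ne {k : ℤ} (hi : orb m k ≠ orb m i) (hj : orb m k ≠ orb m j) :
    orbitSwap m i j k = k := by
  have h : ¬ ∃ g' ∈ reflGroup m, k = g' i := fun h => hi (orb_eq_iff.2 h)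
  have h' : ¬ ∃ g' ∈ reflGroup m, k = g' j := fun h => hj (orb_eq_iff.2 h)
  rw [orbitSwap, dif_neg h, dif_neg h']

theorem orbitSwap_cases (m : ℕ) (i j k : ℤ) :
    (∃ g ∈ reflGroup m, k = g i ∧ orbitSwap m i j k = g j) ∨
    (orb m i ≠ orb m j ∧ ∃ g ∈ reflGroup m, k = g j ∧ orbitSwap m i j k = g i) ∨
    (orb m k ≠ orb m i ∧ orb m k ≠ orb m j ∧ orbitSwap m i j k = k) := by
  by_cases hi : orb m k = orb m i
  · obtain ⟨g, hg, rfl⟩ := orb_eq_iff.1 hi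
    exact Or.inl ⟨g, hg, rfl, orbitSwap_left hg⟩
  · by_cases hj : orb m k = orb m j
    · obtain ⟨g, hg, rfl⟩ := orb_eq_iff.1 hj
      have hij : orb m i ≠ orb m j := fun h => hi (hj.trans h.symm)
      exact Or.inr (Or.inl ⟨hij, g, hg, rfl, orbitSwap_right hg hij⟩)
    · exact Or.inr (Or.inr ⟨hi, hj, orbitSwap_of_ne hi hj⟩)

theorem orbitSwap_equivariant {g : Equiv.Perm ℤ} (hg : g ∈ reflGroup m) (k : ℤ) :
    orbitSwap m i j (g k) = g (orbitSwap m i j k) := by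
  rcases orbitSwap_cases m i j k with ⟨s, hs, rfl, h⟩ | ⟨hij, s, hs, rfl, h⟩ | ⟨hi, hj, h⟩
  · rw [h]
    exact orbitSwap_left (mul_mem hg hs)
  · rw [h]
    exact orbitSwap_right (mul_mem hg hs) hij
  · rw [h, orbitSwap_of_ne (by rwa [orb_apply hg]) (by rwa [orb_apply hg])]

theorem orb_orbitSwap_injective {k l : ℤ}
    (h : orb m (orbitSwap m i j k) = orb m (orbitSwap m i j l)) : orb m k = orb m l := by
  rcases orbitSwap_cases m i j k with ⟨s, hs, rfl, e⟩ | ⟨hij, s, hs, rfl, e⟩ | ⟨hi, hj, e⟩ <;>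
  rcases orbitSwap_cases m i j l with ⟨t, ht, rfl, e'⟩ | ⟨hij', t, ht, rfl, e'⟩ |
    ⟨hi', hj', e'⟩ <;>
  rw [e, e'] at h <;> simp_all [orb_apply]

end orbitSwap

namespace LiftedPartialPerm

variable {m k : ℕ}

/-- The lifted resolution of `f` at a lifted crossing `(i, j)`: the map that sends `g i` to
`g (f j)` and `g j` to `g (f i)`, and agrees with `f` outside the orbits of `i` and `j`. -/
def resolveAt (f : LiftedPartialPerm m k) (p : LiftedCrossing f) : LiftedPartialPerm m k where
  toFun l := f.toFun (orbitSwap m p.1.1 p.1.2 l)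
  equivariant g hg l := by
    rw [orbitSwap_equivariant hg, f.equivariant g hg]
  card_orbits := by
    refine Eq.trans ?_ f.card_orbits
    congr 2
    ext l
    simp only [Set.mem_ofPred_eq]
    obtain ⟨a, b, ha, hb, -⟩ := p.2
    rcases orbitSwap_cases m p.1.1 p.1.2 l with ⟨s, hs, hl, e⟩ | ⟨hij, s, hs, hl, e⟩ | ⟨_, _, e⟩
    · rw [e, hl, f.equivariant s hs, f.equivariant s hs, ha, hb]; simp
    · rw [e, hl, f.equivariant s hs, f.equivariant s hs, ha, hb]; simp
    · rw [e]
  injective l l' a b hl hl' hab := orb_orbitSwap_injective (f.injective _ _ a b hl hl' hab)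

/-- The resolution of `f` at a crossing (it does not depend on the representing pair). -/
def resolve (f : LiftedPartialPerm m k) (c : Crossing f) : LiftedPartialPerm m k :=
  f.resolveAt (Quotient.out (s := crossingSetoid f) c)

/-- Every integer is equivalent to one of `1, …, m - 1`. -/
theorem exists_rep (hm : 1 < m) (i : ℤ) :
    ∃ g ∈ reflGroup m, ∃ s : ℤ, 1 ≤ s ∧ s ≤ m - 1 ∧ i = g s := by
  have h1 : Equiv.subLeft (1 : ℤ) ∈ reflGroup m := Subgroup.subset_closure (by simp)
  have h2 : Equiv.subLeft (2 * (m : ℤ) - 1) ∈ reflGroup m := Subgroup.subset_closure (by simp)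
  have ht : ∀ n : ℤ, Equiv.addRight (n * (2 * (m : ℤ) - 2)) ∈ reflGroup m := by
    intro n
    have key : Equiv.subLeft (2 * (m : ℤ) - 1) * Equiv.subLeft (1 : ℤ)
        = Equiv.addRight (2 * (m : ℤ) - 2) := by
      ext x; simp; ring
    have hmem := mul_mem h2 h1
    rw [key] at hmem
    induction n using Int.induction_on with
    | zero => convert one_mem (reflGroup m); ext x; simp
    | succ n ih => convert mul_mem hmem ih using 1; ext x; simp; ring
    | pred n ih => convert mul_mem (inv_mem hmem) ih using 1; ext x; simp; ring
  have hN : (0 : ℤ) < 2 * m - 2 := by omega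
  have e := Int.emod_add_mul_ediv (i - 1) (2 * m - 2)
  have hr := Int.emod_nonneg (i - 1) hN.ne'
  have hr' := Int.emod_lt_of_pos (i - 1) hN
  set r := (i - 1) % (2 * m - 2)
  set q := (i - 1) / (2 * m - 2)
  by_cases h : r ≤ m - 2
  · refine ⟨_, ht q, r + 1, by omega, by omega, ?_⟩
    simp only [Equiv.coe_addRight]
    linarith
  · refine ⟨_, mul_mem (ht q) h2, 2 * m - 2 - r, by omega, by omega, ?_⟩
    simp only [Equiv.Perm.mul_apply, Equiv.coe_addRight, Equiv.subLeft_apply]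
    linarith

/-- A lifted partial permutation is determined by its values on `{1, …, m - 1}`; only finitely
many of them have their values there in given finite sets. -/
theorem finite_of_values (hm : 1 < m) (V : ℤ → Set (Option ℤ)) (hV : ∀ l, (V l).Finite) :
    {f : LiftedPartialPerm m k | ∀ l : ℤ, 1 ≤ l → l ≤ m - 1 → f.toFun l ∈ V l}.Finite := by
  have hfin : (Set.pi (Set.univ : Set (Set.Icc (1 : ℤ) (m - 1))) fun l => V l).Finite :=
    Set.Finite.pi fun l => hV l
  refine Set.Finite.of_finite_image (f := fun f (l : Set.Icc (1 : ℤ) (m - 1)) => f.toFun l)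
    (hfin.subset ?_) ?_
  · rintro _ ⟨f, hf, rfl⟩ l -
    exact hf l l.2.1 l.2.2
  · intro f _ f' _ h
    ext1
    funext i
    obtain ⟨g, hg, s, hs, hs', rfl⟩ := exists_rep hm i
    rw [f.equivariant g hg, f'.equivariant g hg]
    exact congrArg (Option.map g) (congrFun h ⟨s, hs, hs'⟩)

/-- A lifted partial permutation has only finitely many crossings. -/
theorem finite_crossing (hm : 1 < m) (f : LiftedPartialPerm m k) : Finite (Crossing f) := by
  obtain ⟨B, hB⟩ : ∃ B : ℤ, ∀ i a, f.toFun i = some a → |a - i| ≤ B := by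
    obtain ⟨B, hB⟩ := ((Set.finite_Icc (1 : ℤ) (m - 1)).image
      (fun s => |(f.toFun s).getD 0 - s|)).bddAbove
    refine ⟨B, fun i a hi => ?_⟩
    obtain ⟨g, hg, s, hs, hs', rfl⟩ := exists_rep hm i
    rw [f.equivariant g hg] at hi
    obtain ⟨b, hb, rfl⟩ := Option.map_eq_some_iff.1 hi
    have h := hB ⟨s, ⟨hs, hs'⟩, rfl⟩
    simp only [hb, Option.getD_some] at h
    rcases reflGroup_form hg with ⟨n, hn⟩ | ⟨n, hn⟩
    · rw [hn, hn]
      rwa [show b + n * (2 * m - 2) - (s + n * (2 * m - 2)) = b - s by ring]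
    · rw [hn, hn]
      rwa [show 1 - b + n * (2 * m - 2) - (1 - s + n * (2 * m - 2)) = -(b - s) by ring, abs_neg]
  have hfin : {p : LiftedCrossing f |
      p.1 ∈ Set.Icc (1 : ℤ) (m - 1) ×ˢ Set.Icc (1 - 2 * B) (m - 1 + 2 * B)}.Finite :=
    Set.Finite.preimage Subtype.val_injective.injOn
      ((Set.finite_Icc _ _).prod (Set.finite_Icc _ _))
  have := hfin.to_subtype
  refine Finite.of_surjective (fun p : {p : LiftedCrossing f |
      p.1 ∈ Set.Icc (1 : ℤ) (m - 1) ×ˢ Set.Icc (1 - 2 * B) (m - 1 + 2 * B)} =>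
        (Quotient.mk (crossingSetoid f) p.1 : Crossing f)) ?_
  intro c
  induction c using Quotient.inductionOn with
  | _ p =>
  obtain ⟨⟨i, j⟩, a, b, ha, hb, hab⟩ := p
  dsimp only at ha hb hab
  obtain ⟨g, hg, s, hs, hs', rfl⟩ := exists_rep hm i
  have ha' : f.toFun s = some (g⁻¹ a) := by
    have := f.equivariant g⁻¹ (inv_mem hg) (g s)
    rw [ha] at this
    simpa using this
  have hb' : f.toFun (g⁻¹ j) = some (g⁻¹ b) := by
    rw [f.equivariant g⁻¹ (inv_mem hg), hb]; rfl
  have hab' : Int.sign (s - g⁻¹ j) ≠ Int.sign (g⁻¹ a - g⁻¹ b) := by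
    have key : (∀ x y, g⁻¹ x - g⁻¹ y = x - y) ∨ (∀ x y, g⁻¹ x - g⁻¹ y = -(x - y)) := by
      rcases reflGroup_form (inv_mem hg) with ⟨n, hn⟩ | ⟨n, hn⟩
      · exact Or.inl fun x y => by rw [hn, hn]; ring
      · exact Or.inr fun x y => by rw [hn, hn]; ring
    have hs2 : s = g⁻¹ (g s) := by simp
    rcases key with key | key
    · rw [hs2, key, key]; exact hab
    · rw [hs2, key, key, Int.sign_neg, Int.sign_neg]
      exact fun h => hab (neg_injective h)
  have h1 := abs_le.1 (hB _ _ ha')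
  have h2 := abs_le.1 (hB _ _ hb')
  have h3 : |s - g⁻¹ j| ≤ 2 * B := by
    by_contra hc
    rcases lt_abs.1 (not_le.1 hc) with h | h
    · rw [Int.sign_eq_one_of_pos (by linarith), Int.sign_eq_one_of_pos (by linarith)] at hab'
      exact hab' rfl
    · rw [Int.sign_eq_neg_one_of_neg (by linarith), Int.sign_eq_neg_one_of_neg (by linarith)]
        at hab'
      exact hab' rfl
  have h4 := abs_le.1 h3
  refine ⟨⟨⟨(s, g⁻¹ j), _, _, ha', hb', hab'⟩, ⟨hs, hs'⟩, ?_, ?_⟩, ?_⟩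
  · dsimp only; linarith
  · dsimp only; linarith
  · exact Quotient.sound (s := crossingSetoid f) ⟨g⁻¹, inv_mem hg, Or.inl (by simp)⟩

end LiftedPartialPerm

/-! ### The pong algebra -/

/-- The exponents of the monomial that makes up for a difference of two weight vectors
(which is always a vector of nonnegative integers in the uses below). -/
def exponentOf {m : ℕ} (w : Fin m → ℚ) : Fin m →₀ ℕ :=
  Finsupp.equivFunOnFinite.symm fun i => ⌊w i⌋₊

/-- The pong algebra on `m` walls and `k` strands: the free `𝔽₂[v₁, …, v_m]`-module on the
lifted partial permutations on `k` letters. -/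
def Pong (m k : ℕ) : Type := LiftedPartialPerm m k →₀ Base m

namespace Pong

variable {m k : ℕ}

instance : AddCommGroup (Pong m k) :=
  inferInstanceAs (AddCommGroup (LiftedPartialPerm m k →₀ Base m))

instance : Module (Base m) (Pong m k) :=
  inferInstanceAs (Module (Base m) (LiftedPartialPerm m k →₀ Base m))

/-- The element `v^a · f`. -/
def pure (f : LiftedPartialPerm m k) (a : Fin m →₀ ℕ) : Pong m k :=
  Finsupp.single f (MvPolynomial.monomial a 1)

open Classical in
/-- The product `g · f` of two lifted partial permutations: the composite `g ∘ f`, times a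
monomial, if it is defined and crossing numbers add up; zero otherwise. -/
def mulPure (g f : LiftedPartialPerm m k) : Pong m k :=
  if h : g.Composable f then
    if (g.comp f h).cross = g.cross + f.cross then
      pure (g.comp f h) (exponentOf fun i => f.weight i + g.weight i - (g.comp f h).weight i)
    else 0
  else 0

/-- The multiplication `μ₂`. -/
def mul (m k : ℕ) : Pong m k →ₗ[Base m] Pong m k →ₗ[Base m] Pong m k :=
  Finsupp.linearCombination (Base m) fun g : LiftedPartialPerm m k =>
    (Finsupp.linearCombination (Base m) fun f : LiftedPartialPerm m k => mulPure g f :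
      Pong m k →ₗ[Base m] Pong m k)

instance : Mul (Pong m k) := ⟨fun a b => mul m k a b⟩

/-- The sum of all lifted partial permutations that are the identity on their domain. -/
instance : One (Pong m k) :=
  ⟨∑ᶠ (f : LiftedPartialPerm m k) (_ : ∀ i, f.toFun i = none ∨ f.toFun i = some i), pure f 0⟩

/-- The differential of a lifted partial permutation: the sum of the resolutions that lower the
crossing number by exactly one, each times a monomial. -/
def diffPure (f : LiftedPartialPerm m k) : Pong m k :=
  ∑ᶠ (c : f.Crossing) (_ : (f.resolve c).cross + 1 = f.cross),
    pure (f.resolve c) (exponentOf fun i => f.weight i - (f.resolve c).weight i)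

/-- The differential `μ₁`. -/
def diff (m k : ℕ) : Pong m k →ₗ[Base m] Pong m k :=
  Finsupp.linearCombination (Base m) fun f : LiftedPartialPerm m k => diffPure f

/-- The idempotent of a subset of `{1, …, m - 1}`. -/
def idem (m k : ℕ) (S : Set ℤ) : Pong m k :=
  ∑ᶠ (f : LiftedPartialPerm m k) (_ : ∀ l : ℤ, 1 ≤ l → l ≤ m - 1 →
    (l ∈ S → f.toFun l = some l) ∧ (l ∉ S → f.toFun l = none)), pure f 0

/-- The element `X_{0,j}`: the strand at `j` bounces once off the left wall and returns to `j`,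
the other strands are constant. -/
def leftBounce (m k : ℕ) (j : ℤ) : Pong m k :=
  ∑ᶠ (f : LiftedPartialPerm m k) (_ : f.toFun j = some (1 - j) ∧
    ∀ l : ℤ, 1 ≤ l → l ≤ m - 1 → l ≠ j → f.toFun l = none ∨ f.toFun l = some l), pure f 0

/-- The element `X_{i,m}`: the strand at `i` bounces once off the right wall and returns to `i`,
the other strands are constant. -/
def rightBounce (m k : ℕ) (i : ℤ) : Pong m k :=
  ∑ᶠ (f : LiftedPartialPerm m k) (_ : f.toFun i = some (2 * m - 1 - i) ∧
    ∀ l : ℤ, 1 ≤ l → l ≤ m - 1 → l ≠ i → f.toFun l = none ∨ f.toFun l = some l), pure f 0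

/-- The element `Ω = ∑_{0 < i < m} [X_{0,i}, X_{i,m}]`. -/
def Omega (m k : ℕ) : Pong m k :=
  ∑ i ∈ Finset.Ioo (0 : ℤ) m,
    (leftBounce m k i * rightBounce m k i - rightBounce m k i * leftBounce m k i)

/-- The elements of crossing degree `c` and weight `w`, where `v_i` has degree zero and weight
the `i`-th basis vector. -/
def bigraded (m k c : ℕ) (w : Fin m → ℚ) : AddSubgroup (Pong m k) :=
  AddSubgroup.closure {z | ∃ (f : LiftedPartialPerm m k) (a : Fin m →₀ ℕ),
    f.cross = c ∧ (∀ i, f.weight i + a i = w i) ∧ z = pure f a}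

end Pong

/-- The homology of the pong algebra. -/
abbrev PongHomology (m k : ℕ) : Type := Homology (Pong.diff m k)

/-- The map `e` is compatible with the two gradings: for inner states `x`, `y`, it sends
`U^a γ_{x,y} t^n` to a class with a representative of crossing degree `2kn` and weight
`|v^x_i - v^y_i| / 2 + a_i + n` at the `i`-th wall. -/
def RespectsGradings {m k l : ℕ} (e : (Clg m l)[X] → PongHomology m k) : Prop :=
  ∀ (x y : IdState m l), Blg0.IsInner x → Blg0.IsInner y → ∀ (a : Fin m →₀ ℕ) (n : ℕ),
    ∃ z ∈ Pong.bigraded m k (2 * k * n)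
        (fun i => |((stateWeight x i : ℚ) - stateWeight y i)| / 2 + a i + n),
      IsClassOf (e (Polynomial.C (Clg.proj (Blg0.gen x y (MvPolynomial.monomial a 1)))
        * Polynomial.X ^ n)) z

/-- The map `e` sends the idempotent of an inner state `x` to the class of the idempotent of the
complementary set `{1, …, m - 1} ∖ x`. -/
def RespectsIdempotents {m k l : ℕ} (e : (Clg m l)[X] → PongHomology m k) : Prop :=
  ∀ x : IdState m l, Blg0.IsInner x →
    IsClassOf (e (Polynomial.C (Clg.proj (Blg0.idem x))))
      (Pong.idem m k {l | ∀ a ∈ x.1, ((a : ℕ) : ℤ) ≠ l})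

end PongAlgebra

end

open PongAlgebra

noncomputable section

namespace PongAlgebra

/-! ### The group of motions and exchanges of orbits -/

section Motions

variable {m : ℕ}

theorem translation_mem (m : ℕ) (n : ℤ) :
    Equiv.addRight (n * (2 * (m : ℤ) - 2)) ∈ reflGroup m := by
  have h1 : Equiv.subLeft (1 : ℤ) ∈ reflGroup m := Subgroup.subset_closure (by simp)
  have h2 : Equiv.subLeft (2 * (m : ℤ) - 1) ∈ reflGroup m := Subgroup.subset_closure (by simp)
  have key : Equiv.subLeft (2 * (m : ℤ) - 1) * Equiv.subLeft (1 : ℤ)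
      = Equiv.addRight (2 * (m : ℤ) - 2) := by
    ext x; simp; ring
  have hmem := mul_mem h2 h1
  rw [key] at hmem
  induction n using Int.induction_on with
  | zero => convert one_mem (reflGroup m); ext x; simp
  | succ n ih => convert mul_mem hmem ih using 1; ext x; simp; ring
  | pred n ih => convert mul_mem (inv_mem hmem) ih using 1; ext x; simp; ring

theorem reflection_mem (m : ℕ) (n : ℤ) :
    Equiv.subLeft (1 + n * (2 * (m : ℤ) - 2)) ∈ reflGroup m := by
  have h1 : Equiv.subLeft (1 : ℤ) ∈ reflGroup m := Subgroup.subset_closure (by simp)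
  convert mul_mem (translation_mem m n) h1 using 1
  ext x; simp; ring

theorem orb_eq_iff_exists {i j : ℤ} : orb m i = orb m j ↔
    ∃ n : ℤ, i = j + n * (2 * m - 2) ∨ i = 1 - j + n * (2 * m - 2) := by
  rw [orb_eq_iff]
  constructor
  · rintro ⟨g, hg, rfl⟩
    rcases reflGroup_form hg with ⟨n, hn⟩ | ⟨n, hn⟩
    · exact ⟨n, Or.inl (hn j)⟩
    · exact ⟨n, Or.inr (hn j)⟩
  · rintro ⟨n, h | h⟩
    · exact ⟨_, translation_mem m n, by simpa using h⟩
    · refine ⟨_, reflection_mem m n, ?_⟩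
      rw [h]; simp; ring

theorem motion_sub {g : Equiv.Perm ℤ} (hg : g ∈ reflGroup m) :
    (∀ x y, g x - g y = x - y) ∨ (∀ x y, g x - g y = y - x) := by
  rcases reflGroup_form hg with ⟨n, hn⟩ | ⟨n, hn⟩
  · exact Or.inl fun x y => by rw [hn, hn]; ring
  · exact Or.inr fun x y => by rw [hn, hn]; ring

/-- `j` is not a translate of `i`. -/
def NonTranslate (m : ℕ) (i j : ℤ) : Prop := ∀ n : ℤ, j ≠ i + n * (2 * m - 2)

theorem NonTranslate.symm {i j : ℤ} (h : NonTranslate m i j) : NonTranslate m j i :=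
  fun n hn => h (-n) (by rw [hn]; ring)

theorem NonTranslate.ne {i j : ℤ} (h : NonTranslate m i j) : i ≠ j :=
  fun e => h 0 (by rw [e]; ring)

theorem NonTranslate.map {i j : ℤ} (h : NonTranslate m i j) {g : Equiv.Perm ℤ}
    (hg : g ∈ reflGroup m) : NonTranslate m (g i) (g j) := by
  intro n hn
  rcases motion_sub hg with h' | h'
  · exact h n (by have := h' j i; linarith)
  · exact h (-n) (by have := h' j i; linarith)

theorem orbitSwap_apply_right {i j : ℤ} (h : NonTranslate m i j) {g : Equiv.Perm ℤ}
    (hg : g ∈ reflGroup m) : orbitSwap m i j (g j) = g i := by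
  by_cases hij : orb m i = orb m j
  · obtain ⟨s, hs, hs'⟩ := orb_eq_iff.1 hij.symm
    rcases reflGroup_form hs with ⟨n, hn⟩ | ⟨n, hn⟩
    · exact absurd (hs'.trans (hn i)) (h n)
    · have h1 : g j = (g * s) i := by rw [Equiv.Perm.mul_apply, ← hs']
      rw [h1, orbitSwap_left (mul_mem hg hs), Equiv.Perm.mul_apply, hs', hn, hn]
      congr 1; ring
  · exact orbitSwap_right hg hij

theorem orbitSwap_spec {i j : ℤ} (_ : NonTranslate m i j) (x : ℤ) :
    (∃ g ∈ reflGroup m, x = g i ∧ orbitSwap m i j x = g j) ∨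
    (∃ g ∈ reflGroup m, x = g j ∧ orbitSwap m i j x = g i) ∨
    (orb m x ≠ orb m i ∧ orb m x ≠ orb m j ∧ orbitSwap m i j x = x) := by
  rcases orbitSwap_cases m i j x with h | ⟨-, h⟩ | h
  · exact Or.inl h
  · exact Or.inr (Or.inl h)
  · exact Or.inr (Or.inr h)

theorem orbitSwap_comm {i j : ℤ} (h : NonTranslate m i j) :
    orbitSwap m i j = orbitSwap m j i := by
  funext x
  rcases orbitSwap_spec h x with ⟨g, hg, rfl, e⟩ | ⟨g, hg, rfl, e⟩ | ⟨h1, h2, e⟩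
  · rw [e, orbitSwap_apply_right h.symm hg]
  · rw [e, orbitSwap_left hg]
  · rw [e, orbitSwap_of_ne h2 h1]

theorem orbitSwap_map {i j : ℤ} (h : NonTranslate m i j) {s : Equiv.Perm ℤ}
    (hs : s ∈ reflGroup m) : orbitSwap m (s i) (s j) = orbitSwap m i j := by
  funext x
  rcases orbitSwap_spec h x with ⟨g, hg, rfl, e⟩ | ⟨g, hg, rfl, e⟩ | ⟨h1, h2, e⟩
  · have := orbitSwap_left (i := s i) (j := s j) (mul_mem hg (inv_mem hs))
    simpa [e] using this
  · have := orbitSwap_apply_right (h.map hs) (mul_mem hg (inv_mem hs))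
    simpa [e] using this
  · rw [e, orbitSwap_of_ne] <;> rwa [orb_apply hs]

theorem orbitSwap_orbitSwap {i j : ℤ} (h : NonTranslate m i j) (x : ℤ) :
    orbitSwap m i j (orbitSwap m i j x) = x := by
  rcases orbitSwap_spec h x with ⟨g, hg, rfl, e⟩ | ⟨g, hg, rfl, e⟩ | ⟨h1, h2, e⟩
  · rw [e, orbitSwap_apply_right h hg]
  · rw [e, orbitSwap_left hg]
  · rw [e, e]

theorem orbitSwap_self_left (m : ℕ) (i j : ℤ) : orbitSwap m i j i = j :=
  orbitSwap_left (one_mem (reflGroup m))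

theorem orbitSwap_self_right {i j : ℤ} (h : NonTranslate m i j) : orbitSwap m i j j = i :=
  orbitSwap_apply_right h (one_mem (reflGroup m))

/-- The moved pairs `(x, σ x)` of an exchange are the motions of the defining pair. -/
theorem orbitSwap_ne {i j x : ℤ} (h : NonTranslate m i j) (hx : orbitSwap m i j x ≠ x) :
    ∃ g ∈ reflGroup m, (x = g i ∧ orbitSwap m i j x = g j) ∨
      (x = g j ∧ orbitSwap m i j x = g i) := by
  rcases orbitSwap_spec h x with ⟨g, hg, h⟩ | ⟨g, hg, h⟩ | ⟨-, -, e⟩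
  · exact ⟨g, hg, Or.inl h⟩
  · exact ⟨g, hg, Or.inr h⟩
  · exact absurd e hx

/-- Unordered pairs of integers up to motions. -/
def pairSetoid (m : ℕ) : Setoid (ℤ × ℤ) where
  r p q := ∃ g ∈ reflGroup m, p = (g q.1, g q.2) ∨ p = (g q.2, g q.1)
  iseqv :=
    { refl := fun p => ⟨1, one_mem _, Or.inl rfl⟩
      symm := by
        rintro p q ⟨g, hg, h | h⟩
        · exact ⟨g⁻¹, inv_mem hg, Or.inl (by simp [h])⟩
        · exact ⟨g⁻¹, inv_mem hg, Or.inr (by simp [h])⟩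
      trans := by
        rintro p q r ⟨g, hg, h | h⟩ ⟨g', hg', h' | h'⟩
        · exact ⟨g * g', mul_mem hg hg', Or.inl (by simp [h, h'])⟩
        · exact ⟨g * g', mul_mem hg hg', Or.inr (by simp [h, h'])⟩
        · exact ⟨g * g', mul_mem hg hg', Or.inr (by simp [h, h'])⟩
        · exact ⟨g * g', mul_mem hg hg', Or.inl (by simp [h, h'])⟩ }

/-- Classes of pairs. -/
def PairClass (m : ℕ) : Type := Quotient (pairSetoid m)

/-- The class of a pair. -/
def pairMk (m : ℕ) (i j : ℤ) : PairClass m := Quotient.mk (pairSetoid m) (i, j)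

theorem pairMk_eq_iff {i j i' j' : ℤ} : pairMk m i j = pairMk m i' j' ↔
    ∃ g ∈ reflGroup m, (i = g i' ∧ j = g j') ∨ (i = g j' ∧ j = g i') := by
  refine (Quotient.eq (r := pairSetoid m)).trans ?_
  change (∃ g ∈ reflGroup m, _ ∨ _) ↔ _
  simp only [Prod.ext_iff]

theorem pairMk_comm (i j : ℤ) : pairMk m i j = pairMk m j i :=
  pairMk_eq_iff.2 ⟨1, one_mem _, Or.inr ⟨rfl, rfl⟩⟩

theorem pairMk_map {g : Equiv.Perm ℤ} (hg : g ∈ reflGroup m) (i j : ℤ) :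
    pairMk m (g i) (g j) = pairMk m i j :=
  pairMk_eq_iff.2 ⟨g, hg, Or.inl ⟨rfl, rfl⟩⟩

theorem exists_pairMk (e : PairClass m) : ∃ i j, e = pairMk m i j := by
  induction e using Quotient.inductionOn with
  | _ p => exact ⟨p.1, p.2, rfl⟩

/-- The exchange of a moved pair is the given exchange. -/
theorem orbitSwap_eq_of_pairMk_eq {i j i' j' : ℤ} (h : NonTranslate m i j)
    (e : pairMk m i' j' = pairMk m i j) : orbitSwap m i' j' = orbitSwap m i j := by
  obtain ⟨g, hg, ⟨rfl, rfl⟩ | ⟨rfl, rfl⟩⟩ := pairMk_eq_iff.1 e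
  · exact orbitSwap_map h hg
  · rw [orbitSwap_map h.symm hg, orbitSwap_comm h.symm]

theorem pairMk_orbitSwap {i j x : ℤ} (h : NonTranslate m i j) (hx : orbitSwap m i j x ≠ x) :
    pairMk m x (orbitSwap m i j x) = pairMk m i j := by
  obtain ⟨g, hg, ⟨h1, h2⟩ | ⟨h1, h2⟩⟩ := orbitSwap_ne h hx
  · rw [h2]; rw [h1]; exact pairMk_map hg i j
  · rw [h2]; rw [h1, pairMk_map hg, pairMk_comm]

theorem pairMk_eq_iff_orbitSwap {i j x y : ℤ} (h : NonTranslate m i j) :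
    pairMk m x y = pairMk m i j ↔ y = orbitSwap m i j x ∧ x ≠ y := by
  constructor
  · intro e
    obtain ⟨g, hg, ⟨rfl, rfl⟩ | ⟨rfl, rfl⟩⟩ := pairMk_eq_iff.1 e
    · exact ⟨(orbitSwap_left hg).symm, (h.map hg).ne⟩
    · exact ⟨(orbitSwap_apply_right h hg).symm, (h.map hg).symm.ne⟩
  · rintro ⟨rfl, hxy⟩
    exact pairMk_orbitSwap h hxy.symm

end Motions

namespace LiftedPartialPerm

variable {m k : ℕ}

/-! ### Domain, image, crossings -/

/-- The domain. -/
def dom (f : LiftedPartialPerm m k) : Set ℤ := {i | ∃ a, f.toFun i = some a}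

/-- The image. -/
def im (f : LiftedPartialPerm m k) : Set ℤ := {a | ∃ i, f.toFun i = some a}

theorem map_some (f : LiftedPartialPerm m k) {g : Equiv.Perm ℤ} (hg : g ∈ reflGroup m)
    {i a : ℤ} (h : f.toFun i = some a) : f.toFun (g i) = some (g a) := by
  rw [f.equivariant g hg, h]; rfl

theorem some_inj (f : LiftedPartialPerm m k) {i j a : ℤ} (hi : f.toFun i = some a)
    (hj : f.toFun j = some a) : i = j := by
  obtain ⟨g, hg, rfl⟩ := orb_eq_iff.1 (f.injective i j a a hi hj rfl)
  have h := f.map_some hg hj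
  rw [hi] at h
  have : g = 1 := reflGroup_free hg (one_mem _) (i := a) (by simpa using (Option.some.inj h).symm)
  simp [this]

theorem mem_dom_map (f : LiftedPartialPerm m k) {g : Equiv.Perm ℤ} (hg : g ∈ reflGroup m)
    {i : ℤ} : g i ∈ f.dom ↔ i ∈ f.dom := by
  constructor
  · rintro ⟨a, ha⟩
    exact ⟨g⁻¹ a, by simpa using f.map_some (inv_mem hg) ha⟩
  · rintro ⟨a, ha⟩
    exact ⟨g a, f.map_some hg ha⟩

theorem mem_im_map (f : LiftedPartialPerm m k) {g : Equiv.Perm ℤ} (hg : g ∈ reflGroup m)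
    {i : ℤ} : g i ∈ f.im ↔ i ∈ f.im := by
  constructor
  · rintro ⟨a, ha⟩
    exact ⟨g⁻¹ a, by simpa using f.map_some (inv_mem hg) ha⟩
  · rintro ⟨a, ha⟩
    exact ⟨g a, f.map_some hg ha⟩

/-- The strands that start at `i` and `j` cross. -/
def Inv (f : LiftedPartialPerm m k) (i j : ℤ) : Prop :=
  ∃ a b, f.toFun i = some a ∧ f.toFun j = some b ∧ (i < j ∧ b < a ∨ j < i ∧ a < b)

theorem inv_iff_sign (f : LiftedPartialPerm m k) {i j : ℤ} : f.Inv i j ↔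
    ∃ a b, f.toFun i = some a ∧ f.toFun j = some b ∧ Int.sign (i - j) ≠ Int.sign (a - b) := by
  refine exists_congr fun a => exists_congr fun b => and_congr_right fun ha =>
    and_congr_right fun hb => ?_
  have hab : i = j ↔ a = b := by
    constructor
    · rintro rfl; exact Option.some.inj (ha.symm.trans hb)
    · rintro rfl; exact f.some_inj ha hb
  rcases lt_trichotomy i j with h | h | h <;> rcases lt_trichotomy a b with h' | h' | h'
  · rw [Int.sign_eq_neg_one_of_neg (by omega), Int.sign_eq_neg_one_of_neg (by omega)]; omega
  · omega
  · rw [Int.sign_eq_neg_one_of_neg (by omega), Int.sign_eq_one_of_pos (by omega)]; omega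
  · omega
  · subst h h'; simp
  · omega
  · rw [Int.sign_eq_one_of_pos (by omega), Int.sign_eq_neg_one_of_neg (by omega)]; omega
  · omega
  · rw [Int.sign_eq_one_of_pos (by omega), Int.sign_eq_one_of_pos (by omega)]; omega

theorem Inv.symm {f : LiftedPartialPerm m k} {i j : ℤ} (h : f.Inv i j) : f.Inv j i := by
  obtain ⟨a, b, ha, hb, h⟩ := h
  exact ⟨b, a, hb, ha, h.symm⟩

theorem Inv.map {f : LiftedPartialPerm m k} {i j : ℤ} (h : f.Inv i j) {g : Equiv.Perm ℤ}
    (hg : g ∈ reflGroup m) : f.Inv (g i) (g j) := by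
  obtain ⟨a, b, ha, hb, h⟩ := h
  refine ⟨g a, g b, f.map_some hg ha, f.map_some hg hb, ?_⟩
  rcases motion_sub hg with h' | h'
  · have := h' i j; have := h' a b; omega
  · have := h' i j; have := h' a b; omega

theorem Inv.nonTranslate {f : LiftedPartialPerm m k} {i j : ℤ} (h : f.Inv i j) :
    NonTranslate m i j := by
  rintro n rfl
  obtain ⟨a, b, ha, hb, h⟩ := h
  have := f.map_some (translation_mem m n) ha
  simp only [Equiv.coe_addRight] at this
  rw [hb] at this
  have := Option.some.inj this
  omega

/-- The set of crossings, as classes of pairs. -/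
def crossSet (f : LiftedPartialPerm m k) : Set (PairClass m) :=
  {e | ∃ i j, e = pairMk m i j ∧ f.Inv i j}

theorem pairMk_mem_crossSet {f : LiftedPartialPerm m k} {i j : ℤ} :
    pairMk m i j ∈ f.crossSet ↔ f.Inv i j := by
  constructor
  · rintro ⟨i', j', e, h⟩
    obtain ⟨g, hg, ⟨rfl, rfl⟩ | ⟨rfl, rfl⟩⟩ := pairMk_eq_iff.1 e
    · exact h.map hg
    · exact h.symm.map hg
  · exact fun h => ⟨i, j, rfl, h⟩

/-- The class of a crossing. -/
def Crossing.toClass {f : LiftedPartialPerm m k} (c : Crossing f) : PairClass m :=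
  Quotient.liftOn c (fun p => pairMk m p.1.1 p.1.2) (by
    rintro p q ⟨g, hg, h | h⟩
    · rw [h]; exact pairMk_map hg _ _
    · rw [h, pairMk_map hg, pairMk_comm])

theorem Crossing.toClass_injective (f : LiftedPartialPerm m k) :
    Function.Injective (Crossing.toClass (f := f)) := by
  intro c d
  induction c using Quotient.inductionOn with
  | _ p =>
  induction d using Quotient.inductionOn with
  | _ q =>
  intro h
  obtain ⟨g, hg, h⟩ := pairMk_eq_iff.1 h
  refine Quotient.sound ⟨g, hg, ?_⟩
  rcases h with h | h
  · exact Or.inl (Prod.ext h.1 h.2)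
  · exact Or.inr (Prod.ext h.1 h.2)

theorem Crossing.range_toClass (f : LiftedPartialPerm m k) :
    Set.range (Crossing.toClass (f := f)) = f.crossSet := by
  ext e
  constructor
  · rintro ⟨c, rfl⟩
    induction c using Quotient.inductionOn with
    | _ p => exact ⟨p.1.1, p.1.2, rfl, f.inv_iff_sign.2 p.2⟩
  · rintro ⟨i, j, rfl, h⟩
    exact ⟨Quotient.mk (crossingSetoid f) ⟨(i, j), f.inv_iff_sign.1 h⟩, rfl⟩

theorem Crossing.out_spec {f : LiftedPartialPerm m k} (c : Crossing f) :
    pairMk m (Quotient.out (s := crossingSetoid f) c).1.1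
      (Quotient.out (s := crossingSetoid f) c).1.2 = c.toClass := by
  conv_rhs => rw [← Quotient.out_eq (s := crossingSetoid f) c]
  rfl

theorem cross_eq_ncard (f : LiftedPartialPerm m k) : f.cross = f.crossSet.ncard := by
  rw [← Crossing.range_toClass f, cross, ← Nat.card_coe_set_eq]
  exact Nat.card_congr (Equiv.ofInjective _ (Crossing.toClass_injective f))

theorem finite_crossSet (hm : 1 < m) (f : LiftedPartialPerm m k) : f.crossSet.Finite := by
  have := finite_crossing hm f
  rw [← Crossing.range_toClass f]
  exact Set.finite_range _

theorem resolve_toFun {f : LiftedPartialPerm m k} (c : Crossing f) {i j : ℤ}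
    (h : c.toClass = pairMk m i j) (l : ℤ) :
    (f.resolve c).toFun l = f.toFun (orbitSwap m i j l) := by
  have hc : pairMk m i j ∈ f.crossSet := by
    rw [← h, ← Crossing.range_toClass]; exact ⟨c, rfl⟩
  have h1 := (pairMk_mem_crossSet.1 hc).nonTranslate
  rw [← orbitSwap_eq_of_pairMk_eq h1 (c.out_spec.trans h)]
  rfl

open Classical in
/-- The resolution at a class of pairs (the map itself if this is not a crossing). -/
def res (f : LiftedPartialPerm m k) (e : PairClass m) : LiftedPartialPerm m k :=
  if h : ∃ c : Crossing f, c.toClass = e then f.resolve h.choose else f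

theorem res_toFun {f : LiftedPartialPerm m k} {i j : ℤ} (h : f.Inv i j) (l : ℤ) :
    (f.res (pairMk m i j)).toFun l = f.toFun (orbitSwap m i j l) := by
  have hc : ∃ c : Crossing f, c.toClass = pairMk m i j := by
    have := pairMk_mem_crossSet.2 h
    rwa [← Crossing.range_toClass] at this
  rw [res, dif_pos hc]
  exact resolve_toFun _ hc.choose_spec l

theorem res_toClass (f : LiftedPartialPerm m k) (c : Crossing f) :
    f.res c.toClass = f.resolve c := by
  have hc : ∃ c' : Crossing f, c'.toClass = c.toClass := ⟨c, rfl⟩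
  rw [res, dif_pos hc, Crossing.toClass_injective f hc.choose_spec]

theorem ext_some {f g : LiftedPartialPerm m k}
    (h : ∀ i a, f.toFun i = some a ↔ g.toFun i = some a) : f = g := by
  ext i a
  exact h i a

theorem dom_res {f : LiftedPartialPerm m k} {i j : ℤ} (h : f.Inv i j) :
    (f.res (pairMk m i j)).dom = f.dom := by
  ext x
  have hi : i ∈ f.dom := by obtain ⟨a, b, ha, hb, -⟩ := h; exact ⟨a, ha⟩
  have hj : j ∈ f.dom := by obtain ⟨a, b, ha, hb, -⟩ := h; exact ⟨b, hb⟩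
  have : x ∈ (f.res (pairMk m i j)).dom ↔ orbitSwap m i j x ∈ f.dom := by
    simp only [dom, Set.mem_ofPred_eq, res_toFun h]
  rw [this]
  rcases orbitSwap_spec h.nonTranslate x with ⟨g, hg, rfl, e⟩ | ⟨g, hg, rfl, e⟩ | ⟨-, -, e⟩
  · rw [e, f.mem_dom_map hg, f.mem_dom_map hg]; tauto
  · rw [e, f.mem_dom_map hg, f.mem_dom_map hg]; tauto
  · rw [e]

theorem im_res {f : LiftedPartialPerm m k} {i j : ℤ} (h : f.Inv i j) :
    (f.res (pairMk m i j)).im = f.im := by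
  ext x
  simp only [im, Set.mem_ofPred_eq, res_toFun h]
  constructor
  · rintro ⟨y, hy⟩; exact ⟨_, hy⟩
  · rintro ⟨y, hy⟩
    exact ⟨orbitSwap m i j y, by rw [orbitSwap_orbitSwap h.nonTranslate, hy]⟩

/-! ### Left multiplication by simple transpositions -/

/-- The composite with the exchange of the orbits of `a` and `b`. -/
def post (f : LiftedPartialPerm m k) (a b : ℤ) : LiftedPartialPerm m k where
  toFun i := (f.toFun i).map (orbitSwap m a b)
  equivariant g hg i := by
    rw [f.equivariant g hg]
    cases f.toFun i with
    | none => rfl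
    | some c => simp [orbitSwap_equivariant hg]
  card_orbits := by
    refine Eq.trans ?_ f.card_orbits
    congr 2
    ext i
    simp
  injective i j c d hi hj hcd := by
    obtain ⟨c', hc', rfl⟩ := Option.map_eq_some_iff.1 hi
    obtain ⟨d', hd', rfl⟩ := Option.map_eq_some_iff.1 hj
    exact f.injective i j c' d' hc' hd' (orb_orbitSwap_injective hcd)

theorem post_some {f : LiftedPartialPerm m k} {a b i c : ℤ} (h : f.toFun i = some c) :
    (f.post a b).toFun i = some (orbitSwap m a b c) := by
  simp [post, h]

theorem post_eq_some {f : LiftedPartialPerm m k} {a b i c : ℤ} (hab : NonTranslate m a b) :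
    (f.post a b).toFun i = some c ↔ f.toFun i = some (orbitSwap m a b c) := by
  simp only [post, Option.map_eq_some_iff]
  constructor
  · rintro ⟨d, hd, rfl⟩
    rw [orbitSwap_orbitSwap hab, hd]
  · intro h
    exact ⟨_, h, orbitSwap_orbitSwap hab c⟩

theorem post_post (f : LiftedPartialPerm m k) {a b : ℤ} (hab : NonTranslate m a b) :
    (f.post a b).post a b = f :=
  ext_some fun i c => by
    rw [post_eq_some hab, post_eq_some hab, orbitSwap_orbitSwap hab]

@[simp]
theorem dom_post (f : LiftedPartialPerm m k) (a b : ℤ) : (f.post a b).dom = f.dom := by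
  ext i
  simp [dom, post]

/-- `a < b` are consecutive elements of the set `T`. -/
structure IsGap (T : Set ℤ) (a b : ℤ) : Prop where
  lt : a < b
  left_mem : a ∈ T
  right_mem : b ∈ T
  not_mem : ∀ x, a < x → x < b → x ∉ T

/-- The set `T` is invariant under motions. -/
def Invariant (m : ℕ) (T : Set ℤ) : Prop := ∀ g ∈ reflGroup m, ∀ x, g x ∈ T ↔ x ∈ T

theorem invariant_dom (f : LiftedPartialPerm m k) : Invariant m f.dom :=
  fun _ hg _ => f.mem_dom_map hg

theorem invariant_im (f : LiftedPartialPerm m k) : Invariant m f.im :=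
  fun _ hg _ => f.mem_im_map hg

theorem IsGap.nonTranslate (hm : 1 < m) {T : Set ℤ} (hT : Invariant m T) {a b : ℤ}
    (h : IsGap T a b) : NonTranslate m a b := by
  rintro n rfl
  have hN : (0 : ℤ) < 2 * m - 2 := by omega
  have hn : 0 < n := by
    have := h.lt
    by_contra hn
    nlinarith
  have e := Int.emod_add_mul_ediv (2 * a - 1) (2 * m - 2)
  have h1 := Int.emod_nonneg (2 * a - 1) hN.ne'
  have h2 := Int.emod_lt_of_pos (2 * a - 1) hN
  set r := (2 * a - 1) % (2 * m - 2)
  set q := (2 * a - 1) / (2 * m - 2)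
  have hr : r ≠ 0 := by
    intro hr
    rw [hr] at e
    have : 2 * (((m : ℤ) - 1) * q) = 2 * a - 1 := by linarith
    omega
  have hx := (hT _ (reflection_mem m (q + 1)) a).2 h.left_mem
  refine h.not_mem _ ?_ ?_ hx
  · simp only [Equiv.subLeft_apply]
    have : 2 * a - 1 < (q + 1) * (2 * m - 2) := by linarith
    linarith
  · simp only [Equiv.subLeft_apply]
    have h3 : 1 * (2 * (m : ℤ) - 2) ≤ n * (2 * m - 2) :=
      mul_le_mul_of_nonneg_right (by omega) hN.le
    have : (q + 1) * (2 * (m : ℤ) - 2) < 2 * a - 1 + (2 * m - 2) := by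
      have : 0 < r := lt_of_le_of_ne h1 (Ne.symm hr)
      linarith
    linarith

theorem IsGap.orbitSwap_mem (hm : 1 < m) {T : Set ℤ} (hT : Invariant m T) {a b : ℤ}
    (h : IsGap T a b) {x : ℤ} (hx : x ∈ T) : orbitSwap m a b x ∈ T := by
  rcases orbitSwap_spec (h.nonTranslate hm hT) x with
    ⟨g, hg, rfl, e⟩ | ⟨g, hg, rfl, e⟩ | ⟨-, -, e⟩
  · rw [e, hT g hg]; exact h.right_mem
  · rw [e, hT g hg]; exact h.left_mem
  · rwa [e]

theorem im_post (hm : 1 < m) (f : LiftedPartialPerm m k) {a b : ℤ} (h : IsGap f.im a b) :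
    (f.post a b).im = f.im := by
  have hab := h.nonTranslate hm f.invariant_im
  ext x
  have : x ∈ (f.post a b).im ↔ orbitSwap m a b x ∈ f.im := by
    simp [im, post_eq_some hab]
  rw [this]
  refine ⟨fun hx => ?_, h.orbitSwap_mem hm f.invariant_im⟩
  rw [← orbitSwap_orbitSwap hab x]
  exact h.orbitSwap_mem hm f.invariant_im hx

/-- No element of `T` lies strictly between `x` and its image under a simple exchange. -/
theorem IsGap.not_between (hm : 1 < m) {T : Set ℤ} (hT : Invariant m T) {a b : ℤ}
    (h : IsGap T a b) {x y : ℤ} (hy : y ∈ T) :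
    ¬ (x < y ∧ y < orbitSwap m a b x) ∧ ¬ (orbitSwap m a b x < y ∧ y < x) := by
  have key : ∀ g ∈ reflGroup m, ¬ (g a < y ∧ y < g b) ∧ ¬ (g b < y ∧ y < g a) := by
    intro g hg
    have hy' : g⁻¹ y ∈ T := by rwa [hT _ (inv_mem hg)]
    have hn := h.not_mem (g⁻¹ y)
    have e : y = g (g⁻¹ y) := by simp
    have hl := h.lt
    rcases motion_sub hg with h' | h'
    · have h1 := h' a (g⁻¹ y); have h2 := h' b (g⁻¹ y)
      rw [← e] at h1 h2
      refine ⟨fun hh => hn (by omega) (by omega) hy', fun hh => by omega⟩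
    · have h1 := h' a (g⁻¹ y); have h2 := h' b (g⁻¹ y)
      rw [← e] at h1 h2
      refine ⟨fun hh => by omega, fun hh => hn (by omega) (by omega) hy'⟩
  rcases orbitSwap_spec (h.nonTranslate hm hT) x with
    ⟨g, hg, rfl, e⟩ | ⟨g, hg, rfl, e⟩ | ⟨-, -, e⟩
  · rw [e]; exact key g hg
  · rw [e]; exact (key g hg).symm
  · rw [e]; omega

/-- A simple exchange reverses only the pairs that it exchanges. -/
theorem IsGap.orbitSwap_lt_iff (hm : 1 < m) {T : Set ℤ} (hT : Invariant m T) {a b : ℤ}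
    (h : IsGap T a b) {x y : ℤ} (hx : x ∈ T) (hy : y ∈ T) (hxy : y ≠ orbitSwap m a b x) :
    orbitSwap m a b x < orbitSwap m a b y ↔ x < y := by
  have hab := h.nonTranslate hm hT
  have key : ∀ x y, x ∈ T → y ∈ T → y ≠ orbitSwap m a b x → x < y →
      orbitSwap m a b x < orbitSwap m a b y := by
    intro x y hx hy hxy hlt
    have h1 := (h.not_between hm hT (x := x) hy).1
    have h2 := (h.not_between hm hT (x := y) (h.orbitSwap_mem hm hT hx)).2
    have h3 : orbitSwap m a b x ≠ orbitSwap m a b y := by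
      intro e
      have := congrArg (orbitSwap m a b) e
      rw [orbitSwap_orbitSwap hab, orbitSwap_orbitSwap hab] at this
      omega
    have h4 := (h.not_between hm hT (x := y) hx).2
    omega
  refine ⟨fun hlt => ?_, key x y hx hy hxy⟩
  have := key _ _ (h.orbitSwap_mem hm hT hx) (h.orbitSwap_mem hm hT hy) ?_ hlt
  · rwa [orbitSwap_orbitSwap hab, orbitSwap_orbitSwap hab] at this
  · rw [orbitSwap_orbitSwap hab]
    intro e
    apply hxy
    rw [← e, orbitSwap_orbitSwap hab]

theorem inv_post_iff (hm : 1 < m) {f : LiftedPartialPerm m k} {a b : ℤ} (h : IsGap f.im a b)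
    {i j x y : ℤ} (hi : f.toFun i = some x) (hj : f.toFun j = some y)
    (hxy : y ≠ orbitSwap m a b x) : (f.post a b).Inv i j ↔ f.Inv i j := by
  have hab := h.nonTranslate hm f.invariant_im
  have h1 := h.orbitSwap_lt_iff hm f.invariant_im ⟨i, hi⟩ ⟨j, hj⟩ hxy
  have h2 := h.orbitSwap_lt_iff hm f.invariant_im ⟨j, hj⟩ ⟨i, hi⟩
    (fun e => hxy (by rw [e, orbitSwap_orbitSwap hab]))
  constructor
  · rintro ⟨c, d, hc, hd, hh⟩
    rw [post_some hi] at hc; rw [post_some hj] at hd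
    cases hc; cases hd
    exact ⟨x, y, hi, hj, by omega⟩
  · rintro ⟨c, d, hc, hd, hh⟩
    rw [hi] at hc; rw [hj] at hd
    cases hc; cases hd
    exact ⟨_, _, post_some hi, post_some hj, by omega⟩

theorem IsGap.exists_preimage {f : LiftedPartialPerm m k} {a b : ℤ} (h : IsGap f.im a b) :
    ∃ i j, f.toFun i = some a ∧ f.toFun j = some b ∧ i ≠ j := by
  obtain ⟨i, hi⟩ := h.left_mem
  obtain ⟨j, hj⟩ := h.right_mem
  refine ⟨i, j, hi, hj, ?_⟩
  rintro rfl
  have := h.lt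
  rw [hi] at hj
  have := Option.some.inj hj
  omega

theorem nonTranslate_of_image {f : LiftedPartialPerm m k} {i j a b : ℤ}
    (hi : f.toFun i = some a) (hj : f.toFun j = some b) :
    NonTranslate m i j ↔ NonTranslate m a b := by
  refine forall_congr' fun n => not_congr ?_
  have h1 := f.map_some (translation_mem m n) hi
  simp only [Equiv.coe_addRight] at h1
  constructor
  · rintro rfl
    exact Option.some.inj (hj.symm.trans h1)
  · rintro rfl
    exact f.some_inj hj h1

theorem pairMk_image_iff {f : LiftedPartialPerm m k} {i j i' j' a b a' b' : ℤ}
    (hi : f.toFun i = some a) (hj : f.toFun j = some b)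
    (hi' : f.toFun i' = some a') (hj' : f.toFun j' = some b') :
    pairMk m i' j' = pairMk m i j ↔ pairMk m a' b' = pairMk m a b := by
  rw [pairMk_eq_iff, pairMk_eq_iff]
  refine exists_congr fun g => and_congr_right fun hg => ?_
  have aux : ∀ {i a i' a' : ℤ}, f.toFun i = some a → f.toFun i' = some a' →
      (i' = g i ↔ a' = g a) := by
    intro i a i' a' hi hi'
    constructor
    · rintro rfl; exact Option.some.inj (hi'.symm.trans (f.map_some hg hi))
    · rintro rfl; exact f.some_inj hi' (f.map_some hg hi)
  rw [aux hi hi', aux hj hj', aux hj hi', aux hi hj']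

/-- A simple exchange changes the set of crossings exactly by the exchanged pair. -/
theorem mem_crossSet_post (hm : 1 < m) {f : LiftedPartialPerm m k} {a b i j : ℤ}
    (h : IsGap f.im a b) (hi : f.toFun i = some a) (hj : f.toFun j = some b) (e : PairClass m)
    (he : e ≠ pairMk m i j) : e ∈ (f.post a b).crossSet ↔ e ∈ f.crossSet := by
  have hab := h.nonTranslate hm f.invariant_im
  obtain ⟨i', j', rfl⟩ := exists_pairMk e
  rw [pairMk_mem_crossSet, pairMk_mem_crossSet]
  by_cases hd : i' ∈ f.dom ∧ j' ∈ f.dom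
  · obtain ⟨⟨x, hx⟩, y, hy⟩ := hd
    by_cases hxy : x = y
    · subst hxy
      obtain rfl := f.some_inj hx hy
      constructor <;> rintro ⟨_, _, _, _, hh⟩ <;> omega
    · refine inv_post_iff hm h hx hy fun e' => he ?_
      rw [pairMk_image_iff hi hj hx hy, pairMk_eq_iff_orbitSwap hab]
      exact ⟨e', hxy⟩
  · constructor
    · rintro ⟨c, d, hc, hd', -⟩
      refine absurd ⟨?_, ?_⟩ hd
      · rw [← dom_post f a b]; exact ⟨c, hc⟩
      · rw [← dom_post f a b]; exact ⟨d, hd'⟩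
    · rintro ⟨c, d, hc, hd', -⟩
      exact absurd ⟨⟨c, hc⟩, d, hd'⟩ hd

theorem inv_post_self (hm : 1 < m) {f : LiftedPartialPerm m k} {a b i j : ℤ}
    (h : IsGap f.im a b) (hi : f.toFun i = some a) (hj : f.toFun j = some b) :
    (f.post a b).Inv i j ↔ ¬ f.Inv i j := by
  have hab := h.nonTranslate hm f.invariant_im
  have h1 := post_some (a := a) (b := b) hi
  have h2 := post_some (a := a) (b := b) hj
  rw [orbitSwap_self_left] at h1
  rw [orbitSwap_self_right hab] at h2
  have hl := h.lt
  have hij : i ≠ j := by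
    rintro rfl
    rw [hi] at hj
    have := Option.some.inj hj
    omega
  constructor
  · rintro ⟨c, d, hc, hd, hh⟩ ⟨c', d', hc', hd', hh'⟩
    rw [h1] at hc; rw [h2] at hd; rw [hi] at hc'; rw [hj] at hd'
    cases hc; cases hd; cases hc'; cases hd'
    omega
  · intro hn
    refine ⟨b, a, h1, h2, ?_⟩
    by_contra hc
    exact hn ⟨a, b, hi, hj, by omega⟩

theorem cross_post_of_not_inv (hm : 1 < m) {f : LiftedPartialPerm m k} {a b i j : ℤ}
    (h : IsGap f.im a b) (hi : f.toFun i = some a) (hj : f.toFun j = some b)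
    (hn : ¬ f.Inv i j) : (f.post a b).cross = f.cross + 1 := by
  have : (f.post a b).crossSet = insert (pairMk m i j) f.crossSet := by
    ext e
    by_cases he : e = pairMk m i j
    · subst he
      simp [pairMk_mem_crossSet, inv_post_self hm h hi hj, hn]
    · simp [mem_crossSet_post hm h hi hj e he, he]
  rw [cross_eq_ncard, cross_eq_ncard, this,
    Set.ncard_insert_of_notMem _ (finite_crossSet hm f)]
  rwa [pairMk_mem_crossSet]

theorem cross_post_of_inv (hm : 1 < m) {f : LiftedPartialPerm m k} {a b i j : ℤ}
    (h : IsGap f.im a b) (hi : f.toFun i = some a) (hj : f.toFun j = some b)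
    (hn : f.Inv i j) : (f.post a b).cross + 1 = f.cross := by
  have hab := h.nonTranslate hm f.invariant_im
  have h' : IsGap (f.post a b).im a b := by rwa [im_post hm f h]
  have h1 := post_some (a := a) (b := b) hi
  have h2 := post_some (a := a) (b := b) hj
  rw [orbitSwap_self_left] at h1
  rw [orbitSwap_self_right hab] at h2
  have := cross_post_of_not_inv hm h' h2 h1 (by
    rw [show (f.post a b).Inv j i ↔ (f.post a b).Inv i j from ⟨Inv.symm, Inv.symm⟩,
      inv_post_self hm h hi hj]
    exact fun h => h hn)
  rw [post_post f hab] at this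
  exact this.symm

theorem cross_post_le (hm : 1 < m) {f : LiftedPartialPerm m k} {a b : ℤ}
    (h : IsGap f.im a b) : (f.post a b).cross ≤ f.cross + 1 := by
  obtain ⟨i, j, hi, hj, -⟩ := h.exists_preimage
  by_cases hn : f.Inv i j
  · have := cross_post_of_inv hm h hi hj hn; omega
  · exact (cross_post_of_not_inv hm h hi hj hn).le

end LiftedPartialPerm

namespace LiftedPartialPerm

variable {m k : ℕ}

/-! ### Descents and resolutions -/

theorem lt_of_no_descent {f : LiftedPartialPerm m k}
    (h : ∀ a b i j, IsGap f.im a b → f.toFun i = some a → f.toFun j = some b → ¬ f.Inv i j) :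
    ∀ (n : ℕ) (a b i j : ℤ), (b - a).toNat ≤ n → a < b → f.toFun i = some a →
      f.toFun j = some b → i < j := by
  intro n
  induction n with
  | zero => intro a b i j hn hab; omega
  | succ n ih =>
    intro a b i j hn hab hi hj
    by_cases hc : ∃ c ∈ f.im, a < c ∧ c < b
    · obtain ⟨c, ⟨l, hl⟩, h1, h2⟩ := hc
      exact (ih a c i l (by omega) h1 hi hl).trans (ih c b l j (by omega) h2 hl hj)
    · push Not at hc
      have hgap : IsGap f.im a b := ⟨hab, ⟨i, hi⟩, ⟨j, hj⟩, fun x h1 h2 hx =>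
        absurd h2 (not_lt.2 (hc x hx h1))⟩
      have h1 := h a b i j hgap hi hj
      have h2 : i ≠ j := by
        rintro rfl
        rw [hi] at hj
        have := Option.some.inj hj
        omega
      by_contra h3
      exact h1 ⟨a, b, hi, hj, Or.inr ⟨by omega, hab⟩⟩

theorem exists_descent {f : LiftedPartialPerm m k} (hf : f.crossSet.Nonempty) :
    ∃ a b i j, IsGap f.im a b ∧ f.toFun i = some a ∧ f.toFun j = some b ∧ f.Inv i j := by
  by_contra hc
  push Not at hc
  have key := lt_of_no_descent hc
  obtain ⟨e, i, j, -, a, b, ha, hb, h⟩ := hf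
  rcases h with ⟨h1, h2⟩ | ⟨h1, h2⟩
  · have := key _ b a j i le_rfl h2 hb ha; omega
  · have := key _ a b i j le_rfl h2 ha hb; omega

theorem toFun_orbitSwap {f : LiftedPartialPerm m k} {i j a b : ℤ} (hi : f.toFun i = some a)
    (hj : f.toFun j = some b) (hab : NonTranslate m a b) (l : ℤ) :
    f.toFun (orbitSwap m i j l) = (f.toFun l).map (orbitSwap m a b) := by
  have hij := (nonTranslate_of_image hi hj).2 hab
  rcases orbitSwap_spec hij l with ⟨g, hg, rfl, e⟩ | ⟨g, hg, rfl, e⟩ | ⟨h1, h2, e⟩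
  · rw [e, f.map_some hg hi, f.map_some hg hj, Option.map_some, orbitSwap_left hg]
  · rw [e, f.map_some hg hi, f.map_some hg hj, Option.map_some, orbitSwap_apply_right hab hg]
  · rw [e]
    cases hl : f.toFun l with
    | none => rfl
    | some c =>
      rw [Option.map_some, orbitSwap_of_ne]
      · exact fun hc => h1 (f.injective _ _ _ _ hl hi hc)
      · exact fun hc => h2 (f.injective _ _ _ _ hl hj hc)

theorem res_eq_post {f : LiftedPartialPerm m k} {i j a b : ℤ} (hi : f.toFun i = some a)
    (hj : f.toFun j = some b) (h : f.Inv i j) : f.res (pairMk m i j) = f.post a b := by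
  ext1
  funext l
  rw [res_toFun h, toFun_orbitSwap hi hj ((nonTranslate_of_image hi hj).1 h.nonTranslate)]
  rfl

theorem res_post {f : LiftedPartialPerm m k} {a b i j : ℤ} (h : f.Inv i j)
    (h' : (f.post a b).Inv i j) :
    (f.post a b).res (pairMk m i j) = (f.res (pairMk m i j)).post a b := by
  ext1
  funext l
  rw [res_toFun h']
  simp only [post]
  rw [res_toFun h]

theorem res_post_of_mem {f : LiftedPartialPerm m k} {a b : ℤ} {e : PairClass m}
    (h : e ∈ f.crossSet) (h' : e ∈ (f.post a b).crossSet) :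
    (f.post a b).res e = (f.res e).post a b := by
  obtain ⟨i, j, rfl⟩ := exists_pairMk e
  exact res_post (pairMk_mem_crossSet.1 h) (pairMk_mem_crossSet.1 h')

theorem im_res_of_mem {f : LiftedPartialPerm m k} {e : PairClass m} (h : e ∈ f.crossSet) :
    (f.res e).im = f.im := by
  obtain ⟨i, j, rfl⟩ := exists_pairMk e
  exact im_res (pairMk_mem_crossSet.1 h)

theorem dom_res_of_mem {f : LiftedPartialPerm m k} {e : PairClass m} (h : e ∈ f.crossSet) :
    (f.res e).dom = f.dom := by
  obtain ⟨i, j, rfl⟩ := exists_pairMk e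
  exact dom_res (pairMk_mem_crossSet.1 h)

theorem cross_pos_iff (hm : 1 < m) (f : LiftedPartialPerm m k) :
    0 < f.cross ↔ f.crossSet.Nonempty := by
  rw [cross_eq_ncard, Set.ncard_pos (finite_crossSet hm f)]

/-- Resolving a crossing lowers the crossing number. -/
theorem cross_res_lt (hm : 1 < m) : ∀ (n : ℕ) (f : LiftedPartialPerm m k), f.cross = n →
    ∀ e ∈ f.crossSet, (f.res e).cross < f.cross := by
  intro n
  induction n with
  | zero =>
    intro f hf e he
    have := (cross_pos_iff hm f).2 ⟨e, he⟩
    omega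
  | succ n ih =>
    intro f hf e he
    obtain ⟨a, b, i, j, hgap, hi, hj, hinv⟩ := exists_descent ⟨e, he⟩
    have hlen := cross_post_of_inv hm hgap hi hj hinv
    by_cases hee : e = pairMk m i j
    · subst hee
      rw [res_eq_post hi hj hinv]
      omega
    · have he' := (mem_crossSet_post hm hgap hi hj e hee).2 he
      have h1 := ih (f.post a b) (by omega) e he'
      rw [res_post_of_mem he he'] at h1
      have hgap' : IsGap ((f.res e).post a b).im a b := by
        rw [im_post hm] <;> rwa [im_res_of_mem he]
      have h2 := cross_post_le hm hgap'
      rw [post_post _ (hgap.nonTranslate hm f.invariant_im)] at h2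
      omega

end LiftedPartialPerm

/-! ### The algebra at `v = 1` -/

open LiftedPartialPerm

/-- The specialization of the pong algebra at `v = 1`. -/
abbrev PongOne (m k : ℕ) : Type := LiftedPartialPerm m k →₀ ZMod 2

namespace PongOne

variable {m k : ℕ}

/-- A basis element. -/
abbrev of (f : LiftedPartialPerm m k) : PongOne m k := Finsupp.single f 1

open Classical in
/-- The differential of a basis element. -/
def diffOf (f : LiftedPartialPerm m k) : PongOne m k :=
  ∑ᶠ (e : PairClass m) (_ : e ∈ f.crossSet), if (f.res e).cross + 1 = f.cross then of (f.res e) else 0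

theorem add_self (z : PongOne m k) : z + z = 0 := by
  ext f
  exact CharTwo.add_self_eq_zero _

/-- The differential. -/
def diff (m k : ℕ) : PongOne m k →ₗ[ZMod 2] PongOne m k :=
  Finsupp.linearCombination (ZMod 2) diffOf

theorem diff_of (f : LiftedPartialPerm m k) : diff m k (of f) = diffOf f := by
  simp [diff]

open Classical in
theorem diffOf_eq {f : LiftedPartialPerm m k} {s : Finset (PairClass m)}
    (hs : (s : Set (PairClass m)) = f.crossSet) :
    diffOf f = ∑ e ∈ s, if (f.res e).cross + 1 = f.cross then of (f.res e) else 0 := by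
  rw [diffOf, ← hs]
  exact finsum_mem_coe_finset _ s

open Classical in
/-- Left multiplication by the simple exchange of `a` and `b`. -/
def lift (m k : ℕ) (a b : ℤ) : PongOne m k →ₗ[ZMod 2] PongOne m k :=
  Finsupp.linearCombination (ZMod 2) fun f =>
    if IsGap f.im a b ∧ (f.post a b).cross = f.cross + 1 then of (f.post a b) else 0

open Classical in
theorem lift_of (a b : ℤ) (f : LiftedPartialPerm m k) : lift m k a b (of f) =
    if IsGap f.im a b ∧ (f.post a b).cross = f.cross + 1 then of (f.post a b) else 0 := by
  simp [lift]

/-- The commutation of the differential with left multiplication by a simple exchange. -/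
theorem diff_lift_of (hm : 1 < m) {f : LiftedPartialPerm m k} {a b : ℤ}
    (h : IsGap f.im a b) :
    diff m k (lift m k a b (of f)) = of f + lift m k a b (diff m k (of f)) := by
  classical
  obtain ⟨i, j, hi, hj, hij⟩ := h.exists_preimage
  have hab := h.nonTranslate hm f.invariant_im
  set F := (finite_crossSet hm f).toFinset with hF
  have hFs : (F : Set (PairClass m)) = f.crossSet := by simp [hF]
  have memF : ∀ e, e ∈ F ↔ e ∈ f.crossSet := fun e => by simp [hF]
  rw [diff_of, diffOf_eq hFs, map_sum, lift_of]
  set e0 := pairMk m i j with he0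
  have hgap : ∀ e ∈ f.crossSet, IsGap (f.res e).im a b := fun e he => by
    rwa [im_res_of_mem he]
  by_cases hn : f.Inv i j
  · have hlen := cross_post_of_inv hm h hi hj hn
    rw [if_neg (by omega), map_zero]
    have he0F : e0 ∈ F := (memF _).2 (pairMk_mem_crossSet.2 hn)
    rw [← Finset.add_sum_erase F _ he0F, Finset.sum_eq_zero, add_zero]
    · rw [if_pos (by rw [he0, res_eq_post hi hj hn, hlen]), lift_of, if_pos]
      · rw [he0, res_eq_post hi hj hn, post_post f hab]
        exact (add_self _).symm
      · refine ⟨hgap _ ((memF _).1 he0F), ?_⟩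
        rw [he0, res_eq_post hi hj hn, post_post f hab, hlen]
    · intro e he
      obtain ⟨hne, he⟩ := Finset.mem_erase.1 he
      have he := (memF _).1 he
      have he' := (mem_crossSet_post hm h hi hj e hne).2 he
      split_ifs with hc
      · rw [lift_of, if_neg]
        rintro ⟨-, hc'⟩
        have := cross_res_lt hm _ _ rfl e he'
        rw [res_post_of_mem he he'] at this
        omega
      · exact map_zero _
  · have hlen := cross_post_of_not_inv hm h hi hj hn
    rw [if_pos ⟨h, hlen⟩, diff_of]
    have he0F : e0 ∉ F := fun hc => hn (pairMk_mem_crossSet.1 ((memF _).1 hc))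
    have hi0 : (f.post a b).Inv i j := (inv_post_self hm h hi hj).2 hn
    have hins : ((insert e0 F : Finset (PairClass m)) : Set (PairClass m))
        = (f.post a b).crossSet := by
      ext e
      by_cases hne : e = e0
      · subst hne
        simpa using pairMk_mem_crossSet.2 hi0
      · simp [hne, memF, mem_crossSet_post hm h hi hj e hne]
    rw [diffOf_eq hins, Finset.sum_insert he0F]
    have hres : (f.post a b).res e0 = f := by
      have h1 := post_some (a := a) (b := b) hi
      have h2 := post_some (a := a) (b := b) hj
      rw [orbitSwap_self_left] at h1
      rw [orbitSwap_self_right hab] at h2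
      rw [he0, res_eq_post h1 h2 hi0]
      have : (f.post a b).post b a = (f.post a b).post a b := by
        ext1
        simp only [post, orbitSwap_comm hab]
      rw [this, post_post f hab]
    rw [hres, if_pos hlen.symm]
    congr 1
    refine Finset.sum_congr rfl fun e he => ?_
    have hne : e ≠ e0 := fun hc => he0F (hc ▸ he)
    have he := (memF _).1 he
    have he' := (mem_crossSet_post hm h hi hj e hne).2 he
    have hlt := cross_res_lt hm _ _ rfl e he
    have hle := cross_post_le hm (hgap e he)
    rw [res_post_of_mem he he', hlen]
    by_cases hc : (f.res e).cross + 1 = f.cross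
    · rw [if_pos hc, lift_of]
      by_cases hc' : ((f.res e).post a b).cross = (f.res e).cross + 1
      · rw [if_pos (by omega), if_pos ⟨hgap e he, hc'⟩]
      · rw [if_neg (by omega), if_neg (by tauto)]
    · rw [if_neg hc, if_neg (by omega), map_zero]

/-- The elements supported on a set of basis elements. -/
abbrev Supp (X : Set (LiftedPartialPerm m k)) : Submodule (ZMod 2) (PongOne m k) :=
  Finsupp.supported (ZMod 2) (ZMod 2) X

theorem of_mem_supp {X : Set (LiftedPartialPerm m k)} {f : LiftedPartialPerm m k} (hf : f ∈ X) :
    of f ∈ Supp X :=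
  Finsupp.single_mem_supported _ _ hf

theorem supp_induction {X : Set (LiftedPartialPerm m k)} {p : PongOne m k → Prop}
    (h0 : p 0) (hadd : ∀ x y, p x → p y → p (x + y)) (hof : ∀ f ∈ X, p (of f)) :
    ∀ z ∈ Supp X, p z := by
  intro z hz
  rw [Supp, Finsupp.supported_eq_span_single] at hz
  induction hz using Submodule.span_induction with
  | mem x hx => obtain ⟨f, hf, rfl⟩ := hx; exact hof f hf
  | zero => exact h0
  | add x y _ _ hx hy => exact hadd x y hx hy
  | smul a x _ hx =>
    rcases (by decide : ∀ a : ZMod 2, a = 0 ∨ a = 1) a with rfl | rfl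
    · rwa [zero_smul]
    · rwa [one_smul]

theorem diff_lift (hm : 1 < m) {T : Set ℤ} {a b : ℤ} (h : IsGap T a b) {z : PongOne m k}
    (hz : z ∈ Supp {f | f.im = T}) :
    diff m k (lift m k a b z) = z + lift m k a b (diff m k z) := by
  refine supp_induction (p := fun z => diff m k (lift m k a b z) = z + lift m k a b (diff m k z))
    (by simp) (fun x y hx hy => ?_) ?_ z hz
  · rw [map_add, map_add, hx, hy, map_add, map_add]; abel
  · rintro f rfl
    exact diff_lift_of hm h

theorem diff_mem_supp (hm : 1 < m) {X : Set (LiftedPartialPerm m k)}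
    (hX : ∀ f ∈ X, ∀ e ∈ f.crossSet, f.res e ∈ X) : ∀ z ∈ Supp X, diff m k z ∈ Supp X := by
  classical
  refine supp_induction (by simp) (fun x y hx hy => by rw [map_add]; exact add_mem hx hy) ?_
  intro f hf
  rw [diff_of, diffOf_eq (s := (finite_crossSet hm f).toFinset) (by simp)]
  refine Submodule.sum_mem _ fun e he => ?_
  split_ifs
  · exact of_mem_supp (hX f hf e (by simpa using he))
  · exact zero_mem _

theorem diff_mem_supp_im (hm : 1 < m) {T : Set ℤ} : ∀ z ∈ Supp {f : LiftedPartialPerm m k | f.im = T},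
    diff m k z ∈ Supp {f | f.im = T} :=
  diff_mem_supp hm fun _ hf _ he => (im_res_of_mem he).trans hf

theorem diffOf_eq_zero (hm : 1 < m) {f : LiftedPartialPerm m k} (hf : f.cross = 0) :
    diffOf f = 0 := by
  rw [diffOf_eq (s := ∅)]
  · simp
  · rw [Finset.coe_empty, eq_comm, ← Set.not_nonempty_iff_eq_empty, ← cross_pos_iff hm, hf]
    simp

/-- A basis element with crossings is a simple exchange times a shorter one. -/
theorem exists_eq_lift (hm : 1 < m) {f : LiftedPartialPerm m k} (hf : f.cross ≠ 0) :
    ∃ (g : LiftedPartialPerm m k) (a b : ℤ), IsGap g.im a b ∧ g.post a b = f ∧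
      f.cross = g.cross + 1 ∧ of f = lift m k a b (of g) := by
  classical
  obtain ⟨a, b, i, j, hgap, hi, hj, hinv⟩ :=
    exists_descent ((cross_pos_iff hm f).1 (Nat.pos_of_ne_zero hf))
  have hlen := cross_post_of_inv hm hgap hi hj hinv
  have hpp := post_post f (hgap.nonTranslate hm f.invariant_im)
  have hgap' : IsGap (f.post a b).im a b := by rwa [im_post hm f hgap]
  refine ⟨f.post a b, a, b, hgap', hpp, hlen.symm, ?_⟩
  rw [lift_of, if_pos ⟨hgap', by rw [hpp, hlen]⟩, hpp]

theorem diff_diff_of (hm : 1 < m) : ∀ (n : ℕ) (f : LiftedPartialPerm m k), f.cross = n →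
    diff m k (diff m k (of f)) = 0 := by
  intro n
  induction n with
  | zero =>
    intro f hf
    rw [diff_of, diffOf_eq_zero hm hf, map_zero]
  | succ n ih =>
    intro f hf
    obtain ⟨g, a, b, hgap, -, hlen, e⟩ := exists_eq_lift hm (f := f) (by omega)
    have hg : of g ∈ Supp {f : LiftedPartialPerm m k | f.im = g.im} := of_mem_supp rfl
    rw [e, diff_lift hm hgap hg, map_add, diff_lift hm hgap (diff_mem_supp_im hm _ hg),
      ih g (by omega), map_zero, add_zero]
    exact add_self _

theorem diff_diff (hm : 1 < m) (z : PongOne m k) : diff m k (diff m k z) = 0 := by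
  have : z ∈ Supp (Set.univ : Set (LiftedPartialPerm m k)) := by simp
  refine supp_induction (p := fun z => diff m k (diff m k z) = 0)
    (by simp) (fun x y hx hy => ?_) (fun f _ => diff_diff_of hm _ f rfl) z this
  rw [map_add, map_add, hx, hy, add_zero]

end PongOne

namespace LiftedPartialPerm

variable {m k : ℕ}

/-! ### Composition -/

theorem composable_iff {g f : LiftedPartialPerm m k} : g.Composable f ↔ g.dom = f.im := by
  rw [Composable, Set.ext_iff]
  refine forall_congr' fun a => ?_
  rw [Option.isSome_iff_exists]
  rfl

theorem comp_eq_some {g f : LiftedPartialPerm m k} {h : g.Composable f} {i c : ℤ} :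
    (g.comp f h).toFun i = some c ↔ ∃ b, f.toFun i = some b ∧ g.toFun b = some c := by
  simp [comp, Option.bind_eq_some_iff]

theorem dom_comp {g f : LiftedPartialPerm m k} (h : g.Composable f) :
    (g.comp f h).dom = f.dom := by
  ext i
  constructor
  · rintro ⟨c, hc⟩
    obtain ⟨b, hb, -⟩ := comp_eq_some.1 hc
    exact ⟨b, hb⟩
  · rintro ⟨b, hb⟩
    have : b ∈ g.dom := by rw [composable_iff.1 h]; exact ⟨i, hb⟩
    obtain ⟨c, hc⟩ := this
    exact ⟨c, comp_eq_some.2 ⟨b, hb, hc⟩⟩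

theorem im_comp {g f : LiftedPartialPerm m k} (h : g.Composable f) :
    (g.comp f h).im = g.im := by
  ext c
  constructor
  · rintro ⟨i, hc⟩
    obtain ⟨b, hb, hc⟩ := comp_eq_some.1 hc
    exact ⟨b, hc⟩
  · rintro ⟨b, hc⟩
    have : b ∈ f.im := by rw [← composable_iff.1 h]; exact ⟨c, hc⟩
    obtain ⟨i, hb⟩ := this
    exact ⟨i, comp_eq_some.2 ⟨b, hb, hc⟩⟩

theorem post_composable {g f : LiftedPartialPerm m k} (h : g.Composable f) (a b : ℤ) :
    (g.post a b).Composable f := by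
  rwa [composable_iff, dom_post, ← composable_iff]

theorem post_comp {g f : LiftedPartialPerm m k} (h : g.Composable f) (a b : ℤ) :
    (g.post a b).comp f (post_composable h a b) = (g.comp f h).post a b := by
  ext1
  funext i
  simp only [comp, post]
  cases f.toFun i <;> rfl

theorem inv_comp_of_cross_eq_zero (hm : 1 < m) {g f : LiftedPartialPerm m k}
    (h : g.Composable f) (hg : g.cross = 0) {i j : ℤ} : (g.comp f h).Inv i j ↔ f.Inv i j := by
  have hn : ∀ x y, ¬ g.Inv x y := fun x y hxy => by
    have := (cross_pos_iff hm g).2 ⟨_, pairMk_mem_crossSet.2 hxy⟩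
    omega
  have key : ∀ {x y c d : ℤ}, g.toFun x = some c → g.toFun y = some d → (x < y ↔ c < d) := by
    intro x y c d hc hd
    have h1 : x = y ↔ c = d := by
      constructor
      · rintro rfl; exact Option.some.inj (hc.symm.trans hd)
      · rintro rfl; exact g.some_inj hc hd
    constructor
    · intro hlt
      by_contra hcd
      exact hn x y ⟨c, d, hc, hd, by omega⟩
    · intro hlt
      by_contra hcd
      exact hn x y ⟨c, d, hc, hd, by omega⟩
  constructor
  · rintro ⟨c, d, hc, hd, hh⟩
    obtain ⟨x, hx, hc⟩ := comp_eq_some.1 hc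
    obtain ⟨y, hy, hd⟩ := comp_eq_some.1 hd
    refine ⟨x, y, hx, hy, ?_⟩
    rwa [key hc hd, key hd hc]
  · rintro ⟨x, y, hx, hy, hh⟩
    have hx' : x ∈ g.dom := by rw [composable_iff.1 h]; exact ⟨i, hx⟩
    have hy' : y ∈ g.dom := by rw [composable_iff.1 h]; exact ⟨j, hy⟩
    obtain ⟨c, hc⟩ := hx'
    obtain ⟨d, hd⟩ := hy'
    refine ⟨c, d, comp_eq_some.2 ⟨x, hx, hc⟩, comp_eq_some.2 ⟨y, hy, hd⟩, ?_⟩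
    rwa [← key hc hd, ← key hd hc]

theorem crossSet_comp_of_cross_eq_zero (hm : 1 < m) {g f : LiftedPartialPerm m k}
    (h : g.Composable f) (hg : g.cross = 0) : (g.comp f h).crossSet = f.crossSet := by
  ext e
  obtain ⟨i, j, rfl⟩ := exists_pairMk e
  rw [pairMk_mem_crossSet, pairMk_mem_crossSet, inv_comp_of_cross_eq_zero hm h hg]

theorem res_composable {g f : LiftedPartialPerm m k} (h : g.Composable f) {e : PairClass m}
    (he : e ∈ f.crossSet) : g.Composable (f.res e) := by
  rwa [composable_iff, im_res_of_mem he, ← composable_iff]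

theorem res_comp {g f : LiftedPartialPerm m k} (h : g.Composable f) {e : PairClass m}
    (he : e ∈ f.crossSet) (he' : e ∈ (g.comp f h).crossSet) :
    (g.comp f h).res e = g.comp (f.res e) (res_composable h he) := by
  obtain ⟨i, j, rfl⟩ := exists_pairMk e
  ext1
  funext l
  rw [res_toFun (pairMk_mem_crossSet.1 he')]
  simp only [comp]
  rw [res_toFun (pairMk_mem_crossSet.1 he)]

theorem cross_comp_le (hm : 1 < m) : ∀ (n : ℕ) (g f : LiftedPartialPerm m k)
    (h : g.Composable f), g.cross = n → (g.comp f h).cross ≤ g.cross + f.cross := by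
  intro n
  induction n with
  | zero =>
    intro g f h hg
    rw [cross_eq_ncard (g.comp f h), crossSet_comp_of_cross_eq_zero hm h hg, ← cross_eq_ncard]
    omega
  | succ n ih =>
    intro g f h hg
    obtain ⟨g', a, b, hgap, rfl, hlen, -⟩ := PongOne.exists_eq_lift hm (f := g) (by omega)
    have h' : g'.Composable f := by rwa [composable_iff, dom_post, ← composable_iff] at h
    have h1 := ih g' f h' (by omega)
    have hgap' : IsGap (g'.comp f h').im a b := by rwa [im_comp]
    have h2 := cross_post_le hm hgap'
    rw [← post_comp h'] at h2
    omega

/-- The crossing numbers of two maps add up if no pair of strands crosses twice. -/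
theorem cross_comp_of_disjoint (hm : 1 < m) {g f : LiftedPartialPerm m k} (h : g.Composable f)
    (hd : ∀ i j a b, f.toFun i = some a → f.toFun j = some b → f.Inv i j → ¬ g.Inv a b) :
    (g.comp f h).cross = g.cross + f.cross := by
  classical
  let P : Set (PairClass m) := {e | ∃ i j a b, e = pairMk m i j ∧ f.toFun i = some a ∧
    f.toFun j = some b ∧ g.Inv a b}
  have hpre : ∀ e ∈ g.crossSet, ∃ i j a b, e = pairMk m a b ∧ f.toFun i = some a ∧
      f.toFun j = some b ∧ g.Inv a b := by
    rintro e ⟨a, b, rfl, hab⟩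
    obtain ⟨c, d, hc, hd, -⟩ := id hab
    have ha : a ∈ f.im := by rw [← composable_iff.1 h]; exact ⟨c, hc⟩
    have hb : b ∈ f.im := by rw [← composable_iff.1 h]; exact ⟨d, hd⟩
    obtain ⟨i, hi⟩ := ha
    obtain ⟨j, hj⟩ := hb
    exact ⟨i, j, a, b, rfl, hi, hj, hab⟩
  choose! I J A B hE hI hJ hAB using hpre
  have hP : P = (fun e => pairMk m (I e) (J e)) '' g.crossSet := by
    ext e
    constructor
    · rintro ⟨i, j, a, b, rfl, hi, hj, hab⟩
      have he : pairMk m a b ∈ g.crossSet := pairMk_mem_crossSet.2 hab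
      exact ⟨_, he, (pairMk_image_iff hi hj (hI _ he) (hJ _ he)).2 (hE _ he).symm⟩
    · rintro ⟨e, he, rfl⟩
      exact ⟨I e, J e, A e, B e, rfl, hI e he, hJ e he, hAB e he⟩
  have hPcard : P.ncard = g.cross := by
    rw [hP, Set.InjOn.ncard_image, cross_eq_ncard]
    intro e he e' he' heq
    rw [hE e he, hE e' he']
    exact (pairMk_image_iff (hI e' he') (hJ e' he') (hI e he) (hJ e he)).1 heq
  have hPfin : P.Finite := by
    rw [hP]; exact (finite_crossSet hm g).image _
  have lt_iff : ∀ (u : LiftedPartialPerm m k) {x y c d : ℤ}, u.toFun x = some c →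
      u.toFun y = some d → ¬ u.Inv x y → (x < y ↔ c < d) := by
    intro u x y c d hc hd hn
    have h1 : x = y ↔ c = d := by
      constructor
      · rintro rfl; exact Option.some.inj (hc.symm.trans hd)
      · rintro rfl; exact u.some_inj hc hd
    constructor
    · intro hlt
      by_contra hcd
      exact hn ⟨c, d, hc, hd, by omega⟩
    · intro hlt
      by_contra hcd
      exact hn ⟨c, d, hc, hd, by omega⟩
  have hunion : (g.comp f h).crossSet = P ∪ f.crossSet := by
    ext e
    obtain ⟨i, j, rfl⟩ := exists_pairMk e
    rw [Set.mem_union, pairMk_mem_crossSet, pairMk_mem_crossSet]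
    constructor
    · rintro ⟨c, d, hc, hd', hh⟩
      obtain ⟨x, hx, hc⟩ := comp_eq_some.1 hc
      obtain ⟨y, hy, hd'⟩ := comp_eq_some.1 hd'
      by_contra hcon
      push Not at hcon
      have h1 : ¬ g.Inv x y := fun hg => hcon.1 ⟨i, j, x, y, rfl, hx, hy, hg⟩
      have := lt_iff g hc hd' h1
      have := lt_iff g hd' hc (fun hg => h1 hg.symm)
      exact hcon.2 ⟨x, y, hx, hy, by omega⟩
    · rintro (⟨i', j', a, b, he, hi, hj, hab⟩ | hinv)
      · have hn : ¬ f.Inv i' j' := fun hf => hd _ _ _ _ hi hj hf hab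
        have := lt_iff f hi hj hn
        have := lt_iff f hj hi (fun hg => hn hg.symm)
        obtain ⟨c, d, hc, hd', hh⟩ := hab
        have : (g.comp f h).Inv i' j' :=
          ⟨c, d, comp_eq_some.2 ⟨a, hi, hc⟩, comp_eq_some.2 ⟨b, hj, hd'⟩, by omega⟩
        rwa [← pairMk_mem_crossSet, he, pairMk_mem_crossSet]
      · obtain ⟨x, y, hx, hy, hh⟩ := id hinv
        have hn := hd _ _ _ _ hx hy hinv
        have hx' : x ∈ g.dom := by rw [composable_iff.1 h]; exact ⟨i, hx⟩
        have hy' : y ∈ g.dom := by rw [composable_iff.1 h]; exact ⟨j, hy⟩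
        obtain ⟨c, hc⟩ := hx'
        obtain ⟨d, hd'⟩ := hy'
        have := lt_iff g hc hd' hn
        have := lt_iff g hd' hc (fun hg => hn hg.symm)
        exact ⟨c, d, comp_eq_some.2 ⟨x, hx, hc⟩, comp_eq_some.2 ⟨y, hy, hd'⟩, by omega⟩
  rw [cross_eq_ncard, hunion, Set.ncard_union_eq ?_ hPfin (finite_crossSet hm f), hPcard,
    ← cross_eq_ncard]
  rw [Set.disjoint_left]
  rintro e ⟨i, j, a, b, rfl, hi, hj, hab⟩ he
  exact hd i j a b hi hj (pairMk_mem_crossSet.1 he) hab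

end LiftedPartialPerm

open LiftedPartialPerm

namespace PongOne

variable {m k : ℕ}

open Classical in
/-- The product of basis elements. -/
def mulOf (g f : LiftedPartialPerm m k) : PongOne m k :=
  if h : g.Composable f then
    if (g.comp f h).cross = g.cross + f.cross then of (g.comp f h) else 0
  else 0

/-- The product. -/
def mul (m k : ℕ) : PongOne m k →ₗ[ZMod 2] PongOne m k →ₗ[ZMod 2] PongOne m k :=
  Finsupp.linearCombination (ZMod 2) fun g : LiftedPartialPerm m k =>
    (Finsupp.linearCombination (ZMod 2) fun f : LiftedPartialPerm m k => mulOf g f :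
      PongOne m k →ₗ[ZMod 2] PongOne m k)

theorem mul_of (g f : LiftedPartialPerm m k) : mul m k (of g) (of f) = mulOf g f := by
  simp [mul]

theorem induction_of {p : PongOne m k → Prop} (h0 : p 0) (hadd : ∀ x y, p x → p y → p (x + y))
    (hof : ∀ f, p (of f)) (z : PongOne m k) : p z :=
  supp_induction (X := Set.univ) h0 hadd (fun f _ => hof f) z (by simp)

theorem mul_assoc (hm : 1 < m) (x y z : PongOne m k) :
    mul m k (mul m k x y) z = mul m k x (mul m k y z) := by
  induction x using induction_of with
  | h0 => simp
  | hadd x x' hx hx' => simp [hx, hx']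
  | hof h =>
  induction y using induction_of with
  | h0 => simp
  | hadd x x' hx hx' => simp [hx, hx']
  | hof g =>
  induction z using induction_of with
  | h0 => simp
  | hadd x x' hx hx' => simp [hx, hx']
  | hof f =>
  rw [mul_of, mul_of, mulOf, mulOf]
  by_cases h1 : h.Composable g
  · by_cases h2 : g.Composable f
    · rw [dif_pos h1, dif_pos h2]
      have h3 : (h.comp g h1).Composable f := by
        rwa [composable_iff, dom_comp, ← composable_iff]
      have h4 : h.Composable (g.comp f h2) := by
        rwa [composable_iff, im_comp, ← composable_iff]
      have e : (h.comp g h1).comp f h3 = h.comp (g.comp f h2) h4 := by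
        ext1
        funext i
        simp [comp, Option.bind_assoc]
      have l1 := cross_comp_le hm _ h g h1 rfl
      have l2 := cross_comp_le hm _ g f h2 rfl
      have l3 := cross_comp_le hm _ _ f h3 rfl
      have l4 := cross_comp_le hm _ h _ h4 rfl
      have e' := congrArg LiftedPartialPerm.cross e
      split_ifs with a1 a2 a2
      · rw [mul_of, mul_of, mulOf, mulOf, dif_pos h3, dif_pos h4, e]
        congr 1
        rw [a1, a2]
        simp only [eq_iff_iff]
        omega
      · rw [map_zero, mul_of, mulOf, dif_pos h3, if_neg (by omega)]
      · rw [map_zero, LinearMap.zero_apply, mul_of, mulOf, dif_pos h4, if_neg (by omega)]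
      · simp
    · rw [dif_neg h2, map_zero, dif_pos h1]
      split_ifs
      · rw [mul_of, mulOf, dif_neg]
        rwa [composable_iff, dom_comp, ← composable_iff]
      · simp
  · rw [dif_neg h1, map_zero, LinearMap.zero_apply]
    by_cases h2 : g.Composable f
    · rw [dif_pos h2]
      split_ifs
      · rw [mul_of, mulOf, dif_neg]
        rwa [composable_iff, im_comp, ← composable_iff]
      · simp
    · rw [dif_neg h2, map_zero]

theorem lift_mul (hm : 1 < m) (a b : ℤ) (x y : PongOne m k) :
    mul m k (lift m k a b x) y = lift m k a b (mul m k x y) := by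
  induction x using induction_of with
  | h0 => simp
  | hadd x x' hx hx' => simp [hx, hx']
  | hof g =>
  induction y using induction_of with
  | h0 => simp
  | hadd x x' hx hx' => simp [hx, hx']
  | hof f =>
  rw [lift_of, mul_of, mulOf]
  by_cases h : g.Composable f
  · have h' := post_composable h a b
    have e := post_comp h a b
    have e' := congrArg LiftedPartialPerm.cross e
    have l1 := cross_comp_le hm _ g f h rfl
    have l2 := cross_comp_le hm _ _ f h' rfl
    rw [dif_pos h]
    by_cases hg : IsGap g.im a b
    · have hg' : IsGap (g.comp f h).im a b := by rwa [im_comp]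
      have l3 := cross_post_le hm hg
      have l4 := cross_post_le hm hg'
      split_ifs with a1 a2 a2
      · rw [mul_of, mulOf, dif_pos h', lift_of, e]
        congr 1
        rw [a1.2, a2]
        simp only [hg', true_and, eq_iff_iff]
        omega
      · rw [map_zero, mul_of, mulOf, dif_pos h', if_neg (by omega)]
      · rw [map_zero, LinearMap.zero_apply, lift_of, if_neg]
        rintro ⟨-, a3⟩
        exact a1 ⟨hg, by omega⟩
      · simp
    · rw [if_neg (fun hh => hg hh.1), map_zero, LinearMap.zero_apply]
      split_ifs
      · rw [lift_of, if_neg]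
        rw [im_comp]
        exact fun hh => hg hh.1
      · simp
  · rw [dif_neg h, map_zero]
    split_ifs
    · rw [mul_of, mulOf, dif_neg]
      rwa [composable_iff, dom_post, ← composable_iff]
    · simp

theorem mul_mem_supp_im {T : Set ℤ} {x : PongOne m k}
    (hx : x ∈ Supp {f : LiftedPartialPerm m k | f.im = T}) (y : PongOne m k) :
    mul m k x y ∈ Supp {f : LiftedPartialPerm m k | f.im = T} := by
  refine supp_induction (p := fun x => mul m k x y ∈ Supp {f | f.im = T})
    (by simp) (fun x y hx hy => ?_) ?_ x hx
  · rw [map_add]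
    exact add_mem hx hy
  · rintro g rfl
    induction y using induction_of with
    | h0 => simp
    | hadd x x' hx hx' => rw [map_add]; exact add_mem hx hx'
    | hof f =>
      rw [mul_of, mulOf]
      split_ifs with h
      · exact of_mem_supp (im_comp h)
      · exact zero_mem _
      · exact zero_mem _

theorem leibniz_of_cross_eq_zero (hm : 1 < m) {g : LiftedPartialPerm m k} (hg : g.cross = 0)
    (y : PongOne m k) : diff m k (mul m k (of g) y) = mul m k (of g) (diff m k y) := by
  classical
  induction y using induction_of with
  | h0 => simp
  | hadd x x' hx hx' => simp [hx, hx']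
  | hof f =>
  by_cases h : g.Composable f
  · have hc : ∀ (f : LiftedPartialPerm m k) (h : g.Composable f),
        (g.comp f h).cross = f.cross := fun f h => by
      rw [cross_eq_ncard, crossSet_comp_of_cross_eq_zero hm h hg, ← cross_eq_ncard]
    have hs : ((finite_crossSet hm f).toFinset : Set (PairClass m)) = f.crossSet := by simp
    have hs' := hs.trans (crossSet_comp_of_cross_eq_zero hm h hg).symm
    rw [mul_of, mulOf, dif_pos h, if_pos (by rw [hc, hg, zero_add]), diff_of, diff_of,
      diffOf_eq hs', diffOf_eq hs, map_sum]
    refine Finset.sum_congr rfl fun e he => ?_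
    have he : e ∈ f.crossSet := by simpa using he
    have he' : e ∈ (g.comp f h).crossSet := by
      rwa [crossSet_comp_of_cross_eq_zero hm h hg]
    rw [res_comp h he he', hc, hc]
    split_ifs
    · rw [mul_of, mulOf, dif_pos (res_composable h he), if_pos (by rw [hc, hg, zero_add])]
    · simp
  · have : ∀ f : LiftedPartialPerm m k, ¬ g.Composable f → mulOf g f = 0 := fun f hf => by
      rw [mulOf, dif_neg hf]
    rw [mul_of, this f h, map_zero, diff_of,
      diffOf_eq (s := (finite_crossSet hm f).toFinset) (by simp), map_sum, Finset.sum_eq_zero]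
    intro e he
    have he : e ∈ f.crossSet := by simpa using he
    split_ifs
    · rw [mul_of, this]
      rwa [composable_iff, im_res_of_mem he, ← composable_iff]
    · simp

theorem leibniz_of (hm : 1 < m) : ∀ (n : ℕ) (g : LiftedPartialPerm m k) (y : PongOne m k),
    g.cross = n → diff m k (mul m k (of g) y)
      = mul m k (diff m k (of g)) y + mul m k (of g) (diff m k y) := by
  intro n
  induction n with
  | zero =>
    intro g y hg
    rw [leibniz_of_cross_eq_zero hm hg, diff_of, diffOf_eq_zero hm hg]
    simp
  | succ n ih =>
    intro g y hg
    obtain ⟨g', a, b, hgap, -, hlen, e⟩ := exists_eq_lift hm (f := g) (by omega)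
    have hg' : of g' ∈ Supp {f : LiftedPartialPerm m k | f.im = g'.im} := of_mem_supp rfl
    rw [e, lift_mul hm, diff_lift hm hgap (mul_mem_supp_im hg' y), ih g' y (by omega), map_add,
      diff_lift hm hgap hg', map_add, LinearMap.add_apply, lift_mul hm, lift_mul hm]
    abel

theorem leibniz (hm : 1 < m) (x y : PongOne m k) :
    diff m k (mul m k x y) = mul m k (diff m k x) y + mul m k x (diff m k y) := by
  induction x using induction_of with
  | h0 => simp
  | hadd x x' hx hx' =>
    simp only [map_add, LinearMap.add_apply, hx, hx']
    abel
  | hof g => exact leibniz_of hm _ g y rfl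

end PongOne

/-- The number of elements of `S` in `{1, …, p}`. -/
def lev (S : Set ℤ) (p : ℤ) : ℤ := (S ∩ Set.Icc 1 p).ncard

theorem lev_zero (S : Set ℤ) : lev S 0 = 0 := by
  simp [lev]

open Classical in
theorem lev_succ (S : Set ℤ) {p : ℤ} (hp : 0 ≤ p) :
    lev S (p + 1) = lev S p + if p + 1 ∈ S then 1 else 0 := by
  unfold lev
  split_ifs with h
  · have : S ∩ Set.Icc 1 (p + 1) = insert (p + 1) (S ∩ Set.Icc 1 p) := by
      ext x
      simp only [Set.mem_inter_iff, Set.mem_Icc, Set.mem_insert_iff]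
      constructor
      · rintro ⟨h1, h2, h3⟩
        by_cases hx : x = p + 1
        · exact Or.inl hx
        · exact Or.inr ⟨h1, h2, by omega⟩
      · rintro (rfl | ⟨h1, h2, h3⟩)
        · exact ⟨h, by omega, le_rfl⟩
        · exact ⟨h1, h2, by omega⟩
    rw [this, Set.ncard_insert_of_notMem (by simp) ((Set.finite_Icc _ _).inter_of_right _)]
    push_cast; ring
  · have : S ∩ Set.Icc 1 (p + 1) = S ∩ Set.Icc 1 p := by
      ext x
      simp only [Set.mem_inter_iff, Set.mem_Icc]
      constructor
      · rintro ⟨h1, h2, h3⟩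
        refine ⟨h1, h2, ?_⟩
        by_contra hx
        obtain rfl : x = p + 1 := by omega
        exact h h1
      · rintro ⟨h1, h2, h3⟩
        exact ⟨h1, h2, by omega⟩
    rw [this]; ring

theorem lev_mono (S : Set ℤ) {p q : ℤ} (hpq : p ≤ q) : lev S p ≤ lev S q := by
  unfold lev
  exact_mod_cast Set.ncard_le_ncard
    (Set.inter_subset_inter_right _ (Set.Icc_subset_Icc_right hpq))
    ((Set.finite_Icc _ _).inter_of_right _)

namespace LiftedPartialPerm

variable {m k : ℕ}

/-! ### Ranks -/

/-- A lifted partial permutation moves every integer by a bounded amount. -/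
theorem exists_bound (hm : 1 < m) (f : LiftedPartialPerm m k) :
    ∃ B : ℤ, ∀ i a, f.toFun i = some a → |a - i| ≤ B := by
  obtain ⟨B, hB⟩ := ((Set.finite_Icc (1 : ℤ) (m - 1)).image
    (fun s => |(f.toFun s).getD 0 - s|)).bddAbove
  refine ⟨B, fun i a hi => ?_⟩
  obtain ⟨g, hg, s, hs, hs', rfl⟩ := exists_rep hm i
  rw [f.equivariant g hg] at hi
  obtain ⟨b, hb, rfl⟩ := Option.map_eq_some_iff.1 hi
  have h := hB ⟨s, ⟨hs, hs'⟩, rfl⟩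
  simp only [hb, Option.getD_some] at h
  rcases motion_sub hg with h' | h'
  · rwa [h']
  · rwa [h', abs_sub_comm]

/-- The strands that start at most at `x` and end beyond `y`. -/
def upSet (f : LiftedPartialPerm m k) (x y : ℤ) : Set ℤ :=
  {i | i ≤ x ∧ ∃ b, f.toFun i = some b ∧ y < b}

/-- The strands that start beyond `x` and end at most at `y`. -/
def downSet (f : LiftedPartialPerm m k) (x y : ℤ) : Set ℤ :=
  {i | x < i ∧ ∃ b, f.toFun i = some b ∧ b ≤ y}

theorem finite_upSet (hm : 1 < m) (f : LiftedPartialPerm m k) (x y : ℤ) :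
    (f.upSet x y).Finite := by
  obtain ⟨B, hB⟩ := f.exists_bound hm
  refine (Set.finite_Icc (y - B) x).subset ?_
  rintro i ⟨h1, b, hb, h2⟩
  have := abs_le.1 (hB i b hb)
  exact ⟨by omega, h1⟩

theorem finite_downSet (hm : 1 < m) (f : LiftedPartialPerm m k) (x y : ℤ) :
    (f.downSet x y).Finite := by
  obtain ⟨B, hB⟩ := f.exists_bound hm
  refine (Set.finite_Icc x (y + B)).subset ?_
  rintro i ⟨h1, b, hb, h2⟩
  have := abs_le.1 (hB i b hb)
  exact ⟨by omega, by omega⟩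

/-- The number of strands that start at most at `x` and end beyond `y`. -/
def up (f : LiftedPartialPerm m k) (x y : ℤ) : ℤ := (f.upSet x y).ncard

/-- The number of strands that start beyond `x` and end at most at `y`. -/
def down (f : LiftedPartialPerm m k) (x y : ℤ) : ℤ := (f.downSet x y).ncard

theorem up_nonneg (f : LiftedPartialPerm m k) (x y : ℤ) : 0 ≤ f.up x y := by
  simp [up]

theorem down_zero_zero (f : LiftedPartialPerm m k) : f.down 0 0 = f.up 0 0 := by
  unfold down up
  have key : ∀ i b, f.toFun i = some b → f.toFun (1 - i) = some (1 - b) := fun i b h => by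
    simpa using f.map_some (reflection_mem m 0) h
  have : f.downSet 0 0 = (fun i => 1 - i) '' f.upSet 0 0 := by
    ext i
    constructor
    · rintro ⟨h1, b, hb, h2⟩
      exact ⟨1 - i, ⟨by omega, 1 - b, key _ _ hb, by omega⟩, by simp⟩
    · rintro ⟨i, ⟨h1, b, hb, h2⟩, rfl⟩
      exact ⟨by dsimp only; omega, 1 - b, key _ _ hb, by omega⟩
  rw [this, Set.ncard_image_of_injective]
  exact fun a b h => by simpa using h

open Classical in
theorem up_succ_left (hm : 1 < m) (f : LiftedPartialPerm m k) (x y : ℤ) :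
    f.up (x + 1) y = f.up x y + if ∃ b, f.toFun (x + 1) = some b ∧ y < b then 1 else 0 := by
  unfold up
  split_ifs with h
  · have : f.upSet (x + 1) y = insert (x + 1) (f.upSet x y) := by
      ext i
      simp only [upSet, Set.mem_ofPred_eq, Set.mem_insert_iff]
      constructor
      · rintro ⟨h1, h2⟩
        by_cases hi : i = x + 1
        · exact Or.inl hi
        · exact Or.inr ⟨by omega, h2⟩
      · rintro (rfl | ⟨h1, h2⟩)
        · exact ⟨le_rfl, h⟩
        · exact ⟨by omega, h2⟩
    rw [this, Set.ncard_insert_of_notMem (by simp [upSet]) (f.finite_upSet hm x y)]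
    push_cast; ring
  · have : f.upSet (x + 1) y = f.upSet x y := by
      ext i
      simp only [upSet, Set.mem_ofPred_eq]
      constructor
      · rintro ⟨h1, h2⟩
        refine ⟨?_, h2⟩
        by_contra hi
        obtain rfl : i = x + 1 := by omega
        exact h h2
      · rintro ⟨h1, h2⟩
        exact ⟨by omega, h2⟩
    rw [this]; ring

open Classical in
theorem down_succ_left (hm : 1 < m) (f : LiftedPartialPerm m k) (x y : ℤ) :
    f.down x y = f.down (x + 1) y + if ∃ b, f.toFun (x + 1) = some b ∧ b ≤ y then 1 else 0 := by
  unfold down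
  split_ifs with h
  · have : f.downSet x y = insert (x + 1) (f.downSet (x + 1) y) := by
      ext i
      simp only [downSet, Set.mem_ofPred_eq, Set.mem_insert_iff]
      constructor
      · rintro ⟨h1, h2⟩
        by_cases hi : i = x + 1
        · exact Or.inl hi
        · exact Or.inr ⟨by omega, h2⟩
      · rintro (rfl | ⟨h1, h2⟩)
        · exact ⟨by omega, h⟩
        · exact ⟨by omega, h2⟩
    rw [this, Set.ncard_insert_of_notMem (by simp [downSet]) (f.finite_downSet hm _ y)]
    push_cast; ring
  · have : f.downSet x y = f.downSet (x + 1) y := by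
      ext i
      simp only [downSet, Set.mem_ofPred_eq]
      constructor
      · rintro ⟨h1, h2⟩
        refine ⟨?_, h2⟩
        by_contra hi
        obtain rfl : i = x + 1 := by omega
        exact h h2
      · rintro ⟨h1, h2⟩
        exact ⟨by omega, h2⟩
    rw [this]; ring

open Classical in
theorem up_succ_right (hm : 1 < m) (f : LiftedPartialPerm m k) (x y : ℤ) :
    f.up x y = f.up x (y + 1) + if ∃ i, f.toFun i = some (y + 1) ∧ i ≤ x then 1 else 0 := by
  unfold up
  split_ifs with h
  · obtain ⟨j, hj, hjx⟩ := h
    have : f.upSet x y = insert j (f.upSet x (y + 1)) := by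
      ext i
      simp only [upSet, Set.mem_ofPred_eq, Set.mem_insert_iff]
      constructor
      · rintro ⟨h1, b, hb, h2⟩
        by_cases hi : b = y + 1
        · subst hi; exact Or.inl (f.some_inj hb hj)
        · exact Or.inr ⟨h1, b, hb, by omega⟩
      · rintro (rfl | ⟨h1, b, hb, h2⟩)
        · exact ⟨hjx, _, hj, by omega⟩
        · exact ⟨h1, b, hb, by omega⟩
    rw [this, Set.ncard_insert_of_notMem (by simp [upSet, hj]) (f.finite_upSet hm x _)]
    push_cast; ring
  · have : f.upSet x y = f.upSet x (y + 1) := by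
      ext i
      simp only [upSet, Set.mem_ofPred_eq]
      constructor
      · rintro ⟨h1, b, hb, h2⟩
        refine ⟨h1, b, hb, ?_⟩
        by_contra hi
        obtain rfl : b = y + 1 := by omega
        exact h ⟨i, hb, h1⟩
      · rintro ⟨h1, b, hb, h2⟩
        exact ⟨h1, b, hb, by omega⟩
    rw [this]; ring

open Classical in
theorem down_succ_right (hm : 1 < m) (f : LiftedPartialPerm m k) (x y : ℤ) :
    f.down x (y + 1) = f.down x y + if ∃ i, f.toFun i = some (y + 1) ∧ x < i then 1 else 0 := by
  unfold down
  split_ifs with h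
  · obtain ⟨j, hj, hjx⟩ := h
    have : f.downSet x (y + 1) = insert j (f.downSet x y) := by
      ext i
      simp only [downSet, Set.mem_ofPred_eq, Set.mem_insert_iff]
      constructor
      · rintro ⟨h1, b, hb, h2⟩
        by_cases hi : b = y + 1
        · subst hi; exact Or.inl (f.some_inj hb hj)
        · exact Or.inr ⟨h1, b, hb, by omega⟩
      · rintro (rfl | ⟨h1, b, hb, h2⟩)
        · exact ⟨hjx, _, hj, by omega⟩
        · exact ⟨h1, b, hb, by omega⟩
    rw [this, Set.ncard_insert_of_notMem (by simp [downSet, hj]) (f.finite_downSet hm x _)]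
    push_cast; ring
  · have : f.downSet x (y + 1) = f.downSet x y := by
      ext i
      simp only [downSet, Set.mem_ofPred_eq]
      constructor
      · rintro ⟨h1, b, hb, h2⟩
        refine ⟨h1, b, hb, ?_⟩
        by_contra hi
        obtain rfl : b = y + 1 := by omega
        exact h ⟨i, hb, by omega⟩
      · rintro ⟨h1, b, hb, h2⟩
        exact ⟨h1, b, hb, by omega⟩
    rw [this]; ring

/-- The flux through a pair of cuts depends only on the domain and the image. -/
theorem up_sub_down (hm : 1 < m) (f : LiftedPartialPerm m k) {x y : ℤ} (hx : 0 ≤ x)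
    (hy : 0 ≤ y) : f.up x y - f.down x y = lev f.dom x - lev f.im y := by
  classical
  induction x, hx using Int.leInduction with
  | base =>
    induction y, hy using Int.leInduction with
    | base => rw [down_zero_zero, lev_zero, lev_zero]; ring
    | succ y hy ih =>
      have h1 := up_succ_right hm f 0 y
      have h2 := down_succ_right hm f 0 y
      rw [lev_succ _ hy]
      have h3 : (y + 1 ∈ f.im) ↔ (∃ i, f.toFun i = some (y + 1) ∧ i ≤ 0) ∨
          (∃ i, f.toFun i = some (y + 1) ∧ 0 < i) := by
        constructor
        · rintro ⟨i, hi⟩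
          rcases le_or_gt i 0 with h | h
          · exact Or.inl ⟨i, hi, h⟩
          · exact Or.inr ⟨i, hi, h⟩
        · rintro (⟨i, hi, -⟩ | ⟨i, hi, -⟩) <;> exact ⟨i, hi⟩
      have h4 : ¬ ((∃ i, f.toFun i = some (y + 1) ∧ i ≤ 0) ∧
          (∃ i, f.toFun i = some (y + 1) ∧ 0 < i)) := by
        rintro ⟨⟨i, hi, h⟩, j, hj, h'⟩
        have := f.some_inj hi hj
        omega
      split_ifs at * <;> first | omega | (exfalso; grind only)
  | succ x hx ih =>
    have h1 := up_succ_left hm f x y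
    have h2 := down_succ_left hm f x y
    rw [lev_succ _ hx]
    have h3 : (x + 1 ∈ f.dom) ↔ (∃ b, f.toFun (x + 1) = some b ∧ y < b) ∨
        (∃ b, f.toFun (x + 1) = some b ∧ b ≤ y) := by
      constructor
      · rintro ⟨i, hi⟩
        rcases le_or_gt i y with h | h
        · exact Or.inr ⟨i, hi, h⟩
        · exact Or.inl ⟨i, hi, h⟩
      · rintro (⟨i, hi, -⟩ | ⟨i, hi, -⟩) <;> exact ⟨i, hi⟩
    have h4 : ¬ ((∃ b, f.toFun (x + 1) = some b ∧ y < b) ∧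
        (∃ b, f.toFun (x + 1) = some b ∧ b ≤ y)) := by
      rintro ⟨⟨i, hi, h⟩, j, hj, h'⟩
      rw [hi] at hj
      have := Option.some.inj hj
      omega
    split_ifs at * <;> first | omega | (exfalso; grind only)

theorem up_mono_left (hm : 1 < m) (f : LiftedPartialPerm m k) {x x' : ℤ} (h : x ≤ x') (y : ℤ) :
    f.up x y ≤ f.up x' y := by
  unfold up
  have : f.upSet x y ⊆ f.upSet x' y := fun i hi => ⟨hi.1.trans h, hi.2⟩
  exact_mod_cast Set.ncard_le_ncard this (f.finite_upSet hm _ _)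

theorem up_anti_right (hm : 1 < m) (f : LiftedPartialPerm m k) (x : ℤ) {y y' : ℤ} (h : y ≤ y') :
    f.up x y' ≤ f.up x y := by
  unfold up
  have : f.upSet x y' ⊆ f.upSet x y := fun i hi =>
    ⟨hi.1, hi.2.choose, hi.2.choose_spec.1, h.trans_lt hi.2.choose_spec.2⟩
  exact_mod_cast Set.ncard_le_ncard this (f.finite_upSet hm _ _)

theorem up_le_left (hm : 1 < m) (f : LiftedPartialPerm m k) {x x' : ℤ} (hx : 0 ≤ x) (h : x ≤ x')
    (y : ℤ) : f.up x' y ≤ f.up x y + (lev f.dom x' - lev f.dom x) := by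
  classical
  induction x', h using Int.leInduction with
  | base => simp
  | succ z hz ih =>
    rw [up_succ_left hm, lev_succ _ (hx.trans hz)]
    have : (∃ b, f.toFun (z + 1) = some b ∧ y < b) → z + 1 ∈ f.dom := by
      rintro ⟨b, hb, -⟩; exact ⟨b, hb⟩
    split_ifs <;> first | omega | (exfalso; grind only)

theorem up_le_right (hm : 1 < m) (f : LiftedPartialPerm m k) (x : ℤ) {y y' : ℤ} (hy : 0 ≤ y)
    (h : y ≤ y') : f.up x y ≤ f.up x y' + (lev f.im y' - lev f.im y) := by
  classical
  induction y', h using Int.leInduction with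
  | base => simp
  | succ z hz ih =>
    have hstep := up_succ_right hm f x z
    rw [lev_succ _ (hy.trans hz)]
    have : (∃ i, f.toFun i = some (z + 1) ∧ i ≤ x) → z + 1 ∈ f.im := by
      rintro ⟨b, hb, -⟩; exact ⟨b, hb⟩
    split_ifs at * <;> first | omega | (exfalso; grind only)

theorem exists_upSet_res_embedding {f : LiftedPartialPerm m k} {i j : ℤ} (hinv : f.Inv i j)
    (x y : ℤ) : ∃ φ : ℤ → ℤ, Set.InjOn φ ((f.res (pairMk m i j)).upSet x y) ∧
      ∀ l ∈ (f.res (pairMk m i j)).upSet x y, φ l ∈ f.upSet x y ∧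
        (φ l = l ∨ φ l = orbitSwap m i j l) := by
  classical
  have hij := hinv.nonTranslate
  have hdom := dom_res hinv
  have key : ∀ l ∈ (f.res (pairMk m i j)).upSet x y, l ∉ f.upSet x y →
      orbitSwap m i j l ∈ f.upSet x y ∧
        orbitSwap m i j l ∉ (f.res (pairMk m i j)).upSet x y := by
    rintro l ⟨h1, b, hb, h2⟩ hl
    have hd : l ∈ f.dom := by rw [← hdom]; exact ⟨b, hb⟩
    obtain ⟨c, hc⟩ := hd
    have hcy : c ≤ y := by
      by_contra hcy
      exact hl ⟨h1, c, hc, by omega⟩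
    rw [res_toFun hinv] at hb
    have hne : orbitSwap m i j l ≠ l := by
      intro hh
      rw [hh, hc] at hb
      have := Option.some.inj hb
      omega
    have hcr : f.Inv l (orbitSwap m i j l) := by
      rw [← pairMk_mem_crossSet, pairMk_orbitSwap hij hne]
      exact pairMk_mem_crossSet.2 hinv
    obtain ⟨c', b', hc', hb', hh⟩ := hcr
    rw [hc] at hc'; rw [hb] at hb'
    cases hc'; cases hb'
    refine ⟨⟨by omega, b, hb, h2⟩, ?_⟩
    rintro ⟨-, d, hd, hd'⟩
    rw [res_toFun hinv, orbitSwap_orbitSwap hij, hc] at hd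
    have := Option.some.inj hd
    omega
  refine ⟨fun l => if l ∈ f.upSet x y then l else orbitSwap m i j l, ?_, ?_⟩
  · intro l hl l' hl' h
    dsimp only at h
    split_ifs at h with h1 h2 h2
    · exact h
    · exact absurd (h ▸ hl) (key l' hl' h2).2
    · exact absurd (h ▸ hl') (key l hl h1).2
    · have := congrArg (orbitSwap m i j) h
      rwa [orbitSwap_orbitSwap hij, orbitSwap_orbitSwap hij] at this
  · intro l hl
    dsimp only
    split_ifs with h
    · exact ⟨h, Or.inl rfl⟩
    · exact ⟨(key l hl h).1, Or.inr rfl⟩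

/-- Resolutions lower all ranks. -/
theorem up_res_le (hm : 1 < m) {f : LiftedPartialPerm m k} {e : PairClass m}
    (he : e ∈ f.crossSet) (x y : ℤ) : (f.res e).up x y ≤ f.up x y := by
  obtain ⟨i, j, rfl⟩ := exists_pairMk e
  obtain ⟨φ, h1, h2⟩ := exists_upSet_res_embedding (pairMk_mem_crossSet.1 he) x y
  unfold up
  exact_mod_cast Set.ncard_le_ncard_of_injOn φ (fun l hl => (h2 l hl).1) h1 (f.finite_upSet hm x y)

/-- Resolutions lower the ranks between the two strands. -/
theorem up_res_lt (hm : 1 < m) {f : LiftedPartialPerm m k} {i j a b x y : ℤ}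
    (hi : f.toFun i = some a) (hj : f.toFun j = some b) (hix : i ≤ x) (hxj : x < j) (hby : b ≤ y)
    (hya : y < a) : (f.res (pairMk m i j)).up x y < f.up x y := by
  have hinv : f.Inv i j := ⟨a, b, hi, hj, Or.inl ⟨by omega, by omega⟩⟩
  have hij := hinv.nonTranslate
  obtain ⟨φ, h1, h2⟩ := exists_upSet_res_embedding hinv x y
  have hmem : i ∈ f.upSet x y := ⟨hix, a, hi, hya⟩
  have hfin := f.finite_upSet hm x y
  have h3 : ((f.res (pairMk m i j)).upSet x y).ncard ≤ (f.upSet x y \ {i}).ncard := by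
    refine Set.ncard_le_ncard_of_injOn φ (fun l hl => ⟨(h2 l hl).1, ?_⟩) h1 hfin.sdiff
    rintro (hli : φ l = i)
    obtain ⟨hlx, c, hc, hcy⟩ := hl
    rw [res_toFun hinv] at hc
    rcases (h2 l ⟨hlx, c, by rwa [res_toFun hinv], hcy⟩).2 with h | h
    · obtain rfl : l = i := h.symm.trans hli
      rw [orbitSwap_self_left, hj] at hc
      have := Option.some.inj hc
      omega
    · have : l = j := by
        rw [← orbitSwap_orbitSwap hij l, ← h, hli, orbitSwap_self_left]
      omega
  have h4 := Set.ncard_sdiff_singleton_lt_of_mem hmem hfin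
  unfold up
  exact_mod_cast h3.trans_lt h4

/-! ### Weights -/

/-- The strands that pass the cut at `p + 1/2`. -/
def sepSet (f : LiftedPartialPerm m k) (p : ℤ) : Set ℤ :=
  {i | ∃ b, f.toFun i = some b ∧ (i ≤ p ∧ p < b ∨ b ≤ p ∧ p < i)}

theorem sepSet_eq (f : LiftedPartialPerm m k) (p : ℤ) :
    f.sepSet p = f.upSet p p ∪ f.downSet p p := by
  ext i
  simp only [sepSet, upSet, downSet, Set.mem_union, Set.mem_ofPred_eq]
  constructor
  · rintro ⟨b, hb, ⟨h1, h2⟩ | ⟨h1, h2⟩⟩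
    · exact Or.inl ⟨h1, b, hb, h2⟩
    · exact Or.inr ⟨h2, b, hb, h1⟩
  · rintro (⟨h1, b, hb, h2⟩ | ⟨h2, b, hb, h1⟩)
    · exact ⟨b, hb, Or.inl ⟨h1, h2⟩⟩
    · exact ⟨b, hb, Or.inr ⟨h1, h2⟩⟩

theorem finite_sepSet (hm : 1 < m) (f : LiftedPartialPerm m k) (p : ℤ) : (f.sepSet p).Finite := by
  rw [sepSet_eq]
  exact (f.finite_upSet hm p p).union (f.finite_downSet hm p p)

theorem weight_eq_sepSet (f : LiftedPartialPerm m k) (j : Fin m) :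
    f.weight j = 1 / 2 * ((f.sepSet (j : ℕ)).ncard : ℚ) := by
  have key : ∀ (i : ℤ), ((i : ℚ) < (j : ℚ) + 1 / 2 ↔ i ≤ ((j : ℕ) : ℤ)) := by
    intro i
    constructor
    · intro h
      by_contra hc
      have : (((j : ℕ) : ℤ) + 1 : ℤ) ≤ i := by omega
      have : ((((j : ℕ) : ℤ) + 1 : ℤ) : ℚ) ≤ i := by exact_mod_cast this
      push_cast at this
      linarith
    · intro h
      have : (i : ℚ) ≤ (((j : ℕ) : ℤ) : ℚ) := by exact_mod_cast h
      push_cast at this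
      linarith
  have key' : ∀ (i : ℤ), ((j : ℚ) + 1 / 2 < (i : ℚ) ↔ ((j : ℕ) : ℤ) < i) := by
    intro i
    constructor
    · intro h
      by_contra hc
      have := (key i).2 (by omega)
      linarith
    · intro h
      have : (((j : ℕ) : ℤ) + 1 : ℤ) ≤ i := by omega
      have : ((((j : ℕ) : ℤ) + 1 : ℤ) : ℚ) ≤ i := by exact_mod_cast this
      push_cast at this
      linarith
  unfold weight sepSet
  simp only [key, key']

theorem ncard_sepSet (hm : 1 < m) (f : LiftedPartialPerm m k) (p : ℤ) :
    ((f.sepSet p).ncard : ℤ) = f.up p p + f.down p p := by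
  rw [sepSet_eq, Set.ncard_union_eq ?_ (f.finite_upSet hm p p) (f.finite_downSet hm p p)]
  · simp [up, down]
  · rw [Set.disjoint_left]
    rintro i ⟨h1, -⟩ ⟨h2, -⟩
    omega

/-- Twice the weight at the cut `p`. -/
def sep (f : LiftedPartialPerm m k) (p : ℤ) : ℤ := (f.sepSet p).ncard

theorem weight_eq_sep (f : LiftedPartialPerm m k) (j : Fin m) :
    f.weight j = (f.sep (j : ℕ) : ℚ) / 2 := by
  rw [weight_eq_sepSet, sep]
  push_cast
  ring

theorem sep_eq (hm : 1 < m) (f : LiftedPartialPerm m k) {p : ℤ} (hp : 0 ≤ p) :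
    f.sep p = 2 * f.up p p - (lev f.dom p - lev f.im p) := by
  have := up_sub_down hm f hp hp
  rw [sep, ncard_sepSet hm]
  omega

/-- The weight of a resolution differs by a vector of natural numbers. -/
theorem weight_res (hm : 1 < m) {f : LiftedPartialPerm m k} {e : PairClass m}
    (he : e ∈ f.crossSet) (j : Fin m) :
    ∃ n : ℕ, f.weight j = (f.res e).weight j + n := by
  refine ⟨(f.up (j : ℕ) (j : ℕ) - (f.res e).up (j : ℕ) (j : ℕ)).toNat, ?_⟩
  have h := up_res_le hm he (j : ℕ) (j : ℕ)
  rw [weight_eq_sep, weight_eq_sep, sep_eq hm _ (by positivity), sep_eq hm _ (by positivity),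
    im_res_of_mem he, dom_res_of_mem he]
  have : (((f.up (j : ℕ) (j : ℕ) - (f.res e).up (j : ℕ) (j : ℕ)).toNat : ℕ) : ℤ)
    = f.up (j : ℕ) (j : ℕ) - (f.res e).up (j : ℕ) (j : ℕ) := Int.toNat_of_nonneg (by omega)
  rw [← Int.cast_natCast (R := ℚ), this]
  push_cast
  ring

/-- The defect of additivity of the weight counts the strands that pass a cut twice. -/
theorem weight_comp (hm : 1 < m) {g f : LiftedPartialPerm m k} (h : g.Composable f) (j : Fin m) :
    f.weight j + g.weight j = (g.comp f h).weight j
      + ({i | i ∈ f.sepSet (j : ℕ) ∧ ∃ b, f.toFun i = some b ∧ b ∈ g.sepSet (j : ℕ)}.ncard : ℕ) := by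
  set p : ℤ := ((j : ℕ) : ℤ)
  set A := f.sepSet p
  set B : Set ℤ := {i | ∃ b, f.toFun i = some b ∧ b ∈ g.sepSet p}
  have hA : A.Finite := f.finite_sepSet hm p
  have hgB : g.sepSet p = {b | ∃ i ∈ B, f.toFun i = some b} := by
    ext b
    constructor
    · intro hb
      have : b ∈ f.im := by
        rw [← composable_iff.1 h]; obtain ⟨c, hc, -⟩ := hb; exact ⟨c, hc⟩
      obtain ⟨i, hi⟩ := this
      exact ⟨i, ⟨b, hi, hb⟩, hi⟩
    · rintro ⟨i, ⟨b', hb', hh⟩, hb⟩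
      rw [hb] at hb'
      cases hb'
      exact hh
  have hgB' : g.sepSet p = (fun i => (f.toFun i).getD 0) '' B := by
    rw [hgB]
    ext b
    constructor
    · rintro ⟨i, hi, hb⟩
      exact ⟨i, hi, by simp [hb]⟩
    · rintro ⟨i, hi, rfl⟩
      refine ⟨i, hi, ?_⟩
      obtain ⟨b, hb, -⟩ := hi
      simp [hb]
  have hinj : Set.InjOn (fun i => (f.toFun i).getD 0) B := by
    rintro i ⟨b, hb, -⟩ i' ⟨b', hb', -⟩ he
    simp only [hb, hb', Option.getD_some] at he
    subst he
    exact f.some_inj hb hb'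
  have hBcard : B.ncard = (g.sepSet p).ncard := by
    rw [hgB', hinj.ncard_image]
  have hB : B.Finite := by
    refine Set.Finite.of_finite_image ?_ hinj
    rw [← hgB']
    exact g.finite_sepSet hm p
  have hC : (g.comp f h).sepSet p = (A \ B) ∪ (B \ A) := by
    ext i
    simp only [Set.mem_union, Set.mem_sdiff, A, B, sepSet, Set.mem_ofPred_eq]
    constructor
    · rintro ⟨c, hc, hh⟩
      obtain ⟨b, hb, hc⟩ := comp_eq_some.1 hc
      rcases lt_or_ge p b with hpb | hpb <;> rcases hh with hh | hh
      · left
        refine ⟨⟨b, hb, by omega⟩, ?_⟩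
        rintro ⟨b', hb', c', hc', hh'⟩
        rw [hb] at hb'; cases hb'
        rw [hc] at hc'; cases hc'
        omega
      · right
        refine ⟨⟨b, hb, c, hc, by omega⟩, ?_⟩
        rintro ⟨b', hb', hh'⟩
        rw [hb] at hb'; cases hb'
        omega
      · right
        refine ⟨⟨b, hb, c, hc, by omega⟩, ?_⟩
        rintro ⟨b', hb', hh'⟩
        rw [hb] at hb'; cases hb'
        omega
      · left
        refine ⟨⟨b, hb, by omega⟩, ?_⟩
        rintro ⟨b', hb', c', hc', hh'⟩
        rw [hb] at hb'; cases hb'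
        rw [hc] at hc'; cases hc'
        omega
    · rintro (⟨⟨b, hb, hh⟩, hn⟩ | ⟨⟨b, hb, c, hc, hh⟩, hn⟩)
      · have : b ∈ g.dom := by rw [composable_iff.1 h]; exact ⟨i, hb⟩
        obtain ⟨c, hc⟩ := this
        refine ⟨c, comp_eq_some.2 ⟨b, hb, hc⟩, ?_⟩
        by_contra hcon
        exact hn ⟨b, hb, c, hc, by omega⟩
      · refine ⟨c, comp_eq_some.2 ⟨b, hb, hc⟩, ?_⟩
        by_contra hcon
        exact hn ⟨b, hb, by omega⟩
  have hset : {i | i ∈ A ∧ ∃ b, f.toFun i = some b ∧ b ∈ g.sepSet p} = A ∩ B := rfl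
  rw [weight_eq_sepSet, weight_eq_sepSet, weight_eq_sepSet, hset]
  have e1 := Set.ncard_inter_add_ncard_sdiff_eq_ncard A B hA
  have e2 := Set.ncard_inter_add_ncard_sdiff_eq_ncard B A hB
  rw [Set.inter_comm] at e2
  have e3 : ((g.comp f h).sepSet p).ncard = (A \ B).ncard + (B \ A).ncard := by
    rw [hC, Set.ncard_union_eq ?_ (hA.subset Set.sdiff_subset) (hB.subset Set.sdiff_subset)]
    rw [Set.disjoint_left]
    rintro i ⟨h1, h2⟩ ⟨h3, h4⟩
    exact h2 h3
  rw [e3, ← hBcard, ← e1, ← e2]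
  push_cast
  ring

end LiftedPartialPerm

namespace LiftedPartialPerm

variable {m k : ℕ}

/-! ### Identities -/

theorem card_orbits_dom (f : LiftedPartialPerm m k) : (orb m '' f.dom).ncard = k := by
  refine Eq.trans ?_ f.card_orbits
  congr 2
  ext i
  simp [dom, Option.isSome_iff_exists]

theorem orb_eq_iff_of_some {f : LiftedPartialPerm m k} {i j a b : ℤ} (hi : f.toFun i = some a)
    (hj : f.toFun j = some b) : orb m i = orb m j ↔ orb m a = orb m b := by
  refine ⟨fun h => ?_, f.injective i j a b hi hj⟩
  obtain ⟨g, hg, rfl⟩ := orb_eq_iff.1 h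
  have := Option.some.inj (hi.symm.trans (f.map_some hg hj))
  rw [this, orb_apply hg]

theorem card_orbits_im (f : LiftedPartialPerm m k) : (orb m '' f.im).ncard = k := by
  refine Eq.trans ?_ f.card_orbits_dom
  symm
  have hd : ∀ e ∈ orb m '' f.dom, ∃ i a, f.toFun i = some a ∧ orb m i = e := by
    rintro _ ⟨i, ⟨a, ha⟩, rfl⟩
    exact ⟨i, a, ha, rfl⟩
  choose! I A hI hE using hd
  refine Set.ncard_congr (fun e _ => orb m (A e)) ?_ ?_ ?_
  · exact fun e he => ⟨A e, ⟨I e, hI e he⟩, rfl⟩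
  · intro e e' he he' h
    rw [← hE e he, ← hE e' he']
    exact (orb_eq_iff_of_some (hI e he) (hI e' he')).2 h
  · rintro _ ⟨a, ⟨i, hi⟩, rfl⟩
    have he : orb m i ∈ orb m '' f.dom := ⟨i, ⟨a, hi⟩, rfl⟩
    exact ⟨_, he, (orb_eq_iff_of_some (hI _ he) hi).1 (hE _ he)⟩

open Classical in
/-- The identity of an invariant set. -/
def idOn (T : Set ℤ) (hT : Invariant m T) (hk : (orb m '' T).ncard = k) :
    LiftedPartialPerm m k where
  toFun i := if i ∈ T then some i else none
  equivariant g hg i := by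
    simp only [hT g hg i]
    split_ifs <;> rfl
  card_orbits := by
    convert hk using 3
    ext i
    by_cases h : i ∈ T <;> simp [h]
  injective i j a b hi hj hab := by
    split_ifs at hi hj
    cases hi; cases hj
    exact hab

/-- The identities among the lifted partial permutations. -/
def IsId (f : LiftedPartialPerm m k) : Prop := ∀ i, f.toFun i = none ∨ f.toFun i = some i

theorem IsId.eq {f : LiftedPartialPerm m k} (h : f.IsId) {i a : ℤ} (hi : f.toFun i = some a) :
    a = i := by
  rcases h i with h | h
  · rw [h] at hi; cases hi
  · rw [h] at hi; exact (Option.some.inj hi).symm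

theorem IsId.dom_eq {f : LiftedPartialPerm m k} (h : f.IsId) {i : ℤ} (hi : i ∈ f.dom) :
    f.toFun i = some i := by
  obtain ⟨a, ha⟩ := hi
  rwa [h.eq ha] at ha

theorem IsId.im {f : LiftedPartialPerm m k} (h : f.IsId) : f.im = f.dom := by
  ext a
  constructor
  · rintro ⟨i, hi⟩
    obtain rfl := h.eq hi
    exact ⟨a, hi⟩
  · exact fun ha => ⟨a, h.dom_eq ha⟩

theorem isId_idOn {T : Set ℤ} {hT : Invariant m T} {hk : (orb m '' T).ncard = k} :
    (idOn T hT hk).IsId := by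
  intro i
  by_cases h : i ∈ T
  · exact Or.inr (if_pos h)
  · exact Or.inl (if_neg h)

theorem dom_idOn {T : Set ℤ} {hT : Invariant m T} {hk : (orb m '' T).ncard = k} :
    (idOn T hT hk).dom = T := by
  ext i
  by_cases h : i ∈ T <;> simp [dom, idOn, h]

theorem IsId.ext {f g : LiftedPartialPerm m k} (hf : f.IsId) (hg : g.IsId) (h : f.dom = g.dom) :
    f = g := by
  refine ext_some fun i a => ⟨fun hi => ?_, fun hi => ?_⟩
  · obtain rfl := hf.eq hi
    exact hg.dom_eq (h ▸ ⟨a, hi⟩)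
  · obtain rfl := hg.eq hi
    exact hf.dom_eq (h ▸ ⟨a, hi⟩)

theorem cross_eq_zero_iff (hm : 1 < m) {f : LiftedPartialPerm m k} :
    f.cross = 0 ↔ ∀ i j, ¬ f.Inv i j := by
  constructor
  · intro h i j hij
    have := (cross_pos_iff hm f).2 ⟨_, pairMk_mem_crossSet.2 hij⟩
    omega
  · intro h
    by_contra hc
    obtain ⟨e, i, j, -, hij⟩ := (cross_pos_iff hm f).1 (Nat.pos_of_ne_zero hc)
    exact h i j hij

theorem IsId.cross (hm : 1 < m) {f : LiftedPartialPerm m k} (h : f.IsId) : f.cross = 0 := by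
  rw [cross_eq_zero_iff hm]
  rintro i j ⟨a, b, ha, hb, hh⟩
  obtain rfl := h.eq ha
  obtain rfl := h.eq hb
  omega

theorem IsId.weight {f : LiftedPartialPerm m k} (h : f.IsId) (j : Fin m) : f.weight j = 0 := by
  rw [weight_eq_sepSet]
  have : f.sepSet (j : ℕ) = ∅ := by
    ext i
    simp only [sepSet, Set.mem_ofPred_eq, Set.mem_empty_iff_false, iff_false]
    rintro ⟨b, hb, hh⟩
    obtain rfl := h.eq hb
    omega
  simp [this]

theorem IsId.comp_left {e f : LiftedPartialPerm m k} (he : e.IsId) (h : e.Composable f) :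
    e.comp f h = f := by
  refine ext_some fun i a => ?_
  rw [comp_eq_some]
  constructor
  · rintro ⟨b, hb, hc⟩
    rwa [he.eq hc]
  · intro hi
    have : a ∈ e.dom := by rw [composable_iff.1 h]; exact ⟨i, hi⟩
    exact ⟨a, hi, he.dom_eq this⟩

theorem IsId.comp_right {e f : LiftedPartialPerm m k} (he : e.IsId) (h : f.Composable e) :
    f.comp e h = f := by
  refine ext_some fun i a => ?_
  rw [comp_eq_some]
  constructor
  · rintro ⟨b, hb, hc⟩
    rwa [he.eq hb] at hc
  · intro hi
    have : i ∈ e.dom := by rw [← he.im, ← composable_iff.1 h]; exact ⟨a, hi⟩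
    exact ⟨i, he.dom_eq this, hi⟩

end LiftedPartialPerm

open LiftedPartialPerm

theorem exponentOf_apply {m : ℕ} {w : Fin m → ℚ} {i : Fin m} {n : ℕ} (h : w i = n) :
    exponentOf w i = n := by
  simp [exponentOf, h]

namespace Pong

variable {m k : ℕ}

/-! ### Specialization at `v = 1` and homogeneous elements -/

/-- The specialization at `v = 1`. -/
def spec (m k : ℕ) : Pong m k →+ PongOne m k :=
  Finsupp.mapRange.addMonoidHom (MvPolynomial.eval (fun _ : Fin m => (1 : ZMod 2))).toAddMonoidHom

theorem spec_single (f : LiftedPartialPerm m k) (p : Base m) :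
    spec m k (Finsupp.single f p) = MvPolynomial.eval (fun _ => 1) p • PongOne.of f := by
  rw [PongOne.of, Finsupp.smul_single, smul_eq_mul, mul_one]
  exact Finsupp.mapRange_single (hf := map_zero _)

theorem spec_pure (f : LiftedPartialPerm m k) (a : Fin m →₀ ℕ) :
    spec m k (pure f a) = PongOne.of f := by
  rw [pure, spec_single]
  simp [MvPolynomial.eval_monomial]

theorem single_eq_smul (f : LiftedPartialPerm m k) (p : Base m) :
    (Finsupp.single f p : Pong m k) = p • pure f 0 := by
  refine Eq.trans ?_ (Finsupp.smul_single p f _).symm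
  congr 1
  rw [smul_eq_mul, ← MvPolynomial.C_apply, MvPolynomial.C_1, mul_one]

theorem pure_eq_smul (f : LiftedPartialPerm m k) (a : Fin m →₀ ℕ) :
    (pure f a : Pong m k) = (MvPolynomial.monomial a (1 : ZMod 2)) • pure f 0 :=
  single_eq_smul f _

theorem smul_pure (f : LiftedPartialPerm m k) (a b : Fin m →₀ ℕ) :
    (MvPolynomial.monomial a (1 : ZMod 2)) • (pure f b : Pong m k) = pure f (a + b) := by
  rw [pure_eq_smul f b, smul_smul, MvPolynomial.monomial_mul, mul_one, ← pure_eq_smul]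

theorem induction_smul {p : Pong m k → Prop} (h0 : p 0) (hadd : ∀ x y, p x → p y → p (x + y))
    (hs : ∀ (c : Base m) f, p (c • pure f 0)) (z : Pong m k) : p z :=
  Finsupp.induction_linear (M := Base m) z h0 hadd fun f c => by
    have := hs c f
    rwa [← single_eq_smul] at this

theorem induction_pure {p : Pong m k → Prop} (h0 : p 0) (hadd : ∀ x y, p x → p y → p (x + y))
    (hs : ∀ f a, p (pure f a)) (z : Pong m k) : p z := by
  refine induction_smul h0 hadd (fun c f => ?_) z
  induction c using MvPolynomial.induction_on' with
  | monomial a c =>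
    rcases (by decide : ∀ c : ZMod 2, c = 0 ∨ c = 1) c with rfl | rfl
    · simpa using h0
    · rw [smul_pure]; exact hs _ _
  | add p q hp hq => rw [add_smul]; exact hadd _ _ hp hq

theorem spec_smul (c : Base m) (z : Pong m k) :
    spec m k (c • z) = MvPolynomial.eval (fun _ => 1) c • spec m k z := by
  induction z using induction_smul with
  | h0 => simp
  | hadd x y hx hy => rw [smul_add, map_add, hx, hy, map_add, smul_add]
  | hs d f =>
    rw [smul_smul, ← single_eq_smul, ← single_eq_smul, spec_single, spec_single, map_mul, mul_smul]

theorem mul_pure (g f : LiftedPartialPerm m k) : mul m k (pure g 0) (pure f 0) = mulPure g f := by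
  have h : (MvPolynomial.monomial (0 : Fin m →₀ ℕ) (1 : ZMod 2)) = 1 := by
    rw [← MvPolynomial.C_apply, MvPolynomial.C_1]
  have h1 : mul m k (pure g 0) = Finsupp.linearCombination (Base m) (mulPure g) := by
    refine (Finsupp.linearCombination_single (Base m) _ _).trans ?_
    rw [h]
    exact one_smul _ _
  rw [h1]
  refine (Finsupp.linearCombination_single (Base m) _ _).trans ?_
  rw [h, one_smul]

theorem diff_pure_zero (f : LiftedPartialPerm m k) : diff m k (pure f 0) = diffPure f := by
  have h : (MvPolynomial.monomial (0 : Fin m →₀ ℕ) (1 : ZMod 2)) = 1 := by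
    rw [← MvPolynomial.C_apply, MvPolynomial.C_1]
  refine (Finsupp.linearCombination_single (Base m) _ _).trans ?_
  rw [h, one_smul]

theorem spec_mulPure (g f : LiftedPartialPerm m k) :
    spec m k (mulPure g f) = PongOne.mulOf g f := by
  unfold mulPure PongOne.mulOf
  split_ifs
  · exact spec_pure _ _
  · exact map_zero _
  · exact map_zero _

theorem spec_mul (x y : Pong m k) :
    spec m k (mul m k x y) = PongOne.mul m k (spec m k x) (spec m k y) := by
  induction x using induction_smul with
  | h0 => simp
  | hadd x x' hx hx' => simp only [map_add, LinearMap.add_apply, hx, hx']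
  | hs c g =>
  induction y using induction_smul with
  | h0 => simp
  | hadd x x' hx hx' => simp only [map_add, hx, hx']
  | hs d f =>
  rw [LinearMap.map_smul, LinearMap.map_smul, LinearMap.smul_apply, mul_pure, spec_smul, spec_smul,
    spec_mulPure, spec_smul, spec_smul, LinearMap.map_smul, LinearMap.map_smul,
    LinearMap.smul_apply, spec_pure, spec_pure, PongOne.mul_of]

open Classical in
theorem diffPure_eq (hm : 1 < m) (f : LiftedPartialPerm m k) :
    letI : Fintype f.Crossing := @Fintype.ofFinite _ (finite_crossing hm f)
    (diffPure f : Pong m k) = ∑ c : f.Crossing, if (f.resolve c).cross + 1 = f.cross then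
      pure (f.resolve c) (exponentOf fun i => f.weight i - (f.resolve c).weight i) else 0 := by
  let : Fintype f.Crossing := @Fintype.ofFinite _ (finite_crossing hm f)
  rw [diffPure, finsum_eq_sum_of_fintype]
  exact Finset.sum_congr rfl fun c _ => finsum_eq_if

open Classical in
theorem spec_diffPure (hm : 1 < m) (f : LiftedPartialPerm m k) :
    spec m k (diffPure f) = PongOne.diffOf f := by
  let : Fintype f.Crossing := @Fintype.ofFinite _ (finite_crossing hm f)
  rw [diffPure_eq hm, map_sum, PongOne.diffOf, ← Crossing.range_toClass,
    finsum_mem_range (Crossing.toClass_injective f), finsum_eq_sum_of_fintype]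
  refine Finset.sum_congr rfl fun c _ => ?_
  rw [res_toClass]
  split_ifs
  · exact spec_pure _ _
  · exact map_zero _

theorem spec_diff (hm : 1 < m) (x : Pong m k) :
    spec m k (diff m k x) = PongOne.diff m k (spec m k x) := by
  induction x using induction_smul with
  | h0 => simp
  | hadd x x' hx hx' => simp only [map_add, hx, hx']
  | hs c g =>
  rw [LinearMap.map_smul, diff_pure_zero, spec_smul, spec_diffPure hm, spec_smul, LinearMap.map_smul, spec_pure,
    PongOne.diff_of]

/-- The elements of weight `w`. -/
def weightHom (m k : ℕ) (w : Fin m → ℚ) : AddSubgroup (Pong m k) :=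
  AddSubgroup.closure {z | ∃ (f : LiftedPartialPerm m k) (a : Fin m →₀ ℕ),
    (∀ i, f.weight i + a i = w i) ∧ z = pure f a}

theorem pure_mem_weightHom {f : LiftedPartialPerm m k} {a : Fin m →₀ ℕ} {w : Fin m → ℚ}
    (h : ∀ i, f.weight i + a i = w i) : pure f a ∈ weightHom m k w :=
  AddSubgroup.subset_closure ⟨f, a, h, rfl⟩

theorem weightHom_induction {w : Fin m → ℚ} {p : Pong m k → Prop} (h0 : p 0)
    (hadd : ∀ x y, p x → p y → p (x + y))
    (hs : ∀ f a, (∀ i, f.weight i + a i = w i) → p (pure f a)) (z : Pong m k)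
    (hz : z ∈ weightHom m k w) : p z := by
  have hneg : ∀ x : Pong m k, -x = x := fun x => by
    rw [neg_eq_iff_add_eq_zero]
    refine Finsupp.ext fun f => ?_
    exact CharTwo.add_self_eq_zero (R := Base m) _
  induction hz using AddSubgroup.closure_induction with
  | mem x hx => obtain ⟨f, a, h, rfl⟩ := hx; exact hs f a h
  | zero => exact h0
  | add x y _ _ hx hy => exact hadd x y hx hy
  | neg x _ hx => rwa [hneg]

/-- The coefficient of `v^a f`. -/
def coeff (f : LiftedPartialPerm m k) (a : Fin m →₀ ℕ) : Pong m k →+ ZMod 2 :=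
  (MvPolynomial.coeffAddMonoidHom a).comp
    (Finsupp.applyAddHom f : (LiftedPartialPerm m k →₀ Base m) →+ Base m)

open Classical in
theorem coeff_pure (f g : LiftedPartialPerm m k) (a b : Fin m →₀ ℕ) :
    coeff f a (pure g b : Pong m k) = if g = f ∧ b = a then 1 else 0 := by
  change MvPolynomial.coeff a ((Finsupp.single g (MvPolynomial.monomial b 1) :
    LiftedPartialPerm m k →₀ Base m) f) = _
  rw [Finsupp.single_apply]
  by_cases h : g = f
  · simp [h, MvPolynomial.coeff_monomial]
  · simp [h]

theorem ext_coeff {x y : Pong m k} (h : ∀ f a, coeff f a x = coeff f a y) : x = y :=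
  Finsupp.ext (M := Base m) fun f => MvPolynomial.ext _ _ fun a => h f a

theorem coeff_eq_zero {w : Fin m → ℚ} {z : Pong m k} (hz : z ∈ weightHom m k w)
    {f : LiftedPartialPerm m k} {a : Fin m →₀ ℕ} (h : ¬ ∀ i, f.weight i + a i = w i) :
    coeff f a z = 0 := by
  classical
  refine weightHom_induction (p := fun z => coeff f a z = 0) (map_zero _)
    (fun x y hx hy => by rw [map_add, hx, hy, add_zero]) (fun g b hg => ?_) z hz
  rw [coeff_pure, if_neg]
  rintro ⟨rfl, rfl⟩
  exact h hg

theorem coeff_eq_spec {w : Fin m → ℚ} {z : Pong m k} (hz : z ∈ weightHom m k w)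
    {f : LiftedPartialPerm m k} {a : Fin m →₀ ℕ} (h : ∀ i, f.weight i + a i = w i) :
    coeff f a z = spec m k z f := by
  classical
  refine weightHom_induction (p := fun z => coeff f a z = spec m k z f) (by simp)
    (fun x y hx hy => by rw [map_add, hx, hy, map_add, Finsupp.add_apply]) (fun g b hg => ?_) z hz
  rw [coeff_pure, spec_pure, Finsupp.single_apply]
  refine if_congr ⟨fun h => h.1, fun hgf => ⟨hgf, ?_⟩⟩ rfl rfl
  subst hgf
  ext i
  have h1 := h i
  have h2 := hg i
  have : (b i : ℚ) = a i := by linarith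
  exact_mod_cast this

/-- Homogeneous elements are determined by their specialization. -/
theorem eq_of_spec_eq {w : Fin m → ℚ} {x y : Pong m k} (hx : x ∈ weightHom m k w)
    (hy : y ∈ weightHom m k w) (h : spec m k x = spec m k y) : x = y := by
  refine ext_coeff fun f a => ?_
  by_cases hf : ∀ i, f.weight i + a i = w i
  · rw [coeff_eq_spec hx hf, coeff_eq_spec hy hf, h]
  · rw [coeff_eq_zero hx hf, coeff_eq_zero hy hf]

theorem smul_mem_weightHom {w w' : Fin m → ℚ} {z : Pong m k} (hz : z ∈ weightHom m k w)
    {a : Fin m →₀ ℕ} (h : ∀ i, w i + a i = w' i) :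
    (MvPolynomial.monomial a (1 : ZMod 2)) • z ∈ weightHom m k w' := by
  refine weightHom_induction (p := fun z => (MvPolynomial.monomial a (1 : ZMod 2)) • z
    ∈ weightHom m k w') (by rw [smul_zero]; exact zero_mem _)
    (fun x y hx hy => by rw [smul_add]; exact add_mem hx hy) (fun f b hf => ?_) z hz
  rw [smul_pure]
  refine pure_mem_weightHom fun i => ?_
  rw [Finsupp.add_apply, ← h, ← hf]
  push_cast; ring

theorem mulPure_mem (hm : 1 < m) (g f : LiftedPartialPerm m k) :
    mulPure g f ∈ weightHom m k fun i => f.weight i + g.weight i := by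
  unfold mulPure
  split_ifs with h
  · refine pure_mem_weightHom fun i => ?_
    have := weight_comp hm h i
    rw [exponentOf_apply (i := i) (n := {x | x ∈ f.sepSet (i : ℕ) ∧ ∃ b, f.toFun x = some b ∧
      b ∈ g.sepSet (i : ℕ)}.ncard) (by rw [this]; ring), this]
  · exact zero_mem _
  · exact zero_mem _

theorem diffPure_mem (hm : 1 < m) (f : LiftedPartialPerm m k) :
    diffPure f ∈ weightHom m k f.weight := by
  classical
  rw [diffPure_eq hm]
  refine sum_mem fun c _ => ?_
  split_ifs
  · refine pure_mem_weightHom fun i => ?_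
    have hc : c.toClass ∈ f.crossSet := by rw [← Crossing.range_toClass]; exact ⟨c, rfl⟩
    obtain ⟨n, hn⟩ := weight_res hm hc i
    rw [res_toClass] at hn
    rw [exponentOf_apply (i := i) (n := n) (by rw [hn]; ring), hn]
  · exact zero_mem _

theorem diff_mem_weightHom (hm : 1 < m) {w : Fin m → ℚ} {z : Pong m k}
    (hz : z ∈ weightHom m k w) : diff m k z ∈ weightHom m k w := by
  refine weightHom_induction (p := fun z => diff m k z ∈ weightHom m k w)
    (by rw [map_zero]; exact zero_mem _)
    (fun x y hx hy => by rw [map_add]; exact add_mem hx hy) (fun f b hf => ?_) z hz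
  rw [pure_eq_smul, map_smul, diff_pure_zero]
  exact smul_mem_weightHom (diffPure_mem hm f) hf

theorem mul_mem_weightHom (hm : 1 < m) {w w' w'' : Fin m → ℚ} {x y : Pong m k}
    (hx : x ∈ weightHom m k w) (hy : y ∈ weightHom m k w') (h : ∀ i, w i + w' i = w'' i) :
    mul m k x y ∈ weightHom m k w'' := by
  refine weightHom_induction (p := fun x => mul m k x y ∈ weightHom m k w'')
    (by rw [map_zero]; exact zero_mem _)
    (fun x y hx hy => by rw [map_add]; exact add_mem hx hy) (fun g a hg => ?_) x hx
  refine weightHom_induction (p := fun y => mul m k (pure g a) y ∈ weightHom m k w'')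
    (by rw [map_zero]; exact zero_mem _)
    (fun x y hx hy => by rw [map_add]; exact add_mem hx hy) (fun f b hf => ?_) y hy
  rw [pure_eq_smul g, pure_eq_smul f, map_smul, map_smul, LinearMap.smul_apply, mul_pure]
  refine smul_mem_weightHom (w := fun i => f.weight i + g.weight i + a i)
    (smul_mem_weightHom (mulPure_mem hm g f) fun i => rfl) fun i => ?_
  rw [← h, ← hg, ← hf]
  ring

theorem pure_mem_self (f : LiftedPartialPerm m k) : pure f 0 ∈ weightHom m k f.weight :=
  pure_mem_weightHom fun i => by simp

/-! ### The laws of a differential algebra -/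

theorem mulPure_of_isId_left (hm : 1 < m) {e f : LiftedPartialPerm m k} (he : e.IsId)
    (h : e.dom = f.im) : mulPure e f = pure f 0 := by
  have h' := composable_iff.2 h
  rw [mulPure, dif_pos h', he.comp_left h', he.cross hm, zero_add, if_pos rfl]
  congr 1
  ext i
  rw [exponentOf_apply (n := 0)]
  · rfl
  · rw [he.weight]; simp

theorem mulPure_of_isId_right (hm : 1 < m) {e f : LiftedPartialPerm m k} (he : e.IsId)
    (h : e.dom = f.dom) : mulPure f e = pure f 0 := by
  have h' : f.Composable e := composable_iff.2 (by rw [he.im, h])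
  rw [mulPure, dif_pos h', he.comp_right h', he.cross hm, add_zero, if_pos rfl]
  congr 1
  ext i
  rw [exponentOf_apply (n := 0)]
  · rfl
  · rw [he.weight]; simp

theorem finite_isId (hm : 1 < m) : {f : LiftedPartialPerm m k | f.IsId}.Finite := by
  refine (finite_of_values hm (fun l => {none, some l}) fun l => by simp).subset ?_
  intro f hf l _ _
  simpa using hf l

theorem one_eq (hm : 1 < m) : (1 : Pong m k) = ∑ f ∈ (finite_isId hm).toFinset, pure f 0 := by
  refine Eq.trans (b := ∑ᶠ (f : LiftedPartialPerm m k) (_ : f ∈ {f | f.IsId}), pure f 0) rfl ?_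
  rw [finsum_mem_eq_finite_toFinset_sum _ (finite_isId hm)]

theorem one_mul_pure (hm : 1 < m) (f : LiftedPartialPerm m k) :
    mul m k 1 (pure f 0) = pure f 0 := by
  have hid := isId_idOn (T := f.im) (hT := f.invariant_im) (hk := f.card_orbits_im)
  have hdom := dom_idOn (T := f.im) (hT := f.invariant_im) (hk := f.card_orbits_im)
  rw [one_eq hm, map_sum, LinearMap.sum_apply, Finset.sum_eq_single (idOn f.im f.invariant_im f.card_orbits_im)]
  · rw [mul_pure, mulPure_of_isId_left hm hid hdom]
  · intro e he hne
    have he : e.IsId := by simpa using he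
    rw [mul_pure, mulPure, dif_neg]
    intro hc
    exact hne (he.ext hid ((composable_iff.1 hc).trans hdom.symm))
  · intro h
    exact absurd (by simpa using hid) h

theorem mul_one_pure (hm : 1 < m) (f : LiftedPartialPerm m k) :
    mul m k (pure f 0) 1 = pure f 0 := by
  have hid := isId_idOn (T := f.dom) (hT := f.invariant_dom) (hk := f.card_orbits_dom)
  have hdom := dom_idOn (T := f.dom) (hT := f.invariant_dom) (hk := f.card_orbits_dom)
  rw [one_eq hm, map_sum, Finset.sum_eq_single (idOn f.dom f.invariant_dom f.card_orbits_dom)]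
  · rw [mul_pure, mulPure_of_isId_right hm hid hdom]
  · intro e he hne
    have he : e.IsId := by simpa using he
    rw [mul_pure, mulPure, dif_neg]
    intro hc
    exact hne (he.ext hid (he.im.symm.trans ((composable_iff.1 hc).symm.trans hdom.symm)))
  · intro h
    exact absurd (by simpa using hid) h

theorem mul_assoc' (hm : 1 < m) (x y z : Pong m k) :
    mul m k (mul m k x y) z = mul m k x (mul m k y z) := by
  induction x using induction_smul with
  | h0 => simp
  | hadd x x' hx hx' => simp only [map_add, LinearMap.add_apply, hx, hx']
  | hs c h =>
  induction y using induction_smul with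
  | h0 => simp
  | hadd x x' hx hx' => simp only [map_add, LinearMap.add_apply, hx, hx']
  | hs d g =>
  induction z using induction_smul with
  | h0 => simp
  | hadd x x' hx hx' => simp only [map_add, hx, hx']
  | hs e f =>
  have key : mul m k (mul m k (pure h 0) (pure g 0)) (pure f 0)
      = mul m k (pure h 0) (mul m k (pure g 0) (pure f 0)) := by
    refine eq_of_spec_eq (w := fun i => h.weight i + g.weight i + f.weight i)
      (mul_mem_weightHom hm (mul_mem_weightHom hm (pure_mem_self h) (pure_mem_self g)
        fun i => rfl) (pure_mem_self f) fun i => rfl)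
      (mul_mem_weightHom hm (pure_mem_self h) (mul_mem_weightHom hm (pure_mem_self g)
        (pure_mem_self f) fun i => rfl) fun i => by ring) ?_
    simp only [spec_mul]
    exact PongOne.mul_assoc hm _ _ _
  simp only [map_smul, LinearMap.smul_apply, key]

theorem isDGAlgebra (hm : 1 < m) : IsDGAlgebra (mul m k) 1 (diff m k) where
  mul_assoc := mul_assoc' hm
  one_mul z := by
    induction z using induction_smul with
    | h0 => simp
    | hadd x y hx hy => rw [map_add, hx, hy]
    | hs c f => rw [map_smul, one_mul_pure hm]
  mul_one z := by
    induction z using induction_smul with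
    | h0 => simp
    | hadd x y hx hy => rw [map_add, LinearMap.add_apply, hx, hy]
    | hs c f => rw [map_smul, LinearMap.smul_apply, mul_one_pure hm]
  d_d z := by
    induction z using induction_smul with
    | h0 => simp
    | hadd x y hx hy => rw [map_add, map_add, hx, hy, add_zero]
    | hs c f =>
      have : diff m k (diff m k (pure f 0)) = 0 := by
        refine eq_of_spec_eq (w := f.weight) (diff_mem_weightHom hm (diff_mem_weightHom hm
          (pure_mem_self f))) (zero_mem _) ?_
        rw [spec_diff hm, spec_diff hm, PongOne.diff_diff hm, map_zero]
      rw [map_smul, map_smul, this, smul_zero]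
  leibniz x y := by
    induction x using induction_smul with
    | h0 => simp
    | hadd x x' hx hx' =>
      simp only [map_add, LinearMap.add_apply, hx, hx']
      abel
    | hs c g =>
    induction y using induction_smul with
    | h0 => simp
    | hadd x x' hx hx' =>
      simp only [map_add, hx, hx']
      abel
    | hs d f =>
    have key : diff m k (mul m k (pure g 0) (pure f 0)) = mul m k (diff m k (pure g 0)) (pure f 0)
        + mul m k (pure g 0) (diff m k (pure f 0)) := by
      refine eq_of_spec_eq (w := fun i => g.weight i + f.weight i)
        (diff_mem_weightHom hm (mul_mem_weightHom hm (pure_mem_self g) (pure_mem_self f)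
          fun i => rfl))
        (add_mem (mul_mem_weightHom hm (diff_mem_weightHom hm (pure_mem_self g))
          (pure_mem_self f) fun i => rfl) (mul_mem_weightHom hm (pure_mem_self g)
          (diff_mem_weightHom hm (pure_mem_self f)) fun i => rfl)) ?_
      simp only [spec_mul, spec_diff hm, map_add]
      exact PongOne.leibniz hm _ _
    simp only [map_smul, LinearMap.smul_apply, key, smul_add]

end Pong

open LiftedPartialPerm

namespace PongOne

variable {m k : ℕ}

/-! ### Acyclic sets of basis elements -/

/-- The set `X` of basis elements is closed under resolutions. -/
def Lower (X : Set (LiftedPartialPerm m k)) : Prop := ∀ f ∈ X, ∀ e ∈ f.crossSet, f.res e ∈ X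

/-- All cycles supported on `X` are boundaries of elements supported on `X`. -/
def Acyclic (X : Set (LiftedPartialPerm m k)) : Prop :=
  ∀ z ∈ Supp X, diff m k z = 0 → ∃ y ∈ Supp X, diff m k y = z

theorem acyclic_empty : Acyclic (∅ : Set (LiftedPartialPerm m k)) := by
  intro z hz _
  refine ⟨0, zero_mem _, ?_⟩
  rw [Supp, Finsupp.supported_empty, Submodule.mem_bot] at hz
  rw [hz, map_zero]

theorem lift_mem_supp {a b : ℤ} {X Y : Set (LiftedPartialPerm m k)}
    (h : ∀ f ∈ X, f.post a b ∈ Y) : ∀ z ∈ Supp X, lift m k a b z ∈ Supp Y := by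
  classical
  refine supp_induction (by simp) (fun x y hx hy => by rw [map_add]; exact add_mem hx hy) ?_
  intro f hf
  rw [lift_of]
  split_ifs
  · exact of_mem_supp (h f hf)
  · exact zero_mem _

theorem supp_inter {X Y : Set (LiftedPartialPerm m k)} {z : PongOne m k} (hX : z ∈ Supp X)
    (hY : z ∈ Supp Y) : z ∈ Supp (X ∩ Y) :=
  fun _ hf => ⟨hX hf, hY hf⟩

/-- Left multiplication by a simple exchange contracts a layer that is stable under it. -/
theorem acyclic_of_layer (hm : 1 < m) {X Y : Set (LiftedPartialPerm m k)} {T : Set ℤ} {a b : ℤ}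
    (hT : Invariant m T) (hgap : IsGap T a b) (hX : ∀ f ∈ X, f.im = T) (hYX : Y ⊆ X)
    (lowX : Lower X) (lowY : Lower Y)
    (hst : ∀ f ∈ X, f ∉ Y → f.post a b ∈ X ∧ f.post a b ∉ Y) (hY : Acyclic Y) : Acyclic X := by
  classical
  have hab := hgap.nonTranslate hm hT
  intro z hz hdz
  set z1 := z.filter (fun f => f ∉ Y) with hz1
  set z2 := z.filter (fun f => ¬ f ∉ Y) with hz2
  have hsum : z1 + z2 = z := Finsupp.filter_add_filter_not _ _
  have h1 : z1 ∈ Supp (X \ Y) := by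
    intro f hf
    have hf' : f ∈ z1.support := hf
    rw [hz1, Finsupp.support_filter, Finset.mem_filter] at hf'
    exact ⟨hz hf'.1, hf'.2⟩
  have h2 : z2 ∈ Supp Y := by
    intro f hf
    have hf' : f ∈ z2.support := hf
    rw [hz2, Finsupp.support_filter, Finset.mem_filter] at hf'
    exact not_not.1 hf'.2
  have h1X : z1 ∈ Supp X := Finsupp.supported_mono Set.sdiff_subset h1
  have hd12 : diff m k z1 = diff m k z2 := by
    have : diff m k z1 + diff m k z2 = 0 := by rw [← map_add, hsum, hdz]
    rw [← add_zero (diff m k z1), ← add_self (diff m k z2), ← add_assoc, this, zero_add]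
  have hd1 : diff m k z1 ∈ Supp Y := hd12 ▸ diff_mem_supp hm lowY _ h2
  set y := lift m k a b z1
  have hy : y ∈ Supp X := lift_mem_supp (fun f hf => (hst f hf.1 hf.2).1) _ h1
  have hdy : diff m k y = z1 + lift m k a b (diff m k z1) :=
    diff_lift hm hgap (Finsupp.supported_mono (fun f hf => hX f hf) h1X)
  set u := lift m k a b (diff m k z1) with hu
  have hu1 : u ∈ Supp {f | f ∉ X \ Y} := by
    refine lift_mem_supp (fun f hf hc => ?_) _ hd1
    have := hst _ hc.1 hc.2
    rw [post_post f hab] at this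
    exact this.2 hf
  have hu2 : u ∈ Supp X := by
    have : u = diff m k y + z1 := by
      rw [hdy, add_comm z1, add_assoc, add_self, add_zero]
    rw [this]
    exact add_mem (diff_mem_supp hm lowX _ hy) h1X
  have hu3 : u ∈ Supp Y := by
    refine Finsupp.supported_mono ?_ (supp_inter hu2 hu1)
    rintro f ⟨hf, hf'⟩
    by_contra hc
    exact hf' ⟨hf, hc⟩
  have hz' : z + diff m k y = z2 + u := by
    rw [hdy, ← hsum]
    have := add_self z1
    calc z1 + z2 + (z1 + u) = (z1 + z1) + (z2 + u) := by abel
      _ = z2 + u := by rw [this, zero_add]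
  obtain ⟨y', hy', hdy'⟩ := hY (z2 + u) (add_mem h2 hu3) (by
    rw [← hz', map_add, hdz, diff_diff hm, add_zero])
  refine ⟨y + y', add_mem hy (Finsupp.supported_mono hYX hy'), ?_⟩
  rw [map_add, hdy', ← hz', add_comm z, ← add_assoc, add_self, zero_add]

end PongOne

namespace LiftedPartialPerm

variable {m k : ℕ}

/-! ### Simple exchanges and ranks -/

theorem exists_gap (hm : 1 < m) {T : Set ℤ} (hT : Invariant m T) (hne : T.Nonempty) (p : ℤ) :
    ∃ a b, IsGap T a b ∧ a ≤ p ∧ p < b := by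
  obtain ⟨t, ht⟩ := hne
  have hN : (2 : ℤ) ≤ 2 * m - 2 := by omega
  have hmem : ∀ n : ℤ, t + n * (2 * m - 2) ∈ T := fun n => (hT _ (translation_mem m n) t).2 ht
  have hlow : ∃ x, x ∈ T ∧ x ≤ p := by
    refine ⟨_, hmem (-|p - t|), ?_⟩
    have h1 := neg_abs_le (p - t)
    have h2 := abs_nonneg (p - t)
    nlinarith
  have hhigh : ∃ x, x ∈ T ∧ p < x := by
    refine ⟨_, hmem (|p - t| + 1), ?_⟩
    have h1 := le_abs_self (p - t)
    have h2 := abs_nonneg (p - t)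
    nlinarith
  obtain ⟨x, hx, hxp⟩ := hlow
  obtain ⟨x', hx', hxp'⟩ := hhigh
  obtain ⟨a, ⟨haT, hap⟩, hamax⟩ := Int.exists_greatest_of_bdd (P := fun z => z ∈ T ∧ z ≤ p)
    ⟨p, fun z hz => hz.2⟩ ⟨x, hx, hxp⟩
  obtain ⟨b, ⟨hbT, hpb⟩, hbmin⟩ := Int.exists_least_of_bdd (P := fun z => z ∈ T ∧ p < z)
    ⟨p, fun z hz => hz.2.le⟩ ⟨x', hx', hxp'⟩
  refine ⟨a, b, ⟨by omega, haT, hbT, fun y hy hy' hyT => ?_⟩, hap, hpb⟩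
  by_cases h : y ≤ p
  · have := hamax y ⟨hyT, h⟩; omega
  · have := hbmin y ⟨hyT, by omega⟩; omega

theorem lev_eq_of_forall_notMem {T : Set ℤ} {p q : ℤ} (h : p ≤ q)
    (hn : ∀ t ∈ T, p < t → q < t) : lev T q = lev T p := by
  unfold lev
  congr 2
  ext x
  simp only [Set.mem_inter_iff, Set.mem_Icc]
  constructor
  · rintro ⟨hx, h1, h2⟩
    refine ⟨hx, h1, ?_⟩
    by_contra hc
    have := hn x hx (by omega)
    omega
  · rintro ⟨hx, h1, h2⟩
    exact ⟨hx, h1, by omega⟩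

/-- A cut that lies in an image of the gap at `p` has the level of `p`. -/
theorem lev_eq_of_between (hm : 1 < m) {T : Set ℤ} (hT : Invariant m T) {a b p y : ℤ}
    (h : IsGap T a b) (hap : a ≤ p) (hpb : p < b) (hp : 0 ≤ p) (hpm : p ≤ m - 1) (hy : 0 ≤ y)
    (hym : y ≤ m - 1) {g : Equiv.Perm ℤ} (hg : g ∈ reflGroup m)
    (hb : g a ≤ y ∧ y < g b ∨ g b ≤ y ∧ y < g a) : lev T y = lev T p := by
  have hN : (2 : ℤ) ≤ 2 * m - 2 := by omega
  have hb1 := (hT _ (reflection_mem m 0) b).2 h.right_mem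
  have ha1 := (hT _ (reflection_mem m 1) a).2 h.left_mem
  simp only [Equiv.subLeft_apply] at ha1 hb1
  have hb2 := fun h1 h2 => h.not_mem _ h1 h2 hb1
  have ha2 := fun h1 h2 => h.not_mem _ h1 h2 ha1
  have hab := h.lt
  have key : (∃ n : ℤ, a + n * (2 * m - 2) ≤ y ∧ y < b + n * (2 * m - 2)) ∨
      ∃ n : ℤ, 1 - b + n * (2 * m - 2) ≤ y ∧ y < 1 - a + n * (2 * m - 2) := by
    rcases reflGroup_form hg with ⟨n, hn⟩ | ⟨n, hn⟩
    · rw [hn, hn] at hb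
      exact Or.inl ⟨n, by omega⟩
    · rw [hn, hn] at hb
      exact Or.inr ⟨n, by omega⟩
  have tri : ∀ n : ℤ, n = 0 ∨ 2 * (m : ℤ) - 2 ≤ n * (2 * m - 2) ∨
      n * (2 * (m : ℤ) - 2) ≤ -(2 * m - 2) := by
    intro n
    rcases lt_trichotomy n 0 with hn | hn | hn
    · exact Or.inr (Or.inr (by nlinarith))
    · exact Or.inl hn
    · exact Or.inr (Or.inl (by nlinarith))
  rcases le_total p y with hpy | hpy
  · refine lev_eq_of_forall_notMem hpy fun t ht hpt => ?_
    by_contra hty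
    have hbt : b ≤ t := by
      by_contra hc
      exact h.not_mem t (by omega) (by omega) ht
    have h3 : 1 - b ≤ a := by
      by_contra hc
      exact hb2 (by omega) (by omega)
    rcases key with ⟨n, h1, h2⟩ | ⟨n, h1, h2⟩ <;> rcases tri n with rfl | h' | h' <;> omega
  · refine (lev_eq_of_forall_notMem hpy fun t ht hpt => ?_).symm
    by_contra hty
    have hat : t ≤ a := by
      by_contra hc
      exact h.not_mem t (by omega) (by omega) ht
    have h3 : b ≤ 2 * m - 1 - a := by
      by_contra hc
      exact ha2 (by omega) (by omega)
    rcases key with ⟨n, h1, h2⟩ | ⟨n, h1, h2⟩ <;> rcases tri n with rfl | h' | h' <;> omega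

/-- A simple exchange changes only ranks at the level of its gap. -/
theorem up_post_of_lev_ne (hm : 1 < m) {f : LiftedPartialPerm m k} {a b p y : ℤ}
    (h : IsGap f.im a b) (hap : a ≤ p) (hpb : p < b) (hp : 0 ≤ p) (hpm : p ≤ m - 1) (hy : 0 ≤ y)
    (hym : y ≤ m - 1) (hne : lev f.im y ≠ lev f.im p) (x : ℤ) :
    (f.post a b).up x y = f.up x y := by
  have hab := h.nonTranslate hm f.invariant_im
  unfold up
  congr 2
  ext i
  simp only [upSet, Set.mem_ofPred_eq]
  refine and_congr_right fun _ => ?_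
  have key : ∀ c, y < orbitSwap m a b c ↔ y < c := by
    intro c
    rcases orbitSwap_spec hab c with ⟨g, hg, rfl, e⟩ | ⟨g, hg, rfl, e⟩ | ⟨-, -, e⟩
    · have := mt (lev_eq_of_between hm f.invariant_im h hap hpb hp hpm hy hym hg) hne
      rw [e]; omega
    · have := mt (lev_eq_of_between hm f.invariant_im h hap hpb hp hpm hy hym hg) hne
      rw [e]; omega
    · rw [e]
  constructor
  · rintro ⟨c, hc, hc'⟩
    exact ⟨_, (post_eq_some hab).1 hc, (key c).2 hc'⟩
  · rintro ⟨c, hc, hc'⟩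
    exact ⟨_, post_some hc, (key c).2 hc'⟩

/-- A simple exchange of strands that start beyond `x` does not change ranks at `x`. -/
theorem up_post_of_lt (hm : 1 < m) {f : LiftedPartialPerm m k} {a b i j x y : ℤ}
    (h : IsGap f.im a b) (hay : a ≤ y) (hyb : y < b) (hi : f.toFun i = some a)
    (hj : f.toFun j = some b) (hxi : x < i) (hxj : x < j) :
    (f.post a b).up x y = f.up x y := by
  have hab := h.nonTranslate hm f.invariant_im
  unfold up
  congr 2
  ext l
  simp only [upSet, Set.mem_ofPred_eq]
  refine and_congr_right fun hl => ?_
  have key : ∀ c, f.toFun l = some c → (y < orbitSwap m a b c ↔ y < c) := by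
    intro c hc
    have hca : c ≠ a := by
      rintro rfl
      have := f.some_inj hc hi
      omega
    have hcb : c ≠ b := by
      rintro rfl
      have := f.some_inj hc hj
      omega
    have h1 := h.not_between hm f.invariant_im (x := c) h.left_mem
    have h2 := h.not_between hm f.invariant_im (x := c) h.right_mem
    have hc2 := h.orbitSwap_mem hm f.invariant_im (x := c) ⟨l, hc⟩
    have h3 : ¬ (a < c ∧ c < b) := fun hh => h.not_mem c hh.1 hh.2 ⟨l, hc⟩
    have h4 : ¬ (a < orbitSwap m a b c ∧ orbitSwap m a b c < b) :=
      fun hh => h.not_mem _ hh.1 hh.2 hc2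
    have h5 : orbitSwap m a b c ≠ a := fun hh => hcb (by
      rw [← orbitSwap_orbitSwap hab c, hh, orbitSwap_self_left])
    have h6 : orbitSwap m a b c ≠ b := fun hh => hca (by
      rw [← orbitSwap_orbitSwap hab c, hh, orbitSwap_self_right hab])
    by_contra hne
    omega
  constructor
  · rintro ⟨c, hc, hc'⟩
    have hc := (post_eq_some hab).1 hc
    refine ⟨_, hc, (key _ hc).1 ?_⟩
    rwa [orbitSwap_orbitSwap hab]
  · rintro ⟨c, hc, hc'⟩
    exact ⟨_, post_some hc, (key c hc).2 hc'⟩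

end LiftedPartialPerm

open LiftedPartialPerm

/-! ### Representatives of orbits and levels -/

section Levels

variable {m : ℕ}

theorem mul_period_cases (hm : 1 < m) (n : ℤ) : n = 0 ∨
    0 < n ∧ 2 * (m : ℤ) - 2 ≤ n * (2 * m - 2) ∨ n < 0 ∧ n * (2 * (m : ℤ) - 2) ≤ -(2 * m - 2) := by
  have hN : (2 : ℤ) ≤ 2 * m - 2 := by omega
  rcases lt_trichotomy n 0 with hn | hn | hn
  · exact Or.inr (Or.inr ⟨hn, by nlinarith⟩)
  · exact Or.inl hn
  · exact Or.inr (Or.inl ⟨hn, by nlinarith⟩)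

theorem orb_inj (hm : 1 < m) {i j : ℤ} (hi : 1 ≤ i) (him : i ≤ m - 1) (hj : 1 ≤ j)
    (hjm : j ≤ m - 1) (h : orb m i = orb m j) : i = j := by
  obtain ⟨n, hn⟩ := orb_eq_iff_exists.1 h
  rcases mul_period_cases hm n with rfl | h' | h' <;> omega

theorem orb_injOn (hm : 1 < m) : Set.InjOn (orb m) (Set.Icc (1 : ℤ) (m - 1)) :=
  fun _ hi _ hj h => orb_inj hm hi.1 hi.2 hj.1 hj.2 h

theorem orb_image_inter (hm : 1 < m) {T : Set ℤ} (hT : Invariant m T) :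
    orb m '' (T ∩ Set.Icc 1 (m - 1)) = orb m '' T := by
  refine Set.Subset.antisymm (Set.image_mono Set.inter_subset_left) ?_
  rintro _ ⟨i, hi, rfl⟩
  obtain ⟨g, hg, s, hs, hs', rfl⟩ := exists_rep hm i
  exact ⟨s, ⟨(hT g hg s).1 hi, hs, hs'⟩, (orb_apply hg s).symm⟩

theorem lev_last (hm : 1 < m) {T : Set ℤ} (hT : Invariant m T) :
    lev T (m - 1) = (orb m '' T).ncard := by
  rw [← orb_image_inter hm hT,
    Set.InjOn.ncard_image ((orb_injOn hm).mono Set.inter_subset_right), lev]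

theorem lt_of_lev_lt {S : Set ℤ} {p q : ℤ} (h : lev S p < lev S q) : p < q := by
  by_contra hc
  have := lev_mono S (not_lt.1 hc)
  omega

theorem exists_lev_eq (T : Set ℤ) {p i : ℤ} (hp : 0 ≤ p) (hi : 0 ≤ i) (hip : i ≤ lev T p) :
    ∃ q, 0 ≤ q ∧ q ≤ p ∧ lev T q = i := by
  classical
  induction p, hp using Int.leInduction with
  | base =>
    rw [lev_zero] at hip
    exact ⟨0, le_rfl, le_rfl, by rw [lev_zero]; omega⟩
  | succ p hp ih =>
    by_cases h : i ≤ lev T p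
    · obtain ⟨q, h1, h2, h3⟩ := ih h
      exact ⟨q, h1, by omega, h3⟩
    · refine ⟨p + 1, by omega, le_rfl, ?_⟩
      rw [lev_succ _ hp] at hip ⊢
      split_ifs at hip ⊢ <;> omega

theorem exists_mem_of_lev_eq_add_one {S : Set ℤ} {p q : ℤ} (hp : 0 ≤ p)
    (h : lev S q = lev S p + 1) :
    ∃ s ∈ S, p < s ∧ s ≤ q ∧ ∀ x ∈ S, p < x → x ≤ q → x = s := by
  have hpq : p < q := lt_of_lev_lt (S := S) (by omega)
  have hdec : S ∩ Set.Icc 1 q = (S ∩ Set.Icc 1 p) ∪ (S ∩ Set.Ioc p q) := by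
    ext x
    simp only [Set.mem_inter_iff, Set.mem_union, Set.mem_Icc, Set.mem_Ioc]
    constructor
    · rintro ⟨hx, h1, h2⟩
      by_cases hxp : x ≤ p
      · exact Or.inl ⟨hx, h1, hxp⟩
      · exact Or.inr ⟨hx, by omega, h2⟩
    · rintro (⟨hx, h1, h2⟩ | ⟨hx, h1, h2⟩)
      · exact ⟨hx, h1, by omega⟩
      · exact ⟨hx, by omega, h2⟩
  have hcard : (S ∩ Set.Ioc p q).ncard = 1 := by
    unfold lev at h
    rw [hdec, Set.ncard_union_eq ?_ ((Set.finite_Icc _ _).inter_of_right _)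
      ((Set.finite_Ioc _ _).inter_of_right _)] at h
    · push_cast at h; omega
    · rw [Set.disjoint_left]
      rintro x ⟨-, -, h1⟩ ⟨-, h2, -⟩
      omega
  obtain ⟨s, hs⟩ := Set.ncard_eq_one.1 hcard
  have hmem : s ∈ S ∩ Set.Ioc p q := by rw [hs]; exact rfl
  refine ⟨s, hmem.1, hmem.2.1, hmem.2.2, fun x hx h1 h2 => ?_⟩
  have : x ∈ S ∩ Set.Ioc p q := ⟨hx, h1, h2⟩
  rwa [hs] at this

theorem lev_of_mem {S : Set ℤ} {x : ℤ} (hx : x ∈ S) (h1 : 1 ≤ x) :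
    lev S x = lev S (x - 1) + 1 := by
  classical
  have := lev_succ S (p := x - 1) (by omega)
  rwa [sub_add_cancel, if_pos hx] at this

/-- Elements of a set are determined by their level. -/
theorem eq_of_lev_eq {S : Set ℤ} {x y : ℤ} (hx : x ∈ S) (h1 : 1 ≤ x) (hy : y ∈ S) (h2 : 1 ≤ y)
    (h : lev S x = lev S y) : x = y := by
  have hx' := lev_of_mem hx h1
  have hy' := lev_of_mem hy h2
  rcases lt_trichotomy x y with hlt | rfl | hlt
  · have := lev_mono S (show x ≤ y - 1 by omega); omega
  · rfl
  · have := lev_mono S (show y ≤ x - 1 by omega); omega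

end Levels

namespace LiftedPartialPerm

variable {m k : ℕ}

theorem lev_dom_last (hm : 1 < m) (f : LiftedPartialPerm m k) : lev f.dom (m - 1) = k := by
  rw [lev_last hm f.invariant_dom, f.card_orbits_dom]

theorem lev_im_last (hm : 1 < m) (f : LiftedPartialPerm m k) : lev f.im (m - 1) = k := by
  rw [lev_last hm f.invariant_im, f.card_orbits_im]

theorem ext_of_values (hm : 1 < m) {f f' : LiftedPartialPerm m k}
    (h : ∀ x : ℤ, 1 ≤ x → x ≤ m - 1 → f.toFun x = f'.toFun x) : f = f' := by
  ext1
  funext i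
  obtain ⟨g, hg, s, hs, hs', rfl⟩ := exists_rep hm i
  rw [f.equivariant g hg, f'.equivariant g hg, h s hs hs']

/-- A strand that moves `n` periods to the left contributes `n` to the ranks in the fundamental
domain. -/
theorem le_up_of_translate (hm : 1 < m) {f : LiftedPartialPerm m k} {s t n x y : ℤ}
    (ht : t ≤ m - 1) (hs : 1 ≤ s) (h : f.toFun s = some (t - n * (2 * m - 2)))
    (hx : 0 ≤ x) (hy : y ≤ m - 1) : n ≤ f.up x y := by
  rcases le_total n 0 with hn | hn
  · exact hn.trans (f.up_nonneg x y)
  have hN : (2 : ℤ) ≤ 2 * m - 2 := by omega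
  have hsub : (fun l : ℤ => 1 - s + l * (2 * m - 2)) '' Set.Icc (1 - n) 0 ⊆ f.upSet x y := by
    rintro _ ⟨l, ⟨h1, h2⟩, rfl⟩
    have hl := f.map_some (reflection_mem m l) h
    simp only [Equiv.subLeft_apply] at hl
    have h3 : l * (2 * (m : ℤ) - 2) ≤ 0 := by nlinarith
    have h4 : 1 * (2 * (m : ℤ) - 2) ≤ (l + n) * (2 * m - 2) :=
      mul_le_mul_of_nonneg_right (by omega) (by omega)
    refine ⟨by dsimp only; omega, 1 - t + (l + n) * (2 * m - 2), ?_, by omega⟩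
    dsimp only
    rw [show 1 - s + l * (2 * (m : ℤ) - 2) = 1 + l * (2 * m - 2) - s by ring, hl]
    congr 1
    ring
  have hinj : Function.Injective (fun l : ℤ => 1 - s + l * (2 * (m : ℤ) - 2)) := by
    intro l l' hll
    have : l * (2 * (m : ℤ) - 2) = l' * (2 * m - 2) := by
      dsimp only at hll; linarith
    exact mul_right_cancel₀ (by omega) this
  have := Set.ncard_le_ncard hsub (f.finite_upSet hm x y)
  rw [Set.ncard_image_of_injective _ hinj, ← Finset.coe_Icc, Set.ncard_coe_finset,
    Int.card_Icc] at this
  unfold up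
  omega

/-- All strands move monotonically within the fundamental domain, except for the last one, which
moves `n` periods to the left. -/
def IsCrit (n : ℤ) (f : LiftedPartialPerm m k) : Prop :=
  ∀ x y : ℤ, 1 ≤ x → x ≤ m - 1 → f.toFun x = some y → ∃ t : ℤ, 1 ≤ t ∧ t ≤ m - 1 ∧
    lev f.im t = lev f.dom x ∧ y = t - if lev f.dom x = k then n * (2 * m - 2) else 0

theorem IsCrit.ext (hm : 1 < m) {n : ℤ} {f f' : LiftedPartialPerm m k} (h : f.IsCrit n)
    (h' : f'.IsCrit n) (hd : f.dom = f'.dom) (hi : f.im = f'.im) : f = f' := by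
  refine ext_of_values hm fun x hx hxm => ?_
  have mem : ∀ (f : LiftedPartialPerm m k) t x, f.toFun x = some (t - if lev f.dom x = k then
      n * (2 * m - 2) else 0) → t ∈ f.im := by
    intro f t x hx
    split_ifs at hx
    · refine (f.mem_im_map (translation_mem m (-n))).1 ?_
      refine ⟨x, hx.trans ?_⟩
      simp only [Equiv.coe_addRight]
      congr 1
      ring
    · exact ⟨x, by rw [hx, sub_zero]⟩
  by_cases hdom : x ∈ f.dom
  · obtain ⟨y, hy⟩ := hdom
    have hdom' : x ∈ f'.dom := hd ▸ ⟨y, hy⟩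
    obtain ⟨y', hy'⟩ := hdom'
    obtain ⟨t, h1, -, h3, rfl⟩ := h x y hx hxm hy
    obtain ⟨t', h1', -, h3', rfl⟩ := h' x y' hx hxm hy'
    have ht := mem f t x hy
    have ht' := mem f' t' x hy'
    rw [← hd, ← hi] at h3'
    rw [← hi] at ht'
    obtain rfl := eq_of_lev_eq ht h1 ht' h1' (by omega)
    rw [hy, hy', hd]
  · have hdom' : x ∉ f'.dom := hd ▸ hdom
    have h1 : f.toFun x = none := by
      rw [Option.eq_none_iff_forall_ne_some]
      exact fun a ha => hdom ⟨a, ha⟩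
    have h2 : f'.toFun x = none := by
      rw [Option.eq_none_iff_forall_ne_some]
      exact fun a ha => hdom' ⟨a, ha⟩
    rw [h1, h2]

end LiftedPartialPerm

/-! ### Common cuts of two sets -/

/-- Cuts `p 0 < … < p k` that separate both the elements `s 1 < … < s k` of `S` and the elements
`t 1 < … < t k` of `T`. -/
structure CommonCuts (m k : ℕ) (S T : Set ℤ) (p s t : ℤ → ℤ) : Prop where
  nonneg : ∀ i : ℤ, 0 ≤ i → i ≤ k → 0 ≤ p i
  le_last : ∀ i : ℤ, 0 ≤ i → i ≤ k → p i ≤ m - 1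
  lev_left : ∀ i : ℤ, 0 ≤ i → i ≤ k → lev S (p i) = i
  lev_right : ∀ i : ℤ, 0 ≤ i → i ≤ k → lev T (p i) = i
  left_mem : ∀ i : ℤ, 1 ≤ i → i ≤ k → s i ∈ S ∧ p (i - 1) < s i ∧ s i ≤ p i
  right_mem : ∀ i : ℤ, 1 ≤ i → i ≤ k → t i ∈ T ∧ p (i - 1) < t i ∧ t i ≤ p i
  left_unique : ∀ i : ℤ, 1 ≤ i → i ≤ k → ∀ x ∈ S, p (i - 1) < x → x ≤ p i → x = s i
  right_unique : ∀ i : ℤ, 1 ≤ i → i ≤ k → ∀ x ∈ T, p (i - 1) < x → x ≤ p i → x = t i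

section CommonCuts

variable {m k : ℕ} {S T : Set ℤ}

theorem exists_commonCuts {p : ℤ → ℤ}
    (hp : ∀ i : ℤ, 0 ≤ i → i ≤ k → 0 ≤ p i ∧ p i ≤ m - 1 ∧ lev S (p i) = i ∧ lev T (p i) = i) :
    ∃ s t, CommonCuts m k S T p s t := by
  have h1 : ∀ i : ℤ, 1 ≤ i → i ≤ k → ∃ s ∈ S, p (i - 1) < s ∧ s ≤ p i ∧
      ∀ x ∈ S, p (i - 1) < x → x ≤ p i → x = s := by
    intro i hi hik
    have a := hp i (by omega) hik
    have b := hp (i - 1) (by omega) (by omega)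
    exact exists_mem_of_lev_eq_add_one b.1 (by omega)
  have h2 : ∀ i : ℤ, 1 ≤ i → i ≤ k → ∃ s ∈ T, p (i - 1) < s ∧ s ≤ p i ∧
      ∀ x ∈ T, p (i - 1) < x → x ≤ p i → x = s := by
    intro i hi hik
    have a := hp i (by omega) hik
    have b := hp (i - 1) (by omega) (by omega)
    exact exists_mem_of_lev_eq_add_one b.1 (by omega)
  choose! s hs using h1
  choose! t ht using h2
  exact ⟨s, t, fun i h h' => (hp i h h').1, fun i h h' => (hp i h h').2.1,
    fun i h h' => (hp i h h').2.2.1, fun i h h' => (hp i h h').2.2.2,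
    fun i h h' => ⟨(hs i h h').1, (hs i h h').2.1, (hs i h h').2.2.1⟩,
    fun i h h' => ⟨(ht i h h').1, (ht i h h').2.1, (ht i h h').2.2.1⟩,
    fun i h h' => (hs i h h').2.2.2, fun i h h' => (ht i h h').2.2.2⟩

namespace CommonCuts

variable {p s t : ℤ → ℤ} (c : CommonCuts m k S T p s t)


end CommonCuts
end CommonCuts

open LiftedPartialPerm

namespace CommonCuts

variable {m k : ℕ} {S T : Set ℤ} {p s t : ℤ → ℤ}

theorem mono (c : CommonCuts m k S T p s t) {i j : ℤ} (hi : 0 ≤ i) (hij : i < j) (hj : j ≤ k) :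
    p i < p j :=
  lt_of_lev_lt (S := S) (by
    rw [c.lev_left i hi (by omega), c.lev_left j (by omega) hj]; exact hij)

theorem left_range (c : CommonCuts m k S T p s t) {i : ℤ} (hi : 1 ≤ i) (hk : i ≤ k) :
    1 ≤ s i ∧ s i ≤ m - 1 := by
  have h1 := c.nonneg (i - 1) (by omega) (by omega)
  have h2 := c.le_last i (by omega) hk
  have h3 := c.left_mem i hi hk
  omega

theorem right_range (c : CommonCuts m k S T p s t) {i : ℤ} (hi : 1 ≤ i) (hk : i ≤ k) :
    1 ≤ t i ∧ t i ≤ m - 1 := by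
  have h1 := c.nonneg (i - 1) (by omega) (by omega)
  have h2 := c.le_last i (by omega) hk
  have h3 := c.right_mem i hi hk
  omega

theorem swap (c : CommonCuts m k S T p s t) : CommonCuts m k T S p t s :=
  ⟨c.nonneg, c.le_last, c.lev_right, c.lev_left, c.right_mem, c.left_mem, c.right_unique,
    c.left_unique⟩

theorem lev_left_eq (c : CommonCuts m k S T p s t) {i : ℤ} (hi : 1 ≤ i) (hk : i ≤ k) :
    lev S (s i) = i := by
  have h3 := c.left_mem i hi hk
  have h4 := lev_of_mem h3.1 (c.left_range hi hk).1
  have h5 := lev_mono S (show p (i - 1) ≤ s i - 1 by omega)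
  have h6 := lev_mono S h3.2.2
  rw [c.lev_left i (by omega) hk] at h6
  rw [c.lev_left (i - 1) (by omega) (by omega)] at h5
  omega

theorem exists_left_eq (c : CommonCuts m k S T p s t) (hS : lev S (m - 1) = k) {x : ℤ}
    (hx : x ∈ S) (h1 : 1 ≤ x) (hm : x ≤ m - 1) : 1 ≤ lev S x ∧ lev S x ≤ k ∧ x = s (lev S x) := by
  have h2 := lev_of_mem hx h1
  have h3 : 0 ≤ lev S (x - 1) := by simp [lev]
  have h4 := lev_mono S hm
  have h5 : 1 ≤ lev S x := by omega
  have h6 : lev S x ≤ k := by omega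
  exact ⟨h5, h6, eq_of_lev_eq hx h1 (c.left_mem _ h5 h6).1 (c.left_range h5 h6).1
    (c.lev_left_eq h5 h6).symm⟩

theorem isGap (c : CommonCuts m k S T p s t) {i : ℤ} (hi : 1 ≤ i) (hk : i < k) :
    IsGap T (t i) (t (i + 1)) := by
  have h1 := c.right_mem i hi (by omega)
  have h2 := c.right_mem (i + 1) (by omega) (by omega)
  rw [add_sub_cancel_right] at h2
  refine ⟨by omega, h1.1, h2.1, fun x hx hx' hxT => ?_⟩
  by_cases h : x ≤ p i
  · have := c.right_unique i hi (by omega) x hxT (by omega) h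
    omega
  · have := c.right_unique (i + 1) (by omega) (by omega) x hxT
      (by rw [add_sub_cancel_right]; omega) (by omega)
    omega

/-- The basis elements of bounded weight. -/
def bounded (m k : ℕ) (S T : Set ℤ) (p : ℤ → ℤ) (n : ℤ) : Set (LiftedPartialPerm m k) :=
  {f | f.dom = S ∧ f.im = T ∧ ∀ i : ℤ, 0 ≤ i → i ≤ k → f.up (p i) (p i) ≤ n}

/-- Some rank between consecutive cuts of index at least `j` is not maximal. -/
def slack (m k : ℕ) (S T : Set ℤ) (p : ℤ → ℤ) (n j : ℤ) : Set (LiftedPartialPerm m k) :=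
  {f | f ∈ bounded m k S T p n ∧
    ∃ q : ℤ, j ≤ q ∧ 1 ≤ q ∧ q ≤ k ∧ f.up (p (q - 1)) (p q) < n}

/-- Some rank is not maximal, or one of the first `i` strands moves out of its interval. -/
def moving (m k : ℕ) (S T : Set ℤ) (p s t : ℤ → ℤ) (n i : ℤ) : Set (LiftedPartialPerm m k) :=
  {f | f ∈ bounded m k S T p n ∧ (f ∈ slack m k S T p n 1 ∨
    ∃ q : ℤ, 1 ≤ q ∧ q ≤ i ∧ f.toFun (s q) ≠ some (t q))}

variable {n : ℤ}

theorem lower_bounded (hm : 1 < m) : PongOne.Lower (bounded m k S T p n) := by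
  rintro f ⟨h1, h2, h3⟩ e he
  refine ⟨by rw [dom_res_of_mem he, h1], by rw [im_res_of_mem he, h2], fun i hi hik => ?_⟩
  exact (up_res_le hm he _ _).trans (h3 i hi hik)

theorem lower_slack (hm : 1 < m) (j : ℤ) : PongOne.Lower (slack m k S T p n j) := by
  rintro f ⟨h1, q, h2, h3, h4, h5⟩ e he
  exact ⟨lower_bounded hm f h1 e he, q, h2, h3, h4, (up_res_le hm he _ _).trans_lt h5⟩

theorem acyclic_slack (hm : 1 < m) (hk : 0 < k) (c : CommonCuts m k S T p s t)
    (hT : Invariant m T) (d : ℕ) (hd : d ≤ k) :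
    PongOne.Acyclic (slack m k S T p n (k + 1 - d)) := by
  induction d with
  | zero =>
    convert PongOne.acyclic_empty
    rw [Set.eq_empty_iff_forall_notMem]
    rintro f ⟨h1, q, h2, h3, h4, h5⟩
    push_cast at h2
    omega
  | succ d ih =>
    have ih := ih (by omega)
    obtain ⟨j, hj⟩ : ∃ j : ℤ, j = k + 1 - (d + 1 : ℕ) := ⟨_, rfl⟩
    rw [← hj]
    rw [show (k : ℤ) + 1 - d = j + 1 by push_cast at hj; omega] at ih
    have hj1 : 1 ≤ j := by push_cast at hj; omega
    have hjk : j ≤ k := by push_cast at hj; omega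
    obtain ⟨a, b, hgap, hap, hpb⟩ := exists_gap hm hT ⟨_, (c.right_mem 1 le_rfl (by omega)).1⟩
      (p (j - 1))
    have hne : ∀ f ∈ slack m k S T p n j, ∀ i : ℤ, 0 ≤ i → i ≤ k → i ≠ j - 1 → ∀ x,
        (f.post a b).up x (p i) = f.up x (p i) := by
      intro f hf i hi hik hij x
      have him := hf.1.2.1
      refine up_post_of_lev_ne hm (by rwa [him]) hap hpb (c.nonneg _ (by omega) (by omega))
        (c.le_last _ (by omega) (by omega)) (c.nonneg i hi hik) (c.le_last i hi hik) ?_ x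
      rw [him, c.lev_right i hi hik, c.lev_right _ (by omega) (by omega)]
      exact hij
    refine PongOne.acyclic_of_layer hm hT hgap (fun f hf => hf.1.2.1) ?_ (lower_slack hm _)
      (lower_slack hm _) ?_ ih
    · rintro f ⟨h1, q, h2, h3⟩
      exact ⟨h1, q, by omega, h3⟩
    · intro f hf hnf
      have hgap' : IsGap f.im a b := by rwa [hf.1.2.1]
      have hlt : f.up (p (j - 1)) (p j) < n := by
        obtain ⟨h1, q, h2, h3, h4, h5⟩ := hf
        by_cases hq : q = j
        · rwa [hq] at h5
        · exact absurd ⟨h1, q, by omega, h3, h4, h5⟩ hnf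
      have hbd : f.post a b ∈ bounded m k S T p n := by
        refine ⟨by rw [dom_post, hf.1.1], by rw [im_post hm f hgap', hf.1.2.1], fun i hi hik => ?_⟩
        by_cases hij : i = j - 1
        · subst hij
          have h1 := up_le_right hm (f.post a b) (p (j - 1)) (c.nonneg (j - 1) hi hik)
            (c.mono hi (show j - 1 < j by omega) hjk).le
          rw [im_post hm f hgap', hf.1.2.1, c.lev_right _ hi hik, c.lev_right j (by omega) hjk,
            hne f hf j (by omega) hjk (by omega)] at h1
          omega
        · rw [hne f hf i hi hik hij]
          exact hf.1.2.2 i hi hik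
      refine ⟨⟨hbd, j, le_rfl, hj1, hjk, ?_⟩, ?_⟩
      · rwa [hne f hf j (by omega) hjk (by omega)]
      · rintro ⟨-, q, h2, h3, h4, h5⟩
        rw [hne f hf q (by omega) h4 (by omega)] at h5
        exact hnf ⟨hf.1, q, h2, h3, h4, h5⟩

section Tight

variable {f : LiftedPartialPerm m k}

theorem le_up (hf : f ∈ bounded m k S T p n) (hns : f ∉ slack m k S T p n 1) {q : ℤ}
    (h1 : 1 ≤ q) (hq : q ≤ k) : n ≤ f.up (p (q - 1)) (p q) := by
  by_contra hc
  exact hns ⟨hf, q, h1, h1, hq, not_le.1 hc⟩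

theorem value_le (hm : 1 < m) (c : CommonCuts m k S T p s t) (hf : f ∈ bounded m k S T p n)
    (hns : f ∉ slack m k S T p n 1) {q y : ℤ} (h1 : 1 ≤ q) (hq : q ≤ k)
    (h : f.toFun (s q) = some y) : y ≤ p q := by
  by_contra hc
  have h2 := le_up hf hns h1 hq
  have h3 := hf.2.2 q (by omega) hq
  have h4 := c.left_mem q h1 hq
  have hlt : (f.upSet (p (q - 1)) (p q)).ncard < (f.upSet (p q) (p q)).ncard := by
    refine Set.ncard_lt_ncard ⟨fun i hi => ⟨by have := hi.1; omega, hi.2⟩, fun hh => ?_⟩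
      (f.finite_upSet hm _ _)
    have := (hh (a := s q) ⟨h4.2.2, y, h, not_le.1 hc⟩).1
    omega
  unfold up at h2 h3
  omega

theorem lt_preimage (hm : 1 < m) (c : CommonCuts m k S T p s t) (hf : f ∈ bounded m k S T p n)
    (hns : f ∉ slack m k S T p n 1) {q u : ℤ} (h1 : 1 ≤ q) (hq : q ≤ k)
    (h : f.toFun u = some (t q)) : p (q - 1) < u := by
  by_contra hc
  have h2 := le_up hf hns h1 hq
  have h3 := hf.2.2 (q - 1) (by omega) (by omega)
  have h4 := c.right_mem q h1 hq
  have hlt : (f.upSet (p (q - 1)) (p q)).ncard < (f.upSet (p (q - 1)) (p (q - 1))).ncard := by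
    refine Set.ncard_lt_ncard ⟨?_, fun hh => ?_⟩ (f.finite_upSet hm _ _)
    · rintro i ⟨hi, b, hb, hb'⟩
      exact ⟨hi, b, hb, by omega⟩
    · obtain ⟨-, b, hb, hb'⟩ := hh (a := u) ⟨not_lt.1 hc, _, h, h4.2.1⟩
      rw [h] at hb
      have := Option.some.inj hb
      omega
  unfold up at h2 h3
  omega

end Tight

theorem lower_moving (hm : 1 < m) (c : CommonCuts m k S T p s t) {i : ℤ} (hi : i ≤ k) :
    PongOne.Lower (moving m k S T p s t n i) := by
  rintro f ⟨hf, hor⟩ e he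
  refine ⟨lower_bounded hm f hf e he, ?_⟩
  by_cases hfs : f ∈ slack m k S T p n 1
  · exact Or.inl (lower_slack hm 1 f hfs e he)
  by_cases hrs : f.res e ∈ slack m k S T p n 1
  · exact Or.inl hrs
  obtain ⟨q, hq1, hqi, hq⟩ := hor.resolve_left hfs
  refine Or.inr ⟨q, hq1, hqi, fun hc => ?_⟩
  have hqk : q ≤ k := by omega
  obtain ⟨u, v, rfl⟩ := exists_pairMk e
  have hinv := pairMk_mem_crossSet.1 he
  have hres := lower_bounded hm f hf _ he
  set x := orbitSwap m u v (s q) with hx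
  rw [res_toFun hinv, ← hx] at hc
  have hne : x ≠ s q := fun hh => hq (by rw [← hh, hc])
  have hmk : pairMk m (s q) x = pairMk m u v := pairMk_orbitSwap hinv.nonTranslate hne
  have hI : f.Inv (s q) x := by rw [← pairMk_mem_crossSet, hmk]; exact he
  obtain ⟨a, b, ha, hb, hh⟩ := hI
  obtain rfl : b = t q := Option.some.inj (hb.symm.trans hc)
  have hs := c.left_mem q hq1 hqk
  have ht := c.right_mem q hq1 hqk
  have hxS : x ∈ S := hf.1 ▸ ⟨_, hb⟩
  have haT : a ∈ T := hf.2.1 ▸ ⟨_, ha⟩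
  have hxu := fun h1 h2 => hne (c.left_unique q hq1 hqk x hxS h1 h2)
  have hau : p (q - 1) < a → a ≤ p q → a = t q := c.right_unique q hq1 hqk a haT
  have hmax := le_up hres hrs hq1 hqk
  rcases hh with ⟨h1, h2⟩ | ⟨h1, h2⟩
  · have h3 : p q < x := by
      by_contra hcc
      exact hxu (by omega) (by omega)
    have h4 : p q < a := by
      by_contra hcc
      have := hau (by omega) (by omega)
      omega
    have h5 := up_res_lt hm ha hb hs.2.2 h3 ht.2.2 h4
    rw [hmk] at h5
    have h6 := up_mono_left hm (f.res (pairMk m u v)) (c.mono (by omega)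
      (show q - 1 < q by omega) hqk).le (p q)
    have := hf.2.2 q (by omega) hqk
    omega
  · have h3 : x ≤ p (q - 1) := by
      by_contra hcc
      exact hxu (by omega) (by omega)
    have h4 : a ≤ p (q - 1) := by
      by_contra hcc
      have := hau (by omega) (by omega)
      omega
    have h5 := up_res_lt hm hb ha h3 hs.2.1 h4 ht.2.1
    rw [pairMk_comm, hmk] at h5
    have h6 := up_anti_right hm (f.res (pairMk m u v)) (p (q - 1)) (c.mono (by omega)
      (show q - 1 < q by omega) hqk).le
    have := hf.2.2 (q - 1) (by omega) (by omega)
    omega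

theorem acyclic_moving (hm : 1 < m) (hk : 0 < k) (c : CommonCuts m k S T p s t)
    (hT : Invariant m T) (i : ℕ) (hi : i < k) : PongOne.Acyclic (moving m k S T p s t n i) := by
  induction i with
  | zero =>
    have h := acyclic_slack (n := n) hm hk c hT k le_rfl
    rw [show (k : ℤ) + 1 - k = 1 by omega] at h
    convert h
    ext f
    constructor
    · rintro ⟨h1, h2 | ⟨q, h2, h3, -⟩⟩
      · exact h2
      · push_cast at h3; omega
    · exact fun hf => ⟨hf.1, Or.inl hf⟩
  | succ i ih =>
    have ih := ih (by omega)
    obtain ⟨j, hj⟩ : ∃ j : ℤ, j = (i + 1 : ℕ) := ⟨_, rfl⟩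
    rw [← hj]
    rw [show (i : ℤ) = j - 1 by push_cast at hj; omega] at ih
    have hj1 : 1 ≤ j := by omega
    have hjk : j < k := by omega
    have hgap := c.isGap hj1 hjk
    have htj := c.right_mem j hj1 hjk.le
    have htj1 := c.right_mem (j + 1) (by omega) (by omega)
    rw [add_sub_cancel_right] at htj1
    have hab := hgap.nonTranslate hm hT
    refine PongOne.acyclic_of_layer hm hT hgap (fun f hf => hf.1.2.1) ?_
      (lower_moving hm c (by omega)) (lower_moving hm c (by omega)) ?_ ih
    · rintro f ⟨h1, h2 | ⟨q, h2, h3, h4⟩⟩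
      · exact ⟨h1, Or.inl h2⟩
      · exact ⟨h1, Or.inr ⟨q, h2, by omega, h4⟩⟩
    · intro f hf hnf
      have hns : f ∉ slack m k S T p n 1 := fun h => hnf ⟨hf.1, Or.inl h⟩
      have hfix : ∀ q, 1 ≤ q → q < j → f.toFun (s q) = some (t q) := by
        intro q h1 h2
        by_contra hc
        exact hnf ⟨hf.1, Or.inr ⟨q, h1, by omega, hc⟩⟩
      have hmov : f.toFun (s j) ≠ some (t j) := by
        obtain ⟨q, h1, h2, h3⟩ := hf.2.resolve_left hns
        by_cases hqj : q = j
        · rwa [← hqj]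
        · exact absurd (hfix q h1 (by omega)) h3
      have hgap' : IsGap f.im (t j) (t (j + 1)) := by rwa [hf.1.2.1]
      obtain ⟨u, hu⟩ : t j ∈ f.im := hgap'.left_mem
      obtain ⟨v, hv⟩ : t (j + 1) ∈ f.im := hgap'.right_mem
      have hpu : p j < u := by
        have h1 := lt_preimage hm c hf.1 hns hj1 hjk.le hu
        by_contra hc
        have := c.left_unique j hj1 hjk.le u (hf.1.1 ▸ ⟨_, hu⟩) h1 (by omega)
        rw [this] at hu
        exact hmov hu
      have hpv : p j < v := by
        have h1 := lt_preimage hm c hf.1 hns (by omega) (show j + 1 ≤ k by omega) hv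
        rwa [add_sub_cancel_right] at h1
      have hup' : ∀ x, ∀ i : ℤ, 0 ≤ i → i ≤ k → (i = j → x ≤ p j) →
          (f.post (t j) (t (j + 1))).up x (p i) = f.up x (p i) := by
        intro x i hi hik hx
        by_cases hij : i = j
        · subst hij
          have := hx rfl
          exact up_post_of_lt hm hgap' htj.2.2 htj1.2.1 hu hv (by omega) (by omega)
        · refine up_post_of_lev_ne hm hgap' htj.2.2 htj1.2.1 (c.nonneg _ (by omega) hjk.le)
            (c.le_last _ (by omega) hjk.le) (c.nonneg i hi hik) (c.le_last i hi hik) ?_ x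
          rw [hf.1.2.1, c.lev_right i hi hik, c.lev_right _ (by omega) hjk.le]
          exact hij
      have hbd : f.post (t j) (t (j + 1)) ∈ bounded m k S T p n := by
        refine ⟨by rw [dom_post, hf.1.1], by rw [im_post hm f hgap', hf.1.2.1], fun i hi hik => ?_⟩
        rw [hup' (p i) i hi hik (fun h => by rw [h])]
        exact hf.1.2.2 i hi hik
      have hns' : f.post (t j) (t (j + 1)) ∉ slack m k S T p n 1 := by
        rintro ⟨-, q, h2, h3, h4, h5⟩
        rw [hup' _ q (by omega) h4 (fun h => by
          have := c.mono (show 0 ≤ q - 1 by omega) (show q - 1 < q by omega) h4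
          rw [h] at this ⊢
          exact this.le)] at h5
        exact hns ⟨hf.1, q, h2, h3, h4, h5⟩
      refine ⟨⟨hbd, Or.inr ⟨j, hj1, le_rfl, fun h => ?_⟩⟩, ?_⟩
      · rw [post_eq_some hab, orbitSwap_self_left] at h
        have := f.some_inj h hv
        have := (c.left_mem j hj1 hjk.le).2.2
        omega
      · rintro ⟨-, h | ⟨q, h1, h2, h3⟩⟩
        · exact hns' h
        · apply h3
          have hr := c.right_range h1 (show q ≤ k by omega)
          have hrj := c.right_range hj1 hjk.le
          have hrj1 := c.right_range (show 1 ≤ j + 1 by omega) (show j + 1 ≤ k by omega)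
          have hlev := c.swap.lev_left_eq h1 (show q ≤ k by omega)
          have hlevj := c.swap.lev_left_eq hj1 hjk.le
          have hlevj1 := c.swap.lev_left_eq (show 1 ≤ j + 1 by omega) (show j + 1 ≤ k by omega)
          have h := post_some (a := t j) (b := t (j + 1)) (hfix q h1 (by omega))
          rw [orbitSwap_of_ne] at h
          · exact h
          · intro ho
            rw [orb_inj hm hr.1 hr.2 hrj.1 hrj.2 ho] at hlev
            omega
          · intro ho
            rw [orb_inj hm hr.1 hr.2 hrj1.1 hrj1.2 ho] at hlev
            omega

end CommonCuts

open LiftedPartialPerm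

namespace CommonCuts

variable {m k : ℕ} {S T : Set ℤ} {p s t : ℤ → ℤ} {n : ℤ}

/-- The tight elements are critical. -/
theorem isCrit_of_not_moving (hm : 1 < m) (hk : 0 < k) (c : CommonCuts m k S T p s t)
    {f : LiftedPartialPerm m k} (hf : f ∈ bounded m k S T p n)
    (hnm : f ∉ moving m k S T p s t n (k - 1)) : f.IsCrit n := by
  have hns : f ∉ slack m k S T p n 1 := fun h => hnm ⟨hf, Or.inl h⟩
  have hfix : ∀ q : ℤ, 1 ≤ q → q < k → f.toFun (s q) = some (t q) := by
    intro q h1 h2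
    by_contra hc
    exact hnm ⟨hf, Or.inr ⟨q, h1, by omega, hc⟩⟩
  have hSk : lev S (m - 1) = k := hf.1 ▸ f.lev_dom_last hm
  have hTk : lev T (m - 1) = k := hf.2.1 ▸ f.lev_im_last hm
  have hk1 : (1 : ℤ) ≤ k := by omega
  have hlast : f.toFun (s k) = some (t k - n * (2 * m - 2)) := by
    have hN : (2 : ℤ) ≤ 2 * m - 2 := by omega
    have hsk := c.left_range hk1 le_rfl
    have htk := c.right_range hk1 le_rfl
    have hp0 := c.nonneg 0 le_rfl (by omega)
    have hp0m := c.le_last 0 le_rfl (by omega)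
    have hpkm := c.le_last k (by omega) le_rfl
    obtain ⟨y, hy⟩ : s k ∈ f.dom := hf.1 ▸ (c.left_mem k hk1 le_rfl).1
    have hyp := value_le hm c hf hns hk1 le_rfl hy
    obtain ⟨g, hg, t', ht1, ht2, rfl⟩ := exists_rep hm y
    have htT : t' ∈ T := hf.2.1 ▸ (f.mem_im_map hg).1 ⟨_, hy⟩
    obtain ⟨hq1, hqk, hq⟩ := c.swap.exists_left_eq hTk htT ht1 ht2
    have hqk' : lev T t' = k := by
      by_contra hc
      have h := hfix _ hq1 (by omega)
      rw [← hq] at h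
      have ho := (orb_eq_iff_of_some hy h).2 (orb_apply hg t')
      have hr := c.left_range hq1 hqk
      have e := orb_inj hm hsk.1 hsk.2 hr.1 hr.2 ho
      have h2 := c.lev_left_eq hk1 le_rfl
      rw [e, c.lev_left_eq hq1 hqk] at h2
      exact hc h2
    rw [hqk'] at hq
    subst hq
    rcases reflGroup_form hg with ⟨d, hd⟩ | ⟨d, hd⟩
    · rw [hd] at hy hyp
      have hd0 : d ≤ 0 := by
        rcases mul_period_cases hm d with h | h | h <;> omega
      have hcrit : f.toFun (s k) = some (t k - (-d) * (2 * m - 2)) := by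
        rw [hy]; congr 1; ring
      have hge := le_up_of_translate hm htk.2 hsk.1 hcrit hp0 hp0m
      have hle : f.up (p 0) (p 0) ≤ -d := by
        have hsub : f.upSet (p 0) (p 0) ⊆
            (fun l : ℤ => 1 - s k + l * (2 * m - 2)) '' Set.Icc (1 + d) 0 := by
          rintro i ⟨hi, b, hb, hb'⟩
          obtain ⟨g', hg', x, hx1, hx2, rfl⟩ := exists_rep hm i
          have hxS : x ∈ S := hf.1 ▸ (f.mem_dom_map hg').1 ⟨_, hb⟩
          obtain ⟨hx3, hx4, hx5⟩ := c.exists_left_eq hSk hxS hx1 hx2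
          obtain ⟨w, hw, hw1, hw2⟩ : ∃ w, f.toFun x = some w ∧ w ≤ m - 1 ∧
              (x ≠ s k → 1 ≤ w) := by
            by_cases h : lev S x = k
            · rw [h] at hx5
              exact ⟨_, hx5 ▸ hy, by omega, fun hh => absurd hx5 hh⟩
            · have h' := hfix _ hx3 (by omega)
              rw [← hx5] at h'
              have hr := c.right_range hx3 hx4
              exact ⟨_, h', hr.2, fun _ => hr.1⟩
          have hbw := hb.symm.trans (f.map_some hg' hw)
          cases hbw
          have hxp : p 0 < x := by
            have h6 := c.left_mem _ hx3 hx4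
            rw [← hx5] at h6
            by_cases h7 : lev S x = 1
            · rw [h7] at h6; exact h6.2.1
            · have := c.mono le_rfl (show 0 < lev S x - 1 by omega) (by omega)
              omega
          rcases reflGroup_form hg' with ⟨l, hl⟩ | ⟨l, hl⟩
          · rw [hl] at hi hb'
            rcases mul_period_cases hm l with rfl | h' | h' <;> omega
          · rw [hl] at hi hb'
            by_cases hxs : x = s k
            · subst hxs
              have := Option.some.inj (hw.symm.trans hy)
              subst this
              refine ⟨l, ⟨?_, ?_⟩, (hl _).symm⟩
              · have e : 1 - (t k + d * (2 * (m : ℤ) - 2)) + l * (2 * m - 2)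
                    = 1 - t k + (l - d) * (2 * m - 2) := by ring
                rw [e] at hb'
                rcases mul_period_cases hm (l - d) with h' | h' | h'
                · rw [h'] at hb'; omega
                · omega
                · omega
              · rcases mul_period_cases hm l with h' | h' | h' <;> omega
            · have := hw2 hxs
              rcases mul_period_cases hm l with rfl | h' | h' <;> omega
        have hinj : Function.Injective (fun l : ℤ => 1 - s k + l * (2 * (m : ℤ) - 2)) := by
          intro l l' hll
          have : l * (2 * (m : ℤ) - 2) = l' * (2 * m - 2) := by
            dsimp only at hll; linarith
          exact mul_right_cancel₀ (by omega) this
        have := Set.ncard_le_ncard hsub ((Set.finite_Icc _ _).image _)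
        rw [Set.ncard_image_of_injective _ hinj, ← Finset.coe_Icc, Set.ncard_coe_finset,
          Int.card_Icc] at this
        unfold up
        omega
      have h1 := hf.2.2 0 le_rfl (by omega)
      have h2 := le_up hf hns le_rfl hk1
      rw [sub_self] at h2
      have h3 := up_anti_right hm f (p 0) (c.mono le_rfl (show (0 : ℤ) < 1 by omega) hk1).le
      have : d = -n := by omega
      rw [hy, this]
      congr 1
      ring
    · exfalso
      rw [hd] at hy hyp
      have hd0 : d ≤ 0 := by
        rcases mul_period_cases hm d with h | h | h <;> omega
      have h := f.map_some (reflection_mem m d) hy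
      simp only [Equiv.subLeft_apply] at h
      rw [show 1 + d * (2 * (m : ℤ) - 2) - (1 - t k + d * (2 * m - 2)) = t k by ring] at h
      have h1 := lt_preimage hm c hf hns hk1 le_rfl h
      have h2 := c.nonneg (k - 1) (by omega) (by omega)
      have h3 : d * (2 * (m : ℤ) - 2) ≤ 0 := by nlinarith
      omega
  intro x y hx hxm hxy
  have hxS : x ∈ S := hf.1 ▸ ⟨_, hxy⟩
  obtain ⟨hx3, hx4, hx5⟩ := c.exists_left_eq hSk hxS hx hxm
  have hr := c.right_range hx3 hx4
  refine ⟨t (lev S x), hr.1, hr.2, ?_, ?_⟩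
  · rw [hf.1, hf.2.1, c.swap.lev_left_eq hx3 hx4]
  · rw [hf.1]
    split_ifs with h
    · rw [h] at hx5 ⊢
      rw [hx5, hlast] at hxy
      exact (Option.some.inj hxy).symm
    · have := hfix _ hx3 (by omega)
      rw [← hx5, hxy] at this
      rw [Option.some.inj this, sub_zero]

/-- A critical element is tight. -/
theorem not_moving_of_isCrit (hm : 1 < m) (hk : 0 < k) (c : CommonCuts m k S T p s t)
    {f : LiftedPartialPerm m k} (hd : f.dom = S) (hi : f.im = T) (h : f.IsCrit n) :
    f ∉ moving m k S T p s t n (k - 1) := by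
  have hSk : lev S (m - 1) = k := hd ▸ f.lev_dom_last hm
  have hTk : lev T (m - 1) = k := hi ▸ f.lev_im_last hm
  have hval : ∀ q : ℤ, 1 ≤ q → q ≤ k →
      f.toFun (s q) = some (t q - if q = k then n * (2 * m - 2) else 0) := by
    intro q h1 h2
    have hr := c.left_range h1 h2
    obtain ⟨y, hy⟩ : s q ∈ f.dom := hd ▸ (c.left_mem q h1 h2).1
    obtain ⟨t', ht1, ht2, ht3, rfl⟩ := h (s q) y hr.1 hr.2 hy
    rw [hd, hi, c.lev_left_eq h1 h2] at ht3
    rw [hd, c.lev_left_eq h1 h2] at hy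
    have htT : t' ∈ T := by
      rw [← hi]
      refine (f.mem_im_map (translation_mem m (-(if q = k then n else 0)))).1 ⟨s q, hy.trans ?_⟩
      simp only [Equiv.coe_addRight]
      split_ifs <;> congr 1 <;> ring
    have := (c.swap.exists_left_eq hTk htT ht1 ht2).2.2
    rw [ht3] at this
    rw [hy, this]
  have hk1 : (1 : ℤ) ≤ k := by omega
  have hlast := hval k hk1 le_rfl
  rw [if_pos rfl] at hlast
  rintro ⟨-, ⟨-, q, h1, -, h3, h4⟩ | ⟨q, h1, h2, h3⟩⟩
  · have := le_up_of_translate hm (c.right_range hk1 le_rfl).2 (c.left_range hk1 le_rfl).1 hlast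
      (c.nonneg (q - 1) (by omega) (by omega)) (c.le_last q (by omega) h3)
    omega
  · have := hval q h1 (by omega)
    rw [if_neg (by omega), sub_zero] at this
    exact h3 this

/-- A cycle without critical terms is a boundary. -/
theorem exists_boundary (hm : 1 < m) (hk : 0 < k) (c : CommonCuts m k S T p s t)
    (hT : Invariant m T) {z : PongOne m k} (hz : z ∈ PongOne.Supp (bounded m k S T p n))
    (hd : PongOne.diff m k z = 0)
    (h : ∀ f ∈ bounded m k S T p n, f.IsCrit n → z f = 0) :
    ∃ y ∈ PongOne.Supp (bounded m k S T p n), PongOne.diff m k y = z := by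
  have hac := acyclic_moving (n := n) hm hk c hT (k - 1) (by omega)
  rw [show ((k - 1 : ℕ) : ℤ) = k - 1 by omega] at hac
  have hz' : z ∈ PongOne.Supp (moving m k S T p s t n (k - 1)) := by
    intro f hf
    by_contra hnm
    have hb := hz hf
    exact (Finsupp.mem_support_iff.1 hf) (h f hb (isCrit_of_not_moving hm hk c hb hnm))
  obtain ⟨y, hy, hyz⟩ := hac z hz' hd
  exact ⟨y, Finsupp.supported_mono (fun f hf => hf.1) hy, hyz⟩

/-- Boundaries have no critical terms. -/
theorem diff_apply_of_isCrit (hm : 1 < m) (hk : 0 < k) (c : CommonCuts m k S T p s t)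
    {f : LiftedPartialPerm m k} (hd : f.dom = S) (hi : f.im = T) (h : f.IsCrit n) :
    ∀ y ∈ PongOne.Supp (bounded m k S T p n), PongOne.diff m k y f = 0 := by
  classical
  refine PongOne.supp_induction (by simp)
    (fun x y hx hy => by rw [map_add, Finsupp.add_apply, hx, hy, add_zero]) fun g hg => ?_
  rw [PongOne.diff_of, PongOne.diffOf_eq (s := (finite_crossSet hm g).toFinset) (by simp),
    Finsupp.finsetSum_apply]
  refine Finset.sum_eq_zero fun e he => ?_
  have he : e ∈ g.crossSet := by simpa using he
  split_ifs with hlen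
  · rw [PongOne.of, Finsupp.single_apply, if_neg]
    rintro rfl
    have h1 : g ∉ moving m k S T p s t n (k - 1) := fun hgm =>
      not_moving_of_isCrit hm hk c hd hi h (lower_moving hm c (by omega) g hgm e he)
    have h2 := (isCrit_of_not_moving hm hk c hg h1).ext hm h (hg.1.trans hd.symm)
      (hg.2.1.trans hi.symm)
    rw [← h2] at hlen
    omega
  · rfl

end CommonCuts

open LiftedPartialPerm

variable {m k : ℕ}

/-! ### The basis elements of bounded ranks -/

/-- The basis elements from `S` to `T` whose diagonal ranks are bounded by `U`. -/
def rankBounded (m k : ℕ) (S T : Set ℤ) (U : ℤ → ℤ) : Set (LiftedPartialPerm m k) :=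
  {f | f.dom = S ∧ f.im = T ∧ ∀ q : ℤ, 0 ≤ q → q ≤ m - 1 → f.up q q ≤ U q}

theorem lower_rankBounded (hm : 1 < m) (S T : Set ℤ) (U : ℤ → ℤ) :
    PongOne.Lower (rankBounded m k S T U) := by
  rintro f ⟨h1, h2, h3⟩ e he
  exact ⟨by rw [dom_res_of_mem he, h1], by rw [im_res_of_mem he, h2], fun q hq hqm =>
    (up_res_le hm he _ _).trans (h3 q hq hqm)⟩

theorem exists_tight_cut (hm : 1 < m) (hk : 0 < k) {S T : Set ℤ} {U : ℤ → ℤ}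
    (hT : Invariant m T) (hTk : lev T (m - 1) = k)
    (hac : ¬ PongOne.Acyclic (rankBounded m k S T U)) {i : ℤ} (hi : 0 ≤ i) (hik : i ≤ k) :
    ∃ p : ℤ, 0 ≤ p ∧ p ≤ m - 1 ∧ lev T p = i ∧ ∀ q : ℤ, 0 ≤ q → q ≤ m - 1 → lev T q ≠ i →
      (p ≤ q → U p + 1 ≤ U q + (lev T q - lev T p)) ∧
      (q ≤ p → U p + 1 ≤ U q + (lev S p - lev S q)) := by
  obtain ⟨p0, hp0, hp0m, hlev⟩ := exists_lev_eq T (p := m - 1) (by omega) hi (by omega)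
  have hne : T.Nonempty := by
    rw [Set.nonempty_iff_ne_empty]
    rintro rfl
    simp [lev] at hTk
    omega
  obtain ⟨a, b, hgap, hap, hpb⟩ := exists_gap hm hT hne p0
  by_contra hcon
  apply hac
  refine PongOne.acyclic_of_layer (Y := ∅) hm hT hgap (fun f hf => hf.2.1) (Set.empty_subset _)
    (lower_rankBounded hm S T U) (fun f hf => absurd hf (Set.notMem_empty f)) (fun f hf _ => ?_)
    PongOne.acyclic_empty
  refine ⟨?_, Set.notMem_empty _⟩
  have hgap' : IsGap f.im a b := by rwa [hf.2.1]
  have hdom : (f.post a b).dom = S := by rw [dom_post, hf.1]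
  have him : (f.post a b).im = T := by rw [im_post hm f hgap', hf.2.1]
  have hup : ∀ q : ℤ, 0 ≤ q → q ≤ m - 1 → lev T q ≠ i → (f.post a b).up q q ≤ U q := by
    intro q hq hqm hqi
    rw [up_post_of_lev_ne hm hgap' hap hpb hp0 hp0m hq hqm (by rwa [hf.2.1, hlev])]
    exact hf.2.2 q hq hqm
  refine ⟨hdom, him, fun p hp hpm => ?_⟩
  by_cases hpi : lev T p = i
  · by_contra hlt
    refine hcon ⟨p, hp, hpm, hpi, fun q hq hqm hqi => ⟨fun hpq => ?_, fun hqp => ?_⟩⟩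
    · have h1 := up_mono_left hm (f.post a b) hpq p
      have h2 := up_le_right hm (f.post a b) q hp hpq
      rw [him] at h2
      have := hup q hq hqm hqi
      omega
    · have h1 := up_anti_right hm (f.post a b) p hqp
      have h2 := up_le_left hm (f.post a b) hq hqp q
      rw [hdom] at h2
      have := hup q hq hqm hqi
      omega
  · exact hup p hp hpm hpi

/-- The bound `U` allows exactly `n` periods of motion of a single strand. -/
def GoodBound (m k : ℕ) (S T : Set ℤ) (U : ℤ → ℤ) (n : ℤ) (p : ℤ → ℤ) : Prop :=
  (∀ i : ℤ, 0 ≤ i → i ≤ k → 0 ≤ p i ∧ p i ≤ m - 1 ∧ lev S (p i) = i ∧ lev T (p i) = i ∧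
    U (p i) = n) ∧
  ∀ q : ℤ, 0 ≤ q → q ≤ m - 1 → n ≤ U q ∧ n + (lev S q - lev T q) ≤ U q

theorem acyclic_or_goodBound (hm : 1 < m) (hk : 0 < k) {S T : Set ℤ} {U : ℤ → ℤ}
    (hT : Invariant m T) (hTk : lev T (m - 1) = k) (hSk : lev S (m - 1) = k) :
    PongOne.Acyclic (rankBounded m k S T U) ∨ ∃ n p, GoodBound m k S T U n p := by
  by_cases hac : PongOne.Acyclic (rankBounded m k S T U)
  · exact Or.inl hac
  right
  have h1 : ∀ i : ℤ, 0 ≤ i → i ≤ k → _ := fun i hi hik =>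
    exists_tight_cut hm hk (U := U) hT hTk hac hi hik
  choose! p hp0 hpm hpT hp using h1
  have hmono : ∀ i : ℤ, 0 ≤ i → i + 1 ≤ k → p i < p (i + 1) := fun i hi hik =>
    lt_of_lev_lt (S := T) (by rw [hpT i hi (by omega), hpT (i + 1) (by omega) hik]; omega)
  have hstep : ∀ i : ℤ, 0 ≤ i → i + 1 ≤ k → U (p i) ≤ U (p (i + 1)) ∧
      U (p (i + 1)) + 1 ≤ U (p i) + (lev S (p (i + 1)) - lev S (p i)) := by
    intro i hi hik
    have e1 := hpT i hi (by omega)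
    have e2 := hpT (i + 1) (by omega) hik
    have h := hmono i hi hik
    have a1 := (hp i hi (by omega) (p (i + 1)) (hp0 _ (by omega) hik) (hpm _ (by omega) hik)
      (by omega)).1 h.le
    have a2 := (hp (i + 1) (by omega) hik (p i) (hp0 _ hi (by omega)) (hpm _ hi (by omega))
      (by omega)).2 h.le
    omega
  have hlow : ∀ i : ℤ, 0 ≤ i → i ≤ k → lev S (p 0) + U (p i) - U (p 0) + i ≤ lev S (p i) ∧
      U (p 0) ≤ U (p i) := by
    intro i hi
    induction i, hi using Int.leInduction with
    | base => intro _; omega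
    | succ i hi ih =>
      intro hik
      have := ih (by omega)
      have := hstep i hi hik
      omega
  have hS0 : 0 ≤ lev S (p 0) := by simp [lev]
  have hhigh : ∀ i : ℤ, 0 ≤ i → i ≤ k → lev S (p i) + U (p k) - U (p i) + (k - i) ≤ k ∧
      U (p i) ≤ U (p k) := by
    intro i hi hik
    obtain ⟨d, hd⟩ : ∃ d : ℕ, i = k - d := ⟨(k - i).toNat, by omega⟩
    induction d generalizing i with
    | zero =>
      obtain rfl : i = k := by omega
      have := lev_mono S (hpm k (by omega) le_rfl)
      omega
    | succ d ih =>
      have := ih (i + 1) (by omega) (by omega) (by push_cast at hd; omega)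
      have := hstep i hi (by omega)
      omega
  have hval : ∀ i : ℤ, 0 ≤ i → i ≤ k → lev S (p i) = i ∧ U (p i) = U (p 0) := by
    intro i hi hik
    have a1 := hlow i hi hik
    have a2 := hhigh i hi hik
    have a3 := hlow k (by omega) le_rfl
    omega
  refine ⟨U (p 0), p, fun i hi hik => ⟨hp0 i hi hik, hpm i hi hik, (hval i hi hik).1, hpT i hi hik,
    (hval i hi hik).2⟩, fun q hq hqm => ?_⟩
  have hj0 : 0 ≤ lev T q := by simp [lev]
  have hjk : lev T q ≤ k := hTk ▸ lev_mono T hqm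
  have hlk : lev S q ≤ k := hSk ▸ lev_mono S hqm
  have below : 1 ≤ lev T q → U (p 0) ≤ U q := by
    intro h
    have e := hval (lev T q - 1) (by omega) (by omega)
    have e2 := hpT (lev T q - 1) (by omega) (by omega)
    have hlt : p (lev T q - 1) < q := lt_of_lev_lt (S := T) (by omega)
    have := (hp (lev T q - 1) (by omega) (by omega) q hq hqm (by omega)).1 hlt.le
    omega
  have above : lev T q < k → U (p 0) + (lev S q - lev T q) ≤ U q := by
    intro h
    have e := hval (lev T q + 1) (by omega) (by omega)
    have e2 := hpT (lev T q + 1) (by omega) (by omega)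
    have hlt : q < p (lev T q + 1) := lt_of_lev_lt (S := T) (by omega)
    have := (hp (lev T q + 1) (by omega) (by omega) q hq hqm (by omega)).2 hlt.le
    omega
  have hl0 : 0 ≤ lev S q := by simp [lev]
  by_cases h1 : 1 ≤ lev T q
  · have := below h1
    by_cases h2 : lev T q < k
    · have := above h2; omega
    · omega
  · have := above (by omega); omega

theorem GoodBound.rankBounded_eq (hm : 1 < m) {S T : Set ℤ} {U : ℤ → ℤ} {n : ℤ} {p : ℤ → ℤ}
    (h : GoodBound m k S T U n p) (hTk : lev T (m - 1) = k) :
    rankBounded m k S T U = CommonCuts.bounded m k S T p n := by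
  ext f
  constructor
  · rintro ⟨h1, h2, h3⟩
    refine ⟨h1, h2, fun i hi hik => ?_⟩
    have := h.1 i hi hik
    rw [← this.2.2.2.2]
    exact h3 _ this.1 this.2.1
  · rintro ⟨h1, h2, h3⟩
    refine ⟨h1, h2, fun q hq hqm => ?_⟩
    have hj0 : 0 ≤ lev T q := by simp [lev]
    have hjk : lev T q ≤ k := hTk ▸ lev_mono T hqm
    obtain ⟨a1, a2, a3, a4, a5⟩ := h.1 (lev T q) hj0 hjk
    have a6 := h3 (lev T q) hj0 hjk
    have a7 := h.2 q hq hqm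
    rcases le_total (p (lev T q)) q with hle | hle
    · have b1 := up_le_left hm f a1 hle q
      have b2 := up_anti_right hm f (p (lev T q)) hle
      rw [h1] at b1
      omega
    · have b1 := up_mono_left hm f hle q
      have b2 := up_le_right hm f (p (lev T q)) hq hle
      rw [h2] at b2
      omega

theorem exists_boundary_of_rankBounded (hm : 1 < m) (hk : 0 < k) {S T : Set ℤ} {U : ℤ → ℤ}
    {z : PongOne m k} (hz : z ∈ PongOne.Supp (rankBounded m k S T U))
    (hd : PongOne.diff m k z = 0)
    (h : ∀ f ∈ rankBounded m k S T U, ∀ n p, GoodBound m k S T U n p → f.IsCrit n → z f = 0) :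
    ∃ y ∈ PongOne.Supp (rankBounded m k S T U), PongOne.diff m k y = z := by
  by_cases hne : (rankBounded m k S T U).Nonempty
  · obtain ⟨f0, hf0⟩ := hne
    have hT : Invariant m T := hf0.2.1 ▸ f0.invariant_im
    have hTk : lev T (m - 1) = k := hf0.2.1 ▸ f0.lev_im_last hm
    have hSk : lev S (m - 1) = k := hf0.1 ▸ f0.lev_dom_last hm
    rcases acyclic_or_goodBound (U := U) hm hk hT hTk hSk with hac | ⟨n, p, hg⟩
    · exact hac z hz hd
    · obtain ⟨s, t, c⟩ := exists_commonCuts (m := m) (p := p) fun i hi hik =>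
        ⟨(hg.1 i hi hik).1, (hg.1 i hi hik).2.1, (hg.1 i hi hik).2.2.1, (hg.1 i hi hik).2.2.2.1⟩
      have h := fun f hf => h f hf n p hg
      rw [hg.rankBounded_eq hm hTk] at hz h ⊢
      exact c.exists_boundary hm hk hT hz hd h
  · rw [Set.not_nonempty_iff_eq_empty] at hne
    rw [hne] at hz ⊢
    exact PongOne.acyclic_empty z hz hd

theorem diff_apply_eq_zero_of_goodBound (hm : 1 < m) (hk : 0 < k) {S T : Set ℤ} {U : ℤ → ℤ}
    {n : ℤ} {p : ℤ → ℤ} (hg : GoodBound m k S T U n p) {f : LiftedPartialPerm m k}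
    (hd : f.dom = S) (hi : f.im = T) (h : f.IsCrit n) {y : PongOne m k}
    (hy : y ∈ PongOne.Supp (rankBounded m k S T U)) : PongOne.diff m k y f = 0 := by
  have hTk : lev T (m - 1) = k := hi ▸ f.lev_im_last hm
  obtain ⟨s, t, c⟩ := exists_commonCuts (m := m) (p := p) fun i hi hik =>
    ⟨(hg.1 i hi hik).1, (hg.1 i hi hik).2.1, (hg.1 i hi hik).2.2.1, (hg.1 i hi hik).2.2.2.1⟩
  rw [hg.rankBounded_eq hm hTk] at hy
  exact c.diff_apply_of_isCrit hm hk hd hi h y hy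

open LiftedPartialPerm

namespace LiftedPartialPerm

variable {m k : ℕ}

theorem weight_eq_up (hm : 1 < m) (f : LiftedPartialPerm m k) (j : Fin m) :
    f.weight j = f.up (j : ℕ) (j : ℕ) - ((lev f.dom (j : ℕ) : ℚ) - lev f.im (j : ℕ)) / 2 := by
  rw [weight_eq_sep, sep_eq hm f (by positivity)]
  push_cast
  ring

end LiftedPartialPerm

namespace Pong

variable {m k : ℕ}

/-! ### The homology in a fixed weight -/

/-- The elements of weight `w` from `S` to `T`. -/
def homPart (m k : ℕ) (S T : Set ℤ) (w : Fin m → ℚ) : AddSubgroup (Pong m k) :=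
  AddSubgroup.closure {z | ∃ (f : LiftedPartialPerm m k) (a : Fin m →₀ ℕ),
    f.dom = S ∧ f.im = T ∧ (∀ i, f.weight i + a i = w i) ∧ z = pure f a}

theorem homPart_induction {S T : Set ℤ} {w : Fin m → ℚ} {p : Pong m k → Prop} (h0 : p 0)
    (hadd : ∀ x y, p x → p y → p (x + y))
    (hs : ∀ f a, f.dom = S → f.im = T → (∀ i, f.weight i + a i = w i) → p (pure f a))
    (z : Pong m k) (hz : z ∈ homPart m k S T w) : p z := by
  have hneg : ∀ x : Pong m k, -x = x := fun x => by
    rw [neg_eq_iff_add_eq_zero]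
    refine Finsupp.ext fun f => ?_
    exact CharTwo.add_self_eq_zero (R := Base m) _
  induction hz using AddSubgroup.closure_induction with
  | mem x hx => obtain ⟨f, a, h1, h2, h, rfl⟩ := hx; exact hs f a h1 h2 h
  | zero => exact h0
  | add x y _ _ hx hy => exact hadd x y hx hy
  | neg x _ hx => rwa [hneg]

theorem homPart_le {S T : Set ℤ} {w : Fin m → ℚ} : homPart m k S T w ≤ weightHom m k w :=
  AddSubgroup.closure_mono fun _ ⟨f, a, _, _, h, e⟩ => ⟨f, a, h, e⟩

/-- The weight `w` allows exactly `n` periods of motion of a single strand from `S` to `T`. -/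
def Good (m k : ℕ) (S T : Set ℤ) (w : Fin m → ℚ) (n : ℕ) : Prop :=
  (∀ i : ℕ, i ≤ k → ∃ q : Fin m, lev S (q : ℕ) = i ∧ lev T (q : ℕ) = i ∧ w q = n) ∧
  ∀ q : Fin m, n + |(lev S (q : ℕ) : ℚ) - lev T (q : ℕ)| / 2 ≤ w q

theorem exists_bound_of_weight (hm : 1 < m) {f0 : LiftedPartialPerm m k} {c0 : Fin m →₀ ℕ}
    {w : Fin m → ℚ} (h0 : ∀ i, f0.weight i + c0 i = w i) : ∃ U : ℤ → ℤ,
      (∀ j : Fin m, w j = U (j : ℕ) -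
        ((lev f0.dom (j : ℕ) : ℚ) - lev f0.im (j : ℕ)) / 2) ∧
      (∀ f : LiftedPartialPerm m k, f ∈ rankBounded m k f0.dom f0.im U ↔
        f.dom = f0.dom ∧ f.im = f0.im ∧ ∃ c : Fin m →₀ ℕ, ∀ i, f.weight i + c i = w i) := by
  set U : ℤ → ℤ := fun q => f0.up q q + if h : q.toNat < m then (c0 ⟨q.toNat, h⟩ : ℤ) else 0
  have hU : ∀ j : Fin m, U (j : ℕ) = f0.up (j : ℕ) (j : ℕ) + c0 j := by
    intro j
    simp [U]
  have hw : ∀ j : Fin m, w j = U (j : ℕ) -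
        ((lev f0.dom (j : ℕ) : ℚ) - lev f0.im (j : ℕ)) / 2 := by
    intro j
    rw [hU, ← h0, weight_eq_up hm]
    push_cast
    ring
  refine ⟨U, hw, fun f => ?_⟩
  constructor
  · rintro ⟨h1, h2, h3⟩
    refine ⟨h1, h2, Finsupp.equivFunOnFinite.symm fun j =>
      (U (j : ℕ) - f.up (j : ℕ) (j : ℕ)).toNat, fun j => ?_⟩
    have h4 := h3 (j : ℕ) (by positivity) (by have := j.2; omega)
    have h5 : (((U (j : ℕ) - f.up (j : ℕ) (j : ℕ)).toNat : ℤ) : ℚ)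
        = (U (j : ℕ) - f.up (j : ℕ) (j : ℕ) : ℤ) := by
      rw [Int.toNat_of_nonneg (by omega)]
    rw [Finsupp.equivFunOnFinite_symm_apply_apply, weight_eq_up hm, hw, h1, h2]
    push_cast at h5 ⊢
    rw [h5]
    ring
  · rintro ⟨h1, h2, c, h3⟩
    refine ⟨h1, h2, fun q hq hqm => ?_⟩
    obtain ⟨j, rfl⟩ : ∃ j : Fin m, ((j : ℕ) : ℤ) = q :=
      ⟨⟨q.toNat, by omega⟩, by simp [hq]⟩
    have h4 := h3 j
    rw [weight_eq_up hm, hw, h1, h2] at h4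
    have h5 : (f.up (j : ℕ) (j : ℕ) : ℚ) + c j = U (j : ℕ) := by linarith
    have h6 : f.up (j : ℕ) (j : ℕ) + c j = U (j : ℕ) := by exact_mod_cast h5
    omega

theorem goodBound_iff {S T : Set ℤ} {w : Fin m → ℚ} {U : ℤ → ℤ}
    (hw : ∀ j : Fin m, w j = U (j : ℕ) - ((lev S (j : ℕ) : ℚ) - lev T (j : ℕ)) / 2) {n : ℕ} :
    (∃ p, GoodBound m k S T U n p) ↔ Good m k S T w n := by
  constructor
  · rintro ⟨p, h1, h2⟩
    refine ⟨fun i hi => ?_, fun q => ?_⟩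
    · obtain ⟨a1, a2, a3, a4, a5⟩ := h1 i (by positivity) (by omega)
      have e : (((p i).toNat : ℕ) : ℤ) = p i := Int.toNat_of_nonneg a1
      refine ⟨⟨(p i).toNat, by omega⟩, ?_, ?_, ?_⟩
      · rw [e, a3]
      · rw [e, a4]
      · rw [hw, e, a3, a4, a5]; simp
    · have h3 := h2 (q : ℕ) (by positivity) (by have := q.2; omega)
      rw [hw]
      have h4 : (n : ℚ) ≤ U (q : ℕ) := by exact_mod_cast h3.1
      have h5 : (n : ℚ) + (lev S (q : ℕ) - lev T (q : ℕ)) ≤ U (q : ℕ) := by exact_mod_cast h3.2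
      rcases abs_cases ((lev S (q : ℕ) : ℚ) - lev T (q : ℕ)) with h | h <;> rw [h.1] <;> linarith
  · rintro ⟨h1, h2⟩
    have : Nonempty (Fin m) := ⟨(h1 0 (Nat.zero_le _)).choose⟩
    choose! P hP using h1
    refine ⟨fun i => ((P i.toNat : ℕ) : ℤ), fun i hi hik => ?_, fun q hq hqm => ?_⟩
    · obtain ⟨a1, a2, a3⟩ := hP i.toNat (by omega)
      have e : ((i.toNat : ℕ) : ℤ) = i := Int.toNat_of_nonneg hi
      refine ⟨by positivity, by have := (P i.toNat).2; dsimp only; omega, by rw [a1, e], by rw [a2, e], ?_⟩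
      rw [hw, a1, a2, sub_self, zero_div, sub_zero] at a3
      exact_mod_cast a3
    · obtain ⟨j, rfl⟩ : ∃ j : Fin m, ((j : ℕ) : ℤ) = q :=
        ⟨⟨q.toNat, by omega⟩, by simp [hq]⟩
      have h3 := h2 j
      rw [hw] at h3
      have h4 := le_abs_self ((lev S (j : ℕ) : ℚ) - lev T (j : ℕ))
      have h5 := neg_abs_le ((lev S (j : ℕ) : ℚ) - lev T (j : ℕ))
      constructor
      · have : (n : ℚ) ≤ U (j : ℕ) := by linarith
        exact_mod_cast this
      · have : (n : ℚ) + (lev S (j : ℕ) - lev T (j : ℕ)) ≤ U (j : ℕ) := by linarith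
        exact_mod_cast this

theorem exists_weightHom_spec {w : Fin m → ℚ} {X : Set (LiftedPartialPerm m k)}
    (hX : ∀ f ∈ X, ∃ c : Fin m →₀ ℕ, ∀ i, f.weight i + c i = w i) :
    ∀ y ∈ PongOne.Supp X, ∃ y' ∈ weightHom m k w, spec m k y' = y := by
  refine PongOne.supp_induction ⟨0, zero_mem _, map_zero _⟩ ?_ ?_
  · rintro x y ⟨x', hx, rfl⟩ ⟨y', hy, rfl⟩
    exact ⟨x' + y', add_mem hx hy, map_add _ _ _⟩
  · intro f hf
    obtain ⟨c, hc⟩ := hX f hf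
    exact ⟨pure f c, pure_mem_weightHom hc, spec_pure f c⟩

/-- A homogeneous cycle is a boundary if it has no critical term in a good weight. -/
theorem exists_boundary (hm : 1 < m) (hk : 0 < k) {S T : Set ℤ} {w : Fin m → ℚ} {z : Pong m k}
    (hz : z ∈ homPart m k S T w) (hd : diff m k z = 0)
    (h : ∀ (f : LiftedPartialPerm m k) (b : Fin m →₀ ℕ) (n : ℕ), f.dom = S → f.im = T →
      (∀ i, f.weight i + b i = w i) → Good m k S T w n → f.IsCrit n → coeff f b z = 0) :
    ∃ y, diff m k y = z := by
  by_cases hne : ∃ (f0 : LiftedPartialPerm m k) (c0 : Fin m →₀ ℕ), f0.dom = S ∧ f0.im = T ∧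
      ∀ i, f0.weight i + c0 i = w i
  · obtain ⟨f0, c0, rfl, rfl, h0⟩ := hne
    obtain ⟨U, hw, hU⟩ := exists_bound_of_weight hm h0
    have hzs : spec m k z ∈ PongOne.Supp (rankBounded m k f0.dom f0.im U) := by
      refine homPart_induction (p := fun z => spec m k z ∈
        PongOne.Supp (rankBounded m k f0.dom f0.im U)) (by rw [map_zero]; exact zero_mem _)
        (fun x y hx hy => by rw [map_add]; exact add_mem hx hy) (fun f a h1 h2 h3 => ?_) z hz
      rw [spec_pure]
      exact PongOne.of_mem_supp ((hU f).2 ⟨h1, h2, a, h3⟩)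
    obtain ⟨y, hy, hyz⟩ := exists_boundary_of_rankBounded hm hk hzs
      (by rw [← spec_diff hm, hd, map_zero]) fun f hf n p hg hcr => by
        have hn : 0 ≤ n := by
          have a := hg.1 0 le_rfl (by positivity)
          have b := hf.2.2 (p 0) a.1 a.2.1
          have := f.up_nonneg (p 0) (p 0)
          omega
        lift n to ℕ using hn
        obtain ⟨h1, h2, c, hc⟩ := (hU f).1 hf
        rw [← coeff_eq_spec (homPart_le hz) hc]
        exact h f c n h1 h2 hc ((goodBound_iff hw).1 ⟨p, hg⟩) hcr
    obtain ⟨y', hy', rfl⟩ := exists_weightHom_spec (w := w) (fun f hf => ((hU f).1 hf).2.2) y hy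
    refine ⟨y', eq_of_spec_eq (diff_mem_weightHom hm hy') (homPart_le hz) ?_⟩
    rw [spec_diff hm, hyz]
  · refine ⟨0, ?_⟩
    rw [map_zero]
    refine homPart_induction (p := fun z => 0 = z) rfl
      (fun x y hx hy => by rw [← hx, ← hy, add_zero]) (fun f a h1 h2 h3 => ?_) z hz
    exact absurd ⟨f, a, h1, h2, h3⟩ hne

/-- In a good weight, boundaries have no critical terms. -/
theorem coeff_diff_eq_zero (hm : 1 < m) (hk : 0 < k) {w : Fin m → ℚ} {n : ℕ}
    {f : LiftedPartialPerm m k} {b : Fin m →₀ ℕ} (hg : Good m k f.dom f.im w n)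
    (hw : ∀ i, f.weight i + b i = w i) (hcr : f.IsCrit n) (y : Pong m k) :
    coeff f b (diff m k y) = 0 := by
  induction y using induction_pure with
  | h0 => simp
  | hadd x y hx hy => rw [map_add, map_add, hx, hy, add_zero]
  | hs g c =>
  by_cases hgw : ∀ i, g.weight i + c i = w i
  · have hmem := diff_mem_weightHom hm (pure_mem_weightHom hgw)
    rw [coeff_eq_spec hmem hw, spec_diff hm, spec_pure]
    by_cases hdi : g.dom = f.dom ∧ g.im = f.im
    · obtain ⟨U, hwU, hU⟩ := exists_bound_of_weight hm hw
      obtain ⟨p, hp⟩ := (goodBound_iff hwU).2 hg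
      exact diff_apply_eq_zero_of_goodBound hm hk hp rfl rfl hcr
        (PongOne.of_mem_supp ((hU g).2 ⟨hdi.1, hdi.2, c, hgw⟩))
    · have hlow : PongOne.Lower {f : LiftedPartialPerm m k | f.dom = g.dom ∧ f.im = g.im} := by
        rintro f' ⟨h1, h2⟩ e he
        exact ⟨(dom_res_of_mem he).trans h1, (im_res_of_mem he).trans h2⟩
      have h1 := PongOne.diff_mem_supp hm hlow (PongOne.of g) (PongOne.of_mem_supp ⟨rfl, rfl⟩)
      by_contra hc
      have := h1 (Finsupp.mem_support_iff.2 hc)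
      exact hdi ⟨this.1.symm, this.2.symm⟩
  · exact coeff_eq_zero (diff_mem_weightHom hm (pure_mem_weightHom (w := fun i => g.weight i + c i)
      fun i => rfl)) fun hc => hgw fun i => (hc i).symm.trans (hw i)

end Pong

open LiftedPartialPerm

/-! ### Motions of a single strand -/

section Direction

variable {m : ℕ}

open Classical in
/-- The direction of `x` relative to `i`: it is `1` for translates of `i`, `-1` for reflections of
`i`, and `0` for the other integers. -/
def direction (m : ℕ) (i x : ℤ) : ℤ :=
  if ∃ l : ℤ, x = i + l * (2 * m - 2) then 1
  else if ∃ l : ℤ, x = 1 - i + l * (2 * m - 2) then -1 else 0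

theorem translate_ne_reflection (m : ℕ) (i l l' : ℤ) :
    i + l * (2 * m - 2) ≠ 1 - i + l' * (2 * m - 2) := by
  intro h
  have e1 : l * (2 * (m : ℤ) - 2) = 2 * (l * (m - 1)) := by ring
  have e2 : l' * (2 * (m : ℤ) - 2) = 2 * (l' * (m - 1)) := by ring
  omega

theorem direction_translate (i l : ℤ) : direction m i (i + l * (2 * m - 2)) = 1 :=
  if_pos ⟨l, rfl⟩

theorem direction_reflection (i l : ℤ) : direction m i (1 - i + l * (2 * m - 2)) = -1 := by
  rw [direction, if_neg, if_pos ⟨l, rfl⟩]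
  rintro ⟨l', h⟩
  exact translate_ne_reflection m i l' l h.symm

theorem direction_of_orb_ne {i x : ℤ} (h : orb m x ≠ orb m i) : direction m i x = 0 := by
  rw [direction, if_neg, if_neg]
  · rintro ⟨l, hl⟩
    exact h (orb_eq_iff_exists.2 ⟨l, Or.inr hl⟩)
  · rintro ⟨l, hl⟩
    exact h (orb_eq_iff_exists.2 ⟨l, Or.inl hl⟩)

theorem direction_cases (m : ℕ) (i x : ℤ) :
    (∃ l : ℤ, x = i + l * (2 * m - 2) ∧ direction m i x = 1) ∨
    (∃ l : ℤ, x = 1 - i + l * (2 * m - 2) ∧ direction m i x = -1) ∨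
    (orb m x ≠ orb m i ∧ direction m i x = 0) := by
  by_cases h : orb m x = orb m i
  · obtain ⟨l, rfl | rfl⟩ := orb_eq_iff_exists.1 h
    · exact Or.inl ⟨l, rfl, direction_translate i l⟩
    · exact Or.inr (Or.inl ⟨l, rfl, direction_reflection i l⟩)
  · exact Or.inr (Or.inr ⟨h, direction_of_orb_ne h⟩)

theorem direction_self (m : ℕ) (i : ℤ) : direction m i i = 1 := by
  have := direction_translate (m := m) i 0
  rwa [zero_mul, add_zero] at this

theorem direction_add (m : ℕ) (i x n : ℤ) :
    direction m i (x + n * (2 * m - 2)) = direction m i x := by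
  rcases direction_cases m i x with ⟨l, rfl, h⟩ | ⟨l, rfl, h⟩ | ⟨h0, h⟩ <;> rw [h]
  · rw [← direction_translate (m := m) i (l + n)]; congr 1; ring
  · rw [← direction_reflection (m := m) i (l + n)]; congr 1; ring
  · refine direction_of_orb_ne ?_
    rwa [orb_eq_iff_exists.2 ⟨n, Or.inl rfl⟩]

theorem direction_reflect (m : ℕ) (i x n : ℤ) :
    direction m i (1 - x + n * (2 * m - 2)) = -direction m i x := by
  rcases direction_cases m i x with ⟨l, rfl, h⟩ | ⟨l, rfl, h⟩ | ⟨h0, h⟩ <;> rw [h]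
  · rw [← direction_reflection (m := m) i (n - l)]; congr 1; ring
  · rw [neg_neg, ← direction_translate (m := m) i (n - l)]; congr 1; ring
  · refine direction_of_orb_ne ?_
    rwa [orb_eq_iff_exists.2 ⟨n, Or.inr rfl⟩]

theorem direction_comm (m : ℕ) (i x : ℤ) : direction m i x = direction m x i := by
  rcases direction_cases m i x with ⟨l, rfl, h⟩ | ⟨l, rfl, h⟩ | ⟨h0, h⟩ <;> rw [h]
  · rw [← direction_translate (m := m) (i + l * (2 * m - 2)) (-l)]; congr 1; ring
  · rw [← direction_reflection (m := m) (1 - i + l * (2 * m - 2)) l]; congr 1; ring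
  · exact (direction_of_orb_ne (Ne.symm h0)).symm

theorem direction_reflect_left (m : ℕ) (i x : ℤ) :
    direction m (1 - i) x = -direction m i x := by
  have := direction_reflect m x i 0
  rw [zero_mul, add_zero] at this
  rw [direction_comm, this, direction_comm]

/-- The displacements of a strand that starts at `i` and returns to its orbit. -/
def IsShift (m : ℕ) (i c : ℤ) : Prop :=
  ∃ n : ℤ, c = n * (2 * m - 2) ∨ c = 1 - 2 * i + n * (2 * m - 2)

theorem isShift_mul (m : ℕ) (i n : ℤ) : IsShift m i (n * (2 * m - 2)) := ⟨n, Or.inl rfl⟩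

theorem isShift_period (m : ℕ) (i : ℤ) : IsShift m i (2 * m - 2) := ⟨1, Or.inl (by ring)⟩

theorem orb_add_direction {i c : ℤ} (hc : IsShift m i c) (x : ℤ) :
    orb m (x + direction m i x * c) = orb m x := by
  rw [orb_eq_iff_exists]
  obtain ⟨n, rfl | rfl⟩ := hc
  · exact ⟨direction m i x * n, Or.inl (by ring)⟩
  · rcases direction_cases m i x with ⟨l, rfl, h⟩ | ⟨l, rfl, h⟩ | ⟨h0, h⟩ <;> rw [h]
    · exact ⟨n + 2 * l, Or.inr (by ring)⟩
    · exact ⟨2 * l - n, Or.inr (by ring)⟩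
    · exact ⟨0, Or.inl (by ring)⟩

end Direction

/-- The invariant sets with `k` orbits. -/
def Letters (m k : ℕ) : Type := {T : Set ℤ // Invariant m T ∧ (orb m '' T).ncard = k}

theorem LiftedPartialPerm.Invariant.mem_of_orb_eq {m : ℕ} {T : Set ℤ} (hT : Invariant m T) {x y : ℤ}
    (h : orb m x = orb m y) (hy : y ∈ T) : x ∈ T := by
  obtain ⟨g, hg, rfl⟩ := orb_eq_iff.1 h
  exact (hT g hg y).2 hy

namespace LiftedPartialPerm

variable {m k : ℕ}

open Classical in
/-- The strands of the orbit of `i` move by `c` in their direction, the others are constant. -/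
def move (T : Letters m k) (i c : ℤ) (hc : IsShift m i c) : LiftedPartialPerm m k where
  toFun x := if x ∈ T.1 then some (x + direction m i x * c) else none
  equivariant g hg x := by
    simp only [T.2.1 g hg x]
    split_ifs
    · rw [Option.map_some]
      congr 1
      rcases reflGroup_form hg with ⟨n, hn⟩ | ⟨n, hn⟩
      · rw [hn, hn, direction_add]; ring
      · rw [hn, hn, direction_reflect]; ring
    · rfl
  card_orbits := by
    convert T.2.2 using 3
    ext x
    by_cases h : x ∈ T.1 <;> simp [h]
  injective x y a b hx hy hab := by
    split_ifs at hx hy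
    cases hx; cases hy
    rwa [orb_add_direction hc, orb_add_direction hc] at hab

variable {T : Letters m k} {i c : ℤ} {hc : IsShift m i c}

theorem move_eq_some {x y : ℤ} :
    (move T i c hc).toFun x = some y ↔ x ∈ T.1 ∧ y = x + direction m i x * c := by
  classical
  change (if _ then _ else _) = _ ↔ _
  split_ifs with h
  · simp [h, eq_comm]
  · simp [h]

theorem dom_move : (move T i c hc).dom = T.1 := by
  ext x
  simp [dom, move_eq_some]

theorem im_move : (move T i c hc).im = T.1 := by
  refine Set.Subset.antisymm ?_ fun y hy => ?_
  · rintro y ⟨x, hx⟩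
    obtain ⟨hx', rfl⟩ := move_eq_some.1 hx
    exact T.2.1.mem_of_orb_eq (orb_add_direction hc x) hx'
  · obtain ⟨g, hg, e⟩ := orb_eq_iff.1 (orb_add_direction hc y)
    have h1 : (move T i c hc).toFun y = some (g y) := by
      rw [← e]; exact move_eq_some.2 ⟨hy, rfl⟩
    refine ⟨g⁻¹ y, ?_⟩
    have := map_some _ (inv_mem hg) h1
    simpa using this

/-- Composition with a further move in the same direction creates no double crossings. -/
theorem not_inv_move_of_inv {u v c c' d d' : ℤ} (h : u < v ∧ v + d' * c < u + d * c)
    (hcc : 0 ≤ c ∧ c ≤ c' ∨ c' ≤ c ∧ c ≤ 0) : v + d' * c' < u + d * c' := by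
  have h1 : 0 < (d - d') * c := by nlinarith
  rcases hcc with ⟨h2, h3⟩ | ⟨h2, h3⟩
  · have : 0 < d - d' := by by_contra hn; nlinarith
    nlinarith
  · have : d - d' < 0 := by by_contra hn; nlinarith
    nlinarith

end LiftedPartialPerm

/-! ### Counting in a period -/

section Count

variable {m : ℕ}

theorem LiftedPartialPerm.Invariant.add_mem_iff {T : Set ℤ} (hT : Invariant m T) (x n : ℤ) :
    x + n * (2 * m - 2) ∈ T ↔ x ∈ T :=
  hT _ (translation_mem m n) x

theorem LiftedPartialPerm.Invariant.sub_mem_iff {T : Set ℤ} (hT : Invariant m T) (x n : ℤ) :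
    1 - x + n * (2 * m - 2) ∈ T ↔ x ∈ T := by
  rw [show 1 - x + n * (2 * (m : ℤ) - 2) = 1 + n * (2 * m - 2) - x by ring]
  exact hT _ (reflection_mem m n) x

/-- The translate of `x` in `[a, a + 2m - 2)`. -/
def window (m : ℕ) (a x : ℤ) : ℤ := a + (x - a) % (2 * m - 2)

theorem window_spec (hm : 1 < m) (a x : ℤ) :
    a ≤ window m a x ∧ window m a x < a + (2 * m - 2) ∧
      ∃ n : ℤ, window m a x = x + n * (2 * m - 2) := by
  have hN : (0 : ℤ) < 2 * m - 2 := by omega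
  have e := Int.emod_add_mul_ediv (x - a) (2 * m - 2)
  have hr := Int.emod_nonneg (x - a) hN.ne'
  have hr' := Int.emod_lt_of_pos (x - a) hN
  refine ⟨?_, ?_, -((x - a) / (2 * m - 2)), ?_⟩
  · unfold window; omega
  · unfold window; omega
  · unfold window; linarith

theorem eq_of_window (hm : 1 < m) {a x y n : ℤ} (hx : a ≤ x ∧ x < a + (2 * m - 2))
    (hy : a ≤ y ∧ y < a + (2 * m - 2)) (h : x = y + n * (2 * m - 2)) : x = y := by
  rcases mul_period_cases hm n with rfl | h' | h' <;> omega

theorem ncard_period_eq (hm : 1 < m) {T : Set ℤ} (hT : Invariant m T) (a b : ℤ) :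
    (T ∩ Set.Ico a (a + (2 * m - 2))).ncard = (T ∩ Set.Ico b (b + (2 * m - 2))).ncard := by
  refine Set.ncard_congr (fun x _ => window m b x) ?_ ?_ ?_
  · rintro x ⟨hx, -⟩
    obtain ⟨h1, h2, n, h3⟩ := window_spec hm b x
    refine ⟨?_, h1, h2⟩
    rw [h3]
    exact (hT.add_mem_iff x n).2 hx
  · rintro x y ⟨hx, hx'⟩ ⟨hy, hy'⟩ h
    obtain ⟨-, -, n, h3⟩ := window_spec hm b x
    obtain ⟨-, -, l, h4⟩ := window_spec hm b y
    rw [h3, h4] at h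
    exact eq_of_window hm hx' hy' (n := l - n) (by linarith)
  · rintro y ⟨hy, hy'⟩
    obtain ⟨h1, h2, n, h3⟩ := window_spec hm a y
    refine ⟨window m a y, ⟨?_, h1, h2⟩, ?_⟩
    · rw [h3]
      exact (hT.add_mem_iff y n).2 hy
    · obtain ⟨h4, h5, l, h6⟩ := window_spec hm b (window m a y)
      exact eq_of_window hm ⟨h4, h5⟩ hy' (n := n + l) (by rw [h6, h3]; ring)

theorem ncard_period (hm : 1 < m) {k : ℕ} (T : Letters m k) (a : ℤ) :
    (T.1 ∩ Set.Ico a (a + (2 * m - 2))).ncard = 2 * k := by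
  rw [ncard_period_eq hm T.2.1 a (2 - m)]
  have hlev : (T.1 ∩ Set.Icc 1 ((m : ℤ) - 1)).ncard = k := by
    have := lev_last hm T.2.1
    rw [T.2.2] at this
    unfold lev at this
    exact_mod_cast this
  have hrefl : ∀ x : ℤ, 1 - x ∈ T.1 ↔ x ∈ T.1 := fun x => by
    have := T.2.1.sub_mem_iff x 0
    rwa [zero_mul, add_zero] at this
  have : T.1 ∩ Set.Ico (2 - (m : ℤ)) (2 - m + (2 * m - 2)) = (T.1 ∩ Set.Icc 1 ((m : ℤ) - 1)) ∪
      (fun x => 1 - x) '' (T.1 ∩ Set.Icc 1 ((m : ℤ) - 1)) := by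
    ext x
    simp only [Set.mem_inter_iff, Set.mem_Ico, Set.mem_union, Set.mem_image, Set.mem_Icc]
    constructor
    · rintro ⟨h1, h2, h3⟩
      by_cases hx : 1 ≤ x
      · exact Or.inl ⟨h1, hx, by omega⟩
      · exact Or.inr ⟨1 - x, ⟨(hrefl x).2 h1, by omega, by omega⟩, by ring⟩
    · rintro (⟨h1, h2, h3⟩ | ⟨y, ⟨h1, h2, h3⟩, rfl⟩)
      · exact ⟨h1, by omega, by omega⟩
      · exact ⟨(hrefl y).2 h1, by omega, by omega⟩
  rw [this, Set.ncard_union_eq, Set.ncard_image_of_injective _ (fun x y h => by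
    simpa using h), hlev]
  · ring
  · rw [Set.disjoint_left]
    rintro x ⟨-, h1, h2⟩ ⟨y, ⟨-, h3, h4⟩, e⟩
    have : 1 - y = x := e
    omega

end Count

namespace LiftedPartialPerm

variable {m k : ℕ}

/-! ### Translations of a single strand -/

/-- The translation of the orbit of `i` by one period. -/
abbrev trans (T : Letters m k) (i : ℤ) : LiftedPartialPerm m k :=
  move T i (2 * m - 2) (isShift_period m i)

/-- The partners of the crossings of a translation. -/
def partners (m : ℕ) (T : Set ℤ) (i : ℤ) : Set ℤ :=
  {l | l ∈ T ∧ i < l ∧ l + direction m i l * (2 * m - 2) < i + (2 * m - 2)}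

theorem direction_of_mem_partners {T : Set ℤ} {i l : ℤ} (h : l ∈ partners m T i) :
    direction m i l = 0 ∨ direction m i l = -1 := by
  rcases direction_cases m i l with ⟨n, rfl, h'⟩ | ⟨n, rfl, h'⟩ | ⟨h0, h'⟩
  · have := h.2
    rw [h'] at this
    omega
  · exact Or.inr h'
  · exact Or.inl h'

theorem nonTranslate_of_mem_partners {T : Set ℤ} {i l : ℤ} (h : l ∈ partners m T i) :
    NonTranslate m i l := by
  rintro n rfl
  have := direction_of_mem_partners h
  rw [direction_translate] at this
  omega

theorem trans_inv_of_mem_partners {T : Letters m k} {i l : ℤ} (hi : i ∈ T.1)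
    (h : l ∈ partners m T.1 i) : (trans T i).Inv i l := by
  refine ⟨_, _, move_eq_some.2 ⟨hi, rfl⟩, move_eq_some.2 ⟨h.1, rfl⟩, Or.inl ⟨h.2.1, ?_⟩⟩
  rw [direction_self, one_mul]
  exact h.2.2

theorem crossSet_trans (hm : 1 < m) {T : Letters m k} {i : ℤ} (hi : i ∈ T.1) :
    (trans T i).crossSet = pairMk m i '' partners m T.1 i := by
  refine Set.Subset.antisymm ?_ ?_
  · intro e he
    have key : ∀ x y : ℤ, x ∈ T.1 → y ∈ T.1 → x < y →
        y + direction m i y * (2 * m - 2) < x + direction m i x * (2 * m - 2) →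
        pairMk m x y ∈ pairMk m i '' partners m T.1 i := by
      intro x y hx hy hxy h
      have hN : (2 : ℤ) ≤ 2 * m - 2 := by omega
      rcases direction_cases m i x with ⟨l, rfl, h'⟩ | ⟨l, rfl, h'⟩ | ⟨h0, h'⟩
      · refine ⟨y + (-l) * (2 * m - 2), ⟨(T.2.1.add_mem_iff _ _).2 hy, by linarith, ?_⟩, ?_⟩
        · rw [direction_add]
          rw [h'] at h
          linarith
        · have := pairMk_map (translation_mem m l) i (y + -l * (2 * m - 2))
          rw [← this]
          simp only [Equiv.coe_addRight]
          congr 1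
          ring
      · rw [h'] at h
        rcases direction_cases m i y with ⟨n, rfl, h''⟩ | ⟨n, rfl, h''⟩ | ⟨h0', h''⟩ <;>
          rw [h''] at h <;> omega
      · rw [h'] at h
        rcases direction_cases m i y with ⟨l, rfl, h''⟩ | ⟨l, rfl, h''⟩ | ⟨h0', h''⟩ <;>
          rw [h''] at h
        · omega
        · refine ⟨1 - x + l * (2 * m - 2), ⟨(T.2.1.sub_mem_iff _ _).2 hx, by linarith, ?_⟩, ?_⟩
          · rw [direction_reflect, h']
            linarith
          · rw [pairMk_comm x, ← pairMk_map (reflection_mem m l)]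
            simp only [Equiv.subLeft_apply]
            congr 1 <;> ring
        · omega
    obtain ⟨x, y, rfl⟩ := exists_pairMk e
    obtain ⟨a, b, ha, hb, h⟩ := pairMk_mem_crossSet.1 he
    obtain ⟨hx, rfl⟩ := move_eq_some.1 ha
    obtain ⟨hy, rfl⟩ := move_eq_some.1 hb
    rcases h with ⟨h1, h2⟩ | ⟨h1, h2⟩
    · exact key x y hx hy h1 h2
    · rw [pairMk_comm]
      exact key y x hy hx h1 h2
  · rintro _ ⟨l, hl, rfl⟩
    exact pairMk_mem_crossSet.2 (trans_inv_of_mem_partners hi hl)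

theorem pairMk_injOn_partners (T : Set ℤ) (i : ℤ) :
    Set.InjOn (pairMk m i) (partners m T i) := by
  intro l hl l' hl' h
  have h1 := (pairMk_eq_iff_orbitSwap (nonTranslate_of_mem_partners hl')).1 h
  rw [orbitSwap_self_left] at h1
  exact h1.1

theorem ncard_partners (hm : 1 < m) {T : Letters m k} {i : ℤ} (hi : i ∈ T.1) :
    (partners m T.1 i).ncard = 2 * k := by
  have hN : (2 : ℤ) ≤ 2 * m - 2 := by omega
  obtain ⟨h1, h2, n, h3⟩ := window_spec hm i (1 - i)
  obtain ⟨w, hw⟩ : ∃ w, w = window m i (1 - i) := ⟨_, rfl⟩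
  rw [← hw] at h1 h2 h3
  have hwd : ∀ l : ℤ, direction m i (w + l * (2 * m - 2)) = -1 := fun l => by
    rw [h3, ← direction_reflection (m := m) i (n + l)]; congr 1; ring
  have hwT : ∀ l : ℤ, w + l * (2 * m - 2) ∈ T.1 := fun l => by
    rw [T.2.1.add_mem_iff, h3]
    exact (T.2.1.sub_mem_iff i n).2 hi
  have hwi : i ≠ w := fun hh => by
    have := hwd 0
    rw [zero_mul, add_zero, ← hh, direction_self] at this
    omega
  have hfin : (T.1 ∩ Set.Ico i (i + (2 * m - 2))).Finite := (Set.finite_Ico _ _).inter_of_right _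
  have : partners m T.1 i = insert (w + 1 * (2 * m - 2))
      ((T.1 ∩ Set.Ico i (i + (2 * m - 2))) \ {i}) := by
    ext l
    simp only [Set.mem_insert_iff, Set.mem_sdiff, Set.mem_inter_iff, Set.mem_Ico,
      Set.mem_singleton_iff]
    constructor
    · rintro hl
      rcases direction_cases m i l with ⟨r, rfl, h'⟩ | ⟨r, rfl, h'⟩ | ⟨h0, h'⟩
      · have := hl.2
        rw [h'] at this
        omega
      · have hl2 := hl.2
        rw [h'] at hl2
        have e : 1 - i + r * (2 * (m : ℤ) - 2) = w + (r - n) * (2 * m - 2) := by rw [h3]; ring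
        rcases mul_period_cases hm (r - n) with h | h | h
        · right
          refine ⟨⟨hl.1, by omega, ?_⟩, by omega⟩
          rw [e, h]; omega
        · left
          rw [e]
          rcases mul_period_cases hm (r - n - 1) with h' | h' | h'
          · rw [show r - n = 1 by omega]
          · have e2 : (r - n - 1) * (2 * (m : ℤ) - 2) = (r - n) * (2 * m - 2) - (2 * m - 2) := by
              ring
            omega
          · omega
        · omega
      · have hl2 := hl.2
        rw [h'] at hl2
        exact Or.inr ⟨⟨hl.1, by omega, by omega⟩, by omega⟩
    · rintro (rfl | ⟨⟨hlT, h4, h5⟩, h6⟩)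
      · refine ⟨hwT 1, by omega, ?_⟩
        rw [hwd]
        omega
      · refine ⟨hlT, by omega, ?_⟩
        rcases direction_cases m i l with ⟨r, rfl, h'⟩ | ⟨r, rfl, h'⟩ | ⟨h0, h'⟩
        · rcases mul_period_cases hm r with rfl | h | h <;> omega
        · rw [h']; omega
        · rw [h']; omega
  rw [this, Set.ncard_insert_of_notMem, Set.ncard_sdiff_singleton_of_mem, ncard_period hm T i]
  · have : 0 < (T.1 ∩ Set.Ico i (i + (2 * m - 2))).ncard :=
      (Set.ncard_pos hfin).2 ⟨i, hi, le_rfl, by omega⟩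
    rw [ncard_period hm T i] at this
    omega
  · exact ⟨hi, le_rfl, by omega⟩
  · rintro ⟨⟨-, -, h4⟩, -⟩
    omega

theorem cross_trans (hm : 1 < m) {T : Letters m k} {i : ℤ} (hi : i ∈ T.1) :
    (trans T i).cross = 2 * k := by
  rw [cross_eq_ncard, crossSet_trans hm hi, Set.InjOn.ncard_image (pairMk_injOn_partners T.1 i),
    ncard_partners hm hi]

end LiftedPartialPerm

open LiftedPartialPerm

namespace LiftedPartialPerm

variable {m k : ℕ}

theorem trans_add (T : Letters m k) (i n : ℤ) : trans T (i + n * (2 * m - 2)) = trans T i := by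
  refine ext_some fun x y => ?_
  rw [move_eq_some, move_eq_some, direction_comm, direction_add, direction_comm]

/-- The partner of the crossing that has the same resolution. -/
def copartner (m : ℕ) (i l : ℤ) : ℤ := i + (1 - direction m i l) * (2 * m - 2)

theorem copartner_mem_partners {T : Letters m k} {i l : ℤ} (hi : i ∈ T.1)
    (h : l ∈ partners m T.1 i) : copartner m i l ∈ partners m T.1 l := by
  obtain ⟨h1, h2, h3⟩ := id h
  refine ⟨(T.2.1.add_mem_iff _ _).2 hi, ?_, ?_⟩
  · unfold copartner
    linarith
  · rw [copartner, direction_add, direction_comm]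
    linarith

theorem direction_copartner (m : ℕ) (i l : ℤ) : direction m l (copartner m i l) = direction m i l := by
  rw [copartner, direction_add, direction_comm]

theorem res_trans {T : Letters m k} {i l : ℤ} (hi : i ∈ T.1)
    (h : l ∈ partners m T.1 i) : (trans T i).res (pairMk m i l)
      = (trans T l).res (pairMk m l (copartner m i l)) := by
  have h' := copartner_mem_partners hi h
  have hinv := trans_inv_of_mem_partners hi h
  have hinv' := trans_inv_of_mem_partners h.1 h'
  have hnt := hinv.nonTranslate
  have hnt' := hinv'.nonTranslate
  have hT : ∀ g ∈ reflGroup m, ∀ (j a : ℤ), j ∈ T.1 →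
      (trans T j).toFun (g a) = ((trans T j).toFun a).map g :=
    fun g hg j a _ => (trans T j).equivariant g hg a
  have ho : orb m (copartner m i l) = orb m i := orb_eq_iff_exists.2 ⟨_, Or.inl rfl⟩
  ext1
  funext x
  rw [res_toFun hinv, res_toFun hinv']
  rcases orbitSwap_spec hnt x with ⟨g, hg, rfl, e⟩ | ⟨g, hg, rfl, e⟩ | ⟨h1, h2, e⟩
  · rw [e]
    have e2 : orbitSwap m l (copartner m i l) (g i)
        = g (l + (-(1 - direction m i l)) * (2 * m - 2)) := by
      have := orbitSwap_apply_right hnt' (mul_mem hg (translation_mem m (-(1 - direction m i l))))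
      simp only [Equiv.Perm.mul_apply, Equiv.coe_addRight] at this
      rw [← this]
      congr 2
      unfold copartner
      ring
    rw [e2, hT g hg i l hi, hT g hg l _ h.1, move_eq_some.2 ⟨h.1, rfl⟩,
      move_eq_some.2 ⟨(T.2.1.add_mem_iff _ _).2 h.1, rfl⟩, direction_add, direction_self]
    congr 2
    ring
  · rw [e, orbitSwap_left hg, hT g hg i i hi, hT g hg l _ h.1, move_eq_some.2 ⟨hi, rfl⟩,
      move_eq_some.2 ⟨h'.1, rfl⟩, direction_self, direction_copartner]
    congr 2
    unfold copartner
    ring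
  · rw [e, orbitSwap_of_ne h2 (by rwa [ho])]
    have a1 := direction_of_orb_ne h1
    have a2 := direction_of_orb_ne h2
    by_cases hx : x ∈ T.1
    · rw [move_eq_some.2 ⟨hx, rfl⟩, move_eq_some.2 ⟨hx, rfl⟩, a1, a2]
    · have : ∀ j, (trans T j).toFun x = none := fun j => by
        rw [Option.eq_none_iff_forall_ne_some]
        exact fun a ha => hx (move_eq_some.1 ha).1
      rw [this, this]

open Classical in
/-- Representatives of the translation classes in `T`. -/
def base (T : Letters m k) : Finset ℤ := (Finset.Ico (2 - (m : ℤ)) m).filter (· ∈ T.1)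

theorem mem_base {T : Letters m k} {i : ℤ} : i ∈ base T ↔ (2 - (m : ℤ) ≤ i ∧ i < m) ∧ i ∈ T.1 := by
  simp [base]

theorem window_mem_base (hm : 1 < m) {T : Letters m k} {i : ℤ} (hi : i ∈ T.1) :
    window m (2 - m) i ∈ base T := by
  obtain ⟨h1, h2, n, h3⟩ := window_spec hm (2 - m) i
  refine mem_base.2 ⟨⟨h1, by omega⟩, ?_⟩
  rw [h3]
  exact (T.2.1.add_mem_iff _ _).2 hi

end LiftedPartialPerm

namespace PongOne

variable {m k : ℕ}

theorem partners_finite (hm : 1 < m) (T : Set ℤ) (i : ℤ) : (partners m T i).Finite := by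
  refine (Set.finite_Ioo i (i + 2 * (2 * m - 2) + 1)).subset fun l hl => ⟨hl.2.1, ?_⟩
  have := hl.2.2
  rcases direction_of_mem_partners hl with h | h <;> rw [h] at this <;> omega

theorem partners_add {T : Letters m k} (i l n : ℤ) :
    l + n * (2 * m - 2) ∈ partners m T.1 (i + n * (2 * m - 2)) ↔ l ∈ partners m T.1 i := by
  unfold partners
  simp only [Set.mem_ofPred_eq]
  rw [direction_add, direction_comm, direction_add, direction_comm, T.2.1.add_mem_iff]
  refine and_congr_right fun _ => and_congr ⟨fun h => by linarith, fun h => by linarith⟩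
    ⟨fun h => by linarith, fun h => by linarith⟩

open Classical in
/-- The contribution of a crossing of a translation to the differential. -/
def flagTerm (T : Letters m k) (i l : ℤ) : PongOne m k :=
  if ((trans T i).res (pairMk m i l)).cross + 1 = 2 * k then
    of ((trans T i).res (pairMk m i l)) else 0

theorem flagTerm_add (T : Letters m k) (i l n : ℤ) :
    flagTerm T (i + n * (2 * m - 2)) (l + n * (2 * m - 2)) = flagTerm T i l := by
  unfold flagTerm
  rw [trans_add]
  have := pairMk_map (translation_mem m n) i l
  simp only [Equiv.coe_addRight] at this
  rw [this]

theorem flagTerm_copartner {T : Letters m k} {i l : ℤ} (hi : i ∈ T.1)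
    (h : l ∈ partners m T.1 i) : flagTerm T l (copartner m i l) = flagTerm T i l := by
  unfold flagTerm
  rw [res_trans hi h]

theorem diff_trans (hm : 1 < m) {T : Letters m k} {i : ℤ} (hi : i ∈ T.1) :
    diff m k (of (trans T i)) = ∑ l ∈ (partners_finite hm T.1 i).toFinset, flagTerm T i l := by
  classical
  rw [diff_of, diffOf_eq (s := ((partners_finite hm T.1 i).toFinset).image (pairMk m i))
    (by rw [crossSet_trans hm hi]; simp), Finset.sum_image
    (by simpa using pairMk_injOn_partners T.1 i), cross_trans hm hi]
  rfl

/-- The sum of all translations of single strands of `T` is a cycle. -/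
theorem diff_sum_trans (hm : 1 < m) (T : Letters m k) :
    diff m k (∑ i ∈ base T, of (trans T i)) = 0 := by
  classical
  have key : ∀ i ∈ base T, i ∈ T.1 := fun i hi => (mem_base.1 hi).2
  rw [map_sum, Finset.sum_congr rfl fun i hi => diff_trans hm (key i hi),
    Finset.sum_sigma' (base T) (fun i => (partners_finite hm T.1 i).toFinset) (flagTerm T)]
  obtain ⟨D, hD⟩ : ∃ D : ℤ → ℤ, ∀ l, window m (2 - m) l = l + D l * (2 * m - 2) := by
    choose D hD using fun l => (window_spec hm (2 - m) l).2.2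
    exact ⟨D, hD⟩
  have mem : ∀ p : (_ : ℤ) × ℤ, p ∈ (base T).sigma (fun i => (partners_finite hm T.1 i).toFinset) ↔
      p.1 ∈ base T ∧ p.2 ∈ partners m T.1 p.1 := fun p => by simp
  refine Finset.sum_involution (fun p _ => ⟨p.2 + D p.2 * (2 * m - 2),
    copartner m p.1 p.2 + D p.2 * (2 * m - 2)⟩) ?_ ?_ ?_ ?_
  · rintro ⟨i, l⟩ hp
    obtain ⟨hi, hl⟩ := (mem _).1 hp
    dsimp only at hi hl ⊢
    rw [flagTerm_add, flagTerm_copartner (key i hi) hl]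
    exact add_self _
  · rintro ⟨i, l⟩ hp - h
    obtain ⟨hi, hl⟩ := (mem _).1 hp
    have h1 : l + D l * (2 * m - 2) = i := congrArg Sigma.fst h
    exact nonTranslate_of_mem_partners hl (-D l) (by linarith)
  · rintro ⟨i, l⟩ hp
    obtain ⟨hi, hl⟩ := (mem _).1 hp
    refine (mem _).2 ⟨?_, ?_⟩
    · rw [← hD]
      exact window_mem_base hm hl.1
    · exact (partners_add _ _ _).2 (copartner_mem_partners (key i hi) hl)
  · rintro ⟨i, l⟩ hp
    obtain ⟨hi, hl⟩ := (mem _).1 hp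
    have hib := (mem_base.1 hi).1
    dsimp only at hi hl hib ⊢
    set w := l + D l * (2 * m - 2) with hw
    set i' := copartner m i l + D l * (2 * m - 2) with hi'
    have h1 : copartner m w i' = l + D l * (2 * m - 2) + (1 - direction m i l) * (2 * m - 2) := by
      rw [copartner, hi', direction_add, direction_comm, hw, direction_add, direction_comm,
        direction_copartner]
    have h2 := window_spec hm (2 - m) i'
    have h3 : i' + D i' * (2 * m - 2) = i := by
      rw [← hD]
      refine eq_of_window hm (a := 2 - m) ⟨h2.1, h2.2.1⟩ ⟨hib.1, by omega⟩
        (n := 1 - direction m i l + D l + D i') ?_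
      rw [hD, hi', copartner]
      ring
    rw [h3, h1]
    congr 1
    have h4 : D l + (1 - direction m i l) + D i' = 0 := by
      have hN : (2 * (m : ℤ) - 2) ≠ 0 := by omega
      refine (mul_eq_zero_iff_right hN).1 ?_
      have h5 : i' = i + (1 - direction m i l) * (2 * m - 2) + D l * (2 * m - 2) := by
        rw [hi', copartner]
      linear_combination h3 - h5
    have : l + D l * (2 * (m : ℤ) - 2) + (1 - direction m i l) * (2 * m - 2) + D i' * (2 * m - 2)
        = l + (D l + (1 - direction m i l) + D i') * (2 * m - 2) := by ring
    rw [this, h4, zero_mul, add_zero]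

end PongOne

open LiftedPartialPerm

namespace LiftedPartialPerm

variable {m k : ℕ}

theorem finite_letters (hm : 1 < m) : Finite (Letters m k) := by
  have := (Pong.finite_isId (m := m) (k := k) hm).to_subtype
  refine Finite.of_injective (β := {f : LiftedPartialPerm m k | f.IsId})
    (fun T => ⟨idOn T.1 T.2.1 T.2.2, isId_idOn⟩) fun T T' h => ?_
  have h1 := congrArg (fun f : {f : LiftedPartialPerm m k | f.IsId} => f.1.dom) h
  dsimp only at h1
  rw [dom_idOn, dom_idOn] at h1
  exact Subtype.ext h1

/-- All sets of letters. -/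
def allLetters (hm : 1 < m) : Finset (Letters m k) :=
  have := finite_letters (k := k) hm
  Set.finite_univ.toFinset

theorem mem_allLetters (hm : 1 < m) (T : Letters m k) : T ∈ allLetters hm := by
  simp [allLetters]

/-- The domain as a set of letters. -/
def domLetters (f : LiftedPartialPerm m k) : Letters m k :=
  ⟨f.dom, f.invariant_dom, f.card_orbits_dom⟩

theorem eq_move_of_values (hm : 1 < m) {f : LiftedPartialPerm m k} {j c : ℤ} (h1 : 1 ≤ j)
    (hjm : j ≤ m - 1) (hc : IsShift m j c) (hj : f.toFun j = some (j + c))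
    (hf : ∀ l : ℤ, 1 ≤ l → l ≤ m - 1 → l ≠ j → f.toFun l = none ∨ f.toFun l = some l) :
    f = move f.domLetters j c hc := by
  refine ext_of_values hm fun x hx hxm => ?_
  by_cases hxj : x = j
  · subst hxj
    rw [hj, eq_comm, move_eq_some]
    exact ⟨⟨_, hj⟩, by rw [direction_self, one_mul]⟩
  · have hd : direction m j x = 0 :=
      direction_of_orb_ne fun h => hxj (orb_inj hm hx hxm h1 hjm h)
    rcases hf x hx hxm hxj with h | h
    · rw [h, eq_comm, Option.eq_none_iff_forall_ne_some]
      intro a ha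
      obtain ⟨b, hb⟩ := (move_eq_some.1 ha).1
      rw [h] at hb
      cases hb
    · rw [h, eq_comm, move_eq_some]
      exact ⟨⟨_, h⟩, by rw [hd]; ring⟩

theorem move_values (hm : 1 < m) {T : Letters m k} {j c : ℤ} (h1 : 1 ≤ j)
    (hjm : j ≤ m - 1) (hc : IsShift m j c) (hj : j ∈ T.1) :
    (move T j c hc).toFun j = some (j + c) ∧ ∀ l : ℤ, 1 ≤ l → l ≤ m - 1 → l ≠ j →
      (move T j c hc).toFun l = none ∨ (move T j c hc).toFun l = some l := by
  refine ⟨move_eq_some.2 ⟨hj, by rw [direction_self, one_mul]⟩, fun l hl hlm hlj => ?_⟩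
  have hd : direction m j l = 0 :=
    direction_of_orb_ne fun h => hlj (orb_inj hm hl hlm h1 hjm h)
  by_cases hlT : l ∈ T.1
  · exact Or.inr (move_eq_some.2 ⟨hlT, by rw [hd]; ring⟩)
  · left
    rw [Option.eq_none_iff_forall_ne_some]
    exact fun a ha => hlT (move_eq_some.1 ha).1

/-- Further moves in the same direction have additive crossing numbers. -/
theorem cross_comp_of_move (hm : 1 < m) {g f e : LiftedPartialPerm m k} (h : g.Composable f)
    (he : e.cross = 0) {i c c' : ℤ} (hcc : 0 ≤ c ∧ c ≤ c' ∨ c' ≤ c ∧ c ≤ 0)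
    (hf : ∀ x a, f.toFun x = some a → ∃ u, e.toFun x = some u ∧ a = u + direction m i u * c)
    (hgf : ∀ x a, (g.comp f h).toFun x = some a →
      ∃ u, e.toFun x = some u ∧ a = u + direction m i u * c') :
    (g.comp f h).cross = g.cross + f.cross := by
  have he' := (cross_eq_zero_iff hm).1 he
  refine cross_comp_of_disjoint hm h fun x y a b hx hy hxy hab => ?_
  obtain ⟨a', b', ha', hb', hlt'⟩ := hab
  obtain ⟨u, hu, rfl⟩ := hf x a hx
  obtain ⟨v, hv, rfl⟩ := hf y b hy
  obtain ⟨u', hu', rfl⟩ := hgf x a' (comp_eq_some.2 ⟨_, hx, ha'⟩)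
  obtain ⟨v', hv', rfl⟩ := hgf y b' (comp_eq_some.2 ⟨_, hy, hb'⟩)
  obtain rfl := Option.some.inj (hu.symm.trans hu')
  obtain rfl := Option.some.inj (hv.symm.trans hv')
  obtain ⟨a'', b'', hx', hy', hlt⟩ := hxy
  obtain rfl := Option.some.inj (hx.symm.trans hx')
  obtain rfl := Option.some.inj (hy.symm.trans hy')
  have hno : ∀ x y u v, e.toFun x = some u → e.toFun y = some v → x < y → u < v ∨ u = v := by
    intro x y u v hx hy hxy
    by_contra hc
    exact he' x y ⟨u, v, hx, hy, Or.inl ⟨hxy, by omega⟩⟩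
  have hinj : ∀ x y u, e.toFun x = some u → e.toFun y = some u → x = y :=
    fun x y u h1 h2 => e.some_inj h1 h2
  rcases hlt with ⟨h1, h2⟩ | ⟨h1, h2⟩
  · rcases hno x y u v hu hv h1 with h3 | rfl
    · have := not_inv_move_of_inv ⟨h3, h2⟩ hcc
      omega
    · have := hinj x y u hu hv
      omega
  · rcases hno y x v u hv hu h1 with h3 | rfl
    · have := not_inv_move_of_inv ⟨h3, h2⟩ hcc
      omega
    · have := hinj x y v hu hv
      omega

end LiftedPartialPerm

namespace Pong

variable {m k : ℕ}

/-- The product of two moves of the same strand in the same direction. -/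
theorem mulPure_move (hm : 1 < m) (T : Letters m k) {i i' c c' c'' : ℤ} {hc : IsShift m i c}
    {hc' : IsShift m i' c'} {hc'' : IsShift m i c''} (hcc : 0 ≤ c ∧ c ≤ c'' ∨ c'' ≤ c ∧ c ≤ 0)
    (hcomp : ∀ x, x + direction m i x * c + direction m i' (x + direction m i x * c) * c'
      = x + direction m i x * c'') :
    mulPure (move T i' c' hc') (move T i c hc) = pure (move T i c'' hc'') 0 := by
  have h : (move T i' c' hc').Composable (move T i c hc) := by
    rw [composable_iff, dom_move, im_move]
  have hval : ∀ x a, ((move T i' c' hc').comp (move T i c hc) h).toFun x = some a ↔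
      x ∈ T.1 ∧ a = x + direction m i x * c'' := by
    intro x a
    rw [comp_eq_some]
    constructor
    · rintro ⟨b, hb, ha⟩
      obtain ⟨hx, rfl⟩ := move_eq_some.1 hb
      obtain ⟨-, rfl⟩ := move_eq_some.1 ha
      exact ⟨hx, hcomp x⟩
    · rintro ⟨hx, rfl⟩
      have hb : (move T i c hc).toFun x = some (x + direction m i x * c) :=
        move_eq_some.2 ⟨hx, rfl⟩
      refine ⟨_, hb, move_eq_some.2 ⟨?_, (hcomp x).symm⟩⟩
      have : x + direction m i x * c ∈ (move T i c hc).im := ⟨x, hb⟩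
      rwa [im_move] at this
  have heq : (move T i' c' hc').comp (move T i c hc) h = move T i c'' hc'' :=
    ext_some fun x a => by rw [hval, move_eq_some]
  have hcross := cross_comp_of_move hm h (IsId.cross hm (isId_idOn (hT := T.2.1) (hk := T.2.2)))
    hcc (i := i)
    (fun x a hx => ⟨x, by
      rw [← (isId_idOn (hT := T.2.1) (hk := T.2.2)).dom_eq (by
        rw [dom_idOn]; exact (move_eq_some.1 hx).1)], (move_eq_some.1 hx).2⟩)
    (fun x a hx => ⟨x, by
      rw [← (isId_idOn (hT := T.2.1) (hk := T.2.2)).dom_eq (by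
        rw [dom_idOn]; exact ((hval x a).1 hx).1)], ((hval x a).1 hx).2⟩)
  rw [mulPure, dif_pos h, if_pos hcross, heq]
  congr 1
  ext j
  rw [exponentOf_apply (n := 0)]
  · rfl
  · have hw := weight_comp hm h j
    have hempty : {x | x ∈ (move T i c hc).sepSet (j : ℕ) ∧ ∃ b, (move T i c hc).toFun x = some b ∧
        b ∈ (move T i' c' hc').sepSet (j : ℕ)} = ∅ := by
      rw [Set.eq_empty_iff_forall_notMem]
      rintro x ⟨⟨b', hb', h1⟩, b, hb, d, hd, h2⟩
      obtain rfl := Option.some.inj (hb.symm.trans hb')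
      obtain ⟨hx, rfl⟩ := move_eq_some.1 hb
      have hd' := ((hval x d).1 (comp_eq_some.2 ⟨_, hb, hd⟩)).2
      rcases direction_cases m i x with ⟨r, -, h'⟩ | ⟨r, -, h'⟩ | ⟨h0, h'⟩ <;>
        rw [h'] at h1 h2 hd' <;> omega
    rw [heq, hempty, Set.ncard_empty] at hw
    simp only [Nat.cast_zero, add_zero] at hw ⊢
    linarith

theorem sum_pure_of_image {P : LiftedPartialPerm m k → Prop} {s : Finset (Letters m k)}
    {g : Letters m k → LiftedPartialPerm m k} (hg : ∀ T, (g T).dom = T.1)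
    (h : ∀ f, P f ↔ ∃ T ∈ s, g T = f) :
    (∑ᶠ (f : LiftedPartialPerm m k) (_ : P f), pure f 0 : Pong m k) = ∑ T ∈ s, pure (g T) 0 := by
  have h1 : {f | P f} = g '' (s : Set (Letters m k)) := by
    ext f
    exact h f
  have hinj : Set.InjOn g (s : Set (Letters m k)) := fun T _ T' _ hTT => Subtype.ext (by
    rw [← hg T, ← hg T', hTT])
  refine Eq.trans (b := ∑ᶠ (f : LiftedPartialPerm m k) (_ : f ∈ {f | P f}), pure f 0) rfl ?_
  rw [h1, finsum_mem_image hinj, finsum_mem_coe_finset]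

theorem isShift_left (m : ℕ) (j : ℤ) : IsShift m j (1 - 2 * j) := ⟨0, Or.inr (by ring)⟩

theorem isShift_right (m : ℕ) (j : ℤ) : IsShift m j (2 * m - 1 - 2 * j) :=
  ⟨1, Or.inr (by ring)⟩

open Classical in
/-- The sets of letters that contain `j`. -/
def lettersAt (hm : 1 < m) (j : ℤ) : Finset (Letters m k) :=
  (allLetters hm).filter fun T => j ∈ T.1

theorem mem_lettersAt (hm : 1 < m) {j : ℤ} {T : Letters m k} :
    T ∈ lettersAt hm j ↔ j ∈ T.1 := by
  simp [lettersAt, mem_allLetters]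

theorem sum_bounce (hm : 1 < m) {j c a : ℤ} (h1 : 1 ≤ j) (hjm : j ≤ m - 1) (hc : IsShift m j c)
    (ha : a = j + c) :
    (∑ᶠ (f : LiftedPartialPerm m k) (_ : f.toFun j = some a ∧
      ∀ l : ℤ, 1 ≤ l → l ≤ m - 1 → l ≠ j → f.toFun l = none ∨ f.toFun l = some l),
        pure f 0 : Pong m k) = ∑ T ∈ lettersAt hm j, pure (move T j c hc) 0 := by
  subst ha
  refine sum_pure_of_image (fun T => dom_move) fun f => ⟨fun hf => ?_, ?_⟩
  · exact ⟨f.domLetters, (mem_lettersAt hm).2 ⟨_, hf.1⟩,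
      (eq_move_of_values hm h1 hjm hc hf.1 hf.2).symm⟩
  · rintro ⟨T, hT, rfl⟩
    exact move_values hm h1 hjm hc ((mem_lettersAt hm).1 hT)

theorem mul_sum_move {j c c' : ℤ} (hc : IsShift m j c) (hc' : IsShift m j c')
    {s : Finset (Letters m k)} {F : Letters m k → Pong m k}
    (hF : ∀ T ∈ s, mulPure (move T j c' hc') (move T j c hc) = F T) :
    (∑ T ∈ s, pure (move T j c' hc') 0 : Pong m k) * (∑ T ∈ s, pure (move T j c hc) 0)
      = ∑ T ∈ s, F T := by
  classical
  change mul m k _ _ = _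
  rw [map_sum]
  refine Finset.sum_congr rfl fun T hT => ?_
  rw [map_sum, LinearMap.sum_apply, Finset.sum_eq_single T]
  · rw [mul_pure, hF T hT]
  · intro T' _ hne
    rw [mul_pure, mulPure, dif_neg]
    rw [composable_iff, dom_move, im_move]
    exact fun h => hne (Subtype.ext h)
  · exact fun h => absurd hT h

theorem neg_eq (x : Pong m k) : -x = x := by
  rw [neg_eq_iff_add_eq_zero]
  refine Finsupp.ext fun f => ?_
  exact CharTwo.add_self_eq_zero (R := Base m) _

theorem direction_left (x j : ℤ) :
    direction m j (x + direction m j x * (1 - 2 * j)) = -direction m j x := by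
  rcases direction_cases m j x with ⟨l, rfl, h⟩ | ⟨l, rfl, h⟩ | ⟨h0, h⟩ <;> rw [h]
  · rw [show j + l * (2 * m - 2) + 1 * (1 - 2 * j) = 1 - j + l * (2 * m - 2) by ring,
      direction_reflection]
  · rw [show 1 - j + l * (2 * m - 2) + -1 * (1 - 2 * j) = j + l * (2 * m - 2) by ring,
      direction_translate, neg_neg]
  · rw [zero_mul, add_zero, h, neg_zero]

theorem direction_right (x j : ℤ) :
    direction m j (x + direction m j x * (2 * m - 1 - 2 * j)) = -direction m j x := by
  have : x + direction m j x * (2 * m - 1 - 2 * j)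
      = x + direction m j x * (1 - 2 * j) + direction m j x * (2 * m - 2) := by ring
  rw [this, direction_add, direction_left]

theorem left_mul_right (hm : 1 < m) {j : ℤ} (h1 : 1 ≤ j) (hjm : j ≤ m - 1) :
    leftBounce m k j * rightBounce m k j = ∑ T ∈ lettersAt hm j, pure (trans T j) 0 := by
  unfold leftBounce rightBounce
  rw [sum_bounce (a := 1 - j) hm h1 hjm (isShift_left m j) (by ring),
    sum_bounce (a := 2 * m - 1 - j) hm h1 hjm (isShift_right m j) (by ring)]
  refine mul_sum_move _ _ fun T _ => mulPure_move hm T (Or.inl ⟨by omega, by omega⟩) fun x => ?_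
  rw [direction_right]
  ring

theorem move_neg_eq_trans (T : Letters m k) (j : ℤ) (hc : IsShift m j (-(2 * m - 2))) :
    move T j (-(2 * m - 2)) hc = trans T (1 - j) := by
  refine ext_some fun x a => ?_
  rw [move_eq_some, move_eq_some, direction_reflect_left]
  refine and_congr_right fun _ => ?_
  rw [mul_neg, neg_mul]

theorem right_mul_left (hm : 1 < m) {j : ℤ} (h1 : 1 ≤ j) (hjm : j ≤ m - 1) :
    rightBounce m k j * leftBounce m k j = ∑ T ∈ lettersAt hm j, pure (trans T (1 - j)) 0 := by
  unfold leftBounce rightBounce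
  rw [sum_bounce (a := 1 - j) hm h1 hjm (isShift_left m j) (by ring),
    sum_bounce (a := 2 * m - 1 - j) hm h1 hjm (isShift_right m j) (by ring)]
  refine mul_sum_move _ _ fun T _ => ?_
  have hc : IsShift m j (-(2 * m - 2)) := ⟨-1, Or.inl (by ring)⟩
  rw [← move_neg_eq_trans T j hc]
  refine mulPure_move hm T (Or.inr ⟨by omega, by omega⟩) fun x => ?_
  rw [direction_left]
  ring

/-- The element `Ω` is the sum of all translations of single strands by one period. -/
theorem Omega_eq (hm : 1 < m) :
    Omega m k = ∑ T ∈ allLetters hm, ∑ i ∈ base T, pure (trans T i) 0 := by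
  classical
  have h1 : Omega m k = ∑ j ∈ Finset.Ioo (0 : ℤ) m, ∑ T ∈ allLetters hm,
      if j ∈ T.1 then (pure (trans T j) 0 + pure (trans T (1 - j)) 0 : Pong m k) else 0 := by
    refine Finset.sum_congr rfl fun j hj => ?_
    rw [Finset.mem_Ioo] at hj
    rw [left_mul_right hm (by omega) (by omega), right_mul_left hm (by omega) (by omega),
      sub_eq_add_neg, neg_eq, ← Finset.sum_add_distrib, lettersAt, Finset.sum_filter]
  rw [h1, Finset.sum_comm]
  refine Finset.sum_congr rfl fun T _ => ?_
  rw [← Finset.sum_filter, Finset.sum_add_distrib]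
  have hrefl : ∀ x : ℤ, 1 - x ∈ T.1 ↔ x ∈ T.1 := fun x => by
    have := T.2.1.sub_mem_iff x 0
    rwa [zero_mul, add_zero] at this
  have hb : base T = ((Finset.Ioo (0 : ℤ) m).filter (· ∈ T.1)) ∪
      (((Finset.Ioo (0 : ℤ) m).filter (· ∈ T.1)).image fun j => 1 - j) := by
    ext x
    simp only [mem_base, Finset.mem_union, Finset.mem_filter, Finset.mem_Ioo, Finset.mem_image]
    constructor
    · rintro ⟨⟨h2, h3⟩, h4⟩
      by_cases hx : 0 < x
      · exact Or.inl ⟨⟨hx, h3⟩, h4⟩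
      · exact Or.inr ⟨1 - x, ⟨⟨by omega, by omega⟩, (hrefl x).2 h4⟩, by ring⟩
    · rintro (⟨⟨h2, h3⟩, h4⟩ | ⟨y, ⟨⟨h2, h3⟩, h4⟩, rfl⟩)
      · exact ⟨⟨by omega, h3⟩, h4⟩
      · exact ⟨⟨by omega, by omega⟩, (hrefl y).2 h4⟩
  rw [hb, Finset.sum_union, Finset.sum_image]
  · intro x _ y _ h
    simpa using h
  · rw [Finset.disjoint_left]
    intro x hx hx'
    simp only [Finset.mem_filter, Finset.mem_Ioo, Finset.mem_image] at hx hx'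
    obtain ⟨y, ⟨⟨h2, h3⟩, h4⟩, rfl⟩ := hx'
    omega

theorem weight_trans (hm : 1 < m) {T : Letters m k} {i : ℤ} (hi : i ∈ T.1) (j : Fin m) :
    (trans T i).weight j = 1 := by
  rw [weight_eq_up hm, dom_move, im_move, sub_self, zero_div, sub_zero]
  have : (trans T i).upSet (j : ℕ) (j : ℕ) = {window m ((j : ℕ) - (2 * m - 2) + 1) i} := by
    obtain ⟨h1, h2, n, h3⟩ := window_spec hm ((j : ℕ) - (2 * m - 2) + 1) i
    ext x
    simp only [upSet, Set.mem_ofPred_eq, Set.mem_singleton_iff]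
    constructor
    · rintro ⟨hx, b, hb, hxb⟩
      obtain ⟨hxT, rfl⟩ := move_eq_some.1 hb
      rcases direction_cases m i x with ⟨l, hl, h'⟩ | ⟨l, hl, h'⟩ | ⟨h0, h'⟩
      · rw [h'] at hxb
        exact eq_of_window hm ⟨by omega, by omega⟩ ⟨h1, h2⟩ (n := l - n) (by rw [h3, hl]; ring)
      · rw [h'] at hxb; omega
      · rw [h'] at hxb; omega
    · rintro rfl
      refine ⟨by omega, _, move_eq_some.2 ⟨?_, rfl⟩, ?_⟩
      · rw [h3, T.2.1.add_mem_iff]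
        exact hi
      · rw [h3, direction_add, direction_self, ← h3]
        omega
  rw [up, this, Set.ncard_singleton]
  simp

theorem Omega_mem_weightHom (hm : 1 < m) : Omega m k ∈ weightHom m k fun _ => 1 := by
  rw [Omega_eq hm]
  refine sum_mem fun T _ => sum_mem fun i hi => pure_mem_weightHom fun j => ?_
  rw [weight_trans hm (mem_base.1 hi).2]
  simp

theorem spec_Omega (hm : 1 < m) : spec m k (Omega m k) =
    ∑ T ∈ allLetters hm, ∑ i ∈ base T, PongOne.of (trans T i) := by
  rw [Omega_eq hm, map_sum]
  refine Finset.sum_congr rfl fun T _ => ?_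
  rw [map_sum]
  exact Finset.sum_congr rfl fun i _ => spec_pure _ _

theorem diff_Omega (hm : 1 < m) : diff m k (Omega m k) = 0 := by
  refine eq_of_spec_eq (diff_mem_weightHom hm (Omega_mem_weightHom hm)) (zero_mem _) ?_
  rw [spec_diff hm, spec_Omega hm, map_sum, map_zero]
  exact Finset.sum_eq_zero fun T _ => PongOne.diff_sum_trans hm T

theorem Omega_mem_bigraded (hm : 1 < m) : Omega m k ∈ bigraded m k (2 * k) fun _ => 1 := by
  rw [Omega_eq hm]
  refine sum_mem fun T _ => sum_mem fun i hi => AddSubgroup.subset_closure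
    ⟨_, 0, cross_trans hm (mem_base.1 hi).2, fun j => ?_, rfl⟩
  rw [weight_trans hm (mem_base.1 hi).2]
  simp

end Pong

open LiftedPartialPerm

namespace Letters

variable {m k : ℕ}

theorem lev_last (hm : 1 < m) (T : Letters m k) : lev T.1 (m - 1) = k := by
  rw [PongAlgebra.lev_last hm T.2.1, T.2.2]

theorem exists_rep (hm : 1 < m) (T : Letters m k) {x : ℤ} (hx : x ∈ T.1) :
    ∃ g ∈ reflGroup m, ∃ s ∈ T.1, 1 ≤ s ∧ s ≤ m - 1 ∧ x = g s := by
  obtain ⟨g, hg, s, h1, h2, rfl⟩ := LiftedPartialPerm.exists_rep hm x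
  exact ⟨g, hg, s, (T.2.1 g hg s).1 hx, h1, h2, rfl⟩

theorem exists_lev_eq (hm : 1 < m) (T : Letters m k) {i : ℤ} (hi : 1 ≤ i) (hik : i ≤ k) :
    ∃ t ∈ T.1, 1 ≤ t ∧ t ≤ m - 1 ∧ lev T.1 t = i := by
  have hl := T.lev_last hm
  obtain ⟨q, hq, hqm, hqi⟩ := PongAlgebra.exists_lev_eq T.1 (p := m - 1) (i := i)
    (by omega) (by omega) (by omega)
  obtain ⟨p, hp, hpq, hpi⟩ := PongAlgebra.exists_lev_eq T.1 (p := q) (i := i - 1)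
    (by omega) (by omega) (by omega)
  obtain ⟨t, ht, h1, h2, -⟩ := exists_mem_of_lev_eq_add_one (S := T.1) hp (q := q) (by omega)
  refine ⟨t, ht, by omega, by omega, ?_⟩
  have h3 := lev_of_mem ht (by omega)
  have h4 := lev_mono T.1 (show p ≤ t - 1 by omega)
  have h5 := lev_mono T.1 h2
  omega

theorem lev_pos (T : Letters m k) {t : ℤ} (ht : t ∈ T.1) (h1 : 1 ≤ t) : 1 ≤ lev T.1 t := by
  have := lev_of_mem ht h1
  have := lev_mono T.1 (show 0 ≤ t - 1 by omega)
  rw [lev_zero] at this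
  omega

theorem lev_le (hm : 1 < m) (T : Letters m k) {t : ℤ} (h1 : t ≤ m - 1) : lev T.1 t ≤ k := by
  rw [← T.lev_last hm]
  exact lev_mono _ h1

/-- The elements `x` and `y` have the same position in `S` and `T`. -/
def Corr (S T : Letters m k) (x y : ℤ) : Prop :=
  ∃ g ∈ reflGroup m, ∃ s ∈ S.1, ∃ t ∈ T.1, (1 ≤ s ∧ s ≤ m - 1) ∧ (1 ≤ t ∧ t ≤ m - 1) ∧
    lev T.1 t = lev S.1 s ∧ x = g s ∧ y = g t

theorem Corr.map {S T : Letters m k} {x y : ℤ} (h : Corr S T x y) {g : Equiv.Perm ℤ}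
    (hg : g ∈ reflGroup m) : Corr S T (g x) (g y) := by
  obtain ⟨g', hg', s, hs, t, ht, h1, h2, h3, rfl, rfl⟩ := h
  exact ⟨g * g', mul_mem hg hg', s, hs, t, ht, h1, h2, h3, rfl, rfl⟩

theorem Corr.unique (hm : 1 < m) {S T : Letters m k} {x y y' : ℤ} (h : Corr S T x y)
    (h' : Corr S T x y') : y = y' := by
  obtain ⟨g, hg, s, hs, t, ht, h1, h2, h3, rfl, rfl⟩ := h
  obtain ⟨g', hg', s', hs', t', ht', h1', h2', h3', e, rfl⟩ := h'
  have hss : s = s' := orb_inj hm h1.1 h1.2 h1'.1 h1'.2 (by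
    rw [← orb_apply hg s, e, orb_apply hg'])
  subst hss
  rw [reflGroup_free hg hg' e, eq_of_lev_eq ht h2.1 ht' h2'.1 (h3.trans h3'.symm)]

theorem Corr.symm {S T : Letters m k} {x y : ℤ} (h : Corr S T x y) : Corr T S y x := by
  obtain ⟨g, hg, s, hs, t, ht, h1, h2, h3, rfl, rfl⟩ := h
  exact ⟨g, hg, t, ht, s, hs, h2, h1, h3.symm, rfl, rfl⟩

theorem Corr.exists (hm : 1 < m) (S T : Letters m k) {x : ℤ} (hx : x ∈ S.1) :
    ∃ y, Corr S T x y := by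
  obtain ⟨g, hg, s, hs, h1, h2, rfl⟩ := S.exists_rep hm hx
  obtain ⟨t, ht, h3, h4, h5⟩ := T.exists_lev_eq hm (S.lev_pos hs h1) (S.lev_le hm h2)
  exact ⟨g t, g, hg, s, hs, t, ht, ⟨h1, h2⟩, ⟨h3, h4⟩, h5, rfl, rfl⟩

theorem Corr.mem {S T : Letters m k} {x y : ℤ} (h : Corr S T x y) : x ∈ S.1 := by
  obtain ⟨g, hg, s, hs, t, ht, h1, h2, h3, rfl, rfl⟩ := h
  exact (S.2.1 g hg s).2 hs

theorem Corr.orb_eq {S T : Letters m k} {x y : ℤ} (h : Corr S T x y) :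
    ∃ s t, orb m x = orb m s ∧ orb m y = orb m t ∧ Corr S T s t ∧ s ∈ S.1 ∧ t ∈ T.1 ∧
      (1 ≤ s ∧ s ≤ m - 1) ∧ (1 ≤ t ∧ t ≤ m - 1) := by
  obtain ⟨g, hg, s, hs, t, ht, h1, h2, h3, rfl, rfl⟩ := h
  exact ⟨s, t, orb_apply hg s, orb_apply hg t, ⟨1, one_mem _, s, hs, t, ht, h1, h2, h3, rfl, rfl⟩,
    hs, ht, h1, h2⟩

open Classical in
/-- The order-preserving map from `S` to `T`. -/
def ord (hm : 1 < m) (S T : Letters m k) : LiftedPartialPerm m k where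
  toFun x := if h : ∃ y, Corr S T x y then some h.choose else none
  equivariant g hg x := by
    by_cases h : ∃ y, Corr S T x y
    · have h' : ∃ y, Corr S T (g x) y := ⟨_, h.choose_spec.map hg⟩
      rw [dif_pos h, dif_pos h', Option.map_some, h'.choose_spec.unique hm (h.choose_spec.map hg)]
    · have h' : ¬ ∃ y, Corr S T (g x) y := by
        rintro ⟨y, hy⟩
        exact h ⟨_, by simpa using hy.map (inv_mem hg)⟩
      rw [dif_neg h, dif_neg h', Option.map_none]
  card_orbits := by
    convert S.2.2 using 3
    ext x
    have : (∃ y, Corr S T x y) ↔ x ∈ S.1 :=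
      ⟨fun ⟨y, hy⟩ => hy.mem, fun hx => Corr.exists hm S T hx⟩
    by_cases h : x ∈ S.1
    · simp [this, h]
    · simp [this, h]
  injective x x' y y' hx hx' hyy := by
    have key : ∀ x y, (if h : ∃ y, Corr S T x y then some h.choose else none) = some y →
        Corr S T x y := by
      intro x y h
      split_ifs at h with h1
      cases h
      exact h1.choose_spec
    obtain ⟨s, t, h1, h2, h3, -, -, -, h4⟩ := (key x y hx).orb_eq
    obtain ⟨s', t', h1', h2', h3', -, -, -, h4'⟩ := (key x' y' hx').orb_eq
    have : t = t' := orb_inj hm h4.1 h4.2 h4'.1 h4'.2 (by rw [← h2, ← h2', hyy])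
    subst this
    rw [h1, h1', h3.symm.unique hm h3'.symm]

theorem ord_eq_some (hm : 1 < m) {S T : Letters m k} {x y : ℤ} :
    (ord hm S T).toFun x = some y ↔ Corr S T x y := by
  classical
  change (if h : _ then _ else _) = _ ↔ _
  split_ifs with h
  · rw [Option.some_inj]
    exact ⟨fun h' => h' ▸ h.choose_spec, fun h' => h.choose_spec.unique hm h'⟩
  · simp only [false_iff]
    exact fun h' => h ⟨y, h'⟩

theorem dom_ord (hm : 1 < m) (S T : Letters m k) : (ord hm S T).dom = S.1 := by
  ext x
  constructor
  · rintro ⟨y, hy⟩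
    exact ((ord_eq_some hm).1 hy).mem
  · intro hx
    obtain ⟨y, hy⟩ := Corr.exists hm S T hx
    exact ⟨y, (ord_eq_some hm).2 hy⟩

theorem im_ord (hm : 1 < m) (S T : Letters m k) : (ord hm S T).im = T.1 := by
  ext y
  constructor
  · rintro ⟨x, hy⟩
    exact ((ord_eq_some hm).1 hy).symm.mem
  · intro hy
    obtain ⟨x, hx⟩ := Corr.exists hm T S hy
    exact ⟨x, (ord_eq_some hm).2 hx.symm⟩

theorem ord_apply (hm : 1 < m) {S T : Letters m k} {x y : ℤ} (h1 : 1 ≤ x) (h2 : x ≤ m - 1) :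
    (ord hm S T).toFun x = some y ↔ x ∈ S.1 ∧ y ∈ T.1 ∧ 1 ≤ y ∧ y ≤ m - 1 ∧
      lev T.1 y = lev S.1 x := by
  rw [ord_eq_some]
  constructor
  · intro h
    obtain ⟨g, hg, s, hs, t, ht, h3, h4, h5, rfl, rfl⟩ := id h
    have := orb_inj hm h1 h2 h3.1 h3.2 (orb_apply hg s)
    have hg1 : g = 1 := reflGroup_free hg (one_mem _) (i := s) this
    subst hg1
    exact ⟨hs, ht, h4.1, h4.2, h5⟩
  · rintro ⟨h3, h4, h5, h6, h7⟩
    exact ⟨1, one_mem _, x, h3, y, h4, ⟨h1, h2⟩, ⟨h5, h6⟩, h7, rfl, rfl⟩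

theorem isCrit_ord (hm : 1 < m) (S T : Letters m k) : (ord hm S T).IsCrit 0 := by
  intro x y h1 h2 h
  rw [dom_ord, im_ord]
  obtain ⟨h3, h4, h5, h6, h7⟩ := (ord_apply hm h1 h2).1 h
  exact ⟨y, h5, h6, h7, by simp⟩

theorem Corr.lt (hm : 1 < m) {S T : Letters m k} {x y x' y' : ℤ} (h : Corr S T x y)
    (h' : Corr S T x' y') (hlt : x < x') : y < y' := by
  obtain ⟨g, hg, s, hs, t, ht, h1, h2, h3, rfl, rfl⟩ := h
  obtain ⟨g', hg', s', hs', t', ht', h1', h2', h3', rfl, rfl⟩ := h'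
  have key : ∀ {s s' t t' : ℤ}, t ∈ T.1 → s' ∈ S.1 → 1 ≤ s' → lev T.1 t = lev S.1 s →
      lev T.1 t' = lev S.1 s' → s < s' → t < t' := by
    intro s s' t t' ht hs' h1 h3 h3' hss
    refine lt_of_lev_lt (S := T.1) ?_
    rw [h3, h3', lev_of_mem hs' h1]
    have := lev_mono S.1 (show s ≤ s' - 1 by omega)
    omega
  rcases reflGroup_form hg with ⟨n, hn⟩ | ⟨n, hn⟩ <;>
    rcases reflGroup_form hg' with ⟨n', hn'⟩ | ⟨n', hn'⟩ <;>
    rw [hn, hn'] at hlt ⊢ <;>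
    have e : (n' - n) * (2 * (m : ℤ) - 2) = n' * (2 * m - 2) - n * (2 * m - 2) := by ring
  all_goals rcases mul_period_cases hm (n' - n) with h0 | h0 | h0
  all_goals try rw [h0, zero_mul] at e
  all_goals try omega
  · obtain rfl : n = n' := by omega
    have := key ht hs' h1'.1 h3 h3' (by omega)
    omega
  · obtain rfl : n = n' := by omega
    have := key ht' hs h1.1 h3' h3 (by omega)
    omega

theorem cross_ord (hm : 1 < m) (S T : Letters m k) : (ord hm S T).cross = 0 := by
  rw [cross_eq_zero_iff hm]
  rintro x x' ⟨y, y', h, h', hlt⟩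
  rw [ord_eq_some] at h h'
  rcases hlt with ⟨h1, h2⟩ | ⟨h1, h2⟩
  · have := h.lt hm h' h1
    omega
  · have := h'.lt hm h h1
    omega

theorem _root_.PongAlgebra.LiftedPartialPerm.weight_of_cross_eq_zero (hm : 1 < m)
    {f : LiftedPartialPerm m k} (hf : f.cross = 0) (j : Fin m) :
    f.weight j = |(lev f.dom (j : ℕ) : ℚ) - lev f.im (j : ℕ)| / 2 := by
  rw [cross_eq_zero_iff hm] at hf
  have h1 := f.up_sub_down hm (x := (j : ℕ)) (y := (j : ℕ)) (by positivity) (by positivity)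
  have h2 : f.up (j : ℕ) (j : ℕ) = 0 ∨ f.down (j : ℕ) (j : ℕ) = 0 := by
    by_contra hc
    push Not at hc
    obtain ⟨hu, hd⟩ := hc
    have hu' : (f.upSet (j : ℕ) (j : ℕ)).Nonempty :=
      Set.nonempty_of_ncard_ne_zero fun h => hu (by simp [up, h])
    have hd' : (f.downSet (j : ℕ) (j : ℕ)).Nonempty :=
      Set.nonempty_of_ncard_ne_zero fun h => hd (by simp [down, h])
    obtain ⟨x, hx, a, ha, hxa⟩ := hu'
    obtain ⟨y, hy, b, hb, hyb⟩ := hd'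
    exact hf x y ⟨a, b, ha, hb, Or.inl ⟨by omega, by omega⟩⟩
  have h0 := f.up_nonneg (j : ℕ) (j : ℕ)
  have h0' : 0 ≤ f.down (j : ℕ) (j : ℕ) := by simp [down]
  have h3 : f.up (j : ℕ) (j : ℕ) - f.down (j : ℕ) (j : ℕ)
    = (lev f.dom (j : ℕ) : ℚ) - lev f.im (j : ℕ) := by exact_mod_cast h1
  rw [weight_eq_up hm, ← h3]
  have q0 : (0 : ℚ) ≤ f.up (j : ℕ) (j : ℕ) := by exact_mod_cast h0
  have q0' : (0 : ℚ) ≤ f.down (j : ℕ) (j : ℕ) := by exact_mod_cast h0'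
  rcases h2 with h2 | h2 <;> rw [h2] at * <;> push_cast at *
  · rw [abs_of_nonpos (by linarith)]; ring
  · rw [abs_of_nonneg (by linarith)]; ring

theorem weight_ord (hm : 1 < m) (S T : Letters m k) (j : Fin m) :
    (ord hm S T).weight j = |(lev S.1 (j : ℕ) : ℚ) - lev T.1 (j : ℕ)| / 2 := by
  rw [weight_of_cross_eq_zero hm (cross_ord hm S T), dom_ord, im_ord]

theorem composable_ord (hm : 1 < m) (S T V : Letters m k) :
    (ord hm T V).Composable (ord hm S T) := by
  rw [composable_iff, dom_ord, im_ord]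

theorem ord_comp_ord (hm : 1 < m) (S T V : Letters m k) :
    (ord hm T V).comp (ord hm S T) (composable_ord hm S T V) = ord hm S V := by
  refine IsCrit.ext hm (n := 0) ?_ (isCrit_ord hm S V) ?_ ?_
  · intro x y h1 h2 h
    rw [dom_comp, im_comp, dom_ord, im_ord]
    obtain ⟨z, hz, h⟩ := comp_eq_some.1 h
    obtain ⟨h3, h4, h5, h6, h7⟩ := (ord_apply hm h1 h2).1 hz
    obtain ⟨h3', h4', h5', h6', h7'⟩ := (ord_apply hm h5 h6).1 h
    exact ⟨y, h5', h6', h7'.trans h7, by simp⟩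
  · rw [dom_comp, dom_ord, dom_ord]
  · rw [im_comp, im_ord, im_ord]

theorem ord_self (hm : 1 < m) (T : Letters m k) : ord hm T T = idOn T.1 T.2.1 T.2.2 := by
  refine ext_some fun x y => ?_
  have hid := isId_idOn (hT := T.2.1) (hk := T.2.2)
  rw [ord_eq_some]
  constructor
  · rintro ⟨g, hg, s, hs, t, ht, h1, h2, h3, rfl, rfl⟩
    obtain rfl := eq_of_lev_eq hs h1.1 ht h2.1 h3.symm
    refine hid.dom_eq ?_
    rw [dom_idOn]
    exact (T.2.1 g hg s).2 hs
  · intro h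
    have hx : x ∈ T.1 := by
      rw [← dom_idOn (hT := T.2.1) (hk := T.2.2)]
      exact ⟨y, h⟩
    obtain rfl := hid.eq h
    obtain ⟨g, hg, s, hs, h1, h2, rfl⟩ := T.exists_rep hm hx
    exact ⟨g, hg, s, hs, s, hs, ⟨h1, h2⟩, ⟨h1, h2⟩, rfl, rfl, rfl⟩

end Letters

namespace Pong

variable {m k : ℕ}

theorem mulPure_ord (hm : 1 < m) (S T V : Letters m k) :
    ∃ a : Fin m →₀ ℕ, mulPure (Letters.ord hm T V) (Letters.ord hm S T)
        = pure (Letters.ord hm S V) a ∧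
      ∀ i, (Letters.ord hm S V).weight i + a i
        = (Letters.ord hm S T).weight i + (Letters.ord hm T V).weight i := by
  have h := Letters.composable_ord hm S T V
  refine ⟨_, by rw [mulPure, dif_pos h, Letters.ord_comp_ord, if_pos]; simp [Letters.cross_ord],
    fun i => ?_⟩
  have := weight_comp hm h i
  rw [Letters.ord_comp_ord] at this
  rw [exponentOf_apply (i := i) (n := {x | x ∈ (Letters.ord hm S T).sepSet (i : ℕ) ∧
    ∃ b, (Letters.ord hm S T).toFun x = some b ∧
      b ∈ (Letters.ord hm T V).sepSet (i : ℕ)}.ncard) (by rw [this]; ring), this]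

end Pong

open LiftedPartialPerm

namespace Letters

variable {m k : ℕ}

/-- The last element of `T` in the fundamental domain. -/
def last (hm : 1 < m) (hk : 0 < k) (T : Letters m k) : ℤ :=
  (T.exists_lev_eq hm (i := k) (by omega) le_rfl).choose

theorem last_spec (hm : 1 < m) (hk : 0 < k) (T : Letters m k) :
    T.last hm hk ∈ T.1 ∧ 1 ≤ T.last hm hk ∧ T.last hm hk ≤ m - 1 ∧ lev T.1 (T.last hm hk) = k :=
  (T.exists_lev_eq hm (i := k) (by omega) le_rfl).choose_spec

theorem composable_move_ord (hm : 1 < m) (S T : Letters m k) {i c : ℤ} (hc : IsShift m i c) :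
    (move T i c hc).Composable (ord hm S T) := by
  rw [composable_iff, dom_move, im_ord]

/-- The order-preserving map from `S` to `T`, followed by `n` negative periods of the last
letter. -/
def crit (hm : 1 < m) (hk : 0 < k) (S T : Letters m k) (n : ℕ) : LiftedPartialPerm m k :=
  (move T (T.last hm hk) (-n * (2 * m - 2)) (isShift_mul _ _ _)).comp (ord hm S T)
    (composable_move_ord hm S T _)

variable {hm : 1 < m} {hk : 0 < k} {S T : Letters m k} {n : ℕ}

theorem dom_crit : (crit hm hk S T n).dom = S.1 := by rw [crit, dom_comp, dom_ord]

theorem im_crit : (crit hm hk S T n).im = T.1 := by rw [crit, im_comp, im_move]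

theorem crit_eq_some {x a : ℤ} : (crit hm hk S T n).toFun x = some a ↔
    ∃ u, (ord hm S T).toFun x = some u ∧
      a = u + direction m (T.last hm hk) u * (-n * (2 * m - 2)) := by
  rw [crit, comp_eq_some]
  refine exists_congr fun u => and_congr_right fun hu => ?_
  rw [move_eq_some]
  refine and_iff_right ?_
  rw [← im_ord hm S T]
  exact ⟨x, hu⟩

theorem direction_last {t : ℤ} (ht : t ∈ T.1) (h1 : 1 ≤ t) (h2 : t ≤ m - 1) :
    direction m (T.last hm hk) t = if lev T.1 t = k then 1 else 0 := by
  obtain ⟨h3, h4, h5, h6⟩ := T.last_spec hm hk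
  split_ifs with h
  · rw [eq_of_lev_eq ht h1 h3 h4 (h.trans h6.symm), direction_self]
  · exact direction_of_orb_ne fun h' => h (by rw [orb_inj hm h1 h2 h4 h5 h', h6])

theorem isCrit_crit : (crit hm hk S T n).IsCrit n := by
  intro x y h1 h2 h
  rw [dom_crit, im_crit]
  obtain ⟨t, ht, rfl⟩ := crit_eq_some.1 h
  obtain ⟨h3, h4, h5, h6, h7⟩ := (ord_apply hm h1 h2).1 ht
  refine ⟨t, h5, h6, h7, ?_⟩
  rw [direction_last h4 h5 h6, h7]
  split_ifs <;> ring

theorem eq_crit {f : LiftedPartialPerm m k} (h : f.IsCrit n) (hd : f.dom = S.1) (hi : f.im = T.1) :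
    f = crit hm hk S T n :=
  h.ext hm isCrit_crit (by rw [hd, dom_crit]) (by rw [hi, im_crit])

theorem crit_zero : crit hm hk S T 0 = ord hm S T :=
  (eq_crit (by exact_mod_cast isCrit_ord hm S T) (dom_ord hm S T) (im_ord hm S T)).symm

theorem composable_trans {f : LiftedPartialPerm m k} (hi : f.im = T.1) (i : ℤ) :
    (trans T i).Composable f := by
  rw [composable_iff, LiftedPartialPerm.trans, dom_move, hi]

theorem trans_comp_crit : (trans T (1 - T.last hm hk)).comp (crit hm hk S T n)
    (composable_trans im_crit _) = crit hm hk S T (n + 1) := by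
  refine ext_some fun x a => ?_
  rw [comp_eq_some, crit_eq_some]
  constructor
  · rintro ⟨b, hb, ha⟩
    obtain ⟨u, hu, rfl⟩ := crit_eq_some.1 hb
    obtain ⟨-, rfl⟩ := move_eq_some.1 ha
    refine ⟨u, hu, ?_⟩
    rw [direction_reflect_left, ← mul_assoc, direction_add]
    push_cast
    ring
  · rintro ⟨u, hu, rfl⟩
    have hb : (crit hm hk S T n).toFun x = some _ := crit_eq_some.2 ⟨u, hu, rfl⟩
    refine ⟨_, hb, move_eq_some.2 ⟨?_, ?_⟩⟩
    · rw [← im_crit (hm := hm) (hk := hk) (S := S) (n := n)]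
      exact ⟨x, hb⟩
    · rw [direction_reflect_left, ← mul_assoc, ← mul_assoc, direction_add]
      push_cast
      ring

theorem cross_trans_comp_crit : ((trans T (1 - T.last hm hk)).comp (crit hm hk S T n)
    (composable_trans im_crit _)).cross
      = (trans T (1 - T.last hm hk)).cross + (crit hm hk S T n).cross := by
  have hN : (0 : ℤ) ≤ 2 * m - 2 := by omega
  refine cross_comp_of_move hm _ (cross_ord hm S T) (i := T.last hm hk)
    (c := -n * (2 * m - 2)) (c' := -(n + 1 : ℕ) * (2 * m - 2)) (Or.inr ⟨?_, ?_⟩)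
    (fun x a h => crit_eq_some.1 h) fun x a h => ?_
  · push_cast
    nlinarith
  · nlinarith
  · rw [trans_comp_crit] at h
    exact crit_eq_some.1 h

/-- The only factor of a critical map of rank `n + 1` by a translation that has rank at most `n`
at the left wall is the critical map of rank `n`. -/
theorem eq_of_trans_comp_eq_crit {f : LiftedPartialPerm m k} (hd : f.dom = S.1)
    (hi : f.im = T.1) (hf : f.up 0 0 ≤ n) {i : ℤ} (hib : i ∈ base T)
    (h : (trans T i).comp f (composable_trans hi i) = crit hm hk S T (n + 1)) :
    i = 1 - T.last hm hk ∧ f = crit hm hk S T n := by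
  obtain ⟨h1, h2, h3, h4⟩ := T.last_spec hm hk
  have value : ∀ s t : ℤ, (ord hm S T).toFun s = some t → f.toFun s = some (t +
      direction m (T.last hm hk) t * (-(n + 1 : ℕ) * (2 * m - 2)) -
        direction m i t * (2 * m - 2)) := by
    intro s t hst
    have h5 : (crit hm hk S T (n + 1)).toFun s = some _ := crit_eq_some.2 ⟨t, hst, rfl⟩
    rw [← h, comp_eq_some] at h5
    obtain ⟨u, hu, hut⟩ := h5
    obtain ⟨-, hut⟩ := move_eq_some.1 hut
    rw [hu]
    congr 1
    have : direction m i u = direction m i t := by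
      have e : u = t + (direction m (T.last hm hk) t * -(n + 1 : ℕ) - direction m i u)
          * (2 * m - 2) := by linarith
      have e' := direction_add m i t (direction m (T.last hm hk) t * -(n + 1 : ℕ)
        - direction m i u)
      rwa [← e] at e'
    rw [← this]
    linarith
  obtain ⟨s, hs, hs1, hsm, hsk⟩ := S.exists_lev_eq hm (i := k) (by omega) le_rfl
  have hst : (ord hm S T).toFun s = some (T.last hm hk) :=
    (ord_apply hm hs1 hsm).2 ⟨hs, h1, h2, h3, by omega⟩
  have hlast := value s _ hst
  rw [direction_self] at hlast
  have hup := le_up_of_translate hm (f := f) (t := T.last hm hk)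
    (n := n + 1 + direction m i (T.last hm hk)) h3 hs1
    (by rw [hlast]; congr 1; push_cast; ring) le_rfl (by omega : (0 : ℤ) ≤ m - 1)
  have hi1 : i = 1 - T.last hm hk := by
    have hb := (mem_base.1 hib).1
    rcases direction_cases m i (T.last hm hk) with ⟨l, hl, h'⟩ | ⟨l, hl, h'⟩ | ⟨h0, h'⟩
    · omega
    · rcases mul_period_cases hm l with rfl | h5 | h5 <;> omega
    · omega
  refine ⟨hi1, eq_crit (fun x y hx hxm hxy => ?_) hd hi⟩
  have hxS : x ∈ S.1 := by rw [← hd]; exact ⟨y, hxy⟩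
  obtain ⟨t, ht, ht1, htm, htl⟩ := T.exists_lev_eq hm (S.lev_pos hxS hx) (S.lev_le hm hxm)
  refine ⟨t, ht1, htm, by rw [hd, hi, htl], ?_⟩
  have h6 := value x t ((ord_apply hm hx hxm).2 ⟨hxS, ht, ht1, htm, htl⟩)
  rw [hxy, hi1, direction_reflect_left, direction_last ht ht1 htm] at h6
  rw [Option.some.inj h6, hd, htl]
  split_ifs <;> push_cast <;> ring

end Letters

namespace PongOne

variable {m k : ℕ}

open Classical in
theorem of_apply (f g : LiftedPartialPerm m k) : of f g = if f = g then 1 else 0 :=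
  Finsupp.single_apply

open Classical in
theorem sum_trans_mul_of (hm : 1 < m) {T : Letters m k} {f : LiftedPartialPerm m k}
    (hi : f.im = T.1) :
    mul m k (∑ T ∈ allLetters hm, ∑ i ∈ base T, of (trans T i)) (of f) = ∑ i ∈ base T,
      if ((trans T i).comp f (Letters.composable_trans hi i)).cross
        = (trans T i).cross + f.cross then
      of ((trans T i).comp f (Letters.composable_trans hi i)) else 0 := by
  rw [map_sum, LinearMap.sum_apply, Finset.sum_eq_single T]
  · rw [map_sum, LinearMap.sum_apply]
    refine Finset.sum_congr rfl fun i _ => ?_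
    rw [mul_of, mulOf, dif_pos (Letters.composable_trans hi i)]
  · intro T' _ hne
    rw [map_sum, LinearMap.sum_apply]
    refine Finset.sum_eq_zero fun i _ => ?_
    rw [mul_of, mulOf, dif_neg]
    rw [composable_iff, LiftedPartialPerm.trans, dom_move, hi]
    exact fun h => hne (Subtype.ext h)
  · exact fun h => absurd (mem_allLetters hm T) h

/-- The sum of all translations shifts critical coefficients. -/
theorem sum_trans_mul_apply_crit {hm : 1 < m} {hk : 0 < k} {S T : Letters m k} {n : ℕ}
    {X : Set (LiftedPartialPerm m k)}
    (hX : ∀ f ∈ X, f.dom = S.1 ∧ f.im = T.1 ∧ f.up 0 0 ≤ n) {z : PongOne m k} (hz : z ∈ Supp X) :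
    mul m k (∑ T ∈ allLetters hm, ∑ i ∈ base T, of (trans T i)) z (Letters.crit hm hk S T (n + 1))
      = z (Letters.crit hm hk S T n) := by
  classical
  refine supp_induction (p := fun z => mul m k (∑ T ∈ allLetters hm, ∑ i ∈ base T, of (trans T i))
    z (Letters.crit hm hk S T (n + 1)) = z (Letters.crit hm hk S T n)) ?_ ?_ ?_ z hz
  · rw [map_zero]; rfl
  · intro x y hx hy
    rw [map_add, Finsupp.add_apply, Finsupp.add_apply, hx, hy]
  · intro f hf
    obtain ⟨hd, hi, hu⟩ := hX f hf
    have hlast := T.last_spec hm hk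
    rw [sum_trans_mul_of hm hi, Finsupp.finsetSum_apply,
      Finset.sum_eq_single (1 - T.last hm hk)]
    · by_cases hfc : f = Letters.crit hm hk S T n
      · subst hfc
        rw [if_pos Letters.cross_trans_comp_crit, Letters.trans_comp_crit, of_apply, of_apply,
          if_pos rfl, if_pos rfl]
      · have hne : ∀ (h : _), (trans T (1 - T.last hm hk)).comp f h
            ≠ Letters.crit hm hk S T (n + 1) := by
          intro h h'
          refine hfc (Letters.eq_of_trans_comp_eq_crit hd hi hu ?_ h').2
          refine mem_base.2 ⟨⟨by omega, by omega⟩, ?_⟩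
          have := T.2.1.sub_mem_iff (T.last hm hk) 0
          rw [zero_mul, add_zero] at this
          exact this.2 hlast.1
        rw [of_apply f, if_neg hfc]
        split_ifs
        · rw [of_apply, if_neg (hne _)]
        · rfl
    · intro i hib hne
      split_ifs
      · rw [of_apply, if_neg]
        exact fun h => hne (Letters.eq_of_trans_comp_eq_crit hd hi hu hib h).1
      · rfl
    · intro h
      refine absurd (mem_base.2 ⟨⟨by omega, by omega⟩, ?_⟩) h
      have := T.2.1.sub_mem_iff (T.last hm hk) 0
      rw [zero_mul, add_zero] at this
      exact this.2 hlast.1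

end PongOne

open LiftedPartialPerm

namespace Pong

variable {m k : ℕ}

theorem mul_mem_closure {A B C : Set (Pong m k)}
    (h : ∀ a ∈ A, ∀ b ∈ B, mul m k a b ∈ AddSubgroup.closure C) {x y : Pong m k}
    (hx : x ∈ AddSubgroup.closure A) (hy : y ∈ AddSubgroup.closure B) :
    mul m k x y ∈ AddSubgroup.closure C := by
  induction hx using AddSubgroup.closure_induction with
  | mem a ha =>
    induction hy using AddSubgroup.closure_induction with
    | mem b hb => exact h a ha b hb
    | zero => rw [map_zero]; exact zero_mem _
    | add b b' _ _ hb hb' => rw [map_add]; exact add_mem hb hb'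
    | neg b _ hb => rw [map_neg]; exact neg_mem hb
  | zero => rw [map_zero]; exact zero_mem _
  | add a a' _ _ ha ha' => rw [map_add]; exact add_mem ha ha'
  | neg a _ ha => rw [map_neg]; exact neg_mem ha

theorem mul_pure_pure (hm : 1 < m) (g f : LiftedPartialPerm m k) (b a : Fin m →₀ ℕ) :
    mul m k (pure g b) (pure f a) = 0 ∨ ∃ h : g.Composable f,
      (g.comp f h).cross = g.cross + f.cross ∧ ∃ c,
        mul m k (pure g b) (pure f a) = pure (g.comp f h) c ∧
        ∀ i, (g.comp f h).weight i + c i = (g.weight i + b i) + (f.weight i + a i) := by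
  rw [pure_eq_smul g, pure_eq_smul f, LinearMap.map_smul, LinearMap.map_smul, LinearMap.smul_apply,
    mul_pure]
  by_cases h : g.Composable f
  · by_cases h' : (g.comp f h).cross = g.cross + f.cross
    · refine Or.inr ⟨h, h', _, by rw [mulPure, dif_pos h, if_pos h', smul_pure, smul_pure],
        fun i => ?_⟩
      have hw := weight_comp hm h i
      rw [Finsupp.add_apply, Finsupp.add_apply, exponentOf_apply (i := i)
        (n := {x | x ∈ f.sepSet (i : ℕ) ∧ ∃ b, f.toFun x = some b ∧
          b ∈ g.sepSet (i : ℕ)}.ncard) (by rw [hw]; ring)]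
      push_cast
      linarith
    · exact Or.inl (by rw [mulPure, dif_pos h, if_neg h', smul_zero, smul_zero])
  · exact Or.inl (by rw [mulPure, dif_neg h, smul_zero, smul_zero])

theorem mul_mem_bigraded (hm : 1 < m) {c c' c'' : ℕ} {w w' w'' : Fin m → ℚ} {x y : Pong m k}
    (hx : x ∈ bigraded m k c' w') (hy : y ∈ bigraded m k c w) (hc : c' + c = c'')
    (h : ∀ i, w' i + w i = w'' i) : mul m k x y ∈ bigraded m k c'' w'' := by
  refine mul_mem_closure ?_ hx hy
  rintro _ ⟨g, b, hg, hgw, rfl⟩ _ ⟨f, a, hf, hfw, rfl⟩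
  rcases mul_pure_pure hm g f b a with h0 | ⟨hcomp, hcross, e, h1, h2⟩
  · rw [h0]; exact zero_mem _
  · rw [h1]
    refine AddSubgroup.subset_closure ⟨_, e, by rw [hcross, hg, hf, hc], fun i => ?_, rfl⟩
    rw [h2, hgw, hfw, h]

theorem smul_mem_homPart {S T : Set ℤ} {w w' : Fin m → ℚ} {z : Pong m k}
    (hz : z ∈ homPart m k S T w) {a : Fin m →₀ ℕ} (h : ∀ i, w i + a i = w' i) :
    (MvPolynomial.monomial a (1 : ZMod 2)) • z ∈ homPart m k S T w' := by
  refine homPart_induction (p := fun z => (MvPolynomial.monomial a (1 : ZMod 2)) • z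
    ∈ homPart m k S T w') (by rw [smul_zero]; exact zero_mem _)
    (fun x y hx hy => by rw [smul_add]; exact add_mem hx hy) (fun f b hd hi hf => ?_) z hz
  rw [smul_pure]
  refine AddSubgroup.subset_closure ⟨f, _, hd, hi, fun i => ?_, rfl⟩
  rw [Finsupp.add_apply, ← h, ← hf]
  push_cast; ring

theorem smul_mem_bigraded {c : ℕ} {w w' : Fin m → ℚ} {z : Pong m k}
    (hz : z ∈ bigraded m k c w) {a : Fin m →₀ ℕ} (h : ∀ i, w i + a i = w' i) :
    (MvPolynomial.monomial a (1 : ZMod 2)) • z ∈ bigraded m k c w' := by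
  induction hz using AddSubgroup.closure_induction with
  | mem x hx =>
    obtain ⟨f, b, hc, hf, rfl⟩ := hx
    rw [smul_pure]
    refine AddSubgroup.subset_closure ⟨f, _, hc, fun i => ?_, rfl⟩
    rw [Finsupp.add_apply, ← h, ← hf]
    push_cast; ring
  | zero => rw [smul_zero]; exact zero_mem _
  | add x y _ _ hx hy => rw [smul_add]; exact add_mem hx hy
  | neg x _ hx => rw [smul_neg]; exact neg_mem hx

theorem diff_mem_homPart (hm : 1 < m) {S T : Set ℤ} {w : Fin m → ℚ} {z : Pong m k}
    (hz : z ∈ homPart m k S T w) : diff m k z ∈ homPart m k S T w := by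
  refine homPart_induction (p := fun z => diff m k z ∈ homPart m k S T w)
    (by rw [map_zero]; exact zero_mem _)
    (fun x y hx hy => by rw [map_add]; exact add_mem hx hy) (fun f b hd hi hf => ?_) z hz
  classical
  rw [pure_eq_smul, map_smul, diff_pure_zero]
  refine smul_mem_homPart (w := f.weight) ?_ hf
  rw [diffPure_eq hm]
  refine sum_mem fun c _ => ?_
  split_ifs
  · have hc : c.toClass ∈ f.crossSet := by rw [← Crossing.range_toClass]; exact ⟨c, rfl⟩
    refine AddSubgroup.subset_closure ⟨_, _, ?_, ?_, fun i => ?_, rfl⟩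
    · rw [← res_toClass, dom_res_of_mem hc, hd]
    · rw [← res_toClass, im_res_of_mem hc, hi]
    · obtain ⟨n, hn⟩ := weight_res hm hc i
      rw [res_toClass] at hn
      rw [exponentOf_apply (i := i) (n := n) (by rw [hn]; ring), hn]
  · exact zero_mem _

theorem Omega_mem_closure (hm : 1 < m) : Omega m k ∈ AddSubgroup.closure
    {z | ∃ (T : Letters m k) (i : ℤ), i ∈ T.1 ∧ z = pure (trans T i) 0} := by
  rw [Omega_eq hm]
  exact sum_mem fun T _ => sum_mem fun i hi =>
    AddSubgroup.subset_closure ⟨T, i, (mem_base.1 hi).2, rfl⟩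

theorem Omega_mul_mem_homPart (hm : 1 < m) {S T : Set ℤ} {w w' : Fin m → ℚ} {y : Pong m k}
    (hy : y ∈ homPart m k S T w) (h : ∀ i, 1 + w i = w' i) :
    mul m k (Omega m k) y ∈ homPart m k S T w' := by
  refine mul_mem_closure ?_ (Omega_mem_closure hm) hy
  rintro _ ⟨V, i, hi, rfl⟩ _ ⟨f, a, hf, hf', hfw, rfl⟩
  rcases mul_pure_pure hm (trans V i) f 0 a with h0 | ⟨hc, -, c, h1, h2⟩
  · rw [h0]; exact zero_mem _
  · rw [h1]
    refine AddSubgroup.subset_closure ⟨_, c, by rw [dom_comp, hf], ?_, fun i => ?_, rfl⟩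
    · have := composable_iff.1 hc
      rw [LiftedPartialPerm.trans, dom_move] at this
      rw [im_comp, LiftedPartialPerm.trans, im_move, this, hf']
    · rw [h2, hfw, weight_trans hm hi, ← h]
      simp

theorem mul_Omega_mem_homPart (hm : 1 < m) {S T : Set ℤ} {w w' : Fin m → ℚ} {y : Pong m k}
    (hy : y ∈ homPart m k S T w) (h : ∀ i, 1 + w i = w' i) :
    mul m k y (Omega m k) ∈ homPart m k S T w' := by
  refine mul_mem_closure ?_ hy (Omega_mem_closure hm)
  rintro _ ⟨f, a, hf, hf', hfw, rfl⟩ _ ⟨V, i, hi, rfl⟩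
  rcases mul_pure_pure hm f (trans V i) a 0 with h0 | ⟨hc, -, c, h1, h2⟩
  · rw [h0]; exact zero_mem _
  · rw [h1]
    refine AddSubgroup.subset_closure ⟨_, c, ?_, by rw [im_comp, hf'], fun i => ?_, rfl⟩
    · have := composable_iff.1 hc
      rw [LiftedPartialPerm.trans, im_move] at this
      rw [dom_comp, LiftedPartialPerm.trans, dom_move, ← this, hf]
    · rw [h2, hfw, weight_trans hm hi, ← h]
      simp [add_comm]

/-- The element `Ω^n e`, where `e` is the order-preserving map from `S` to `T`. -/
def omegaOrd (hm : 1 < m) (n : ℕ) (S T : Letters m k) : Pong m k :=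
  (mul m k (Omega m k))^[n] (pure (Letters.ord hm S T) 0)

/-- The weight of `Ω^n e`. -/
def omegaWeight (n : ℕ) (S T : Letters m k) (i : Fin m) : ℚ :=
  n + |(lev S.1 (i : ℕ) : ℚ) - lev T.1 (i : ℕ)| / 2

variable {hm : 1 < m} {S T : Letters m k} {n : ℕ}

theorem omegaOrd_zero : omegaOrd hm 0 S T = pure (Letters.ord hm S T) 0 := rfl

theorem omegaOrd_succ : omegaOrd hm (n + 1) S T = mul m k (Omega m k) (omegaOrd hm n S T) :=
  Function.iterate_succ_apply' _ _ _

theorem omegaOrd_mem : omegaOrd hm n S T ∈ homPart m k S.1 T.1 (omegaWeight n S T) := by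
  induction n with
  | zero =>
    refine AddSubgroup.subset_closure ⟨_, 0, Letters.dom_ord hm S T, Letters.im_ord hm S T,
      fun i => ?_, rfl⟩
    rw [Letters.weight_ord, omegaWeight]
    simp
  | succ n ih =>
    rw [omegaOrd_succ]
    refine Omega_mul_mem_homPart hm ih fun i => ?_
    rw [omegaWeight, omegaWeight]
    push_cast
    ring

theorem omegaOrd_mem_bigraded : omegaOrd hm n S T ∈ bigraded m k (2 * k * n)
    (omegaWeight n S T) := by
  induction n with
  | zero =>
    refine AddSubgroup.subset_closure ⟨_, 0, Letters.cross_ord hm S T, fun i => ?_, rfl⟩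
    rw [Letters.weight_ord, omegaWeight]
    simp
  | succ n ih =>
    rw [omegaOrd_succ]
    refine mul_mem_bigraded hm (Omega_mem_bigraded hm) ih (by ring) fun i => ?_
    rw [omegaWeight, omegaWeight]
    push_cast
    ring

theorem diff_omegaOrd : diff m k (omegaOrd hm n S T) = 0 := by
  induction n with
  | zero =>
    rw [omegaOrd_zero]
    have h : spec m k (diff m k (pure (Letters.ord hm S T) 0)) = 0 := by
      rw [spec_diff hm, spec_pure, PongOne.diff_of,
        PongOne.diffOf_eq_zero hm (Letters.cross_ord hm S T)]
    refine eq_of_spec_eq (diff_mem_weightHom hm (pure_mem_self _)) (zero_mem _) ?_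
    rw [h, map_zero]
  | succ n ih =>
    rw [omegaOrd_succ, (isDGAlgebra hm).leibniz, diff_Omega hm, ih]
    simp

theorem spec_omegaOrd_mem : spec m k (omegaOrd hm n S T) ∈
    PongOne.Supp {f : LiftedPartialPerm m k | f.dom = S.1 ∧ f.im = T.1 ∧ f.up 0 0 ≤ n} := by
  refine homPart_induction (p := fun z => spec m k z ∈ PongOne.Supp
    {f : LiftedPartialPerm m k | f.dom = S.1 ∧ f.im = T.1 ∧ f.up 0 0 ≤ n})
    (by rw [map_zero]; exact zero_mem _) (fun x y hx hy => by rw [map_add]; exact add_mem hx hy)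
    (fun f a hd hi hw => ?_) _ omegaOrd_mem
  rw [spec_pure]
  refine PongOne.of_mem_supp ⟨hd, hi, ?_⟩
  have h := hw ⟨0, by omega⟩
  rw [weight_eq_up hm, omegaWeight] at h
  simp only [Nat.cast_zero, lev_zero] at h
  simp only [Int.cast_zero, sub_zero, zero_div, abs_zero, add_zero] at h
  have h' : f.up 0 0 + a ⟨0, by omega⟩ = n := by exact_mod_cast h
  omega

theorem spec_omegaOrd_crit {hk : 0 < k} :
    spec m k (omegaOrd hm n S T) (Letters.crit hm hk S T n) = 1 := by
  classical
  induction n with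
  | zero =>
    rw [omegaOrd_zero, spec_pure, Letters.crit_zero, PongOne.of_apply, if_pos rfl]
  | succ n ih =>
    rw [omegaOrd_succ, spec_mul, spec_Omega hm,
      PongOne.sum_trans_mul_apply_crit (fun f hf => hf) spec_omegaOrd_mem, ih]

theorem le_up_crit {hk : 0 < k} : (n : ℤ) ≤ (Letters.crit hm hk S T n).up 0 0 := by
  obtain ⟨h1, h2, h3, h4⟩ := T.last_spec hm hk
  obtain ⟨s, hs, hs1, hsm, hsk⟩ := S.exists_lev_eq hm (i := k) (by omega) le_rfl
  have hst : (Letters.ord hm S T).toFun s = some (T.last hm hk) :=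
    (Letters.ord_apply hm hs1 hsm).2 ⟨hs, h1, h2, h3, by omega⟩
  refine le_up_of_translate hm (t := T.last hm hk) h3 hs1 ?_ le_rfl (by omega)
  rw [Letters.crit_eq_some]
  refine ⟨_, hst, ?_⟩
  rw [direction_self]
  ring

theorem spec_omegaOrd_crit_of_lt {hk : 0 < k} {n' : ℕ} (h : n < n') :
    spec m k (omegaOrd hm n S T) (Letters.crit hm hk S T n') = 0 := by
  by_contra hc
  have h1 := spec_omegaOrd_mem (hm := hm) (S := S) (T := T) (n := n) (Finsupp.mem_support_iff.2 hc)
  have h2 := h1.2.2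
  have h3 := le_up_crit (hm := hm) (hk := hk) (S := S) (T := T) (n := n')
  omega

end Pong

open LiftedPartialPerm

namespace Pong

variable {m k : ℕ} {hm : 1 < m} {hk : 0 < k} {S T : Letters m k} {n : ℕ}

theorem spec_mem_of_homPart {S T : Set ℤ} {w : Fin m → ℚ} {z : Pong m k}
    (hz : z ∈ homPart m k S T w) : spec m k z ∈ PongOne.Supp {f : LiftedPartialPerm m k |
      f.dom = S ∧ f.im = T ∧ ∃ b : Fin m →₀ ℕ, ∀ i, f.weight i + b i = w i} := by
  refine homPart_induction (p := fun z => spec m k z ∈ PongOne.Supp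
    {f : LiftedPartialPerm m k | f.dom = S ∧ f.im = T ∧
      ∃ b : Fin m →₀ ℕ, ∀ i, f.weight i + b i = w i})
    (by rw [map_zero]; exact zero_mem _) (fun x y hx hy => by rw [map_add]; exact add_mem hx hy)
    (fun f a hd hi hw => ?_) _ hz
  rw [spec_pure]
  exact PongOne.of_mem_supp ⟨hd, hi, a, hw⟩

variable (hm hk S T n) in
theorem exists_weight_crit : ∃ b : Fin m →₀ ℕ,
    ∀ i, (Letters.crit hm hk S T n).weight i + b i = omegaWeight n S T i := by
  have h := spec_mem_of_homPart (omegaOrd_mem (hm := hm) (S := S) (T := T) (n := n))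
    (Finsupp.mem_support_iff.2 (by rw [spec_omegaOrd_crit (hm := hm) (hk := hk)]; exact one_ne_zero))
  exact h.2.2

theorem coeff_smul_of_homPart {S T : Set ℤ} {w w' : Fin m → ℚ} {z : Pong m k}
    (hz : z ∈ homPart m k S T w) {a b : Fin m →₀ ℕ} (h : ∀ i, w i + a i = w' i)
    {f : LiftedPartialPerm m k} (hb : ∀ i, f.weight i + b i = w' i) :
    coeff f b ((MvPolynomial.monomial a (1 : ZMod 2)) • z) = spec m k z f := by
  rw [coeff_eq_spec (homPart_le (smul_mem_homPart hz h)) hb, spec_smul]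
  simp [MvPolynomial.eval_monomial]

theorem coeff_eq_zero_of_homPart {S T : Set ℤ} {w : Fin m → ℚ} {z : Pong m k}
    (hz : z ∈ homPart m k S T w) {f : LiftedPartialPerm m k} {b : Fin m →₀ ℕ}
    (h : ¬ (f.dom = S ∧ f.im = T ∧ ∀ i, f.weight i + b i = w i)) : coeff f b z = 0 := by
  classical
  refine homPart_induction (p := fun z => coeff f b z = 0) (map_zero _)
    (fun x y hx hy => by rw [map_add, hx, hy, add_zero]) (fun g c hd hi hw => ?_) z hz
  rw [coeff_pure, if_neg]
  rintro ⟨rfl, rfl⟩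
  exact h ⟨hd, hi, hw⟩

theorem le_of_good {w : Fin m → ℚ} {n' : ℕ} (hg : Good m k S.1 T.1 w n) {a : Fin m →₀ ℕ}
    (h : ∀ i, omegaWeight n' S T i + a i = w i) : n' ≤ n := by
  obtain ⟨q, h1, h2, h3⟩ := hg.1 0 (Nat.zero_le _)
  have h4 := h q
  rw [omegaWeight, h1, h2, h3, sub_self, abs_zero, zero_div, add_zero] at h4
  have h5 : n' + a q = n := by exact_mod_cast h4
  omega

theorem Good.unique {S T : Set ℤ} {w : Fin m → ℚ} {n n' : ℕ} (h : Good m k S T w n)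
    (h' : Good m k S T w n') : n = n' := by
  have key : ∀ {n n' : ℕ}, Good m k S T w n → Good m k S T w n' → n ≤ n' := by
    intro n n' h h'
    obtain ⟨q, h1, h2, h3⟩ := h'.1 0 (Nat.zero_le _)
    have h4 := h.2 q
    rw [h3, h1, h2, sub_self, abs_zero, zero_div, add_zero] at h4
    exact_mod_cast h4
  exact le_antisymm (key h h') (key h' h)

theorem coeff_crit_smul_omegaOrd {w : Fin m → ℚ} {n' : ℕ} (hg : Good m k S.1 T.1 w n)
    {a b : Fin m →₀ ℕ} (h : ∀ i, omegaWeight n' S T i + a i = w i)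
    (hb : ∀ i, (Letters.crit hm hk S T n).weight i + b i = w i) :
    coeff (Letters.crit hm hk S T n) b
      ((MvPolynomial.monomial a (1 : ZMod 2)) • omegaOrd hm n' S T) = if n' = n then 1 else 0 := by
  rw [coeff_smul_of_homPart omegaOrd_mem h hb]
  split_ifs with hn
  · subst hn
    exact spec_omegaOrd_crit
  · exact spec_omegaOrd_crit_of_lt (lt_of_le_of_ne (le_of_good hg h) hn)

theorem eq_of_weight {f : LiftedPartialPerm m k} {a b : Fin m →₀ ℕ}
    {w : Fin m → ℚ} (ha : ∀ i, f.weight i + a i = w i) (hb : ∀ i, f.weight i + b i = w i) :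
    a = b := by
  ext i
  have : (a i : ℚ) = b i := by linarith [ha i, hb i]
  exact_mod_cast this

/-- A homogeneous cycle is a boundary if its critical coefficient vanishes. -/
theorem exists_boundary_of_coeff_crit (hm : 1 < m) (hk : 0 < k) {w : Fin m → ℚ} {z : Pong m k}
    (hz : z ∈ homPart m k S.1 T.1 w) (hd : diff m k z = 0)
    (h : ∀ (b : Fin m →₀ ℕ) (n : ℕ), Good m k S.1 T.1 w n →
      (∀ i, (Letters.crit hm hk S T n).weight i + b i = w i) →
      coeff (Letters.crit hm hk S T n) b z = 0) :
    ∃ y, diff m k y = z := by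
  refine exists_boundary hm hk hz hd fun f b n hfd hfi hw hg hcr => ?_
  obtain rfl := Letters.eq_crit (hm := hm) (hk := hk) hcr hfd hfi
  exact h b n hg hw

theorem diff_smul_omegaOrd (p : Base m) : diff m k (p • omegaOrd hm n S T) = 0 := by
  rw [LinearMap.map_smul, diff_omegaOrd, smul_zero]

theorem exists_boundary_of_not_good (hm : 1 < m) (hk : 0 < k) {a : Fin m →₀ ℕ}
    (h : ¬ Good m k S.1 T.1 (fun i => omegaWeight n S T i + a i) n) :
    ∃ y, diff m k y = (MvPolynomial.monomial a (1 : ZMod 2)) • omegaOrd hm n S T := by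
  refine exists_boundary_of_coeff_crit hm hk (smul_mem_homPart omegaOrd_mem fun i => rfl)
    (diff_smul_omegaOrd _) fun b n' hg hb => ?_
  rw [coeff_crit_smul_omegaOrd hg (fun i => rfl) hb, if_neg]
  rintro rfl
  exact h hg

theorem exists_exponent (hm : 1 < m) {w : Fin m → ℚ} (hg : Good m k S.1 T.1 w n)
    {f : LiftedPartialPerm m k} (hd : f.dom = S.1) (hi : f.im = T.1) {c : Fin m →₀ ℕ}
    (hc : ∀ i, f.weight i + c i = w i) :
    ∃ a : Fin m →₀ ℕ, ∀ i, omegaWeight n S T i + a i = w i := by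
  refine ⟨Finsupp.equivFunOnFinite.symm fun i => (f.up (i : ℕ) (i : ℕ) + c i - n -
    max (lev S.1 (i : ℕ) - lev T.1 (i : ℕ)) 0).toNat, fun i => ?_⟩
  rw [Finsupp.equivFunOnFinite_symm_apply_apply]
  have h1 := hg.2 i
  have h2 := hc i
  rw [weight_eq_up hm, hd, hi] at h2
  have hmax : |(lev S.1 (i : ℕ) : ℚ) - lev T.1 (i : ℕ)| / 2
      + ((lev S.1 (i : ℕ) : ℚ) - lev T.1 (i : ℕ)) / 2
      = (max (lev S.1 (i : ℕ) - lev T.1 (i : ℕ)) 0 : ℤ) := by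
    push_cast
    rcases le_total ((lev S.1 (i : ℕ) : ℚ) - lev T.1 (i : ℕ)) 0 with h | h
    · rw [max_eq_right h, abs_of_nonpos h]; ring
    · rw [max_eq_left h, abs_of_nonneg h]; ring
  obtain ⟨d, hd'⟩ : ∃ d : ℤ, d = max (lev S.1 (i : ℕ) - lev T.1 (i : ℕ)) 0 := ⟨_, rfl⟩
  rw [← hd'] at hmax ⊢
  have h3 : (0 : ℚ) ≤ (f.up (i : ℕ) (i : ℕ) + c i - n - d : ℤ) := by
    push_cast
    linarith
  have h4 : 0 ≤ f.up (i : ℕ) (i : ℕ) + c i - n - d := by exact_mod_cast h3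
  have h5 : ((f.up (i : ℕ) (i : ℕ) + c i - n - d).toNat : ℚ)
      = f.up (i : ℕ) (i : ℕ) + c i - n - d := by
    have : (((f.up (i : ℕ) (i : ℕ) + c i - n - d).toNat : ℤ) : ℚ)
      = (f.up (i : ℕ) (i : ℕ) + c i - n - d : ℤ) := by rw [Int.toNat_of_nonneg h4]
    push_cast at this
    exact this
  rw [omegaWeight, h5, ← h2]
  linarith

/-- A homogeneous cycle is homologous to zero or to some `v^a Ω^n e`. -/
theorem homPart_cycle (hm : 1 < m) (hk : 0 < k) {w : Fin m → ℚ} {z : Pong m k}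
    (hz : z ∈ homPart m k S.1 T.1 w) (hd : diff m k z = 0) :
    (∃ y, diff m k y = z) ∨ ∃ (n : ℕ) (a : Fin m →₀ ℕ) (y : Pong m k), diff m k y
      = z - (MvPolynomial.monomial a (1 : ZMod 2)) • omegaOrd hm n S T := by
  by_cases h0 : ∃ y, diff m k y = z
  · exact Or.inl h0
  right
  obtain ⟨b, n, hg, hb, hc⟩ : ∃ (b : Fin m →₀ ℕ) (n : ℕ), Good m k S.1 T.1 w n ∧
      (∀ i, (Letters.crit hm hk S T n).weight i + b i = w i) ∧
      coeff (Letters.crit hm hk S T n) b z ≠ 0 := by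
    by_contra hcon
    exact h0 (exists_boundary_of_coeff_crit hm hk hz hd fun b n hg hb => by
      by_contra hc
      exact hcon ⟨b, n, hg, hb, hc⟩)
  obtain ⟨a, ha⟩ := exists_exponent hm hg Letters.dom_crit Letters.im_crit hb
  refine ⟨n, a, exists_boundary_of_coeff_crit hm hk (sub_mem hz (smul_mem_homPart omegaOrd_mem ha))
    (by rw [map_sub, hd, diff_smul_omegaOrd, sub_zero]) fun b' n' hg' hb' => ?_⟩
  obtain rfl := hg.unique hg'
  obtain rfl := eq_of_weight hb hb'
  rw [map_sub, coeff_crit_smul_omegaOrd hg ha hb, if_pos rfl]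
  generalize coeff (Letters.crit hm hk S T n) b z = c at hc
  revert hc c
  decide

/-! ### Centrality -/

theorem ord_comp_trans : (Letters.ord hm S T).Composable (trans S (1 - S.last hm hk)) := by
  rw [composable_iff, Letters.dom_ord, LiftedPartialPerm.trans, im_move]

theorem isCrit_ord_comp_trans :
    ((Letters.ord hm S T).comp (trans S (1 - S.last hm hk)) ord_comp_trans).IsCrit 1 := by
  intro x y h1 h2 h
  obtain ⟨u, hu, huy⟩ := comp_eq_some.1 h
  obtain ⟨hx, rfl⟩ := move_eq_some.1 hu
  rw [direction_reflect_left, Letters.direction_last hx h1 h2] at huy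
  rw [dom_comp, im_comp, LiftedPartialPerm.trans, dom_move, Letters.im_ord]
  obtain ⟨t, ht, ht1, htm, htl⟩ := T.exists_lev_eq hm (S.lev_pos hx h1) (S.lev_le hm h2)
  have hxt : (Letters.ord hm S T).toFun x = some t :=
    (Letters.ord_apply hm h1 h2).2 ⟨hx, ht, ht1, htm, htl⟩
  refine ⟨t, ht1, htm, htl, ?_⟩
  obtain ⟨c, hc⟩ : ∃ c : ℤ, c = if lev S.1 x = k then 1 else 0 := ⟨_, rfl⟩
  rw [← hc] at huy
  have h3 := (Letters.ord hm S T).map_some (translation_mem m (-c)) hxt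
  simp only [Equiv.coe_addRight] at h3
  rw [show x + -c * (2 * m - 2) = x + -c * (2 * m - 2) from rfl, huy] at h3
  rw [Option.some.inj h3, hc]
  split_ifs <;> ring

theorem ord_comp_trans_eq : (Letters.ord hm S T).comp (trans S (1 - S.last hm hk)) ord_comp_trans
    = Letters.crit hm hk S T 1 := by
  refine Letters.eq_crit isCrit_ord_comp_trans ?_ ?_
  · rw [dom_comp, LiftedPartialPerm.trans, dom_move]
  · rw [im_comp, Letters.im_ord]

theorem eq_of_ord_comp_trans {i : ℤ} (hi : i ∈ base S)
    {h : (Letters.ord hm S T).Composable (trans S i)}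
    (he : (Letters.ord hm S T).comp (trans S i) h = Letters.crit hm hk S T 1) :
    i = 1 - S.last hm hk := by
  obtain ⟨h1, h2, h3, h4⟩ := S.last_spec hm hk
  rw [← ord_comp_trans_eq] at he
  have hv : ∃ a, (Letters.ord hm S T).toFun (S.last hm hk - (2 * m - 2)) = some a := by
    have : S.last hm hk - (2 * m - 2) ∈ (Letters.ord hm S T).dom := by
      rw [Letters.dom_ord]
      have := (S.2.1.add_mem_iff (S.last hm hk) (-1)).2 h1
      rwa [neg_one_mul, ← sub_eq_add_neg] at this
    exact this
  obtain ⟨a, ha⟩ := hv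
  have h5 : ((Letters.ord hm S T).comp (trans S (1 - S.last hm hk)) ord_comp_trans).toFun
      (S.last hm hk) = some a := by
    refine comp_eq_some.2 ⟨_, move_eq_some.2 ⟨h1, rfl⟩, ?_⟩
    rw [direction_reflect_left, direction_self, neg_one_mul, ← sub_eq_add_neg]
    exact ha
  rw [← he, comp_eq_some] at h5
  obtain ⟨u, hu, hua⟩ := h5
  obtain ⟨-, hu⟩ := move_eq_some.1 hu
  have h6 := (Letters.ord hm S T).some_inj hua ha
  have hb := (mem_base.1 hi).1
  have hN : (2 : ℤ) ≤ 2 * m - 2 := by omega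
  rcases direction_cases m i (S.last hm hk) with ⟨l, hl, h'⟩ | ⟨l, hl, h'⟩ | ⟨h0, h'⟩
  · rw [h'] at hu; omega
  · rcases mul_period_cases hm l with rfl | h5 | h5 <;> omega
  · rw [h'] at hu; omega

theorem spec_ord_mul_Omega_crit : spec m k (mul m k (pure (Letters.ord hm S T) 0) (Omega m k))
    (Letters.crit hm hk S T 1) = 1 := by
  classical
  have hlast := S.last_spec hm hk
  have hbase : 1 - S.last hm hk ∈ base S := by
    refine mem_base.2 ⟨⟨by omega, by omega⟩, ?_⟩
    have := S.2.1.sub_mem_iff (S.last hm hk) 0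
    rw [zero_mul, add_zero] at this
    exact this.2 hlast.1
  rw [spec_mul, spec_pure, spec_Omega hm, map_sum, Finset.sum_eq_single S, map_sum,
    Finsupp.finsetSum_apply, Finset.sum_eq_single (1 - S.last hm hk)]
  · rw [PongOne.mul_of, PongOne.mulOf, dif_pos ord_comp_trans, if_pos, PongOne.of_apply,
      if_pos ord_comp_trans_eq]
    have h1 := Letters.cross_trans_comp_crit (hm := hm) (hk := hk) (S := S) (T := T) (n := 0)
    have h2 := Letters.trans_comp_crit (hm := hm) (hk := hk) (S := S) (T := T) (n := 0)
    have hT := T.last_spec hm hk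
    have hT' : 1 - T.last hm hk ∈ T.1 := by
      have := T.2.1.sub_mem_iff (T.last hm hk) 0
      rw [zero_mul, add_zero] at this
      exact this.2 hT.1
    rw [h2, Letters.crit_zero, Letters.cross_ord, cross_trans hm hT'] at h1
    rw [ord_comp_trans_eq, Letters.cross_ord, cross_trans hm (mem_base.1 hbase).2,
      add_comm]
    exact h1
  · intro i hi hne
    rw [PongOne.mul_of, PongOne.mulOf]
    split_ifs with h1 h2
    · rw [PongOne.of_apply, if_neg]
      exact fun h => hne (eq_of_ord_comp_trans hi h)
    · rfl
    · rfl
  · exact fun h => absurd hbase h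
  · intro T' _ hne
    rw [map_sum]
    refine Finset.sum_eq_zero fun i _ => ?_
    rw [PongOne.mul_of, PongOne.mulOf, dif_neg]
    rw [composable_iff, Letters.dom_ord, LiftedPartialPerm.trans, im_move]
    exact fun h => hne (Subtype.ext h.symm)
  · exact fun h => absurd (mem_allLetters hm S) h

/-- The cycle `Ω` is central up to boundaries. -/
theorem exists_commutator_boundary (hm : 1 < m) (hk : 0 < k) (S T : Letters m k) :
    ∃ y, diff m k y = mul m k (pure (Letters.ord hm S T) 0) (Omega m k) - omegaOrd hm 1 S T := by
  have h0 : omegaOrd hm 0 S T ∈ homPart m k S.1 T.1 (omegaWeight 0 S T) := omegaOrd_mem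
  have h1 : mul m k (pure (Letters.ord hm S T) 0) (Omega m k) ∈
      homPart m k S.1 T.1 (omegaWeight 1 S T) := by
    refine mul_Omega_mem_homPart hm h0 fun i => ?_
    rw [omegaWeight, omegaWeight]
    push_cast
    ring
  have hd : diff m k (pure (Letters.ord hm S T) 0) = 0 := diff_omegaOrd (n := 0)
  refine exists_boundary_of_coeff_crit hm hk (sub_mem h1 omegaOrd_mem) ?_ fun b n hg hb => ?_
  · rw [map_sub, (isDGAlgebra hm).leibniz, hd, diff_Omega hm, diff_omegaOrd]
    simp
  · have hn : n = 1 := by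
      obtain ⟨q, h2, h3, h4⟩ := hg.1 0 (Nat.zero_le _)
      rw [omegaWeight, h2, h3, sub_self, abs_zero, zero_div, add_zero] at h4
      exact_mod_cast h4.symm
    subst hn
    rw [map_sub, coeff_eq_spec (homPart_le h1) hb, coeff_eq_spec (homPart_le omegaOrd_mem) hb,
      spec_ord_mul_Omega_crit, spec_omegaOrd_crit, sub_self]

end Pong

namespace Blg0

variable {m l : ℕ}

/-! ### States and their gaps -/

/-- The number of elements below `p` that are not in the state `x`. -/
def gaps (x : IdState m l) (p : ℕ) : ℕ :=
  (Finset.univ.filter fun z : Fin (m + 1) => z ∉ x.1 ∧ (z : ℕ) < p).card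

theorem gaps_zero (x : IdState m l) : gaps x 0 = 0 := by simp [gaps]

open Classical in
theorem gaps_succ (x : IdState m l) (z : Fin (m + 1)) :
    gaps x (z + 1) = gaps x z + if z ∈ x.1 then 0 else 1 := by
  have h : (Finset.univ.filter fun y : Fin (m + 1) => y ∉ x.1 ∧ (y : ℕ) < z + 1)
      = if z ∈ x.1 then (Finset.univ.filter fun y : Fin (m + 1) => y ∉ x.1 ∧ (y : ℕ) < z)
        else insert z (Finset.univ.filter fun y : Fin (m + 1) => y ∉ x.1 ∧ (y : ℕ) < z) := by
    ext y
    by_cases hy : y = z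
    · subst hy
      split_ifs with h <;> simp [h]
    · have : (y : ℕ) ≠ z := fun h => hy (Fin.ext h)
      have h2 : (y : ℕ) < z + 1 ↔ (y : ℕ) < z := by omega
      split_ifs with h <;>
        simp only [Finset.mem_filter, Finset.mem_univ, true_and, Finset.mem_insert, hy, h2, false_or]
  rw [gaps, h]
  split_ifs with hz
  · rfl
  · rw [Finset.card_insert_of_notMem (by simp), gaps]

theorem gaps_step (x : IdState m l) {p : ℕ} (hp : p ≤ m) :
    gaps x (p + 1) = gaps x p ∨ gaps x (p + 1) = gaps x p + 1 := by
  have := gaps_succ x ⟨p, by omega⟩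
  split_ifs at this
  · exact Or.inl this
  · exact Or.inr this

theorem gaps_mono (x : IdState m l) {p q : ℕ} (h : p ≤ q) : gaps x p ≤ gaps x q :=
  Finset.card_le_card fun z hz => by
    simp only [Finset.mem_filter, Finset.mem_univ, true_and] at hz ⊢
    exact ⟨hz.1, by omega⟩

theorem gaps_last (x : IdState m l) : gaps x (m + 1) + l = m + 1 := by
  have h : (Finset.univ.filter fun z : Fin (m + 1) => z ∉ x.1 ∧ (z : ℕ) < m + 1) = x.1ᶜ := by
    ext z
    simp only [Finset.mem_filter, Finset.mem_univ, true_and, Finset.mem_compl, z.2, and_true]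
  have h2 := Finset.card_add_card_compl x.1
  rw [x.2, Fintype.card_fin] at h2
  rw [gaps, h]
  omega

theorem mem_iff_gaps (x : IdState m l) (z : Fin (m + 1)) :
    z ∈ x.1 ↔ gaps x (z + 1) = gaps x z := by
  classical
  rw [gaps_succ]
  split_ifs with h <;> simp [h]

theorem state_ext {x y : IdState m l} (h : ∀ p, p ≤ m + 1 → gaps x p = gaps y p) : x = y := by
  refine Subtype.ext (Finset.ext fun z => ?_)
  rw [mem_iff_gaps, mem_iff_gaps, h _ (by omega), h _ (by omega)]

theorem exists_state {H : ℕ → ℕ} (h0 : H 0 = 0) (h1 : H (m + 1) + l = m + 1)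
    (hs : ∀ p, p ≤ m → H (p + 1) = H p ∨ H (p + 1) = H p + 1) :
    ∃ x : IdState m l, ∀ p, p ≤ m + 1 → gaps x p = H p := by
  classical
  obtain ⟨s, hs'⟩ : ∃ s : Finset (Fin (m + 1)), ∀ z : Fin (m + 1), z ∈ s ↔ H (z + 1) = H z :=
    ⟨Finset.univ.filter fun z => H (z + 1) = H z, by simp⟩
  have key : ∀ p, p ≤ m + 1 → gaps (⟨s, rfl⟩ : IdState m s.card) p = H p := by
    intro p hp
    induction p with
    | zero => rw [gaps_zero, h0]
    | succ p ih =>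
      have h2 := gaps_succ (⟨s, rfl⟩ : IdState m s.card) ⟨p, by omega⟩
      have h3 := ih (by omega)
      have h4 := hs p (by omega)
      dsimp only at h2
      rw [h2, h3]
      split_ifs with h5
      · exact ((hs' _).1 h5).symm
      · have : ¬ H (p + 1) = H p := fun h => h5 ((hs' ⟨p, by omega⟩).2 h)
        omega
  have hc : s.card = l := by
    have h2 := gaps_last (⟨s, rfl⟩ : IdState m s.card)
    rw [key _ le_rfl] at h2
    omega
  subst hc
  exact ⟨⟨s, rfl⟩, key⟩

theorem stateWeight_eq (x : IdState m l) (j : Fin m) :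
    stateWeight x j = (gaps x (j + 1) : ℤ) + l - 1 - (j : ℕ) := by
  classical
  have h1 := Finset.card_filter_add_card_filter_not (s := x.1)
    (fun a : Fin (m + 1) => (j : ℕ) + 1 ≤ (a : ℕ))
  have h2 := Finset.card_filter_add_card_filter_not
    (s := Finset.univ.filter fun a : Fin (m + 1) => (a : ℕ) < j + 1) (fun a => a ∉ x.1)
  have h3 : (Finset.univ.filter fun a : Fin (m + 1) => (a : ℕ) < j + 1).card = j + 1 := by
    rw [Fin.card_filter_val_lt]
    omega
  have h4 : ((Finset.univ.filter fun a : Fin (m + 1) => (a : ℕ) < j + 1).filter fun a => a ∉ x.1).card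
      = gaps x (j + 1) := by
    rw [gaps, Finset.filter_filter]
    exact congrArg Finset.card (Finset.filter_congr fun a _ => and_comm)
  have h5 : ((Finset.univ.filter fun a : Fin (m + 1) => (a : ℕ) < j + 1).filter
      fun a => ¬ a ∉ x.1).card = (x.1.filter fun a : Fin (m + 1) => ¬ (j : ℕ) + 1 ≤ (a : ℕ)).card := by
    refine congrArg Finset.card (Finset.ext fun a => ?_)
    simp [and_comm]
  rw [h3, h4, h5] at h2
  rw [x.2] at h1
  unfold stateWeight
  omega

theorem mulExponent_eq (x y z : IdState m l) (j : Fin m) : mulExponent x y z j =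
    (((gaps x (j + 1) : ℤ) - gaps y (j + 1)).natAbs + ((gaps y (j + 1) : ℤ) - gaps z (j + 1)).natAbs
      - ((gaps x (j + 1) : ℤ) - gaps z (j + 1)).natAbs) / 2 := by
  rw [mulExponent, Finsupp.equivFunOnFinite_symm_apply_apply]
  simp only [stateWeight_eq]
  congr 2
  · congr 2 <;> ring_nf
  · ring_nf

theorem mulExponent_eq_zero {x y z : IdState m l} (h : ∀ p, p ≤ m →
    gaps x p ≤ gaps y p ∧ gaps y p ≤ gaps z p ∨ gaps z p ≤ gaps y p ∧ gaps y p ≤ gaps x p) :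
    mulExponent x y z = 0 := by
  ext j
  rw [mulExponent_eq, Finsupp.zero_apply]
  have := h (j + 1) (by omega)
  omega

theorem isLeftMove_of_gaps {x y : IdState m l} {i : Fin m}
    (h1 : gaps x (i + 1) = gaps y (i + 1) + 1)
    (h2 : ∀ p, p ≤ m + 1 → p ≠ i + 1 → gaps x p = gaps y p) : IsLeftMove i x y := by
  classical
  have a0 := h2 i (by omega) (by omega)
  have a2 := h2 (i + 1 + 1) (by omega) (by omega)
  have b1 := gaps_step x (p := i) (by omega)
  have b2 := gaps_step y (p := i) (by omega)
  have b3 := gaps_step x (p := i + 1) (by omega)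
  have b4 := gaps_step y (p := i + 1) (by omega)
  refine ⟨?_, ?_, ?_⟩
  · rw [mem_iff_gaps]
    simp only [Fin.val_succ]
    omega
  · rw [mem_iff_gaps]
    simp only [Fin.val_castSucc]
    omega
  · ext z
    rw [Finset.mem_insert, Finset.mem_erase, mem_iff_gaps, mem_iff_gaps, Fin.ext_iff, Ne, Fin.ext_iff]
    simp only [Fin.val_castSucc, Fin.val_succ]
    by_cases hz : (z : ℕ) = i
    · rw [hz]; omega
    · by_cases hz' : (z : ℕ) = i + 1
      · rw [hz']; omega
      · rw [h2 z (by omega) hz', h2 (z + 1) (by omega) (by omega)]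
        simp [hz, hz']

theorem gaps_of_isLeftMove {x y : IdState m l} {i : Fin m} (h : IsLeftMove i x y) :
    gaps x (i + 1) = gaps y (i + 1) + 1 ∧
      ∀ p, p ≤ m + 1 → p ≠ i + 1 → gaps x p = gaps y p := by
  classical
  obtain ⟨h1, h2, h3⟩ := h
  have hne : i.castSucc ≠ i.succ := by
    rw [Ne, Fin.ext_iff, Fin.val_castSucc, Fin.val_succ]
    omega
  have hy1 : i.castSucc ∈ y.1 := by rw [h3]; simp
  have hy2 : i.succ ∉ y.1 := by rw [h3]; simp [hne.symm]
  have low : ∀ p, p ≤ (i : ℕ) → gaps x p = gaps y p := by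
    intro p hp
    induction p with
    | zero => rw [gaps_zero, gaps_zero]
    | succ p ih =>
      have e1 := gaps_succ x ⟨p, by omega⟩
      have e2 := gaps_succ y ⟨p, by omega⟩
      have : (⟨p, by omega⟩ : Fin (m + 1)) ∈ x.1 ↔ (⟨p, by omega⟩ : Fin (m + 1)) ∈ y.1 := by
        rw [h3, Finset.mem_insert, Finset.mem_erase, Fin.ext_iff, Ne, Fin.ext_iff]
        simp only [Fin.val_castSucc, Fin.val_succ]
        have a1 : p ≠ i := by omega
        have a2 : p ≠ i + 1 := by omega
        simp [a1, a2]
      dsimp only at e1 e2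
      simp only [this] at e1
      rw [e1, e2, ih (by omega)]
  have c1 := gaps_succ x i.castSucc
  have c2 := gaps_succ y i.castSucc
  have c3 := gaps_succ x i.succ
  have c4 := gaps_succ y i.succ
  rw [if_neg h2, Fin.val_castSucc, low i le_rfl] at c1
  rw [if_pos hy1, Fin.val_castSucc] at c2
  rw [if_pos h1, Fin.val_succ] at c3
  rw [if_neg hy2, Fin.val_succ] at c4
  refine ⟨by omega, fun p hp hpi => ?_⟩
  by_cases hp' : p ≤ i
  · exact low p hp'
  · obtain ⟨q, rfl⟩ : ∃ q, p = i + 1 + 1 + q := ⟨p - (i + 2), by omega⟩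
    clear hp' hpi
    induction q with
    | zero => rw [add_zero]; omega
    | succ q ih =>
      have e1 := gaps_succ x ⟨i + 1 + 1 + q, by omega⟩
      have e2 := gaps_succ y ⟨i + 1 + 1 + q, by omega⟩
      have : (⟨i + 1 + 1 + q, by omega⟩ : Fin (m + 1)) ∈ x.1 ↔
          (⟨i + 1 + 1 + q, by omega⟩ : Fin (m + 1)) ∈ y.1 := by
        rw [h3, Finset.mem_insert, Finset.mem_erase, Fin.ext_iff, Ne, Fin.ext_iff]
        simp only [Fin.val_castSucc, Fin.val_succ]
        have a1 : (i : ℕ) + 1 + 1 + q ≠ i := by omega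
        have a2 : (i : ℕ) + 1 + 1 + q ≠ i + 1 := by omega
        simp [a1, a2]
      dsimp only at e1 e2
      simp only [this] at e1
      rw [← add_assoc, e1, e2, ih (by omega)]

/-! ### The monomials in the ideal of relations -/

/-- At some inner level, the exponent is positive at all walls where `x` and `y` both have this
level. -/
def Killed (x y : IdState m l) (a : Fin m →₀ ℕ) : Prop :=
  ∃ i, 1 ≤ i ∧ i + l ≤ m ∧ ∀ j : Fin m, gaps x (j + 1) = i → gaps y (j + 1) = i → 1 ≤ a j

theorem Killed.symm {x y : IdState m l} {a : Fin m →₀ ℕ} (h : Killed x y a) : Killed y x a := by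
  obtain ⟨i, h1, h2, h3⟩ := h
  exact ⟨i, h1, h2, fun j hx hy => h3 j hy hx⟩

theorem Killed.mono {x y : IdState m l} {a b : Fin m →₀ ℕ} (h : Killed x y a) (hab : a ≤ b) :
    Killed x y b := by
  obtain ⟨i, h1, h2, h3⟩ := h
  exact ⟨i, h1, h2, fun j hx hy => (h3 j hx hy).trans (hab j)⟩

theorem Killed.mul_right {x y : IdState m l} {a : Fin m →₀ ℕ} (h : Killed x y a)
    (z : IdState m l) : Killed x z (a + mulExponent x y z) := by
  obtain ⟨i, h1, h2, h3⟩ := h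
  refine ⟨i, h1, h2, fun j hx hz => ?_⟩
  have := h3 j hx
  rw [Finsupp.add_apply, mulExponent_eq]
  omega

theorem Killed.mul_left {y z : IdState m l} {a : Fin m →₀ ℕ} (h : Killed y z a)
    (x : IdState m l) : Killed x z (a + mulExponent x y z) := by
  obtain ⟨i, h1, h2, h3⟩ := h
  refine ⟨i, h1, h2, fun j hx hz => ?_⟩
  have := fun hy => h3 j hy hz
  rw [Finsupp.add_apply, mulExponent_eq]
  omega

theorem killed_of_isLeftMove {x y z : IdState m l} {i j : Fin m} (hij : (j : ℕ) = i + 1)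
    (h1 : IsLeftMove j x y) (h2 : IsLeftMove i y z) (a : Fin m →₀ ℕ) : Killed x z a := by
  obtain ⟨a1, a2⟩ := gaps_of_isLeftMove h1
  obtain ⟨b1, b2⟩ := gaps_of_isLeftMove h2
  have c1 := a2 (i + 1) (by omega) (by omega)
  have c2 := b2 (j + 1) (by omega) (by omega)
  have c3 := a2 i (by omega) (by omega)
  have c4 := b2 i (by omega) (by omega)
  have c5 := a2 (j + 1 + 1) (by omega) (by omega)
  have s1 := gaps_step x (p := j) (by omega)
  have s2 := gaps_step y (p := j) (by omega)
  have s3 := gaps_step z (p := j) (by omega)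
  have s4 := gaps_mono y (show (j : ℕ) + 1 + 1 ≤ m + 1 by omega)
  have s5 := gaps_step z (p := i) (by omega)
  have s6 := gaps_step x (p := j + 1) (by omega)
  have s7 := gaps_last y
  rw [hij] at s1 s2 s3 s4 s6 a1 c2 c5
  refine ⟨gaps x (i + 1), by omega, by omega, fun q hx hz => ?_⟩
  have e1 : (q : ℕ) + 1 ≤ i + 1 := by
    by_contra hc
    have := gaps_mono x (show (i : ℕ) + 1 + 1 ≤ q + 1 by omega)
    omega
  have e2 := gaps_mono z e1
  omega

theorem killed_of_notMem {x : IdState m l} {j : Fin m} (h1 : j.castSucc ∉ x.1)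
    (h2 : j.succ ∉ x.1) : Killed x x (Finsupp.single j 1) := by
  classical
  have e1 := gaps_succ x j.castSucc
  have e2 := gaps_succ x j.succ
  rw [if_neg h1, Fin.val_castSucc] at e1
  rw [if_neg h2, Fin.val_succ] at e2
  have s1 := gaps_mono x (show (j : ℕ) + 1 + 1 ≤ m + 1 by omega)
  have s2 := gaps_last x
  refine ⟨gaps x (j + 1), by omega, by omega, fun q hx _ => ?_⟩
  have : q = j := by
    by_contra hne
    rcases lt_or_gt_of_ne (fun h => hne (Fin.ext h) : (q : ℕ) ≠ j) with h | h
    · have := gaps_mono x (show (q : ℕ) + 1 ≤ j by omega)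
      omega
    · have := gaps_mono x (show (j : ℕ) + 1 + 1 ≤ q + 1 by omega)
      omega
  rw [this, Finsupp.single_eq_same]

end Blg0

namespace Blg0

variable {m l : ℕ}

theorem gen_apply_self (x y : IdState m l) (p : Base m) : gen x y p x y = p := by
  simp [gen]

theorem gen_apply_of_ne {x y a b : IdState m l} (h : ¬ (a = x ∧ b = y)) (p : Base m) :
    gen x y p a b = 0 := by
  by_cases ha : a = x
  · subst ha
    have hb : b ≠ y := fun hb => h ⟨rfl, hb⟩
    simp [gen, Pi.single_eq_of_ne hb]
  · simp [gen, Pi.single_eq_of_ne ha]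

theorem gen_add (x y : IdState m l) (p q : Base m) : gen x y (p + q) = gen x y p + gen x y q := by
  refine ext' fun a b => ?_
  rw [add_apply]
  by_cases h : a = x ∧ b = y
  · obtain ⟨rfl, rfl⟩ := h
    rw [gen_apply_self, gen_apply_self, gen_apply_self]
  · rw [gen_apply_of_ne h, gen_apply_of_ne h, gen_apply_of_ne h, add_zero]

theorem gen_zero (x y : IdState m l) : gen x y (0 : Base m) = 0 := by
  refine ext' fun a b => ?_
  by_cases h : a = x ∧ b = y
  · obtain ⟨rfl, rfl⟩ := h
    rw [gen_apply_self, zero_apply]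
  · rw [gen_apply_of_ne h, zero_apply]

theorem gen_mul_gen (x y z : IdState m l) (p q : Base m) :
    gen x y p * gen y z q = gen x z (p * q * MvPolynomial.monomial (mulExponent x y z) 1) := by
  refine ext' fun a b => ?_
  rw [mul_apply, Finset.sum_eq_single y]
  · by_cases h : a = x ∧ b = z
    · obtain ⟨rfl, rfl⟩ := h
      rw [gen_apply_self, gen_apply_self, gen_apply_self]
    · rw [gen_apply_of_ne h]
      by_cases ha : a = x
      · rw [gen_apply_of_ne (a := y) fun h' => h ⟨ha, h'.2⟩, mul_zero, zero_mul]
      · rw [gen_apply_of_ne (a := a) fun h' => ha h'.1, zero_mul, zero_mul]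
  · intro c _ hc
    rw [gen_apply_of_ne (b := c) fun h => hc h.2, zero_mul, zero_mul]
  · simp

theorem sum_apply (s : Finset (IdState m l)) (F : IdState m l → Blg0 m l) (u v : IdState m l) :
    (∑ x ∈ s, F x) u v = ∑ x ∈ s, F x u v :=
  (congrFun (Finset.sum_apply u s F) v).trans (Finset.sum_apply v s fun x => F x u)

theorem eq_sum_gen (b : Blg0 m l) : b = ∑ x, ∑ y, gen x y (b x y) := by
  refine ext' fun u v => ?_
  rw [sum_apply, Finset.sum_eq_single u, sum_apply, Finset.sum_eq_single v]
  · rw [gen_apply_self]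
  · exact fun y _ hy => gen_apply_of_ne (fun h => hy h.2.symm) _
  · simp
  · intro x _ hx
    rw [sum_apply]
    exact Finset.sum_eq_zero fun y _ => gen_apply_of_ne (fun h => hx h.1.symm) _
  · simp

open Classical in
theorem idem_mul_indicator {P : IdState m l → IdState m l → Prop} {M : Blg0 m l}
    (hM : ∀ a b, M a b = if P a b then 1 else 0) {x y : IdState m l}
    (h : ∀ b, P x b ↔ b = y) : idem x * M = gen x y 1 := by
  refine ext' fun a b => ?_
  rw [mul_apply, Finset.sum_eq_single x]
  · by_cases ha : a = x
    · subst ha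
      rw [idem, gen_apply_self, hM, mulExponent_left]
      simp only [h]
      split_ifs with hb
      · subst hb
        rw [gen_apply_self]
        simp
      · rw [gen_apply_of_ne fun h' => hb h'.2]
        simp
    · rw [idem, gen_apply_of_ne fun h' => ha h'.1, gen_apply_of_ne fun h' => ha h'.1]
      simp
  · intro c _ hc
    rw [idem, gen_apply_of_ne fun h' => hc h'.2]
    simp
  · simp

open Classical in
theorem indicator_mul_idem {P : IdState m l → IdState m l → Prop} {M : Blg0 m l}
    (hM : ∀ a b, M a b = if P a b then 1 else 0) {y z : IdState m l}
    (h : ∀ a, P a z ↔ a = y) : M * idem z = gen y z 1 := by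
  refine ext' fun a b => ?_
  rw [mul_apply, Finset.sum_eq_single z]
  · by_cases hb : b = z
    · subst hb
      rw [idem, gen_apply_self, hM, mulExponent_right]
      simp only [h]
      split_ifs with ha
      · subst ha
        rw [gen_apply_self]
        simp
      · rw [gen_apply_of_ne fun h' => ha h'.1]
        simp
    · rw [idem, gen_apply_of_ne fun h' => hb h'.2, gen_apply_of_ne fun h' => hb h'.2]
      simp
  · intro c _ hc
    rw [idem, gen_apply_of_ne (a := c) fun h' => hc h'.1]
    simp
  · simp

theorem isLeftMove_right_unique {i : Fin m} {x y : IdState m l} (h : IsLeftMove i x y)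
    (b : IdState m l) : IsLeftMove i x b ↔ b = y := by
  refine ⟨fun hb => ?_, fun hb => hb ▸ h⟩
  exact Subtype.ext (hb.2.2.trans h.2.2.symm)

theorem isLeftMove_left_unique {i : Fin m} {x y : IdState m l} (h : IsLeftMove i x y)
    (a : IdState m l) : IsLeftMove i a y ↔ a = x := by
  refine ⟨fun ha => state_ext fun p hp => ?_, fun ha => ha ▸ h⟩
  obtain ⟨h1, h2⟩ := gaps_of_isLeftMove h
  obtain ⟨h3, h4⟩ := gaps_of_isLeftMove ha
  by_cases hpi : p = i + 1
  · subst hpi; omega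
  · rw [h2 p hp hpi, h4 p hp hpi]

variable (m l) in
/-- The ideal of relations. -/
def relIdeal : TwoSidedIdeal (Blg0 m l) := TwoSidedIdeal.span (relations m l)

theorem gen_mem_of_factor {x x' z' y : IdState m l} {r : Base m} (h : gen x' z' r ∈ relIdeal m l)
    (p : Base m) : gen x y (p * r *
      MvPolynomial.monomial (mulExponent x x' z' + mulExponent x z' y) 1) ∈ relIdeal m l := by
  have h1 := (relIdeal m l).mul_mem_right _ (gen z' y 1)
    ((relIdeal m l).mul_mem_left (gen x x' p) _ h)
  rw [gen_mul_gen, gen_mul_gen, mul_one, mul_assoc, MvPolynomial.monomial_mul, one_mul] at h1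
  exact h1

theorem gen_single_mem {x : IdState m l} {j : Fin m} (h1 : j.castSucc ∉ x.1)
    (h2 : j.succ ∉ x.1) : gen x x (MvPolynomial.X j) ∈ relIdeal m l := by
  have h3 : gen x x (MvPolynomial.X j) = idem x * U j := by
    refine ext' fun a b => ?_
    rw [mul_apply, Finset.sum_eq_single x]
    · by_cases h : a = x ∧ b = x
      · obtain ⟨rfl, rfl⟩ := h
        simp [gen_apply_self, idem, U, mulExponent_left]
      · rw [gen_apply_of_ne h]
        by_cases ha : a = x
        · have hb : ¬ x = b := fun hb => h ⟨ha, hb.symm⟩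
          simp [U, hb]
        · rw [idem, gen_apply_of_ne fun h' => ha h'.1]
          simp
    · intro c _ hc
      rw [idem, gen_apply_of_ne fun h' => hc h'.2]
      simp
    · simp
  rw [h3]
  exact TwoSidedIdeal.subset_span (Or.inr ⟨x, j, h1, h2, rfl⟩)

theorem mulExponent_of_isLeftMove {i j : Fin m} (hij : (j : ℕ) = i + 1) {x v z : IdState m l}
    (h1 : IsLeftMove j x v) (h2 : IsLeftMove i v z) :
    mulExponent x v z = 0 ∧ mulExponent z v x = 0 := by
  obtain ⟨a1, a2⟩ := gaps_of_isLeftMove h1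
  obtain ⟨b1, b2⟩ := gaps_of_isLeftMove h2
  have key : ∀ p, p ≤ m → gaps z p ≤ gaps v p ∧ gaps v p ≤ gaps x p := by
    intro p hp
    by_cases hp1 : p = i + 1
    · have := a2 p (by omega) (by omega)
      subst hp1; omega
    · have := b2 p (by omega) hp1
      by_cases hp2 : p = j + 1
      · subst hp2; omega
      · have := a2 p (by omega) hp2
        omega
  exact ⟨mulExponent_eq_zero fun p hp => Or.inr (key p hp),
    mulExponent_eq_zero fun p hp => Or.inl (key p hp)⟩

theorem gen_left_mem {i j : Fin m} (hij : (j : ℕ) = i + 1) {x v z : IdState m l}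
    (h1 : IsLeftMove j x v) (h2 : IsLeftMove i v z) : gen x z 1 ∈ relIdeal m l := by
  have h3 : idem x * (L j * L i) * idem z = gen x z 1 := by
    rw [← mul_assoc, idem_mul_indicator (M := L j) (fun a b => rfl) (isLeftMove_right_unique h1), mul_assoc,
      indicator_mul_idem (M := L i) (fun a b => rfl) (isLeftMove_left_unique h2), gen_mul_gen,
      (mulExponent_of_isLeftMove hij h1 h2).1]
    simp
  rw [← h3]
  exact (relIdeal m l).mul_mem_right _ _ ((relIdeal m l).mul_mem_left _ _
    (TwoSidedIdeal.subset_span (Or.inl (Or.inl ⟨i, j, hij, rfl⟩))))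

theorem gen_right_mem {i j : Fin m} (hij : (j : ℕ) = i + 1) {x v z : IdState m l}
    (h1 : IsLeftMove j x v) (h2 : IsLeftMove i v z) : gen z x 1 ∈ relIdeal m l := by
  have h3 : idem z * (R i * R j) * idem x = gen z x 1 := by
    rw [← mul_assoc, idem_mul_indicator (M := R i) (P := fun a b => IsLeftMove i b a) (fun a b => rfl)
      (isLeftMove_left_unique h2), mul_assoc,
      indicator_mul_idem (M := R j) (P := fun a b => IsLeftMove j b a) (fun a b => rfl)
      (isLeftMove_right_unique h1), gen_mul_gen, (mulExponent_of_isLeftMove hij h1 h2).2]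
    simp
  rw [← h3]
  exact (relIdeal m l).mul_mem_right _ _ ((relIdeal m l).mul_mem_left _ _
    (TwoSidedIdeal.subset_span (Or.inl (Or.inr ⟨i, j, hij, rfl⟩))))

/-- Two states that are far apart at the level `i` factor through two successive left moves. -/
theorem exists_left_moves {x y : IdState m l} {i p : ℕ} (hi : 1 ≤ i) (hil : i + l ≤ m)
    (hpm : p ≤ m) (h1 : gaps x p = i) (h2 : gaps x (p + 1) = i + 1) (h3 : gaps y p < i) :
    ∃ (x' v z : IdState m l) (i₀ j₀ : Fin m), (j₀ : ℕ) = i₀ + 1 ∧ IsLeftMove j₀ x' v ∧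
      IsLeftMove i₀ v z ∧ ∀ q, q ≤ m →
        gaps x q ≤ gaps x' q ∧ gaps x' q ≤ gaps z q ∧ gaps z q ≤ gaps y q ∨
        gaps y q ≤ gaps z q ∧ gaps z q ≤ gaps x' q ∧ gaps x' q ≤ gaps x q := by
  have hy1 := gaps_step y hpm
  have hyl := gaps_last y
  have hp0 : p ≠ 0 := by
    rintro rfl
    rw [gaps_zero] at h1
    omega
  have hp1 : p + 1 ≤ m := by
    by_contra hc
    obtain rfl : p = m := by omega
    omega
  have hy2 := gaps_step y hp1
  have hx1 := gaps_step x (p := p - 1) (by omega)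
  rw [show p - 1 + 1 = p by omega] at hx1
  have build : ∀ c d : ℕ, (c = i ∨ c + 1 = i) → (d = i ∨ d = i + 1) → (d = c ∨ d = c + 1) →
      ∃ u : IdState m l, ∀ q, q ≤ m + 1 → gaps u q = if q < p then min (gaps x q) (i - 1) else
        if q = p then c else if q = p + 1 then d else max (gaps y q) (i + 1) := by
    intro c d hc hd hcd
    refine exists_state ?_ ?_ fun q hq => ?_
    · rw [if_pos (by omega), gaps_zero]; omega
    · rw [if_neg (by omega), if_neg (by omega), if_neg (by omega)]; omega
    · have a1 := gaps_step x hq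
      have a2 := gaps_step y hq
      rcases lt_trichotomy (q + 1) p with hlt | rfl | hgt
      · rw [if_pos hlt, if_pos (by omega)]; omega
      · rw [if_neg (by omega), if_pos rfl, if_pos (by omega)]; omega
      · rw [if_neg (by omega), if_neg (by omega)]
        rcases lt_trichotomy q p with hlt | rfl | hgt'
        · omega
        · rw [if_pos rfl, if_neg (by omega), if_pos rfl]; omega
        · rw [if_neg (by omega), if_neg (by omega), if_neg (by omega)]
          by_cases hq1 : q = p + 1
          · subst hq1
            rw [if_pos rfl]; omega
          · rw [if_neg hq1]; omega
  obtain ⟨x', hx'⟩ := build i (i + 1) (by omega) (by omega) (by omega)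
  obtain ⟨v, hv⟩ := build i i (by omega) (by omega) (by omega)
  obtain ⟨z, hz⟩ := build (i - 1) i (by omega) (by omega) (by omega)
  refine ⟨x', v, z, ⟨p - 1, by omega⟩, ⟨p, by omega⟩, by dsimp only; omega, ?_, ?_, ?_⟩
  · refine isLeftMove_of_gaps ?_ fun q hq hne => ?_
    · dsimp only
      rw [hx' _ (by omega), hv _ (by omega)]
      simp
    · dsimp only at hne
      rw [hx' _ hq, hv _ hq, if_neg hne, if_neg hne]
  · refine isLeftMove_of_gaps ?_ fun q hq hne => ?_
    · dsimp only
      rw [show p - 1 + 1 = p by omega, hv p (by omega), hz p (by omega), if_neg (lt_irrefl _),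
        if_neg (lt_irrefl _), if_pos rfl, if_pos rfl]
      omega
    · dsimp only at hne
      rw [hv _ hq, hz _ hq, if_neg (c := q = p) (by omega), if_neg (c := q = p) (by omega)]
  · intro q hq
    rw [hx' q (by omega), hz q (by omega)]
    rcases lt_trichotomy q p with hlt | rfl | hgt
    · rw [if_pos hlt, if_pos hlt]
      have b1 := gaps_mono x hlt.le
      have b2 := gaps_mono y hlt.le
      omega
    · rw [if_neg (lt_irrefl _), if_neg (lt_irrefl _), if_pos rfl, if_pos rfl]
      omega
    · simp only [show ¬ q < p by omega, show ¬ q = p by omega, if_false]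
      have b1 := gaps_mono x (show p + 1 ≤ q by omega)
      by_cases hq1 : q = p + 1
      · subst hq1
        simp only [if_true]; omega
      · simp only [hq1, if_false]; omega

/-- A state whose level `i` is attained at a single given wall. -/
theorem exists_pinched {x y : IdState m l} {i : ℕ} (hi : 1 ≤ i) (hil : i + l ≤ m) {j : Fin m}
    (hx : gaps x (j + 1) = i) (hy : gaps y (j + 1) = i) : ∃ u : IdState m l,
      j.castSucc ∉ u.1 ∧ j.succ ∉ u.1 ∧ ∀ q : Fin m, mulExponent x u y q =
        if q ≠ j ∧ gaps x (q + 1) = i ∧ gaps y (q + 1) = i then 1 else 0 := by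
  have hxl := gaps_last x
  have hyl := gaps_last y
  obtain ⟨u, hu⟩ : ∃ u : IdState m l, ∀ q, q ≤ m + 1 → gaps u q =
      if q < j + 1 then min (gaps x q) (i - 1) else if q = j + 1 then i else
        max (gaps x q) (i + 1) := by
    refine exists_state ?_ ?_ fun q hq => ?_
    · rw [if_pos (by omega), gaps_zero]; omega
    · rw [if_neg (by omega), if_neg (by omega)]; omega
    · have a1 := gaps_step x hq
      rcases lt_trichotomy q j with hlt | rfl | hgt
      · rw [if_pos (by omega), if_pos (by omega)]; omega
      · rw [if_neg (by omega), if_pos rfl, if_pos (by omega)]; omega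
      · rw [if_neg (by omega), if_neg (by omega), if_neg (by omega)]
        by_cases hq1 : q = j + 1
        · subst hq1
          rw [if_pos rfl]; omega
        · rw [if_neg hq1]; omega
  refine ⟨u, ?_, ?_, fun q => ?_⟩
  · rw [mem_iff_gaps, Fin.val_castSucc, hu _ (by omega), hu _ (by omega)]
    simp
    omega
  · rw [mem_iff_gaps, Fin.val_succ, hu _ (by omega), hu _ (by omega), if_neg (by omega),
      if_neg (by omega), if_neg (by omega), if_pos rfl]
    omega
  · rw [mulExponent_eq, hu _ (by omega)]
    rcases lt_trichotomy (q : ℕ) j with hlt | heq | hgt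
    · have b1 := gaps_mono x (show (q : ℕ) + 1 ≤ j + 1 by omega)
      have b2 := gaps_mono y (show (q : ℕ) + 1 ≤ j + 1 by omega)
      have hne : q ≠ j := fun h => by subst h; omega
      rw [if_pos (by omega)]
      split_ifs with h
      · omega
      · have h' : ¬ (gaps x (q + 1) = i ∧ gaps y (q + 1) = i) := fun h' => h ⟨hne, h'⟩
        omega
    · have hqj : q = j := Fin.ext heq
      subst hqj
      simp [hx, hy]
    · have b1 := gaps_mono x (show (j : ℕ) + 1 ≤ q + 1 by omega)
      have b2 := gaps_mono y (show (j : ℕ) + 1 ≤ q + 1 by omega)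
      have hne : q ≠ j := fun h => by subst h; omega
      rw [if_neg (by omega), if_neg (by omega)]
      split_ifs with h
      · omega
      · have h' : ¬ (gaps x (q + 1) = i ∧ gaps y (q + 1) = i) := fun h' => h ⟨hne, h'⟩
        omega

theorem exists_gaps_eq (x : IdState m l) {i : ℕ} (hil : i + l ≤ m) :
    ∃ p, p ≤ m ∧ gaps x p = i ∧ gaps x (p + 1) = i + 1 := by
  classical
  have hl := gaps_last x
  have hex : ∃ q, i < gaps x q := ⟨m + 1, by omega⟩
  have h1 := Nat.find_spec hex
  have h2 := fun q => Nat.find_min hex (m := q)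
  have h3 : Nat.find hex ≤ m + 1 := Nat.find_min' hex (by omega)
  have h4 : Nat.find hex ≠ 0 := fun h => by
    rw [h, gaps_zero] at h1
    omega
  have h5 := h2 (Nat.find hex - 1) (by omega)
  have h6 := gaps_step x (p := Nat.find hex - 1) (by omega)
  rw [show Nat.find hex - 1 + 1 = Nat.find hex by omega] at h6
  refine ⟨Nat.find hex - 1, by omega, by omega, ?_⟩
  rw [show Nat.find hex - 1 + 1 = Nat.find hex by omega]
  omega

theorem Killed.gen_mem {x y : IdState m l} {a : Fin m →₀ ℕ} (h : Killed x y a) :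
    gen x y (MvPolynomial.monomial a 1) ∈ relIdeal m l := by
  obtain ⟨i, hi, hil, h⟩ := h
  by_cases hc : ∃ j : Fin m, gaps x (j + 1) = i ∧ gaps y (j + 1) = i
  · obtain ⟨j, hx, hy⟩ := hc
    obtain ⟨u, h1, h2, h3⟩ := exists_pinched hi hil hx hy
    have hle : mulExponent x u u + mulExponent x u y + Finsupp.single j 1 ≤ a := by
      intro q
      rw [mulExponent_right, zero_add, Finsupp.add_apply, h3]
      by_cases hq : q = j
      · subst hq
        have := h q hx hy
        simpa using this
      · have := h q
        rw [Finsupp.single_eq_of_ne hq]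
        split_ifs with h' <;> omega
    have h4 := gen_mem_of_factor (x := x) (y := y) (gen_single_mem h1 h2)
      (MvPolynomial.monomial (a - (mulExponent x u u + mulExponent x u y + Finsupp.single j 1)) 1)
    rw [MvPolynomial.X, MvPolynomial.monomial_mul, MvPolynomial.monomial_mul, one_mul, one_mul] at h4
    convert h4 using 4
    rw [add_assoc, add_comm (Finsupp.single j 1), tsub_add_cancel_of_le hle]
  · have key : ∀ (x y x' z : IdState m l), (∀ q, q ≤ m →
        gaps x q ≤ gaps x' q ∧ gaps x' q ≤ gaps z q ∧ gaps z q ≤ gaps y q ∨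
        gaps y q ≤ gaps z q ∧ gaps z q ≤ gaps x' q ∧ gaps x' q ≤ gaps x q) →
        gen x' z 1 ∈ relIdeal m l → gen x y (MvPolynomial.monomial a 1) ∈ relIdeal m l := by
      intro x y x' z h1 h2
      have h3 := gen_mem_of_factor (x := x) (y := y) h2 (MvPolynomial.monomial a 1)
      rw [mulExponent_eq_zero fun p hp => ?_, mulExponent_eq_zero fun p hp => ?_] at h3
      · simpa using h3
      · have := h1 p hp; omega
      · have := h1 p hp; omega
    obtain ⟨p, hp, hp1, hp2⟩ := exists_gaps_eq x hil
    obtain ⟨p', hp', hp1', hp2'⟩ := exists_gaps_eq y hil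
    have hne : ∀ q, 1 ≤ q → q ≤ m → ¬ (gaps x q = i ∧ gaps y q = i) := by
      intro q h1 h2 h3
      refine hc ⟨⟨q - 1, by omega⟩, ?_⟩
      dsimp only
      rwa [show q - 1 + 1 = q by omega]
    have hp0 : p ≠ 0 := by
      rintro rfl
      rw [gaps_zero] at hp1
      omega
    have hp0' : p' ≠ 0 := by
      rintro rfl
      rw [gaps_zero] at hp1'
      omega
    by_cases hlt : gaps y p < i
    · obtain ⟨x', v, z, i₀, j₀, h1, h2, h3, h4⟩ := exists_left_moves hi hil hp hp1 hp2 hlt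
      exact key x y x' z h4 (gen_left_mem h1 h2 h3)
    · have h5 := hne p (by omega) hp
      have h6 := hne p' (by omega) hp'
      have h7 : p' ≤ p := by
        by_contra hcon
        have := gaps_mono y (show p ≤ p' by omega)
        omega
      have h8 := gaps_mono x h7
      obtain ⟨x', v, z, i₀, j₀, h1, h2, h3, h4⟩ :=
        exists_left_moves (x := y) (y := x) hi hil hp' hp1' hp2' (by omega)
      exact key x y z x' (fun q hq => by have := h4 q hq; omega) (gen_right_mem h1 h2 h3)

/-- The ideal of the killed monomials. -/
def killedIdeal (x y : IdState m l) : Ideal (Base m) :=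
  Ideal.span ((fun a => MvPolynomial.monomial a 1) '' {a | Killed x y a})

theorem Killed.monomial_mem {x y : IdState m l} {a : Fin m →₀ ℕ} (h : Killed x y a) :
    MvPolynomial.monomial a 1 ∈ killedIdeal x y :=
  Ideal.subset_span ⟨a, h, rfl⟩

theorem mem_killedIdeal {x y : IdState m l} {p : Base m} :
    p ∈ killedIdeal x y ↔ ∀ a, MvPolynomial.coeff a p ≠ 0 → Killed x y a := by
  rw [killedIdeal, MvPolynomial.mem_ideal_span_monomial_image]
  refine forall_congr' fun a => ?_
  rw [MvPolynomial.mem_support_iff]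
  refine imp_congr_right fun _ => ⟨?_, fun h => ⟨a, h, le_rfl⟩⟩
  rintro ⟨b, hb, hba⟩
  exact Killed.mono hb hba

theorem mul_mem_killedIdeal {x y x' y' : IdState m l} {n : Fin m →₀ ℕ}
    (h : ∀ a, Killed x y a → Killed x' y' (a + n)) {p : Base m} (hp : p ∈ killedIdeal x y) :
    p * MvPolynomial.monomial n 1 ∈ killedIdeal x' y' := by
  induction hp using Submodule.span_induction with
  | mem p hp =>
    obtain ⟨a, ha, rfl⟩ := hp
    dsimp only
    rw [MvPolynomial.monomial_mul, one_mul]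
    exact (h a ha).monomial_mem
  | zero => rw [zero_mul]; exact zero_mem _
  | add p q _ _ hp hq => rw [add_mul]; exact add_mem hp hq
  | smul c p _ hp => rw [smul_eq_mul, mul_assoc]; exact Ideal.mul_mem_left _ _ hp

variable (m l) in
/-- The two-sided ideal of the elements with entries in the killed ideals. -/
def killedTwoSided : TwoSidedIdeal (Blg0 m l) :=
  TwoSidedIdeal.mk' {b | ∀ x y, b x y ∈ killedIdeal x y} (fun x y => zero_mem _)
    (fun {a b} ha hb x y => add_mem (ha x y) (hb x y)) (fun {a} ha x y => neg_mem (ha x y))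
    (fun {a b} hb x z => sum_mem fun y _ => by
      rw [mul_assoc]
      exact Ideal.mul_mem_left _ _ (mul_mem_killedIdeal (fun c hc => hc.mul_left x) (hb y z)))
    (fun {a b} ha x z => sum_mem fun y _ => by
      rw [mul_comm (a x y), mul_assoc]
      exact Ideal.mul_mem_left _ _ (mul_mem_killedIdeal (fun c hc => hc.mul_right z) (ha x y)))

theorem mem_killedTwoSided {b : Blg0 m l} :
    b ∈ killedTwoSided m l ↔ ∀ x y, b x y ∈ killedIdeal x y :=
  TwoSidedIdeal.mem_mk' _ _ _ _ _ _ _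

theorem killedIdeal_eq_top {x y : IdState m l} (h : Killed x y 0) (p : Base m) :
    p ∈ killedIdeal x y := by
  have := Ideal.mul_mem_left _ p h.monomial_mem
  simpa using this

theorem relIdeal_eq : relIdeal m l = killedTwoSided m l := by
  refine le_antisymm (TwoSidedIdeal.span_le.2 ?_) fun b hb => ?_
  · rintro b ((⟨i, j, hij, rfl⟩ | ⟨i, j, hij, rfl⟩) | ⟨x, j, h1, h2, rfl⟩)
    · refine mem_killedTwoSided.2 fun x z => sum_mem fun y _ => ?_
      unfold L
      split_ifs with h1 h2
      · exact killedIdeal_eq_top (killed_of_isLeftMove hij h1 h2 0) _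
      all_goals simp
    · refine mem_killedTwoSided.2 fun x z => sum_mem fun y _ => ?_
      unfold R
      split_ifs with h1 h2
      · exact killedIdeal_eq_top (killed_of_isLeftMove hij h2 h1 0).symm _
      all_goals simp
    · refine mem_killedTwoSided.2 fun a b => sum_mem fun c _ => ?_
      by_cases h : a = x ∧ c = x ∧ c = b
      · obtain ⟨rfl, rfl, rfl⟩ := h
        have := (killed_of_notMem h1 h2).monomial_mem
        simpa [idem, gen_apply_self, U, mulExponent_left, MvPolynomial.X] using this
      · by_cases h' : a = x ∧ c = x
        · have hne : ¬ c = b := fun hb => h ⟨h'.1, h'.2, hb⟩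
          simp [U, hne]
        · rw [idem, gen_apply_of_ne h']
          simp
  · rw [eq_sum_gen b]
    refine sum_mem fun x _ => sum_mem fun y _ => ?_
    have := mem_killedTwoSided.1 hb x y
    unfold killedIdeal at this
    generalize b x y = p at this
    induction this using Submodule.span_induction with
    | mem p hp =>
      obtain ⟨a, ha, rfl⟩ := hp
      exact Killed.gen_mem ha
    | zero => rw [gen_zero]; exact zero_mem _
    | add p q _ _ hp hq => rw [gen_add]; exact add_mem hp hq
    | smul c p _ hp =>
      have h := (relIdeal m l).mul_mem_left (gen x x c) _ hp
      rw [gen_mul_gen, mulExponent_left] at h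
      simpa using h

theorem mk_eq_zero_iff {b : Blg0 m l} :
    Blg.mk m l b = 0 ↔ ∀ x y a, MvPolynomial.coeff a (b x y) ≠ 0 → Killed x y a := by
  have h : Blg.mk m l b = 0 ↔ b ∈ relIdeal m l := by
    rw [← map_zero (Blg.mk m l)]
    exact (RingCon.eq _).trans (TwoSidedIdeal.mem_iff _ _).symm
  rw [h, relIdeal_eq, mem_killedTwoSided]
  simp only [mem_killedIdeal]

end Blg0

open LiftedPartialPerm

namespace Blg0

variable {m l k : ℕ}

/-! ### The set of letters of a state -/

/-- The invariant set of letters that are equivalent to elements of `{1, …, m - 1} ∖ x`. -/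
def lettersSet (x : IdState m l) : Set ℤ :=
  {z | ∃ s : Fin (m + 1), s ∉ x.1 ∧ 1 ≤ (s : ℕ) ∧ (s : ℕ) + 1 ≤ m ∧ orb m z = orb m (s : ℕ)}

theorem mem_lettersSet (hm : 1 < m) (x : IdState m l) {s : Fin (m + 1)} (h1 : 1 ≤ (s : ℕ))
    (h2 : (s : ℕ) + 1 ≤ m) : ((s : ℕ) : ℤ) ∈ lettersSet x ↔ s ∉ x.1 := by
  constructor
  · rintro ⟨s', h3, h4, h5, h6⟩
    have := orb_inj hm (by omega) (by omega) (by omega) (by omega) h6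
    rwa [Fin.ext (by omega : (s : ℕ) = s')]
  · exact fun h => ⟨s, h, h1, h2, rfl⟩

theorem invariant_lettersSet (x : IdState m l) : Invariant m (lettersSet x) := by
  intro g hg z
  simp only [lettersSet, Set.mem_ofPred_eq, orb_apply hg]

theorem lev_lettersSet (hm : 1 < m) {x : IdState m l} (hx : IsInner x) {p : ℕ} (hp : p + 1 ≤ m) :
    lev (lettersSet x) p = (gaps x (p + 1) : ℤ) - 1 := by
  classical
  induction p with
  | zero =>
    have := gaps_succ x 0
    rw [if_neg hx.1] at this
    simp only [Fin.val_zero, gaps_zero] at this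
    rw [Nat.cast_zero, lev_zero, this]
    simp
  | succ p ih =>
    have h1 := lev_succ (lettersSet x) (p := (p : ℤ)) (by omega)
    have h2 := gaps_succ x ⟨p + 1, by omega⟩
    have h3 := mem_lettersSet hm x (s := ⟨p + 1, by omega⟩) (by simp) (by simpa using hp)
    dsimp only at h2 h3
    push_cast at h3 ⊢
    rw [h1, ih (by omega), h2]
    simp only [h3]
    split_ifs <;> push_cast <;> ring

theorem ncard_lettersSet (hm : 1 < m) (hl : l + k + 1 = m) {x : IdState m l} (hx : IsInner x) :
    (orb m '' lettersSet x).ncard = k := by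
  classical
  have h1 := lev_last hm (invariant_lettersSet x)
  have h2 := lev_lettersSet hm hx (p := m - 1) (by omega)
  have h3 := gaps_succ x (Fin.last m)
  have h4 := gaps_last x
  rw [if_neg hx.2, Fin.val_last] at h3
  rw [show m - 1 + 1 = m by omega, show ((m - 1 : ℕ) : ℤ) = m - 1 by omega, h1] at h2
  omega

/-- The states without `0` and `m`. -/
abbrev Inner (m l : ℕ) : Type := {x : IdState m l // IsInner x}

instance : Fintype (Inner m l) := Fintype.ofFinite _

/-- The letters of an inner state. -/
def Inner.letters (hm : 1 < m) (hl : l + k + 1 = m) (x : Inner m l) : Letters m k :=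
  ⟨lettersSet x.1, invariant_lettersSet x.1, ncard_lettersSet hm hl x.2⟩

variable {hm : 1 < m} {hl : l + k + 1 = m}

theorem lev_letters (x : Inner m l) {p : ℕ} (hp : p + 1 ≤ m) :
    lev (x.letters hm hl).1 p = (gaps x.1 (p + 1) : ℤ) - 1 :=
  lev_lettersSet hm x.2 hp

theorem letters_injective : Function.Injective (Inner.letters hm hl) := by
  intro x y h
  refine Subtype.ext (state_ext fun p hp => ?_)
  rcases p with _ | p
  · rw [gaps_zero, gaps_zero]
  · by_cases hpm : p + 1 ≤ m
    · have h1 := lev_letters (hm := hm) (hl := hl) x hpm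
      rw [h, lev_letters y hpm] at h1
      omega
    · have h1 := gaps_last x.1
      have h2 := gaps_last y.1
      rw [show p + 1 = m + 1 by omega]
      omega

theorem letters_surjective : Function.Surjective (Inner.letters hm hl) := by
  intro T
  have hlast := T.lev_last hm
  obtain ⟨x, hx⟩ : ∃ x : IdState m l, ∀ p, p ≤ m + 1 → gaps x p =
      if p = 0 then 0 else if p = m + 1 then k + 2 else (lev T.1 (p - 1)).toNat + 1 := by
    classical
    refine exists_state (by simp) (by simp; omega) fun p hp => ?_
    rw [if_neg (by omega)]
    rcases Nat.eq_zero_or_pos p with rfl | hp0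
    · rw [if_neg (by omega), if_pos rfl]
      simp [lev_zero]
    · rw [if_neg (by omega : ¬ p = 0), if_neg (by omega : ¬ p = m + 1)]
      by_cases hpm : p = m
      · subst hpm
        rw [if_pos rfl, hlast]
        omega
      · rw [if_neg (by omega)]
        have h1 := lev_succ T.1 (p := (p : ℤ) - 1) (by omega)
        have h2 := lev_mono T.1 (show (0 : ℤ) ≤ p - 1 by omega)
        rw [lev_zero] at h2
        rw [sub_add_cancel] at h1
        push_cast
        rw [add_sub_cancel_right, h1]
        split_ifs <;> omega
  have hinner : IsInner x := by
    constructor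
    · rw [mem_iff_gaps]
      simp only [Fin.val_zero]
      rw [hx _ (by omega), hx _ (by omega), if_neg (by omega), if_neg (by omega), if_pos rfl]
      omega
    · rw [mem_iff_gaps, Fin.val_last, hx _ (by omega), hx _ (by omega), if_neg (by omega),
        if_pos rfl, if_neg (by omega), if_neg (by omega), hlast]
      omega
  have hlev : ∀ p : ℕ, p + 1 ≤ m → lev (lettersSet x) p = lev T.1 p := by
    intro p hp
    have h2 := lev_mono T.1 (show (0 : ℤ) ≤ p by omega)
    rw [lev_zero] at h2
    rw [lev_lettersSet hm hinner hp, hx _ (by omega), if_neg (by omega), if_neg (by omega)]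
    push_cast
    simp only [add_sub_cancel_right]
    omega
  refine ⟨⟨x, hinner⟩, Subtype.ext (Set.ext fun z => ?_)⟩
  obtain ⟨g, hg, s, h1, h2, rfl⟩ := exists_rep hm z
  change g s ∈ lettersSet x ↔ _
  rw [invariant_lettersSet x g hg, T.2.1 g hg]
  classical
  lift s to ℕ using by omega
  have h3 := hlev s (by omega)
  have h4 := hlev (s - 1) (by omega)
  have h5 := lev_succ (lettersSet x) (p := ((s - 1 : ℕ) : ℤ)) (by omega)
  have h6 := lev_succ T.1 (p := ((s - 1 : ℕ) : ℤ)) (by omega)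
  have h7 : ((s - 1 : ℕ) : ℤ) + 1 = s := by omega
  rw [h7] at h5 h6
  by_cases ha : (s : ℤ) ∈ lettersSet x <;> by_cases hb : (s : ℤ) ∈ T.1
  · simp [ha, hb]
  · rw [if_pos ha] at h5
    rw [if_neg hb] at h6
    omega
  · rw [if_neg ha] at h5
    rw [if_pos hb] at h6
    omega
  · simp [ha, hb]

theorem abs_lev_letters (x y : Inner m l) (i : Fin m) :
    |(lev (y.letters hm hl).1 (i : ℕ) : ℚ) - lev (x.letters hm hl).1 (i : ℕ)|
      = |(stateWeight x.1 i : ℚ) - stateWeight y.1 i| := by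
  rw [lev_letters x (by omega), lev_letters y (by omega), stateWeight_eq, stateWeight_eq, abs_sub_comm]
  push_cast
  congr 1
  ring

theorem good_iff_not_killed {x y : Inner m l} {n : ℕ} {a : Fin m →₀ ℕ} :
    Pong.Good m k (y.letters hm hl).1 (x.letters hm hl).1
      (fun i => Pong.omegaWeight n (y.letters hm hl) (x.letters hm hl) i + a i) n ↔
      ¬ Killed x.1 y.1 a := by
  constructor
  · rintro ⟨h1, -⟩ ⟨i, hi, hil, h⟩
    obtain ⟨q, h2, h3, h4⟩ := h1 (i - 1) (by omega)
    dsimp only [Pong.omegaWeight] at h4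
    rw [h2, h3, sub_self, abs_zero, zero_div, add_zero] at h4
    have h5 : a q = 0 := by
      have : (a q : ℚ) = 0 := by linarith
      exact_mod_cast this
    rw [lev_letters _ (by omega)] at h2 h3
    have := h q (by omega) (by omega)
    omega
  · intro h
    refine ⟨fun i hi => ?_, fun q => ?_⟩
    · by_contra hc
      refine h ⟨i + 1, by omega, by omega, fun j hx hy => ?_⟩
      by_contra ha
      have ha' : a j = 0 := by omega
      have h2 := lev_letters (hm := hm) (hl := hl) x (p := j) (by omega)
      have h3 := lev_letters (hm := hm) (hl := hl) y (p := j) (by omega)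
      rw [hx] at h2
      rw [hy] at h3
      refine hc ⟨j, by rw [h3]; push_cast; ring, by rw [h2]; push_cast; ring, ?_⟩
      dsimp only [Pong.omegaWeight]
      rw [h2, h3, ha']
      simp
    · dsimp only [Pong.omegaWeight]
      have : (0 : ℚ) ≤ a q := by positivity
      linarith

theorem innerIdem_apply_of_ne {x y : IdState m l} (h : x ≠ y) : innerIdem m l x y = 0 := by
  rw [innerIdem, sum_apply]
  exact Finset.sum_eq_zero fun w _ => gen_apply_of_ne (fun h' => h (h'.1.trans h'.2.symm)) _

theorem innerIdem_apply_self {x : IdState m l} (h : IsInner x) : innerIdem m l x x = 1 := by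
  rw [innerIdem, sum_apply, Finset.sum_eq_single x]
  · exact gen_apply_self _ _ _
  · exact fun w _ hw => gen_apply_of_ne (fun h' => hw h'.1.symm) _
  · simp [h]

theorem innerIdem_apply_of_not {x : IdState m l} (h : ¬ IsInner x) : innerIdem m l x x = 0 := by
  rw [innerIdem, sum_apply]
  refine Finset.sum_eq_zero fun w hw => gen_apply_of_ne (fun h' => ?_) _
  rw [h'.1] at h
  exact h (by simpa using hw)

theorem innerIdem_mul_apply (b : Blg0 m l) (x y : IdState m l) :
    (innerIdem m l * b) x y = innerIdem m l x x * b x y := by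
  rw [mul_apply, Finset.sum_eq_single x]
  · rw [mulExponent_left]
    simp
  · intro c _ hc
    rw [innerIdem_apply_of_ne hc.symm]
    simp
  · simp

theorem mul_innerIdem_apply (b : Blg0 m l) (x y : IdState m l) :
    (b * innerIdem m l) x y = b x y * innerIdem m l y y := by
  rw [mul_apply, Finset.sum_eq_single y]
  · rw [mulExponent_right]
    simp
  · intro c _ hc
    rw [innerIdem_apply_of_ne hc]
    simp
  · simp

/-- The element `b` has no entries outside the inner states. -/
def IsInnerSupported (b : Blg0 m l) : Prop := ∀ x y, b x y ≠ 0 → IsInner x ∧ IsInner y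

theorem isInnerSupported_mul (b : Blg0 m l) :
    IsInnerSupported (innerIdem m l * b * innerIdem m l) := by
  intro x y h
  rw [mul_innerIdem_apply, innerIdem_mul_apply] at h
  constructor
  · by_contra hc
    rw [innerIdem_apply_of_not hc, zero_mul, zero_mul] at h
    exact h rfl
  · by_contra hc
    rw [innerIdem_apply_of_not hc, mul_zero] at h
    exact h rfl

end Blg0

open LiftedPartialPerm

namespace Pong

variable {m k : ℕ}

/-! ### Homology classes -/

/-- The homology class of a cycle. -/
def cls (z : Pong m k) (hz : diff m k z = 0) : PongHomology m k :=
  Submodule.Quotient.mk ⟨z, hz⟩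

theorem cls_eq_iff {z z' : Pong m k} {hz : diff m k z = 0} {hz' : diff m k z' = 0} :
    cls z hz = cls z' hz' ↔ ∃ y, diff m k y = z - z' :=
  Submodule.Quotient.eq _

theorem cls_eq_zero_iff {z : Pong m k} {hz : diff m k z = 0} :
    cls z hz = 0 ↔ ∃ y, diff m k y = z :=
  Submodule.Quotient.mk_eq_zero _

theorem exists_cls (h : PongHomology m k) : ∃ z hz, h = cls z hz := by
  obtain ⟨z, rfl⟩ := Submodule.Quotient.mk_surjective _ h
  exact ⟨z.1, z.2, rfl⟩

theorem smul_cls (p : Base m) (z : Pong m k) (hz : diff m k z = 0) :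
    p • cls z hz = cls (p • z) (by rw [LinearMap.map_smul, hz, smul_zero]) := rfl

theorem exists_sum_cls {ι : Type*} (s : Finset ι) {Z : ι → Pong m k} (hZ : ∀ i, diff m k (Z i) = 0) :
    ∃ h, ∑ i ∈ s, cls (Z i) (hZ i) = cls (∑ i ∈ s, Z i) h := by
  classical
  have h : diff m k (∑ i ∈ s, Z i) = 0 := by
    rw [map_sum]
    exact Finset.sum_eq_zero fun i _ => hZ i
  refine ⟨h, ?_⟩
  have h1 : ∑ i ∈ s, cls (Z i) (hZ i) = Submodule.Quotient.mk
      (∑ i ∈ s, (⟨Z i, hZ i⟩ : LinearMap.ker (diff m k))) :=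
    (map_sum (Submodule.mkQ ((LinearMap.range (diff m k)).submoduleOf (LinearMap.ker (diff m k))))
      _ s).symm
  rw [h1]
  refine congrArg Submodule.Quotient.mk (Subtype.ext ?_)
  exact AddSubmonoidClass.coe_finsetSum _ s

/-- The class of `Ω^n e`, where `e` is the order-preserving map from `S` to `T`. -/
def omegaClass (hm : 1 < m) (n : ℕ) (S T : Letters m k) : PongHomology m k :=
  cls (omegaOrd hm n S T) diff_omegaOrd

variable {hm : 1 < m} {S T V : Letters m k} {n : ℕ}

theorem monomial_smul_omegaClass_of_not_good (hk : 0 < k) {a : Fin m →₀ ℕ}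
    (h : ¬ Good m k S.1 T.1 (fun i => omegaWeight n S T i + a i) n) :
    (MvPolynomial.monomial a (1 : ZMod 2)) • omegaClass hm n S T = 0 := by
  rw [omegaClass, smul_cls, cls_eq_zero_iff]
  exact exists_boundary_of_not_good hm hk h

theorem Omega_mul_omegaClass : homologyMul (isDGAlgebra hm) (cls (Omega m k) (diff_Omega hm))
    (omegaClass hm n S T) = omegaClass hm (n + 1) S T := by
  refine cls_eq_iff.2 ⟨0, ?_⟩
  rw [omegaOrd_succ, map_zero]
  exact (sub_self _).symm

theorem omegaClass_mul_Omega (hk : 0 < k) : homologyMul (isDGAlgebra hm) (omegaClass hm 0 S T)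
    (cls (Omega m k) (diff_Omega hm)) = omegaClass hm 1 S T :=
  cls_eq_iff.2 (exists_commutator_boundary hm hk S T)

/-! ### Homogeneous decomposition -/

/-- The image as a set of letters. -/
def imLetters (f : LiftedPartialPerm m k) : Letters m k :=
  ⟨f.im, f.invariant_im, f.card_orbits_im⟩

theorem exists_decomposition (z : Pong m k) :
    ∃ Z : (Letters m k × Letters m k × (Fin m → ℚ)) →₀ Pong m k,
      (∀ κ, Z κ ∈ homPart m k κ.1.1 κ.2.1.1 κ.2.2) ∧ Z.sum (fun _ u => u) = z := by
  classical
  induction z using induction_pure with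
  | h0 => exact ⟨0, fun κ => zero_mem _, Finsupp.sum_zero_index⟩
  | hadd x y hx hy =>
    obtain ⟨Z, h1, h2⟩ := hx
    obtain ⟨Z', h1', h2'⟩ := hy
    refine ⟨Z + Z', fun κ => add_mem (h1 κ) (h1' κ), ?_⟩
    rw [Finsupp.sum_add_index' (fun _ => rfl) (fun _ _ _ => rfl), h2, h2']
  | hs f a =>
    refine ⟨Finsupp.single (f.domLetters, imLetters f, fun i => f.weight i + a i) (pure f a),
      fun κ => ?_, Finsupp.sum_single_index rfl⟩
    rw [Finsupp.single_apply]
    split_ifs with h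
    · subst h
      exact AddSubgroup.subset_closure ⟨f, a, rfl, rfl, fun i => rfl, rfl⟩
    · exact zero_mem _

theorem eq_zero_of_sum_homPart {s : Finset (Letters m k × Letters m k × (Fin m → ℚ))}
    {W : Letters m k × Letters m k × (Fin m → ℚ) → Pong m k}
    (hW : ∀ κ, W κ ∈ homPart m k κ.1.1 κ.2.1.1 κ.2.2) (h : ∑ κ ∈ s, W κ = 0) :
    ∀ κ ∈ s, W κ = 0 := by
  intro κ hκ
  refine ext_coeff fun f a => ?_
  rw [map_zero]
  by_cases hf : f.dom = κ.1.1 ∧ f.im = κ.2.1.1 ∧ ∀ i, f.weight i + a i = κ.2.2 i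
  · have h1 := congrArg (coeff f a) h
    rw [map_zero, map_sum, Finset.sum_eq_single κ] at h1
    · exact h1
    · intro κ' _ hne
      refine coeff_eq_zero_of_homPart (hW κ') fun h' => hne ?_
      refine Prod.ext (Subtype.ext (h'.1.symm.trans hf.1)) (Prod.ext
        (Subtype.ext (h'.2.1.symm.trans hf.2.1)) (funext fun i => ?_))
      rw [← h'.2.2 i, hf.2.2 i]
    · exact fun h' => absurd hκ h'
  · exact coeff_eq_zero_of_homPart (hW κ) hf

/-- The homology is spanned by the classes `v^a [Ω^n e]`. -/
theorem mem_closure_omegaClass (hm : 1 < m) (hk : 0 < k) (h : PongHomology m k) :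
    h ∈ AddSubgroup.closure {h : PongHomology m k | ∃ (n : ℕ) (S T : Letters m k) (a : Fin m →₀ ℕ),
      h = (MvPolynomial.monomial a (1 : ZMod 2)) • omegaClass hm n S T} := by
  obtain ⟨z, hz, rfl⟩ := exists_cls h
  obtain ⟨Z, h1, rfl⟩ := exists_decomposition z
  have h2 : ∀ κ, diff m k (Z κ) = 0 := by
    intro κ
    by_cases hκ : κ ∈ Z.support
    · refine eq_zero_of_sum_homPart (s := Z.support) (W := fun κ => diff m k (Z κ))
        (fun κ => diff_mem_homPart hm (h1 κ)) ?_ κ hκ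
      rw [← map_sum]
      exact hz
    · rw [Finsupp.notMem_support_iff.1 hκ, map_zero]
  obtain ⟨h3, h4⟩ := exists_sum_cls Z.support h2
  refine Eq.mpr (congrArg (· ∈ _) h4.symm) (sum_mem fun κ _ => ?_)
  rcases homPart_cycle hm hk (h1 κ) (h2 κ) with h5 | ⟨n, a, h5⟩
  · rw [cls_eq_zero_iff.2 h5]
    exact zero_mem _
  · refine AddSubgroup.subset_closure ⟨n, κ.1, κ.2.1, a, ?_⟩
    rw [omegaClass, smul_cls]
    exact cls_eq_iff.2 h5

theorem coeff_crit_smul {hk : 0 < k} {a₀ b : Fin m →₀ ℕ} {w : Fin m → ℚ}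
    (hg : Good m k S.1 T.1 w n) (ha : ∀ i, omegaWeight n S T i + a₀ i = w i)
    (hb : ∀ i, (Letters.crit hm hk S T n).weight i + b i = w i) (p : Base m) (n' : ℕ)
    (S' T' : Letters m k) [Decidable (n' = n ∧ S' = S ∧ T' = T)] :
    coeff (Letters.crit hm hk S T n) b (p • omegaOrd hm n' S' T')
      = if n' = n ∧ S' = S ∧ T' = T then MvPolynomial.coeff a₀ p else 0 := by
  classical
  induction p using MvPolynomial.induction_on' with
  | add p q hp hq =>
    rw [add_smul, map_add, hp, hq, MvPolynomial.coeff_add]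
    split_ifs <;> simp
  | monomial a c =>
    rcases (by decide : ∀ c : ZMod 2, c = 0 ∨ c = 1) c with rfl | rfl
    · simp
    have hmem := smul_mem_homPart (omegaOrd_mem (hm := hm) (n := n') (S := S') (T := T'))
      (a := a) fun i => rfl
    rw [MvPolynomial.coeff_monomial]
    by_cases hST : S' = S ∧ T' = T
    · obtain ⟨rfl, rfl⟩ := hST
      by_cases hw : ∀ i, omegaWeight n' S' T' i + a i = w i
      · rw [coeff_crit_smul_omegaOrd hg hw hb]
        by_cases hn : n' = n
        · subst hn
          have : a = a₀ := by
            ext i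
            have h1 := hw i
            rw [← ha i] at h1
            have : (a i : ℚ) = a₀ i := by linarith
            exact_mod_cast this
          simp [this]
        · simp [hn]
      · rw [coeff_eq_zero_of_homPart hmem fun h => hw fun i => (h.2.2 i).symm.trans (hb i)]
        split_ifs with h1 h2
        · subst h2
          obtain ⟨rfl, -⟩ := h1
          exact absurd ha hw
        · rfl
        · rfl
    · rw [coeff_eq_zero_of_homPart hmem fun h => hST ⟨Subtype.ext ?_, Subtype.ext ?_⟩, if_neg]
      · exact fun h => hST h.2
      · rw [← h.1, Letters.dom_crit]
      · rw [← h.2.1, Letters.im_crit]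

end Pong

open LiftedPartialPerm

namespace Clg

variable {m l : ℕ}

/-! ### Polynomials over the bordered algebra -/

theorem corner_val_mul {R : Type*} [Ring R] {e : R} (he : IsIdempotentElem e) (a b : he.Corner) :
    (a * b).1 = a.1 * b.1 := rfl

theorem exists_proj (c : Clg m l) : ∃ b, c = proj b := by
  obtain ⟨b, hb⟩ := RingCon.mk'_surjective (c := (TwoSidedIdeal.span (Blg0.relations m l)).ringCon) c.1
  refine ⟨b, Subtype.ext ?_⟩
  obtain ⟨c, d, hd⟩ := c
  have hJ := Blg.isIdempotentElem_inner m l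
  change c = Blg.mk m l (Blg0.innerIdem m l) * Blg.mk m l b * Blg.mk m l (Blg0.innerIdem m l)
  have hb' : Blg.mk m l b = c := hb
  rw [hb', ← hd, ← mul_assoc, ← mul_assoc, hJ.eq, mul_assoc, hJ.eq]

theorem proj_val (b : Blg0 m l) :
    (proj b).1 = Blg.mk m l (Blg0.innerIdem m l * b * Blg0.innerIdem m l) := by
  rw [map_mul, map_mul]
  rfl

theorem proj_add (b b' : Blg0 m l) : proj (b + b') = proj b + proj b' := by
  refine Subtype.ext ?_
  change (proj (b + b')).1 = (proj b).1 + (proj b').1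
  rw [proj_val, proj_val, proj_val, ← map_add, mul_add, add_mul]

theorem proj_sub (b b' : Blg0 m l) : proj (b - b') = proj b - proj b' := by
  rw [eq_sub_iff_add_eq, ← proj_add, sub_add_cancel]

theorem proj_mul (b b' : Blg0 m l) :
    proj b * proj b' = proj (b * Blg0.innerIdem m l * b') := by
  refine Subtype.ext ((corner_val_mul _ _ _).trans ?_)
  have hJ := Blg0.isIdempotentElem_innerIdem (m := m) (k := l)
  rw [proj_val, proj_val, proj_val]
  refine (map_mul (Blg.mk m l) _ _).symm.trans (congrArg (Blg.mk m l) ?_)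
  simp only [mul_assoc]
  rw [← mul_assoc (Blg0.innerIdem m l) (Blg0.innerIdem m l), hJ.eq]

theorem proj_innerIdem : proj (Blg0.innerIdem m l) = 1 := by
  refine Subtype.ext ?_
  have hJ := Blg0.isIdempotentElem_innerIdem (m := m) (k := l)
  rw [proj_val, hJ.eq, hJ.eq]
  rfl

theorem proj_eq_zero {b : Blg0 m l} : proj b = 0 ↔
    Blg.mk m l (Blg0.innerIdem m l * b * Blg0.innerIdem m l) = 0 := by
  rw [← proj_val]
  exact Subtype.ext_iff

theorem exists_addEquiv {H : Type*} [AddCommGroup H] (φ : ℕ → Blg0 m l →+ H)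
    (h0 : ∀ n b, proj b = 0 → φ n b = 0)
    (hinj : ∀ (s : Finset ℕ) (b : ℕ → Blg0 m l), ∑ n ∈ s, φ n (b n) = 0 → ∀ n ∈ s, proj (b n) = 0)
    (hsurj : ∀ h, h ∈ AddSubgroup.closure {h | ∃ n b, h = φ n b}) :
    ∃ e : (Clg m l)[X] ≃+ H,
      ∀ n b, e (Polynomial.C (proj b) * Polynomial.X ^ n) = φ n b := by
  choose r hr using exists_proj (m := m) (l := l)
  have hφ : ∀ n b b', proj b = proj b' → φ n b = φ n b' := by
    intro n b b' h
    rw [← sub_eq_zero, ← map_sub]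
    exact h0 _ _ (by rw [proj_sub, h, sub_self])
  let E : (Clg m l)[X] →+ H :=
    { toFun := fun p => p.sum fun n c => φ n (r c)
      map_zero' := Polynomial.sum_zero_index _
      map_add' := fun p q => Polynomial.sum_add_index p q _
        (fun n => h0 n _ (hr 0).symm)
        (fun n c d => by
          rw [← map_add]
          exact hφ _ _ _ (by rw [← hr, proj_add, ← hr, ← hr])) }
  have hE : ∀ n b, E (Polynomial.C (proj b) * Polynomial.X ^ n) = φ n b := by
    intro n b
    rw [Polynomial.C_mul_X_pow_eq_monomial]
    refine (Polynomial.sum_monomial_index _ (fun n c => φ n (r c)) (h0 n _ (hr 0).symm)).trans ?_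
    exact hφ _ _ _ (hr _).symm
  refine ⟨AddEquiv.ofBijective E ⟨?_, ?_⟩, hE⟩
  · rw [injective_iff_map_eq_zero]
    intro p hp
    have h1 := hinj p.support (fun n => r (p.coeff n)) hp
    ext n : 1
    by_cases hn : n ∈ p.support
    · rw [hr (p.coeff n), h1 n hn, Polynomial.coeff_zero]
    · rw [Polynomial.notMem_support_iff.1 hn, Polynomial.coeff_zero]
  · intro h
    induction hsurj h using AddSubgroup.closure_induction with
    | mem _ h =>
      obtain ⟨n, b, rfl⟩ := h
      exact ⟨_, hE n b⟩
    | zero => exact ⟨0, map_zero E⟩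
    | add _ _ _ _ h h' =>
      obtain ⟨p, rfl⟩ := h
      obtain ⟨q, rfl⟩ := h'
      exact ⟨p + q, map_add E p q⟩
    | neg _ _ h =>
      obtain ⟨p, rfl⟩ := h
      exact ⟨-p, map_neg E p⟩

theorem map_mul_of_proj {H : Type*} [Ring H] (e : (Clg m l)[X] →+ H)
    (h : ∀ n n' b b', e (Polynomial.C (proj (b * Blg0.innerIdem m l * b')) * Polynomial.X ^ (n + n'))
      = e (Polynomial.C (proj b) * Polynomial.X ^ n) * e (Polynomial.C (proj b') * Polynomial.X ^ n'))
    (p q : (Clg m l)[X]) : e (p * q) = e p * e q := by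
  induction p using Polynomial.induction_on' with
  | add p p' hp hp' => rw [add_mul, map_add, map_add, hp, hp', add_mul]
  | monomial n c =>
    induction q using Polynomial.induction_on' with
    | add q q' hq hq' => rw [mul_add, map_add, map_add, hq, hq', mul_add]
    | monomial n' c' =>
      obtain ⟨b, rfl⟩ := exists_proj c
      obtain ⟨b', rfl⟩ := exists_proj c'
      rw [Polynomial.monomial_mul_monomial, proj_mul, ← Polynomial.C_mul_X_pow_eq_monomial,
        ← Polynomial.C_mul_X_pow_eq_monomial, ← Polynomial.C_mul_X_pow_eq_monomial, h]

end Clg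

open LiftedPartialPerm

namespace Pong

variable {m k l : ℕ}

/-! ### The comparison map -/

theorem homologyMul_assoc (hm : 1 < m) (a b c : PongHomology m k) :
    homologyMul (isDGAlgebra hm) (homologyMul (isDGAlgebra hm) a b) c
      = homologyMul (isDGAlgebra hm) a (homologyMul (isDGAlgebra hm) b c) :=
  letI := homologyRing (isDGAlgebra hm (k := k))
  mul_assoc a b c

theorem omegaClass_mul_omegaClass (hm : 1 < m) (hk : 0 < k) {S T T' V : Letters m k} {p : Base m}
    (h : homologyMul (isDGAlgebra hm) (omegaClass hm 0 T V) (omegaClass hm 0 S T')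
      = p • omegaClass hm 0 S V) (n n' : ℕ) :
    homologyMul (isDGAlgebra hm) (omegaClass hm n T V) (omegaClass hm n' S T')
      = p • omegaClass hm (n + n') S V := by
  induction n with
  | zero =>
    rw [zero_add]
    induction n' with
    | zero => exact h
    | succ n' ih =>
      rw [← Omega_mul_omegaClass (hm := hm), ← homologyMul_assoc hm, omegaClass_mul_Omega hk,
        ← Omega_mul_omegaClass (hm := hm) (n := 0), homologyMul_assoc hm, ih, LinearMap.map_smul,
        Omega_mul_omegaClass (hm := hm)]
  | succ n ih =>
    rw [← Omega_mul_omegaClass (hm := hm), homologyMul_assoc hm, ih, LinearMap.map_smul, Omega_mul_omegaClass (hm := hm),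
      Nat.succ_add]

theorem omegaClass_zero_mul (hm : 1 < m) (S T V : Letters m k) : ∃ a : Fin m →₀ ℕ,
    (∀ i : Fin m, |(lev S.1 (i : ℕ) : ℚ) - lev V.1 (i : ℕ)| / 2 + a i
      = |(lev S.1 (i : ℕ) : ℚ) - lev T.1 (i : ℕ)| / 2
        + |(lev T.1 (i : ℕ) : ℚ) - lev V.1 (i : ℕ)| / 2) ∧
    homologyMul (isDGAlgebra hm) (omegaClass hm 0 T V) (omegaClass hm 0 S T)
      = MvPolynomial.monomial a (1 : ZMod 2) • omegaClass hm 0 S V := by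
  obtain ⟨a, h1, h2⟩ := mulPure_ord hm S T V
  refine ⟨a, fun i => ?_, ?_⟩
  · have := h2 i
    rwa [Letters.weight_ord, Letters.weight_ord, Letters.weight_ord] at this
  · refine cls_eq_iff.2 ⟨0, ?_⟩
    rw [map_zero]
    refine (sub_eq_zero.2 ?_).symm
    change mul m k (pure (Letters.ord hm T V) 0) (pure (Letters.ord hm S T) 0)
      = (MvPolynomial.monomial a (1 : ZMod 2)) • pure (Letters.ord hm S V) 0
    rw [mul_pure, h1, smul_pure, add_zero]

theorem omegaClass_zero_mul_of_ne (hm : 1 < m) {S T T' V : Letters m k} (h : T ≠ T') :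
    homologyMul (isDGAlgebra hm) (omegaClass hm 0 T V) (omegaClass hm 0 S T')
      = (0 : Base m) • omegaClass hm 0 S V := by
  rw [zero_smul]
  refine cls_eq_zero_iff.2 ⟨0, ?_⟩
  rw [map_zero]
  change 0 = mul m k (pure (Letters.ord hm T V) 0) (pure (Letters.ord hm S T') 0)
  rw [mul_pure, mulPure, dif_neg]
  rw [composable_iff, Letters.dom_ord, Letters.im_ord]
  exact fun h' => h (Subtype.ext h')

variable (hm : 1 < m) (hl : l + k + 1 = m)

/-- The class `[Ω^n e]`, where `e` is the order-preserving map from the letters of `y` to those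
of `x`. -/
def stateClass (n : ℕ) (x y : Blg0.Inner m l) : PongHomology m k :=
  omegaClass hm n (y.letters hm hl) (x.letters hm hl)

theorem stateClass_mul (hk : 0 < k) (x y z : Blg0.Inner m l) (n n' : ℕ) :
    homologyMul (isDGAlgebra hm) (stateClass hm hl n x y) (stateClass hm hl n' y z)
      = MvPolynomial.monomial (mulExponent x.1 y.1 z.1) (1 : ZMod 2)
        • stateClass hm hl (n + n') x z := by
  obtain ⟨a, h1, h2⟩ := omegaClass_zero_mul hm (z.letters hm hl) (y.letters hm hl) (x.letters hm hl)
  have h3 : a = mulExponent x.1 y.1 z.1 := by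
    ext i
    have h4 := h1 i
    rw [Blg0.abs_lev_letters, Blg0.abs_lev_letters, Blg0.abs_lev_letters] at h4
    simp only [mulExponent, Finsupp.equivFunOnFinite_symm_apply_apply]
    have h5 : |stateWeight x.1 i - stateWeight z.1 i| + 2 * (a i : ℤ)
        = |stateWeight y.1 i - stateWeight z.1 i| + |stateWeight x.1 i - stateWeight y.1 i| := by
      have : |(stateWeight x.1 i : ℚ) - stateWeight z.1 i| + 2 * (a i : ℚ)
        = |(stateWeight y.1 i : ℚ) - stateWeight z.1 i|
          + |(stateWeight x.1 i : ℚ) - stateWeight y.1 i| := by linarith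
      exact_mod_cast this
    simp only [Int.abs_eq_natAbs] at h5
    omega
  rw [← h3]
  exact omegaClass_mul_omegaClass hm hk h2 n n'

theorem stateClass_mul_of_ne (hk : 0 < k) {x y y' z : Blg0.Inner m l} (h : y ≠ y') (n n' : ℕ) :
    homologyMul (isDGAlgebra hm) (stateClass hm hl n x y) (stateClass hm hl n' y' z) = 0 :=
  (omegaClass_mul_omegaClass hm hk
    (omegaClass_zero_mul_of_ne hm fun h' => h (Blg0.letters_injective h')) n n').trans
    (zero_smul _ _)

/-- The map that sends `p γ_{x,y}` to `p [Ω^n e]`, with `e` the order-preserving map from the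
letters of `y` to those of `x`. -/
def compare (n : ℕ) : Blg0 m l →+ PongHomology m k where
  toFun b := ∑ x : Blg0.Inner m l, ∑ y : Blg0.Inner m l, b x.1 y.1 • stateClass hm hl n x y
  map_zero' := Finset.sum_eq_zero fun x _ => Finset.sum_eq_zero fun y _ => zero_smul _ _
  map_add' b b' := by
    simp only [Blg0.add_apply, add_smul, Finset.sum_add_distrib]

theorem compare_apply (n : ℕ) (b : Blg0 m l) : compare hm hl n b
    = ∑ x : Blg0.Inner m l, ∑ y : Blg0.Inner m l, b x.1 y.1 • stateClass hm hl n x y := rfl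

theorem compare_gen (n : ℕ) (x y : Blg0.Inner m l) (p : Base m) :
    compare hm hl n (Blg0.gen x.1 y.1 p) = p • stateClass hm hl n x y := by
  rw [compare_apply, Finset.sum_eq_single x, Finset.sum_eq_single y, Blg0.gen_apply_self]
  · intro y' _ h
    rw [Blg0.gen_apply_of_ne fun h' => h (Subtype.ext h'.2), zero_smul]
  · simp
  · intro x' _ h
    refine Finset.sum_eq_zero fun y' _ => ?_
    rw [Blg0.gen_apply_of_ne fun h' => h (Subtype.ext h'.1), zero_smul]
  · simp

theorem sandwich_apply (b : Blg0 m l) (x y : Blg0.Inner m l) :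
    (Blg0.innerIdem m l * b * Blg0.innerIdem m l) x.1 y.1 = b x.1 y.1 := by
  rw [Blg0.mul_innerIdem_apply, Blg0.innerIdem_mul_apply, Blg0.innerIdem_apply_self x.2,
    Blg0.innerIdem_apply_self y.2, one_mul, mul_one]

theorem proj_eq_zero_iff {b : Blg0 m l} : Clg.proj b = 0 ↔ ∀ (x y : Blg0.Inner m l) (a : Fin m →₀ ℕ),
    MvPolynomial.coeff a (b x.1 y.1) ≠ 0 → Blg0.Killed x.1 y.1 a := by
  rw [Clg.proj_eq_zero, Blg0.mk_eq_zero_iff]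
  constructor
  · intro h x y a ha
    exact h x.1 y.1 a (by rwa [sandwich_apply])
  · intro h x y a ha
    obtain ⟨hx, hy⟩ := Blg0.isInnerSupported_mul b x y fun h' => ha (by rw [h', MvPolynomial.coeff_zero])
    exact h ⟨x, hx⟩ ⟨y, hy⟩ a (by rwa [sandwich_apply b ⟨x, hx⟩ ⟨y, hy⟩] at ha)

theorem compare_eq_zero (hk : 0 < k) (n : ℕ) (b : Blg0 m l) (h : Clg.proj b = 0) :
    compare hm hl n b = 0 := by
  rw [proj_eq_zero_iff] at h
  refine Finset.sum_eq_zero fun x _ => Finset.sum_eq_zero fun y _ => ?_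
  rw [(b x.1 y.1).as_sum, Finset.sum_smul]
  refine Finset.sum_eq_zero fun a ha => ?_
  have ha' := MvPolynomial.mem_support_iff.1 ha
  rw [(by decide : ∀ c : ZMod 2, c ≠ 0 → c = 1) _ ha']
  refine monomial_smul_omegaClass_of_not_good hk ?_
  rw [Blg0.good_iff_not_killed, not_not]
  exact h x y a ha'

theorem compare_mul (hk : 0 < k) (n n' : ℕ) (b b' : Blg0 m l) :
    compare hm hl (n + n') (b * Blg0.innerIdem m l * b')
      = homologyMul (isDGAlgebra hm) (compare hm hl n b) (compare hm hl n' b') := by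
  have h1 : ∀ x z : Blg0.Inner m l, (b * Blg0.innerIdem m l * b') x.1 z.1
      = ∑ y : Blg0.Inner m l, b x.1 y.1 * b' y.1 z.1
        * MvPolynomial.monomial (mulExponent x.1 y.1 z.1) 1 := by
    intro x z
    rw [Blg0.mul_apply]
    refine (Fintype.sum_of_injective Subtype.val Subtype.val_injective _ _ (fun y hy => ?_)
      fun y => ?_).symm
    · rw [Blg0.mul_innerIdem_apply, Blg0.innerIdem_apply_of_not fun h => hy ⟨⟨y, h⟩, rfl⟩]
      simp
    · rw [Blg0.mul_innerIdem_apply, Blg0.innerIdem_apply_self y.2, mul_one]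
  have h2 : ∀ x y y' z : Blg0.Inner m l, homologyMul (isDGAlgebra hm)
      (b x.1 y.1 • stateClass hm hl n x y) (b' y'.1 z.1 • stateClass hm hl n' y' z)
      = b x.1 y.1 • b' y'.1 z.1 • homologyMul (isDGAlgebra hm)
        (stateClass hm hl n x y) (stateClass hm hl n' y' z) := by
    intro x y y' z
    rw [LinearMap.map_smul, LinearMap.map_smul, LinearMap.smul_apply, smul_comm]
  have h3 : ∀ u, homologyMul (isDGAlgebra hm) (compare hm hl n b) u
      = ∑ x : Blg0.Inner m l, ∑ y : Blg0.Inner m l,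
        homologyMul (isDGAlgebra hm) (b x.1 y.1 • stateClass hm hl n x y) u := by
    intro u
    rw [compare_apply]
    simp only [map_sum, LinearMap.sum_apply]
  rw [h3, compare_apply, compare_apply]
  refine Finset.sum_congr rfl fun x _ => ?_
  simp only [map_sum, h2, h1, Finset.sum_smul]
  rw [Finset.sum_comm]
  refine Finset.sum_congr rfl fun y _ => ?_
  symm
  rw [Finset.sum_eq_single y]
  · refine Finset.sum_congr rfl fun z _ => ?_
    rw [stateClass_mul hm hl hk, mul_smul, mul_smul]
  · intro y' _ hne
    refine Finset.sum_eq_zero fun z _ => ?_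
    rw [stateClass_mul_of_ne hm hl hk hne.symm, smul_zero, smul_zero]
  · simp

end Pong

open LiftedPartialPerm

namespace Pong

variable {m k l : ℕ}

theorem proj_eq_zero_of_sum_compare (hm : 1 < m) (hl : l + k + 1 = m) (hk : 0 < k) (s : Finset ℕ)
    (b : ℕ → Blg0 m l) (h : ∑ n ∈ s, compare hm hl n (b n) = 0) (n : ℕ) (hn : n ∈ s) :
    Clg.proj (b n) = 0 := by
  classical
  rw [proj_eq_zero_iff]
  intro x y a ha
  by_contra hkill
  have hg := Blg0.good_iff_not_killed (hm := hm) (hl := hl) (n := n) |>.2 hkill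
  let t : Finset (ℕ × Blg0.Inner m l × Blg0.Inner m l) := s ×ˢ Finset.univ ×ˢ Finset.univ
  let Z : ℕ × Blg0.Inner m l × Blg0.Inner m l → Pong m k := fun i =>
    b i.1 i.2.1.1 i.2.2.1 • omegaOrd hm i.1 (i.2.2.letters hm hl) (i.2.1.letters hm hl)
  have hZ : ∀ i, diff m k (Z i) = 0 := fun i => diff_smul_omegaOrd _
  obtain ⟨h1, h2⟩ := exists_sum_cls t hZ
  have h3 : ∑ i ∈ t, cls (Z i) (hZ i) = 0 := by
    rw [← h, Finset.sum_product]
    refine Finset.sum_congr rfl fun n' _ => ?_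
    rw [Finset.sum_product]
    rfl
  obtain ⟨Y, hY⟩ := cls_eq_zero_iff.1 (h2.symm.trans h3)
  obtain ⟨b₀, hb₀⟩ := exists_weight_crit (hm := hm) (hk := hk) (S := y.letters hm hl)
    (T := x.letters hm hl) (n := n)
  have hb : ∀ i, (Letters.crit hm hk (y.letters hm hl) (x.letters hm hl) n).weight i
      + ((b₀ + a) i : ℕ) = omegaWeight n (y.letters hm hl) (x.letters hm hl) i + a i := by
    intro i
    rw [← hb₀ i, Finsupp.add_apply]
    push_cast
    ring
  have h4 := coeff_diff_eq_zero hm hk (f := Letters.crit hm hk (y.letters hm hl) (x.letters hm hl) n)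
    (by rw [Letters.dom_crit, Letters.im_crit]; exact hg) hb Letters.isCrit_crit Y
  rw [hY, map_sum, Finset.sum_eq_single (n, x, y)] at h4
  · rw [coeff_crit_smul hg (fun i => rfl) hb, if_pos ⟨rfl, rfl, rfl⟩] at h4
    exact ha h4
  · rintro ⟨n', x', y'⟩ _ hne
    rw [coeff_crit_smul hg (fun i => rfl) hb, if_neg]
    rintro ⟨h5, h6, h7⟩
    dsimp only at h5 h6 h7
    exact hne (by rw [h5, Blg0.letters_injective h6, Blg0.letters_injective h7])
  · exact fun h => absurd (by simpa [t] using hn) h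

theorem mem_closure_compare (hm : 1 < m) (hl : l + k + 1 = m) (hk : 0 < k) (h : PongHomology m k) :
    h ∈ AddSubgroup.closure {h | ∃ n b, h = compare hm hl n b} := by
  refine AddSubgroup.closure_mono ?_ (mem_closure_omegaClass hm hk h)
  rintro _ ⟨n, S, T, a, rfl⟩
  obtain ⟨x, rfl⟩ := Blg0.letters_surjective (hm := hm) (hl := hl) T
  obtain ⟨y, rfl⟩ := Blg0.letters_surjective (hm := hm) (hl := hl) S
  exact ⟨n, _, (compare_gen hm hl n x y _).symm⟩

theorem idem_eq (hm : 1 < m) (hl : l + k + 1 = m) (x : Blg0.Inner m l) :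
    idem m k {l | ∀ a ∈ x.1.1, ((a : ℕ) : ℤ) ≠ l}
      = omegaOrd hm 0 (x.letters hm hl) (x.letters hm hl) := by
  classical
  rw [omegaOrd_zero, Letters.ord_self]
  have hmem : ∀ s : ℤ, 1 ≤ s → s ≤ m - 1 →
      (s ∈ {l : ℤ | ∀ a ∈ x.1.1, ((a : ℕ) : ℤ) ≠ l} ↔ s ∈ (x.letters hm hl).1) := by
    intro s h1 h2
    lift s to ℕ using by omega
    refine Iff.trans ?_ (Blg0.mem_lettersSet hm x.1 (s := ⟨s, by omega⟩) (by dsimp only; omega)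
      (by dsimp only; omega)).symm
    simp only [Set.mem_ofPred_eq]
    constructor
    · exact fun h hs => h _ hs rfl
    · rintro h a ha h'
      exact h ((Fin.ext (by exact_mod_cast h' : (a : ℕ) = s) : a = ⟨s, _⟩) ▸ ha)
  have hiff : ∀ f : LiftedPartialPerm m k, (∀ s : ℤ, 1 ≤ s → s ≤ m - 1 →
      (s ∈ {l : ℤ | ∀ a ∈ x.1.1, ((a : ℕ) : ℤ) ≠ l} → f.toFun s = some s) ∧
      (s ∉ {l : ℤ | ∀ a ∈ x.1.1, ((a : ℕ) : ℤ) ≠ l} → f.toFun s = none)) ↔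
      f = idOn (x.letters hm hl).1 (x.letters hm hl).2.1 (x.letters hm hl).2.2 := by
    intro f
    constructor
    · intro h
      ext1
      funext i
      obtain ⟨g, hg, s, h1, h2, rfl⟩ := exists_rep hm i
      rw [f.equivariant g hg, LiftedPartialPerm.equivariant _ g hg]
      congr 1
      dsimp only [idOn]
      by_cases hs : s ∈ (x.letters hm hl).1
      · rw [if_pos hs, (h s h1 h2).1 ((hmem s h1 h2).2 hs)]
      · rw [if_neg hs, (h s h1 h2).2 fun h' => hs ((hmem s h1 h2).1 h')]
    · rintro rfl s h1 h2
      dsimp only [idOn]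
      exact ⟨fun h => if_pos ((hmem s h1 h2).1 h), fun h => if_neg fun h' => h ((hmem s h1 h2).2 h')⟩
  rw [idem]
  simp only [hiff]
  exact finsum_cond_eq_left

variable {e : (Clg m l)[X] → PongHomology m k} {hm : 1 < m} {hl : l + k + 1 = m}

theorem respectsIdempotents_of_compare
    (he : ∀ n (b : Blg0 m l), e (Polynomial.C (Clg.proj b) * Polynomial.X ^ n) = compare hm hl n b) :
    RespectsIdempotents e := by
  intro x hx
  refine ⟨?_, ?_⟩
  · rw [idem_eq hm hl ⟨x, hx⟩]
    exact diff_omegaOrd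
  · have h1 := he 0 (Blg0.idem x)
    rw [pow_zero, mul_one] at h1
    rw [h1, Blg0.idem, compare_gen hm hl 0 ⟨x, hx⟩ ⟨x, hx⟩, one_smul]
    refine congrArg Submodule.Quotient.mk (Subtype.ext ?_)
    exact (idem_eq hm hl ⟨x, hx⟩).symm

theorem omegaWeight_letters (n : ℕ) (x y : Blg0.Inner m l) (i : Fin m) :
    omegaWeight n (y.letters hm hl) (x.letters hm hl) i
      = |(stateWeight x.1 i : ℚ) - stateWeight y.1 i| / 2 + n := by
  rw [omegaWeight, Blg0.abs_lev_letters, add_comm]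

theorem respectsGradings_of_compare
    (he : ∀ n (b : Blg0 m l), e (Polynomial.C (Clg.proj b) * Polynomial.X ^ n) = compare hm hl n b) :
    RespectsGradings e := by
  intro x y hx hy a n
  refine ⟨MvPolynomial.monomial a (1 : ZMod 2) • omegaOrd hm n
    (Blg0.Inner.letters hm hl ⟨y, hy⟩) (Blg0.Inner.letters hm hl ⟨x, hx⟩),
    smul_mem_bigraded omegaOrd_mem_bigraded fun i => ?_, diff_smul_omegaOrd _, ?_⟩
  · rw [omegaWeight_letters]
    ring
  · rw [he, compare_gen hm hl n ⟨x, hx⟩ ⟨y, hy⟩]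
    rfl

theorem exists_ringEquiv (hm : 1 < m) (hl : l + k + 1 = m) (hk : 0 < k) :
    letI : Ring (PongHomology m k) := homologyRing (isDGAlgebra hm)
    ∃ e : (Clg m l)[X] ≃+* PongHomology m k,
      IsClassOf (e Polynomial.X) (Omega m k) ∧
      (∀ (i : Fin m) (p : (Clg m l)[X]),
        e (Polynomial.C (Clg.proj (Blg0.U i)) * p) = (MvPolynomial.X i : Base m) • e p) ∧
      RespectsIdempotents e ∧ RespectsGradings e := by
  let : Ring (PongHomology m k) := homologyRing (isDGAlgebra hm)
  obtain ⟨e₀, he₀⟩ := Clg.exists_addEquiv (compare hm hl) (compare_eq_zero hm hl hk)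
    (proj_eq_zero_of_sum_compare hm hl hk) (mem_closure_compare hm hl hk)
  have hmul : ∀ p q, e₀ (p * q) = e₀ p * e₀ q := by
    refine Clg.map_mul_of_proj (e₀ : (Clg m l)[X] →+ PongHomology m k) fun n n' b b' => ?_
    change e₀ _ = e₀ _ * e₀ _
    rw [he₀, he₀, he₀]
    exact compare_mul hm hl hk n n' b b'
  let e : (Clg m l)[X] ≃+* PongHomology m k := { e₀ with map_mul' := hmul }
  have he : ∀ n b, e (Polynomial.C (Clg.proj b) * Polynomial.X ^ n) = compare hm hl n b := he₀
  have hone : compare hm hl 0 (Blg0.innerIdem m l) = (1 : PongHomology m k) := by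
    rw [← he, Clg.proj_innerIdem, Polynomial.C_1, pow_zero, mul_one]
    exact map_one e
  refine ⟨e, ⟨diff_Omega hm, ?_⟩, fun i p => ?_, respectsIdempotents_of_compare he,
    respectsGradings_of_compare he⟩
  · have h1 : e Polynomial.X = compare hm hl 1 (Blg0.innerIdem m l) := by
      rw [← he, Clg.proj_innerIdem, Polynomial.C_1, pow_one, one_mul]
    have h2 : homologyMul (isDGAlgebra hm) (cls (Omega m k) (diff_Omega hm))
        (compare hm hl 0 (Blg0.innerIdem m l)) = compare hm hl 1 (Blg0.innerIdem m l) := by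
      rw [compare_apply, compare_apply]
      simp only [map_sum, LinearMap.map_smul, stateClass, Omega_mul_omegaClass]
    rw [h1, ← h2, hone]
    exact mul_one (cls (Omega m k) (diff_Omega hm))
  · have h1 : e (Polynomial.C (Clg.proj (Blg0.U i))) = (MvPolynomial.X i : Base m) • (1 : PongHomology m k) := by
      have := he 0 (Blg0.U i)
      rw [pow_zero, mul_one] at this
      rw [this, ← hone, compare_apply, compare_apply, Finset.smul_sum]
      refine Finset.sum_congr rfl fun x _ => ?_
      rw [Finset.smul_sum]
      refine Finset.sum_congr rfl fun y _ => ?_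
      rw [smul_smul, Blg0.U]
      congr 1
      by_cases h : x.1 = y.1
      · rw [if_pos h, ← h, Blg0.innerIdem_apply_self x.2, mul_one]
      · rw [if_neg h, Blg0.innerIdem_apply_of_ne h, mul_zero]
    rw [map_mul, h1]
    change homologyMul (isDGAlgebra hm) _ _ = _
    rw [LinearMap.map_smul, LinearMap.smul_apply]
    exact congrArg _ (one_mul (e p))

end Pong

open LiftedPartialPerm

namespace Pong

variable {m l : ℕ}

/-! ### The case without strands -/

/-- The exponent vector `(n, …, n)`. -/
def constExponent (m n : ℕ) : Fin m →₀ ℕ := Finsupp.equivFunOnFinite.symm fun _ => n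

theorem constExponent_apply (n : ℕ) (i : Fin m) : constExponent m n i = n := by
  simp [constExponent]

open Classical in
/-- Multiplication by `(v_1 ⋯ v_m)^n`, after removal of all monomials divisible by
`v_1 ⋯ v_m`. -/
def shift (m n : ℕ) : Base m →ₗ[ZMod 2] Base m :=
  (MvPolynomial.basisMonomials (Fin m) (ZMod 2)).constr (ZMod 2) fun a =>
    if ∃ i, a i = 0 then MvPolynomial.monomial (a + constExponent m n) 1 else 0

open Classical in
theorem shift_monomial (n : ℕ) (a : Fin m →₀ ℕ) : shift m n (MvPolynomial.monomial a 1)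
    = if ∃ i, a i = 0 then MvPolynomial.monomial (a + constExponent m n) 1 else 0 := by
  have := (MvPolynomial.basisMonomials (Fin m) (ZMod 2)).constr_basis (ZMod 2) (fun a =>
    if ∃ i, a i = 0 then (MvPolynomial.monomial (a + constExponent m n) 1 : Base m) else 0) a
  rwa [MvPolynomial.coe_basisMonomials] at this

theorem coeff_shift {a : Fin m →₀ ℕ} (ha : ∃ i, a i = 0) (n n' : ℕ) (p : Base m) :
    MvPolynomial.coeff (a + constExponent m n) (shift m n' p)
      = if n' = n then MvPolynomial.coeff a p else 0 := by
  classical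
  induction p using MvPolynomial.induction_on' with
  | add p q hp hq =>
    rw [map_add, MvPolynomial.coeff_add, MvPolynomial.coeff_add, hp, hq]
    split_ifs <;> simp
  | monomial b c =>
    rcases (by decide : ∀ c : ZMod 2, c = 0 ∨ c = 1) c with rfl | rfl
    · simp
    rw [shift_monomial, MvPolynomial.coeff_monomial]
    by_cases hb : ∃ i, b i = 0
    · rw [if_pos hb, MvPolynomial.coeff_monomial]
      by_cases hn : n' = n
      · subst hn
        rw [if_pos rfl]
        simp only [add_left_inj]
      · rw [if_neg hn, if_neg]
        intro h
        obtain ⟨i, hi⟩ := ha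
        obtain ⟨j, hj⟩ := hb
        have h1 := DFunLike.congr_fun h i
        have h2 := DFunLike.congr_fun h j
        rw [Finsupp.add_apply, Finsupp.add_apply, constExponent_apply, constExponent_apply] at h1 h2
        omega
    · rw [if_neg hb, MvPolynomial.coeff_zero, if_neg (fun h : b = a => hb (h ▸ ha)), ite_self]

theorem shift_eq_zero (n : ℕ) {p : Base m} (h : ∀ a, MvPolynomial.coeff a p ≠ 0 → ∀ i, 1 ≤ a i) :
    shift m n p = 0 := by
  rw [p.as_sum, map_sum]
  refine Finset.sum_eq_zero fun a ha => ?_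
  have ha' := MvPolynomial.mem_support_iff.1 ha
  rw [(by decide : ∀ c : ZMod 2, c ≠ 0 → c = 1) _ ha', shift_monomial, if_neg]
  rintro ⟨i, hi⟩
  have := h a ha' i
  omega

variable {hm : 1 < m} {hl : l + 0 + 1 = m}

theorem toFun_eq_none (hm : 1 < m) (f : LiftedPartialPerm m 0) (i : ℤ) : f.toFun i = none := by
  by_contra h
  obtain ⟨a, ha⟩ := Option.ne_none_iff_exists'.1 h
  obtain ⟨g, hg, s, hs, h1, h2, -⟩ := f.domLetters.exists_rep hm (x := i) ⟨a, ha⟩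
  have h3 := f.domLetters.lev_pos hs h1
  have h4 := f.domLetters.lev_le hm h2
  push_cast at h4
  omega

theorem lev_eq_zero (hm : 1 < m) (T : Letters m 0) (j : Fin m) : lev T.1 (j : ℕ) = 0 := by
  have h1 := T.lev_le hm (t := (j : ℕ)) (by omega)
  have h2 := lev_mono T.1 (show (0 : ℤ) ≤ (j : ℕ) by omega)
  rw [lev_zero] at h2
  push_cast at h1
  omega

theorem exists_eq_smul (S T : Letters m 0) (z : Pong m 0) :
    ∃ p : Base m, z = p • omegaOrd hm 0 S T := by
  induction z using induction_pure with
  | h0 => exact ⟨0, (zero_smul _ _).symm⟩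
  | hadd x y hx hy =>
    obtain ⟨p, rfl⟩ := hx
    obtain ⟨q, rfl⟩ := hy
    exact ⟨p + q, (add_smul _ _ _).symm⟩
  | hs f a =>
    refine ⟨MvPolynomial.monomial a 1, ?_⟩
    rw [pure_eq_smul, omegaOrd_zero]
    congr 2
    ext1
    funext i
    rw [toFun_eq_none hm, toFun_eq_none hm]

theorem smul_omegaClass_eq_zero {S T : Letters m 0} {p : Base m}
    (h : p • omegaClass hm 0 S T = 0) : p = 0 := by
  rw [omegaClass, smul_cls] at h
  obtain ⟨y, hy⟩ := cls_eq_zero_iff.1 h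
  obtain ⟨q, rfl⟩ := exists_eq_smul (hm := hm) S T y
  rw [diff_smul_omegaOrd] at hy
  rw [omegaOrd_zero, ← single_eq_smul] at hy
  exact Finsupp.single_eq_zero.1 hy.symm

theorem killed_iff (x y : Blg0.Inner m l) (a : Fin m →₀ ℕ) (hm : 1 < m) (hl : l + 0 + 1 = m) :
    Blg0.Killed x.1 y.1 a ↔ ∀ j, 1 ≤ a j := by
  have hgaps : ∀ (x : Blg0.Inner m l) (j : Fin m), Blg0.gaps x.1 (j + 1) = 1 := by
    intro x j
    have := Blg0.lev_letters (k := 0) (hm := hm) (hl := hl) x (p := j) (by omega)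
    rw [lev_eq_zero hm] at this
    omega
  constructor
  · rintro ⟨i, h1, h2, h3⟩ j
    exact h3 j (by rw [hgaps]; omega) (by rw [hgaps]; omega)
  · exact fun h => ⟨1, le_rfl, by omega, fun j _ _ => h j⟩

theorem inner_eq (hm : 1 < m) (hl : l + 0 + 1 = m) (x y : Blg0.Inner m l) : x = y := by
  refine Blg0.letters_injective (k := 0) (hm := hm) (hl := hl) (Subtype.ext (Set.ext fun i => ?_))
  have hempty : ∀ T : Letters m 0, i ∉ T.1 := fun T hi =>  by
    rw [← Letters.dom_ord (hm := hm) (S := T) (T := T)] at hi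
    obtain ⟨a, ha⟩ := hi
    rw [toFun_eq_none hm] at ha
    cases ha
  exact iff_of_false (hempty _) (hempty _)

theorem exists_addEquiv (hm : 1 < m) (hl : l + 0 + 1 = m) :
    ∃ e : (Clg m l)[X] ≃+ PongHomology m 0, RespectsIdempotents e ∧ RespectsGradings e := by
  obtain ⟨x, -⟩ := Blg0.letters_surjective (k := 0) (hm := hm) (hl := hl)
    (LiftedPartialPerm.domLetters (k := 0) ⟨fun _ => none, fun _ _ _ => rfl, by simp, by simp⟩)
  let S : Letters m 0 := Blg0.Inner.letters (k := 0) hm hl x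
  let φ : ℕ → Blg0 m l →+ PongHomology m 0 := fun n =>
    { toFun := fun b => shift m n (b x.1 x.1) • omegaClass hm 0 S S
      map_zero' := by rw [Blg0.zero_apply, map_zero, zero_smul]
      map_add' := fun b b' => by rw [Blg0.add_apply, map_add, add_smul] }
  have hφ : ∀ n b, φ n b = shift m n (b x.1 x.1) • omegaClass hm 0 S S := fun _ _ => rfl
  obtain ⟨e, he⟩ := Clg.exists_addEquiv φ (fun n b h => by
      rw [hφ, shift_eq_zero, zero_smul]
      intro a ha
      exact (killed_iff x x a hm hl).1 (proj_eq_zero_iff.1 h x x a ha))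
    (fun s b h n hn => by
      rw [proj_eq_zero_iff]
      intro x' y' a ha
      obtain rfl := inner_eq hm hl x x'
      obtain rfl := inner_eq hm hl x y'
      rw [killed_iff x x a hm hl]
      by_contra hc
      push Not at hc
      have hc' : ∃ i, a i = 0 := hc.imp fun i hi => by omega
      simp only [hφ] at h
      rw [← Finset.sum_smul] at h
      have h1 := congrArg (MvPolynomial.coeff (a + constExponent m n)) (smul_omegaClass_eq_zero h)
      rw [MvPolynomial.coeff_sum, Finset.sum_eq_single n, coeff_shift hc', if_pos rfl] at h1
      · exact ha h1
      · intro n' _ hne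
        rw [coeff_shift hc', if_neg hne]
      · exact fun h => absurd hn h)
    (fun h => by
      obtain ⟨z, hz, rfl⟩ := exists_cls h
      obtain ⟨p, rfl⟩ := exists_eq_smul (hm := hm) S S z
      rw [← smul_cls p _ diff_omegaOrd]
      induction p using MvPolynomial.induction_on' with
      | add p q hp hq =>
        rw [add_smul]
        exact add_mem (hp (diff_smul_omegaOrd _)) (hq (diff_smul_omegaOrd _))
      | monomial a c =>
        rcases (by decide : ∀ c : ZMod 2, c = 0 ∨ c = 1) c with rfl | rfl
        · rw [MvPolynomial.monomial_zero, zero_smul]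
          exact zero_mem _
        have : Nonempty (Fin m) := ⟨⟨0, by omega⟩⟩
        obtain ⟨i, hi⟩ := Finite.exists_min a
        refine AddSubgroup.subset_closure ⟨a i, Blg0.gen x.1 x.1
          (MvPolynomial.monomial (a - constExponent m (a i)) 1), ?_⟩
        rw [hφ, Blg0.gen_apply_self, shift_monomial, if_pos, tsub_add_cancel_of_le]
        · rfl
        · exact fun j => by rw [constExponent_apply]; exact hi j
        · exact ⟨i, by rw [Finsupp.tsub_apply, constExponent_apply, Nat.sub_self]⟩)
  refine ⟨e, fun x' hx' => ?_, fun x' y' hx' hy' a n => ?_⟩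
  · obtain rfl : x.1 = x' := congrArg Subtype.val (inner_eq hm hl x ⟨x', hx'⟩)
    have h1 := he 0 (Blg0.idem x.1)
    have h2 : shift m 0 (1 : Base m) = 1 := by
      have := shift_monomial 0 (0 : Fin m →₀ ℕ)
      rw [if_pos ⟨⟨0, by omega⟩, rfl⟩] at this
      have h0 : (0 : Fin m →₀ ℕ) + constExponent m 0 = 0 := by
        ext i
        rw [Finsupp.add_apply, constExponent_apply]
        rfl
      rw [h0] at this
      exact this
    rw [pow_zero, mul_one, hφ, Blg0.idem, Blg0.gen_apply_self, h2, one_smul] at h1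
    refine ⟨(idem_eq (k := 0) hm hl x).symm ▸ diff_omegaOrd, ?_⟩
    exact h1.trans (congrArg Submodule.Quotient.mk (Subtype.ext (idem_eq (k := 0) hm hl x).symm))
  · obtain rfl : x.1 = x' := congrArg Subtype.val (inner_eq hm hl x ⟨x', hx'⟩)
    obtain rfl : x.1 = y' := congrArg Subtype.val (inner_eq hm hl x ⟨y', hy'⟩)
    refine ⟨shift m n (MvPolynomial.monomial a (1 : ZMod 2)) • omegaOrd hm 0 S S, ?_,
      diff_smul_omegaOrd _, ?_⟩
    · rw [shift_monomial]
      split_ifs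
      · rw [show 2 * 0 * n = 2 * 0 * 0 by omega]
        have h1 : omegaOrd hm 0 S S ∈ bigraded m 0 (2 * 0 * 0) (omegaWeight 0 S S) :=
          omegaOrd_mem_bigraded
        refine smul_mem_bigraded h1 fun i => ?_
        rw [omegaWeight_letters (k := 0), Finsupp.add_apply, constExponent_apply]
        push_cast
        ring
      · rw [zero_smul]
        exact zero_mem _
    · rw [he, hφ, Blg0.gen_apply_self]
      rfl

end Pong

end PongAlgebra

end

open PongAlgebra
theorem mainTheorem3 (m k : ℕ) (hm : 1 < m) (hk : k < m) :
    ∃ hP : IsDGAlgebra (Pong.mul m k) 1 (Pong.diff m k),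
      letI : Ring (PongHomology m k) := homologyRing hP
      (0 < k → ∃ e : Polynomial (Clg m (m - k - 1)) ≃+* PongHomology m k,
        IsClassOf (e Polynomial.X) (Pong.Omega m k) ∧
        (∀ (i : Fin m) (p : Polynomial (Clg m (m - k - 1))),
          e (Polynomial.C (Clg.proj (Blg0.U i)) * p) = (MvPolynomial.X i : Base m) • e p) ∧
        RespectsIdempotents e ∧ RespectsGradings e) ∧
      (k = 0 → ∃ e : Polynomial (Clg m (m - k - 1)) ≃+ PongHomology m k,
        RespectsIdempotents e ∧ RespectsGradings e) := by
  refine ⟨Pong.isDGAlgebra hm, fun hk' => Pong.exists_ringEquiv hm (by omega) hk', ?_⟩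
  rintro rfl
  exact Pong.exists_addEquiv hm (by omega)
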